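/- **Model.** Algorithms are randomized unit-cost word-RAM programs with words of $O(\log N)$ bits, $N$ being the input size plus the number of requests; time bounds hold for every outcome of the coin tosses. In an online problem, each answer has to be output before the next part of the input is revealed; inputs are fixed independently of the coin tosses. **OMv Hypothesis.** In online Boolean matrix-vector multiplication (OMv), one is given $M\in\{0,1\}^{n\times n}$ and then, one after another, vectors $v_1,\dots,v_n\in\{0,1\}^n$; the Boolean product $Mv_i$ has to be output before $v_{i+1}$ is revealed. The hypothesis: for no $\varepsilon>0$ is there an algorithm that solves OMv in $O(n^{3-\varepsilon})$ total time with error probability at most $1/3$. **Problem.** In *incremental* (resp. *decremental*) *transitive closure with predictions*, the offline input is a number $n\ge 1$ of vertices, $V=[n]$, and a predicted sequence $\hat e_1,\dots,\hat e_m$ of distinct directed edges in $V\times V$. The online input interleaves updates $e_1,\dots,e_m$, which form a permutation of $\hat e_1,\dots,\hat e_m$, with reachability queries $(s,t)\in V\times V$. The graph is initially empty and $e_i$ is inserted (resp. the initial edge set is $\{\hat e_1,\dots,\hat e_m\}$ and $e_i$ is deleted). A query asks whether the current graph has a directed path (possibly of length $0$) from $s$ to $t$; each answer must be right with probability at least $2/3$.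 The prediction error is $\eta_\infty=\max_e|t(e)-\hat t(e)|$, where $t(e)$ and $\hat t(e)$ are the positions of the edge $e$ in the actual and in the predicted sequence of updates ($\eta_\infty=0$ if $m=0$). **Theorem.** Assume the OMv Hypothesis. Then for no $\varepsilon>0$ is there an algorithm for incremental transitive closure with predictions with preprocessing time polynomial in $n$, worst-case edge insertion time $O(n^{1-\varepsilon})$, and worst-case query time $O((1+\eta_\infty)^{2-\varepsilon})$; and for no $\varepsilon>0$ is there an algorithm for decremental transitive closure with predictions with preprocessing time polynomial in $n$, worst-case edge deletion time $O(n^{1-\varepsilon})$, and worst-case query time $O((1+\eta_\infty)^{2-\varepsilon})$. In both cases this remains true if the update and query times are only required to be amortized, i.e. if, after polynomial preprocessing, the total time for the $m$ updates and any number $q$ of queries is only required to be $O(m\,n^{1-\varepsilon}+q\,(1+\eta_\infty)^{2-\varepsilon})$. -/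

import Mathlib

namespace OMvLB

/-! ### A randomized word RAM with unit cost -/

/-- Arithmetic, comparison and bitwise operations on words. -/
inductive BinOp
  | add | sub | mul | div | mod | eq | lt | and | or | xor | shl | shr

/-- Value of an operation on natural numbers (subtraction is truncated, division by zero gives
zero, comparisons return `0` or `1`). -/
def BinOp.eval : BinOp → ℕ → ℕ → ℕ
  | .add, x, y => x + y
  | .sub, x, y => x - y
  | .mul, x, y => x * y
  | .div, x, y => x / y
  | .mod, x, y => x % y
  | .eq, x, y => if x = y then 1 else 0
  | .lt, x, y => if x < y then 1 else 0
  | .and, x, y => x &&& y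
  | .or, x, y => x ||| y
  | .xor, x, y => x ^^^ y
  | .shl, x, y => x <<< y
  | .shr, x, y => x >>> y

/-- Structured programs of the random access machine. A program mentions finitely many registers
and literals; all other data is in the memory, which is addressed indirectly. -/
inductive Prog
  /-- do nothing -/
  | skip
  /-- register `r` gets the literal `c` -/
  | const (r c : ℕ)
  /-- register `r` gets the value of `o` on the registers `a` and `b` -/
  | op (o : BinOp) (r a b : ℕ)
  /-- register `r` gets the content of the memory cell whose address is in register `a` -/
  | load (r a : ℕ)
  /-- the memory cell whose address is in register `a` gets the content of register `r` -/
  | store (a r : ℕ)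
  /-- register `r` gets the word of the (read-only) input whose index is in register `a` -/
  | input (r a : ℕ)
  /-- the output cell whose index is in register `a` gets the content of register `r` -/
  | output (a r : ℕ)
  /-- register `r` gets a fresh random bit -/
  | flip (r : ℕ)
  /-- sequential composition -/
  | seq (p q : Prog)
  /-- run `p` if register `r` is nonzero, else `q` -/
  | ite (r : ℕ) (p q : Prog)
  /-- repeat `p` as long as register `r` is nonzero -/
  | while (r : ℕ) (p : Prog)

/-- Configuration of the machine: registers, memory, output cells, and the number of random bits
consumed so far (which the program cannot inspect). -/
structure State where
  reg : ℕ → ℕ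
  mem : ℕ → ℕ
  out : ℕ → ℕ
  coins : ℕ

/-- Everything is zero before the first call. -/
def State.init : State := ⟨fun _ => 0, fun _ => 0, fun _ => 0, 0⟩

/-- Write a value to a register. -/
def State.setReg (s : State) (r x : ℕ) : State := { s with reg := Function.update s.reg r x }

/-- `Exec W ω inp p s t s'`: with words restricted to the values `0, …, W - 1`, coin tosses `ω` and
input `inp`, the program `p` started in `s` halts in `s'` after exactly `t` unit-cost steps.
An instruction whose result is not a word (is `≥ W`) has no execution, so a halting run
never overflows. Cells of `inp` beyond its length read as zero. -/
inductive Exec (W : ℕ) (ω : ℕ → Bool) (inp : List ℕ) : Prog → State → ℕ → State → Prop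
  | skip (s : State) : Exec W ω inp .skip s 1 s
  | const (s : State) (r c : ℕ) (h : c < W) :
      Exec W ω inp (.const r c) s 1 (s.setReg r c)
  | op (s : State) (o : BinOp) (r a b : ℕ) (h : o.eval (s.reg a) (s.reg b) < W) :
      Exec W ω inp (.op o r a b) s 1 (s.setReg r (o.eval (s.reg a) (s.reg b)))
  | load (s : State) (r a : ℕ) :
      Exec W ω inp (.load r a) s 1 (s.setReg r (s.mem (s.reg a)))
  | store (s : State) (a r : ℕ) :
      Exec W ω inp (.store a r) s 1 { s with mem := Function.update s.mem (s.reg a) (s.reg r) }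
  | input (s : State) (r a : ℕ) (h : inp.getD (s.reg a) 0 < W) :
      Exec W ω inp (.input r a) s 1 (s.setReg r (inp.getD (s.reg a) 0))
  | output (s : State) (a r : ℕ) :
      Exec W ω inp (.output a r) s 1 { s with out := Function.update s.out (s.reg a) (s.reg r) }
  | flip (s : State) (r : ℕ) (h : (ω s.coins).toNat < W) :
      Exec W ω inp (.flip r) s 1 { s.setReg r (ω s.coins).toNat with coins := s.coins + 1 }
  | seq {p q : Prog} {s s' s'' : State} {t t' : ℕ} (hp : Exec W ω inp p s t s')
      (hq : Exec W ω inp q s' t' s'') : Exec W ω inp (.seq p q) s (t + t') s''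
  | ite_true {p q : Prog} {s s' : State} {r t : ℕ} (h : s.reg r ≠ 0)
      (hp : Exec W ω inp p s t s') : Exec W ω inp (.ite r p q) s (t + 1) s'
  | ite_false {p q : Prog} {s s' : State} {r t : ℕ} (h : s.reg r = 0)
      (hq : Exec W ω inp q s t s') : Exec W ω inp (.ite r p q) s (t + 1) s'
  | while_done {p : Prog} {s : State} {r : ℕ} (h : s.reg r = 0) :
      Exec W ω inp (.while r p) s 1 s
  | while_step {p : Prog} {s s' s'' : State} {r t t' : ℕ} (h : s.reg r ≠ 0)
      (hp : Exec W ω inp p s t s') (hw : Exec W ω inp (.while r p) s' t' s'') :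
      Exec W ω inp (.while r p) s (t + t' + 1) s''

/-- What is observed of one call: the number of steps and the output cells. -/
structure CallRecord where
  time : ℕ
  out : ℕ → ℕ

/-- `Session W ω s calls recs`: starting in `s`, the listed programs are called one after another,
each on its own input. Registers, memory and the position in the coin sequence persist from call to
call, the output cells are cleared. A call sees neither the inputs nor the number of later calls,
and its output is fixed before the next call starts, so this is the online setting. -/
inductive Session (W : ℕ) (ω : ℕ → Bool) :
    State → List (Prog × List ℕ) → List CallRecord → Prop
  | nil (s : State) : Session W ω s [] []
  | cons {s s' : State} {p : Prog} {inp : List ℕ} {t : ℕ} {calls : List (Prog × List ℕ)}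
      {recs : List CallRecord} (hp : Exec W ω inp p { s with out := fun _ => 0 } t s')
      (hs : Session W ω s' calls recs) :
      Session W ω s ((p, inp) :: calls) (⟨t, s'.out⟩ :: recs)

/-- The law of an infinite sequence of independent fair coin tosses. -/
noncomputable def coinMeasure : MeasureTheory.Measure (ℕ → Bool) :=
  MeasureTheory.Measure.infinitePi fun _ => (PMF.uniformOfFintype Bool).toMeasure

/-! ### Online Boolean matrix-vector multiplication -/

/-- An algorithm for OMv: one program that receives the matrix, and one that receives a vector and
outputs a product. -/
structure OMvAlgorithm where
  start : Prog
  query : Prog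

/-- The Boolean product `M v`. -/
def boolMulVec {n : ℕ} (M : Matrix (Fin n) (Fin n) Bool) (v : Fin n → Bool) (i : Fin n) : Bool :=
  decide (∃ j, M i j = true ∧ v j = true)

/-- The calls in an OMv instance: first `n` and the entries of `M` row by row, then the vectors
`v 0, …, v (n - 1)`. -/
def OMvAlgorithm.calls (A : OMvAlgorithm) {n : ℕ} (M : Matrix (Fin n) (Fin n) Bool)
    (v : Fin n → Fin n → Bool) : List (Prog × List ℕ) :=
  (A.start, n :: (List.finRange n).flatMap fun i => (List.finRange n).map fun j => (M i j).toNat) ::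
    (List.finRange n).map fun k => (A.query, (List.finRange n).map fun j => (v k j).toNat)

/-- The run on words of `O(log n)` bits: values are less than `(n + 2) ^ κ`. The record `r₀` belongs
to reading the matrix, the list `rs` to the queries. -/
def OMvAlgorithm.Run (A : OMvAlgorithm) (κ : ℕ) {n : ℕ} (M : Matrix (Fin n) (Fin n) Bool)
    (v : Fin n → Fin n → Bool) (ω : ℕ → Bool) (r₀ : CallRecord) (rs : List CallRecord) : Prop :=
  Session ((n + 2) ^ κ) ω State.init (A.calls M v) (r₀ :: rs)

/-- All products are right with probability at least `2/3`. -/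
def OMvAlgorithm.Correct (A : OMvAlgorithm) (κ : ℕ) : Prop :=
  ∀ n : ℕ, 0 < n → ∀ (M : Matrix (Fin n) (Fin n) Bool) (v : Fin n → Fin n → Bool),
    2 / 3 ≤ coinMeasure {ω | ∃ r₀ rs, A.Run κ M v ω r₀ rs ∧
      ∀ (k : Fin n) (r : CallRecord), rs[(k : ℕ)]? = some r →
        ∀ i : Fin n, r.out i = (boolMulVec M (v k) i).toNat}

/-- Whatever the coin tosses, the algorithm halts, and its total time (including the time to read
the matrix) is at most `C n ^ (3 - ε)`. -/
def OMvAlgorithm.TimeBound (A : OMvAlgorithm) (κ : ℕ) (C ε : ℝ) : Prop :=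
  ∀ n : ℕ, 0 < n → ∀ (M : Matrix (Fin n) (Fin n) Bool) (v : Fin n → Fin n → Bool) (ω : ℕ → Bool),
    ∃ r₀ rs, A.Run κ M v ω r₀ rs ∧
      ((r₀.time + (rs.map CallRecord.time).sum : ℕ) : ℝ) ≤ C * (n : ℝ) ^ (3 - ε)

/-- The OMv Hypothesis: for no `ε > 0` is there a randomized `O(n ^ (3 - ε))`-time algorithm that
solves online Boolean matrix-vector multiplication with error probability at most `1/3`. -/
def OMvHypothesis : Prop :=
  ∀ ε : ℝ, 0 < ε →
    ¬ ∃ (A : OMvAlgorithm) (κ : ℕ) (C : ℝ), A.Correct κ ∧ A.TimeBound κ C ε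

/-! ### Partially dynamic transitive closure with predictions -/

/-- Whether updates insert edges (into an initially empty graph) or delete edges. -/
inductive Mode
  | incremental
  | decremental

/-- An online request on a directed graph with vertex set `Fin n`. -/
inductive Request (n : ℕ)
  /-- the next edge to be inserted or deleted -/
  | update (e : Fin n × Fin n)
  /-- is there a path from `s` to `t`? -/
  | query (s t : Fin n)

/-- The edge of an update. -/
def Request.edge? {n : ℕ} : Request n → Option (Fin n × Fin n)
  | .update e => some e
  | .query _ _ => none

/-- The edges updated by a list of requests, in order. -/
def updates {n : ℕ} (l : List (Request n)) : List (Fin n × Fin n) := l.filterMap Request.edge?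

/-- An instance: a predicted sequence of distinct edges, and an interleaved sequence of updates and
queries in which the same edges are updated, in a possibly different order. -/
structure Instance (n : ℕ) where
  predicted : List (Fin n × Fin n)
  requests : List (Request n)
  nodup : predicted.Nodup
  perm : (updates requests).Perm predicted

/-- The maximal prediction error: the maximum over the edges of the absolute difference of actual
and predicted position (`0` if there are no edges). -/
def Instance.etaInf {n : ℕ} (I : Instance n) : ℕ :=
  I.predicted.toFinset.sup fun e =>
    (((updates I.requests).idxOf e : ℤ) - (I.predicted.idxOf e : ℤ)).natAbs

/-- The edges of the graph just before request number `i` (counted from zero). In the decremental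
case the initial graph consists of all edges of the predicted sequence. -/
def Instance.edgesAt {n : ℕ} (I : Instance n) (m : Mode) (i : ℕ) : Set (Fin n × Fin n) :=
  match m with
  | .incremental => {e | e ∈ updates (I.requests.take i)}
  | .decremental => {e | e ∈ I.predicted ∧ e ∉ updates (I.requests.take i)}

/-- There is a directed path (possibly of length zero) from `s` to `t`. -/
def Reachable {n : ℕ} (E : Set (Fin n × Fin n)) (s t : Fin n) : Prop :=
  Relation.ReflTransGen (fun x y => (x, y) ∈ E) s t

/-- An algorithm for the dynamic problem: three programs working on the same memory. -/
structure TCAlgorithm where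
  preprocess : Prog
  update : Prog
  query : Prog

/-- The program and input that serve a request. -/
def TCAlgorithm.call (A : TCAlgorithm) {n : ℕ} : Request n → Prog × List ℕ
  | .update e => (A.update, [(e.1 : ℕ), (e.2 : ℕ)])
  | .query s t => (A.query, [(s : ℕ), (t : ℕ)])

/-- All calls in an instance. The offline input is the number of vertices, the number of predicted
updates, and the predicted sequence. -/
def TCAlgorithm.calls (A : TCAlgorithm) {n : ℕ} (I : Instance n) : List (Prog × List ℕ) :=
  (A.preprocess, n :: I.predicted.length :: I.predicted.flatMap fun e => [(e.1 : ℕ), (e.2 : ℕ)]) ::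
    I.requests.map A.call

/-- The run on words whose number of bits is logarithmic in the number of vertices plus the number
of requests. The record `r₀` belongs to the preprocessing, the list `rs` to the requests. -/
def TCAlgorithm.Run (A : TCAlgorithm) (κ : ℕ) {n : ℕ} (I : Instance n) (ω : ℕ → Bool)
    (r₀ : CallRecord) (rs : List CallRecord) : Prop :=
  Session ((n + I.requests.length + 2) ^ κ) ω State.init (A.calls I) (r₀ :: rs)

open Classical in
/-- In every instance (fixed independently of the coin tosses), each query is answered rightly, by
`1` for YES and `0` for NO, with probability at least `2/3`. -/
def TCAlgorithm.Correct (A : TCAlgorithm) (m : Mode) (κ : ℕ) : Prop :=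
  ∀ n : ℕ, 0 < n → ∀ (I : Instance n) (i : ℕ) (s t : Fin n),
    I.requests[i]? = some (.query s t) →
      2 / 3 ≤ coinMeasure {ω | ∃ r₀ rs, A.Run κ I ω r₀ rs ∧
        ∀ r, rs[i]? = some r → r.out 0 = if Reachable (I.edgesAt m i) s t then 1 else 0}

/-- The time allowed for a request: `C n ^ (1 - ε)` for an update and `C (1 + η) ^ (2 - ε)` for a
query, where `η` is the maximal prediction error. -/
noncomputable def allowedTime {n : ℕ} (C ε : ℝ) (I : Instance n) : Request n → ℝ
  | .update _ => C * (n : ℝ) ^ (1 - ε)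
  | .query _ _ => C * (1 + (I.etaInf : ℝ)) ^ (2 - ε)

/-- Whatever the coin tosses, the algorithm halts, preprocessing takes at most `n ^ d + d` steps, and
each single request takes at most its allowed time. -/
def TCAlgorithm.WorstCaseTimeBound (A : TCAlgorithm) (κ d : ℕ) (C ε : ℝ) : Prop :=
  ∀ n : ℕ, 0 < n → ∀ (I : Instance n) (ω : ℕ → Bool),
    ∃ r₀ rs, A.Run κ I ω r₀ rs ∧ r₀.time ≤ n ^ d + d ∧
      ∀ p ∈ I.requests.zip rs, (p.2.time : ℝ) ≤ allowedTime C ε I p.1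

/-- Whatever the coin tosses, the algorithm halts, preprocessing takes at most `n ^ d + d` steps, and
the total time of all requests is at most the sum of their allowed times. -/
def TCAlgorithm.AmortizedTimeBound (A : TCAlgorithm) (κ d : ℕ) (C ε : ℝ) : Prop :=
  ∀ n : ℕ, 0 < n → ∀ (I : Instance n) (ω : ℕ → Bool),
    ∃ r₀ rs, A.Run κ I ω r₀ rs ∧ r₀.time ≤ n ^ d + d ∧
      (((rs.map CallRecord.time).sum : ℕ) : ℝ) ≤ (I.requests.map (allowedTime C ε I)).sum

end OMvLB

/-! The proof turns an algorithm for the dynamic problem, in either mode, into an OMv algorithm with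
total time `O(N ^ (3 - ε / (2 * (d + 4))))`, where `d` is the exponent of the preprocessing time.

A `b × b` matrix is encoded in a graph on `5 * b` vertices: rows, columns, an edge from row to
column for each entry 1, and for each of `b` stages a private source and a private sink. Given bits
for the rows and columns, stage `k` sees to it that, when its query is asked, exactly those of its
edges source → row and column → sink are present whose bit is set. The query then decides whether a
vector-matrix-vector product is nonzero. Edges of other stages do no harm, since foreign sources
cannot be entered and foreign sinks cannot be left (`reachable_iff`). All edges are known in
advance; the bits only decide which of the `2 * b` edges of a stage precede its query. So the actual
sequence permutes the predicted one inside windows of length `2 * b`, whence `η ≤ 2 * b`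
(`etaInf_productInstance_le`), and `3 * b ^ 2` updates and `b` queries take time `O(b ^ (3 - ε))`
together (`sum_allowedTime_productInstance_le`).

An `N × N` matrix is cut into about `(N / b) ^ 2` blocks. To multiply a vector, all blocks are
visited; the row bits mark the rows whose product is not yet known to be 1, the column bits are the
part of the vector. A negative answer means that the block contributes nothing new; a positive one
triggers a scan of the block in `O(b ^ 2)` steps. A right positive answer yields a new row, so there
are `O(N)` scans per vector (`Layout.Ideal.block`, `wp_block`). After `b` vectors the stages are
used up and every simulated instance is reset to its state after preprocessing. With `N / b` such
batches the simulation costs about `N ^ 3 * b ^ (-ε)`, up to a logarithm. Preprocessing is done once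
per block and copy, and is affordable because `b` is about `N ^ (1 / (d + 4))`.

Correctness is promised only for inputs independent of the coins, whereas the bits of later blocks
depend on earlier answers. Therefore the run is compared with an ideal history that is a function of
the matrix and the vectors alone. For the ideal history a majority vote of `R = O(log N)`
independent copies errs with probability at most `(17 / 18) ^ R` (`majority_error_le`), and a union
bound over vectors and blocks makes all ideal votes right with probability at least `2 / 3`
(`two_thirds_le_good`). If they are right, the actual history equals the ideal one by induction
(`wp_blocks`, `session_queries`). The time bound holds for all coins, as the number of scans is
capped.

The reduction has to be a word-RAM program. It is written in a small imperative language with a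
verified compiler (`Cmd.compile_correct`). The given programs are translated into that language
(`wp_sim`), working on cells with generation stamps, so that the reset of all instances is a single
increment. -/

namespace OMvLB

/-! ### Basic facts about executions -/

/-- With the coin sequence fixed, execution is a partial function. This justifies the functions
`callState`, `callTime` and `runState`, which replace the relations in the rest of the proof. -/
theorem Exec.det {W : ℕ} {ω : ℕ → Bool} {inp : List ℕ} {p : Prog} {s s₁ s₂ : State} {t₁ t₂ : ℕ}
    (h₁ : Exec W ω inp p s t₁ s₁) (h₂ : Exec W ω inp p s t₂ s₂) : t₁ = t₂ ∧ s₁ = s₂ := by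
  induction h₁ generalizing t₂ s₂ with
  | seq _ _ ih₁ ih₂ =>
    cases h₂ with
    | seq hp hq =>
      obtain ⟨rfl, rfl⟩ := ih₁ hp
      obtain ⟨rfl, rfl⟩ := ih₂ hq
      exact ⟨rfl, rfl⟩
  | ite_true h _ ih =>
    cases h₂ with
    | ite_true _ hp => obtain ⟨rfl, rfl⟩ := ih hp; exact ⟨rfl, rfl⟩
    | ite_false h' _ => exact absurd h' h
  | ite_false h _ ih =>
    cases h₂ with
    | ite_false _ hp => obtain ⟨rfl, rfl⟩ := ih hp; exact ⟨rfl, rfl⟩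
    | ite_true h' _ => exact absurd h h'
  | while_done h =>
    cases h₂ with
    | while_done _ => exact ⟨rfl, rfl⟩
    | while_step h' _ _ => exact absurd h h'
  | while_step h _ _ ih₁ ih₂ =>
    cases h₂ with
    | while_done h' => exact absurd h' h
    | while_step _ hp hq =>
      obtain ⟨rfl, rfl⟩ := ih₁ hp
      obtain ⟨rfl, rfl⟩ := ih₂ hq
      exact ⟨rfl, rfl⟩
  | _ => cases h₂; exact ⟨rfl, rfl⟩

/-- A step consumes at most one coin. Time bounds therefore also bound the length of the tape that
has to be prepared for a simulated run. -/
theorem Exec.coins_le {W : ℕ} {ω : ℕ → Bool} {inp : List ℕ} {p : Prog} {s s' : State} {t : ℕ}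
    (h : Exec W ω inp p s t s') : s.coins ≤ s'.coins ∧ s'.coins ≤ s.coins + t := by
  induction h <;> (try simp only [State.setReg]) <;> omega

/-- A run inspects no coin beyond its final position. Events about bounded runs thus depend on
finitely many coins, which gives their measurability. -/
theorem Exec.congr_coins {W : ℕ} {ω ω' : ℕ → Bool} {inp : List ℕ} {p : Prog} {s s' : State} {t : ℕ}
    (h : Exec W ω inp p s t s') (hω : ∀ i < s'.coins, ω i = ω' i) : Exec W ω' inp p s t s' := by
  induction h with
  | skip s => exact .skip s
  | const s r c h => exact .const s r c h
  | op s o r a b h => exact .op s o r a b h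
  | load s r a => exact .load s r a
  | store s a r => exact .store s a r
  | input s r a h => exact .input s r a h
  | output s a r => exact .output s a r
  | flip s r h =>
    have e : ω s.coins = ω' s.coins := hω _ (by simp)
    rw [e] at h ⊢
    exact .flip s r h
  | seq hp hq ih₁ ih₂ =>
    exact .seq (ih₁ fun i hi => hω i (hi.trans_le hq.coins_le.1)) (ih₂ hω)
  | ite_true h _ ih => exact .ite_true h (ih hω)
  | ite_false h _ ih => exact .ite_false h (ih hω)
  | while_done h => exact .while_done h
  | while_step h hp hw ih₁ ih₂ =>
    exact .while_step h (ih₁ fun i hi => hω i (hi.trans_le hw.coins_le.1)) (ih₂ hω)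

/-- All registers and memory cells hold words. -/
def State.Bdd (W : ℕ) (s : State) : Prop := (∀ r, s.reg r < W) ∧ ∀ a, s.mem a < W

theorem State.Bdd.setReg {W : ℕ} {s : State} (h : s.Bdd W) {r x : ℕ} (hx : x < W) :
    (s.setReg r x).Bdd W := by
  refine ⟨fun r' => ?_, h.2⟩
  by_cases e : r' = r
  · subst e; simpa [State.setReg] using hx
  · simpa [State.setReg, e] using h.1 r'

/-- Each new value is either checked against `W` or copied from a register or cell. Since addresses
are register contents, `W` memory cells suffice to simulate a program. -/
theorem Exec.bdd {W : ℕ} {ω : ℕ → Bool} {inp : List ℕ} {p : Prog} {s s' : State} {t : ℕ}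
    (h : Exec W ω inp p s t s') (hs : s.Bdd W) : s'.Bdd W := by
  induction h with
  | skip s => exact hs
  | const s r c h => exact hs.setReg h
  | op s o r a b h => exact hs.setReg h
  | load s r a => exact hs.setReg (hs.2 _)
  | store s a r =>
    refine ⟨hs.1, fun a' => ?_⟩
    by_cases e : a' = s.reg a
    · subst e; simpa using hs.1 r
    · simpa [e] using hs.2 a'
  | input s r a h => exact hs.setReg h
  | output s a r => exact hs
  | flip s r h => exact hs.setReg h
  | seq hp hq ih₁ ih₂ => exact ih₂ (ih₁ hs)
  | ite_true h _ ih => exact ih hs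
  | ite_false h _ ih => exact ih hs
  | while_done h => exact hs
  | while_step h hp hw ih₁ ih₂ => exact ih₂ (ih₁ hs)

/-! ### Runs of a list of calls as functions of the initial state -/

/-- The state with cleared output cells in which a call starts. -/
def State.clear (s : State) : State := { s with out := fun _ => 0 }

/-- A call halts. -/
def CallHalts (W : ℕ) (ω : ℕ → Bool) (s : State) (c : Prog × List ℕ) : Prop :=
  ∃ x : ℕ × State, Exec W ω c.2 c.1 s.clear x.1 x.2

open Classical in
/-- The state after a call (unchanged if the call does not halt). -/
noncomputable def callState (W : ℕ) (ω : ℕ → Bool) (s : State) (c : Prog × List ℕ) : State :=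
  if h : CallHalts W ω s c then h.choose.2 else s

open Classical in
/-- The number of steps of a call. -/
noncomputable def callTime (W : ℕ) (ω : ℕ → Bool) (s : State) (c : Prog × List ℕ) : ℕ :=
  if h : CallHalts W ω s c then h.choose.1 else 0

theorem CallHalts.exec {W : ℕ} {ω : ℕ → Bool} {s : State} {c : Prog × List ℕ}
    (h : CallHalts W ω s c) :
    Exec W ω c.2 c.1 s.clear (callTime W ω s c) (callState W ω s c) := by
  unfold callTime callState
  rw [dif_pos h, dif_pos h]
  exact h.choose_spec

theorem callState_eq {W : ℕ} {ω : ℕ → Bool} {s s' : State} {c : Prog × List ℕ} {t : ℕ}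
    (h : Exec W ω c.2 c.1 s.clear t s') :
    callTime W ω s c = t ∧ callState W ω s c = s' :=
  (CallHalts.exec ⟨(t, s'), h⟩).det h

/-- The state after a list of calls. -/
noncomputable def runState (W : ℕ) (ω : ℕ → Bool) : State → List (Prog × List ℕ) → State
  | s, [] => s
  | s, c :: l => runState W ω (callState W ω s c) l

/-- The total number of steps of a list of calls. -/
noncomputable def runTime (W : ℕ) (ω : ℕ → Bool) : State → List (Prog × List ℕ) → ℕ
  | _, [] => 0
  | s, c :: l => callTime W ω s c + runTime W ω (callState W ω s c) l

/-- All calls in a list halt. -/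
def RunHalts (W : ℕ) (ω : ℕ → Bool) : State → List (Prog × List ℕ) → Prop
  | _, [] => True
  | s, c :: l => CallHalts W ω s c ∧ RunHalts W ω (callState W ω s c) l

/-- The records of a list of calls. -/
noncomputable def runRecords (W : ℕ) (ω : ℕ → Bool) :
    State → List (Prog × List ℕ) → List CallRecord
  | _, [] => []
  | s, c :: l => ⟨callTime W ω s c, (callState W ω s c).out⟩ ::
      runRecords W ω (callState W ω s c) l

theorem runState_append (W : ℕ) (ω : ℕ → Bool) (s : State) (l l' : List (Prog × List ℕ)) :
    runState W ω s (l ++ l') = runState W ω (runState W ω s l) l' := by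
  induction l generalizing s with
  | nil => rfl
  | cons c l ih => exact ih _

theorem runTime_append (W : ℕ) (ω : ℕ → Bool) (s : State) (l l' : List (Prog × List ℕ)) :
    runTime W ω s (l ++ l') = runTime W ω s l + runTime W ω (runState W ω s l) l' := by
  induction l generalizing s with
  | nil => simp [runTime, runState]
  | cons c l ih => simp [runTime, runState, ih, add_assoc]

theorem runHalts_append (W : ℕ) (ω : ℕ → Bool) (s : State) (l l' : List (Prog × List ℕ)) :
    RunHalts W ω s (l ++ l') ↔ RunHalts W ω s l ∧ RunHalts W ω (runState W ω s l) l' := by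
  induction l generalizing s with
  | nil => simp [RunHalts, runState]
  | cons c l ih => simp [RunHalts, runState, ih, and_assoc]

theorem session_iff {W : ℕ} {ω : ℕ → Bool} {s : State} {l : List (Prog × List ℕ)}
    {recs : List CallRecord} :
    Session W ω s l recs ↔ RunHalts W ω s l ∧ recs = runRecords W ω s l := by
  constructor
  · intro h
    induction h with
    | nil s => exact ⟨trivial, rfl⟩
    | cons hp hs ih =>
      rename_i s s' p inp t calls recs
      obtain ⟨rfl, rfl⟩ := callState_eq (c := (p, inp)) hp
      exact ⟨⟨⟨(_, _), hp⟩, ih.1⟩, by rw [ih.2]; rfl⟩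
  · rintro ⟨h, rfl⟩
    induction l generalizing s with
    | nil => exact .nil s
    | cons c l ih => exact .cons h.1.exec (ih h.2)

theorem runRecords_time (W : ℕ) (ω : ℕ → Bool) (s : State) (l : List (Prog × List ℕ)) :
    ((runRecords W ω s l).map CallRecord.time).sum = runTime W ω s l := by
  induction l generalizing s with
  | nil => rfl
  | cons c l ih => simp [runRecords, runTime, ih]

theorem runRecords_append_getElem? (W : ℕ) (ω : ℕ → Bool) (s : State)
    (l l' : List (Prog × List ℕ)) (c : Prog × List ℕ) :
    (runRecords W ω s (l ++ c :: l'))[l.length]? =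
      some ⟨callTime W ω (runState W ω s l) c, (callState W ω (runState W ω s l) c).out⟩ := by
  induction l generalizing s with
  | nil => simp [runRecords, runState]
  | cons d l ih => simp [runRecords, runState, ih]

theorem RunHalts.coins_le {W : ℕ} {ω : ℕ → Bool} {s : State} {l : List (Prog × List ℕ)}
    (h : RunHalts W ω s l) : s.coins ≤ (runState W ω s l).coins ∧
      (runState W ω s l).coins ≤ s.coins + runTime W ω s l := by
  induction l generalizing s with
  | nil => simp [runState]
  | cons c l ih =>
    have h₁ := h.1.exec.coins_le
    have h₂ := ih h.2
    simp only [runState, runTime, State.clear] at *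
    omega

theorem RunHalts.congr_coins {W : ℕ} {ω ω' : ℕ → Bool} {s : State} {l : List (Prog × List ℕ)}
    (h : RunHalts W ω s l) (hω : ∀ i < (runState W ω s l).coins, ω i = ω' i) :
    runState W ω' s l = runState W ω s l := by
  induction l generalizing s with
  | nil => rfl
  | cons c l ih =>
    have h₁ := h.1.exec.congr_coins (ω' := ω') fun i hi => hω i (hi.trans_le h.2.coins_le.1)
    have h₂ := (callState_eq h₁).2
    simp only [runState] at *
    rw [h₂]
    exact ih h.2 hω

/-! ### A programming language with variables, arrays and expressions, and its compiler -/

/-- Variables of the high-level language. -/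
inductive Var
  | x₁ | x₂ | x₃ | y₁ | y₂ | answer | inpLen | base | copy | gen | step
  | dim | side | copies | blocks | padded | verts | edges | tapeLen | coinLen | stride
  | pow | log | i | j | l | block | votes | found
  deriving DecidableEq

/-- Arrays of the high-level language. -/
inductive Arr
  | cells | stamp | inp | coins | mat | vec | det
  deriving DecidableEq

/-- The register that holds a variable; registers with odd numbers are used for intermediate
results. -/
def Var.toReg (x : Var) : ℕ := 2 * x.ctorIdx

theorem Var.toReg_injective : Function.Injective Var.toReg := by
  intro x y h
  have h' : x.ctorIdx = y.ctorIdx := by unfold Var.toReg at h; omega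
  revert h'
  cases x <;> cases y <;> first | (intro; rfl) | (intro h; exact absurd h (by decide))

/-- The residue modulo `8` of the addresses of an array. -/
def Arr.toNat (a : Arr) : ℕ := a.ctorIdx

theorem Arr.toNat_lt (a : Arr) : a.toNat < 8 := by cases a <;> decide

theorem Arr.toNat_injective : Function.Injective Arr.toNat := by
  intro x y
  cases x <;> cases y <;> first | (intro; rfl) | (intro h; exact absurd h (by decide))

/-- States of the high-level language; the time is counted in steps of that language. -/
structure HState where
  var : Var → ℕ
  arr : Arr → ℕ → ℕ
  out : ℕ → ℕ
  coins : ℕ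
  time : ℕ

/-- Let one unit of time pass. -/
def HState.tick (h : HState) : HState := { h with time := h.time + 1 }

/-- Assign a value to a variable. -/
def HState.set (h : HState) (x : Var) (v : ℕ) : HState :=
  { h with var := Function.update h.var x v }

/-- Assign a value to an array entry. -/
def HState.setArr (h : HState) (a : Arr) (i v : ℕ) : HState :=
  { h with arr := Function.update h.arr a (Function.update (h.arr a) i v) }

/-- Operations allowed in expressions. -/
inductive AOp
  | add | sub | mul | div | mod | eq | lt

/-- The machine instruction of an operation. -/
def AOp.toBinOp : AOp → BinOp
  | .add => .add
  | .sub => .sub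
  | .mul => .mul
  | .div => .div
  | .mod => .mod
  | .eq => .eq
  | .lt => .lt

/-- Value of an operation. -/
def AOp.eval (o : AOp) : ℕ → ℕ → ℕ := o.toBinOp.eval

@[simp] theorem AOp.eval_add (x y : ℕ) : AOp.add.eval x y = x + y := rfl
@[simp] theorem AOp.eval_sub (x y : ℕ) : AOp.sub.eval x y = x - y := rfl
@[simp] theorem AOp.eval_mul (x y : ℕ) : AOp.mul.eval x y = x * y := rfl
@[simp] theorem AOp.eval_div (x y : ℕ) : AOp.div.eval x y = x / y := rfl
@[simp] theorem AOp.eval_mod (x y : ℕ) : AOp.mod.eval x y = x % y := rfl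
@[simp] theorem AOp.eval_eq (x y : ℕ) : AOp.eq.eval x y = if x = y then 1 else 0 := rfl
@[simp] theorem AOp.eval_lt (x y : ℕ) : AOp.lt.eval x y = if x < y then 1 else 0 := rfl

/-- Expressions. -/
inductive Expr
  | const (c : ℕ)
  | var (x : Var)
  | arr (a : Arr) (e : Expr)
  | inp (e : Expr)
  | bin (o : AOp) (e f : Expr)

/-- Value of an expression. -/
def Expr.eval (inp : List ℕ) (h : HState) : Expr → ℕ
  | .const c => c
  | .var x => h.var x
  | .arr a e => h.arr a (e.eval inp h)
  | .inp e => inp.getD (e.eval inp h) 0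
  | .bin o e f => o.eval (e.eval inp h) (f.eval inp h)

instance : Coe Var Expr := ⟨Expr.var⟩
instance (n : ℕ) : OfNat Expr n := ⟨Expr.const n⟩
instance : Add Expr := ⟨Expr.bin .add⟩
instance : Sub Expr := ⟨Expr.bin .sub⟩
instance : Mul Expr := ⟨Expr.bin .mul⟩
instance : Div Expr := ⟨Expr.bin .div⟩
instance : Mod Expr := ⟨Expr.bin .mod⟩

/-- Comparison for equality. -/
def Expr.eq (e f : Expr) : Expr := .bin .eq e f

/-- Comparison. -/
def Expr.lt (e f : Expr) : Expr := .bin .lt e f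

/-- A power with literal exponent. -/
def Expr.pow (e : Expr) : ℕ → Expr
  | 0 => 1
  | k + 1 => Expr.pow e k * e

section eval
variable (inp : List ℕ) (h : HState) (e f : Expr)

@[simp] theorem Expr.eval_const (c : ℕ) : (Expr.const c).eval inp h = c := rfl
@[simp] theorem Expr.eval_ofNat (n : ℕ) : (ofNat(n) : Expr).eval inp h = n := rfl
@[simp] theorem Expr.eval_var (x : Var) : (Expr.var x).eval inp h = h.var x := rfl
@[simp] theorem Expr.eval_arr (a : Arr) :
    (Expr.arr a e).eval inp h = h.arr a (e.eval inp h) := rfl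
@[simp] theorem Expr.eval_inp :
    (Expr.inp e).eval inp h = inp.getD (e.eval inp h) 0 := rfl
@[simp] theorem Expr.eval_add : (e + f).eval inp h = e.eval inp h + f.eval inp h := rfl
@[simp] theorem Expr.eval_sub : (e - f).eval inp h = e.eval inp h - f.eval inp h := rfl
@[simp] theorem Expr.eval_mul : (e * f).eval inp h = e.eval inp h * f.eval inp h := rfl
@[simp] theorem Expr.eval_div : (e / f).eval inp h = e.eval inp h / f.eval inp h := rfl
@[simp] theorem Expr.eval_mod : (e % f).eval inp h = e.eval inp h % f.eval inp h := rfl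
@[simp] theorem Expr.eval_eq :
    (e.eq f).eval inp h = if e.eval inp h = f.eval inp h then 1 else 0 := rfl
@[simp] theorem Expr.eval_lt :
    (e.lt f).eval inp h = if e.eval inp h < f.eval inp h then 1 else 0 := rfl
@[simp] theorem Expr.eval_pow (k : ℕ) : (e.pow k).eval inp h = e.eval inp h ^ k := by
  induction k with
  | zero => rfl
  | succ k ih => simp [Expr.pow, ih, pow_succ]

end eval

/-- A bound for the literals, for the growth of values and for the evaluation time. -/
def Expr.size : Expr → ℕ
  | .const c => c + 1
  | .var _ => 3
  | .arr _ e => e.size + 8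
  | .inp e => e.size + 8
  | .bin _ e f => e.size + f.size + 1

/-- Commands. -/
inductive Cmd
  | skip
  | assign (x : Var) (e : Expr)
  | op (o : BinOp) (x y z : Var)
  | store (a : Arr) (e f : Expr)
  | out (e f : Expr)
  | flip (x : Var)
  | seq (c d : Cmd)
  | ite (e : Expr) (c d : Cmd)
  | while (e : Expr) (c : Cmd)

/-- Semantics of commands; values that are assigned or stored have to be less than `B`. -/
inductive HExec (B : ℕ) (ω : ℕ → Bool) (inp : List ℕ) : Cmd → HState → HState → Prop
  | skip (h : HState) : HExec B ω inp .skip h h.tick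
  | assign (h : HState) (x : Var) (e : Expr) (hB : e.eval inp h < B) :
      HExec B ω inp (.assign x e) h (h.set x (e.eval inp h)).tick
  | op (h : HState) (o : BinOp) (x y z : Var) (hB : o.eval (h.var y) (h.var z) < B) :
      HExec B ω inp (.op o x y z) h (h.set x (o.eval (h.var y) (h.var z))).tick
  | store (h : HState) (a : Arr) (e f : Expr) (hB : f.eval inp h < B) :
      HExec B ω inp (.store a e f) h (h.setArr a (e.eval inp h) (f.eval inp h)).tick
  | out (h : HState) (e f : Expr) :
      HExec B ω inp (.out e f) h
        { h with out := Function.update h.out (e.eval inp h) (f.eval inp h) }.tick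
  | flip (h : HState) (x : Var) :
      HExec B ω inp (.flip x) h { h.set x (ω h.coins).toNat with coins := h.coins + 1 }.tick
  | seq {c d : Cmd} {h h' h'' : HState} (hc : HExec B ω inp c h h')
      (hd : HExec B ω inp d h' h'') : HExec B ω inp (.seq c d) h h''
  | ite_true {e : Expr} {c d : Cmd} {h h' : HState} (he : e.eval inp h ≠ 0)
      (hc : HExec B ω inp c h.tick h') : HExec B ω inp (.ite e c d) h h'
  | ite_false {e : Expr} {c d : Cmd} {h h' : HState} (he : e.eval inp h = 0)
      (hd : HExec B ω inp d h.tick h') : HExec B ω inp (.ite e c d) h h'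
  | while_done {e : Expr} {c : Cmd} {h : HState} (he : e.eval inp h = 0) :
      HExec B ω inp (.while e c) h h.tick
  | while_step {e : Expr} {c : Cmd} {h h' h'' : HState} (he : e.eval inp h ≠ 0)
      (hc : HExec B ω inp c h.tick h') (hw : HExec B ω inp (.while e c) h' h'') :
      HExec B ω inp (.while e c) h h''

/-- A register for intermediate results. -/
def tmp (i : ℕ) : ℕ := 2 * i + 1

/-- Turn an index into the address of an array entry, then continue with `q`. -/
def addressThen (a : Arr) (i : ℕ) (q : Prog) : Prog :=
  .seq (.const (tmp (i + 1)) 8) <| .seq (.op .mul (tmp i) (tmp i) (tmp (i + 1))) <|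
    .seq (.const (tmp (i + 1)) a.toNat) <| .seq (.op .add (tmp i) (tmp i) (tmp (i + 1))) q

/-- Evaluate an expression into the register `tmp i`. -/
def Expr.compile : Expr → ℕ → Prog
  | .const c, i => .const (tmp i) c
  | .var x, i => .seq (.const (tmp i) 0) (.op .add (tmp i) (tmp i) x.toReg)
  | .arr a e, i => .seq (e.compile i) <| addressThen a i <| .load (tmp i) (tmp i)
  | .inp e, i => .seq (e.compile i) (.input (tmp i) (tmp i))
  | .bin o e f, i => .seq (e.compile i) <| .seq (f.compile (i + 1)) <|
      .op o.toBinOp (tmp i) (tmp i) (tmp (i + 1))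

/-- Translate commands into programs of the random access machine. -/
def Cmd.compile : Cmd → Prog
  | .skip => .skip
  | .assign x e => .seq (e.compile 0) <| .seq (.const (tmp 1) 0) <|
      .op .add x.toReg (tmp 0) (tmp 1)
  | .op o x y z => .op o x.toReg y.toReg z.toReg
  | .store a e f => .seq (e.compile 0) <| addressThen a 0 <| .seq (f.compile 1) <|
      .store (tmp 0) (tmp 1)
  | .out e f => .seq (e.compile 0) <| .seq (f.compile 1) <| .output (tmp 0) (tmp 1)
  | .flip x => .flip x.toReg
  | .seq c d => .seq c.compile d.compile
  | .ite e c d => .seq (e.compile 0) <| .ite (tmp 0) c.compile d.compile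
  | .while e c => .seq (e.compile 0) <| .while (tmp 0) (.seq c.compile (e.compile 0))

/-- All expressions in a command have at most the given size. -/
def Cmd.Fits (S : ℕ) : Cmd → Prop
  | .skip => True
  | .assign _ e => e.size ≤ S
  | .op _ _ _ _ => True
  | .store _ e f => e.size ≤ S ∧ f.size ≤ S
  | .out e f => e.size ≤ S ∧ f.size ≤ S
  | .flip _ => True
  | .seq c d => c.Fits S ∧ d.Fits S
  | .ite e c d => e.size ≤ S ∧ c.Fits S ∧ d.Fits S
  | .while e c => e.size ≤ S ∧ c.Fits S

theorem Cmd.Fits.mono {S S' : ℕ} (hS : S ≤ S') {c : Cmd} (h : c.Fits S) : c.Fits S' := by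
  induction c with
  | skip => trivial
  | assign x e => exact le_trans h hS
  | op => trivial
  | store a e f => exact ⟨h.1.trans hS, h.2.trans hS⟩
  | out e f => exact ⟨h.1.trans hS, h.2.trans hS⟩
  | flip => trivial
  | seq c d ihc ihd => exact ⟨ihc h.1, ihd h.2⟩
  | ite e c d ihc ihd => exact ⟨h.1.trans hS, ihc h.2.1, ihd h.2.2⟩
  | _ =>
    rename_i ih
    exact ⟨h.1.trans hS, ih h.2⟩

theorem Cmd.exists_fits (c : Cmd) : ∃ S, c.Fits S := by
  induction c with
  | skip => exact ⟨0, trivial⟩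
  | assign x e => exact ⟨_, le_rfl⟩
  | op => exact ⟨0, trivial⟩
  | store a e f => exact ⟨_, le_max_left _ _, le_max_right _ _⟩
  | out e f => exact ⟨_, le_max_left _ _, le_max_right _ _⟩
  | flip => exact ⟨0, trivial⟩
  | seq c d ihc ihd =>
    obtain ⟨S, hS⟩ := ihc
    obtain ⟨S', hS'⟩ := ihd
    exact ⟨max S S', hS.mono (le_max_left _ _), hS'.mono (le_max_right _ _)⟩
  | ite e c d ihc ihd =>
    obtain ⟨S, hS⟩ := ihc
    obtain ⟨S', hS'⟩ := ihd
    exact ⟨e.size + S + S', by omega, hS.mono (by omega), hS'.mono (by omega)⟩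
  | _ =>
    rename_i e c ih
    obtain ⟨S, hS⟩ := ih
    exact ⟨e.size + S, by omega, hS.mono (by omega)⟩

/-- All variables and array entries are less than `B`. -/
def HState.Bdd (B : ℕ) (h : HState) : Prop := (∀ x, h.var x < B) ∧ ∀ a i, h.arr a i < B

theorem HState.Bdd.set {B : ℕ} {h : HState} (hB : h.Bdd B) {x : Var} {v : ℕ} (hv : v < B) :
    (h.set x v).Bdd B := by
  refine ⟨fun y => ?_, hB.2⟩
  by_cases e : y = x
  · subst e; simpa [HState.set] using hv
  · simpa [HState.set, e] using hB.1 y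

theorem HState.Bdd.setArr {B : ℕ} {h : HState} (hB : h.Bdd B) {a : Arr} {i v : ℕ} (hv : v < B) :
    (h.setArr a i v).Bdd B := by
  refine ⟨hB.1, fun a' i' => ?_⟩
  by_cases e : a' = a
  · subst e
    by_cases e' : i' = i
    · subst e'; simpa [HState.setArr] using hv
    · simpa [HState.setArr, e'] using hB.2 a' i'
  · simpa [HState.setArr, e] using hB.2 a' i'

theorem HExec.bdd {B : ℕ} {ω : ℕ → Bool} {inp : List ℕ} {c : Cmd} {h h' : HState}
    (H : HExec B ω inp c h h') (hB : 1 < B) (hh : h.Bdd B) : h'.Bdd B := by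
  induction H with
  | skip h => exact hh
  | assign h x e hB => exact HState.Bdd.set hh hB
  | op h o x y z hB => exact HState.Bdd.set hh hB
  | store h a e f hB => exact HState.Bdd.setArr hh hB
  | out h e f => exact hh
  | flip h x =>
    exact HState.Bdd.set hh ((Bool.toNat_le _).trans_lt hB)
  | seq _ _ ihc ihd => exact ihd (ihc hh)
  | ite_true _ _ ih => exact ih hh
  | ite_false _ _ ih => exact ih hh
  | while_done _ => exact hh
  | while_step _ _ _ ihc ihw => exact ihw (ihc hh)

/-- A machine state represents a state of the high-level language. -/
structure Represents (s : State) (h : HState) : Prop where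
  var : ∀ x : Var, s.reg x.toReg = h.var x
  arr : ∀ (a : Arr) (i : ℕ), s.mem (8 * i + a.toNat) = h.arr a i
  out : s.out = h.out
  coins : s.coins = h.coins

theorem tmp_ne_toReg (i : ℕ) (x : Var) : x.toReg ≠ tmp i := by
  unfold tmp Var.toReg; omega

theorem Represents.setTmp {s : State} {h : HState} (H : Represents s h) (i v : ℕ) :
    Represents (s.setReg (tmp i) v) h :=
  ⟨fun x => by simp [State.setReg, tmp_ne_toReg, H.var], H.arr, H.out, H.coins⟩

theorem setReg_self (s : State) (r v : ℕ) : (s.setReg r v).reg r = v := by simp [State.setReg]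

theorem setReg_tmp_of_ne (s : State) {i j : ℕ} (v : ℕ) (h : i ≠ j) :
    (s.setReg (tmp j) v).reg (tmp i) = s.reg (tmp i) := by
  simp only [State.setReg]
  exact Function.update_of_ne (by unfold tmp; omega) _ _

/-- Variables, array entries and input words are below `B`; only sums and products grow, and the
extra factor `B ≥ 8` of an operation absorbs the sum of the two bounds. -/
theorem Expr.eval_lt_pow {B : ℕ} {inp : List ℕ} {h : HState} (hh : h.Bdd B)
    (hinp : ∀ i, inp.getD i 0 < B) (hB : 8 ≤ B) (e : Expr) : e.eval inp h < B ^ e.size := by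
  have hpos : ∀ k, 0 < B ^ k := fun k => Nat.pow_pos (by omega)
  induction e with
  | const c =>
    calc c < 2 ^ c := Nat.lt_two_pow_self
      _ ≤ B ^ c := Nat.pow_le_pow_left (by omega) c
      _ ≤ B ^ (c + 1) := Nat.pow_le_pow_right (by omega) (by omega)
  | var x => exact (hh.1 x).trans_le (Nat.le_self_pow (by simp [Expr.size]) B)
  | arr a e ih => exact (hh.2 a _).trans_le (Nat.le_self_pow (by simp [Expr.size]) B)
  | inp e ih => exact (hinp _).trans_le (Nat.le_self_pow (by simp [Expr.size]) B)
  | bin o e f ihe ihf =>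
    simp only [Expr.eval, Expr.size]
    generalize e.eval inp h = x at *
    generalize f.eval inp h = y at *
    have h1 : 1 ≤ B ^ e.size := hpos _
    have h2 : 1 ≤ B ^ f.size := hpos _
    have key : B ^ (e.size + f.size + 1) = B ^ e.size * B ^ f.size * B := by ring
    have h3 : B ^ e.size ≤ B ^ e.size * B ^ f.size := Nat.le_mul_of_pos_right _ h2
    have h4 : B ^ f.size ≤ B ^ e.size * B ^ f.size := Nat.le_mul_of_pos_left _ h1
    have h5 : B ^ e.size * B ^ f.size * 8 ≤ B ^ e.size * B ^ f.size * B :=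
      Nat.mul_le_mul_left _ hB
    have h6 : x * y ≤ B ^ e.size * B ^ f.size := Nat.mul_le_mul ihe.le ihf.le
    rw [key]
    cases o <;> simp only [AOp.eval_add, AOp.eval_sub, AOp.eval_mul, AOp.eval_div, AOp.eval_mod,
      AOp.eval_eq, AOp.eval_lt]
    · omega
    · omega
    · omega
    · have := Nat.div_le_self x y; omega
    · have := Nat.mod_le x y; omega
    · split <;> omega
    · split <;> omega

theorem exec_addressThen {W : ℕ} {ω : ℕ → Bool} {inp : List ℕ} {h : HState} (a : Arr) (i v : ℕ)
    {s : State} (hs : Represents s h) (hv : s.reg (tmp i) = v) (hW : 8 * v + 9 ≤ W) :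
    ∃ s', Represents s' h ∧ s'.reg (tmp i) = 8 * v + a.toNat ∧
      (∀ j < i, s'.reg (tmp j) = s.reg (tmp j)) ∧
      ∀ q t s'', Exec W ω inp q s' t s'' →
        Exec W ω inp (addressThen a i q) s (1 + (1 + (1 + (1 + t)))) s'' := by
  have ha := a.toNat_lt
  set s₂ := s.setReg (tmp (i + 1)) 8 with hs₂
  have e2 : BinOp.mul.eval (s₂.reg (tmp i)) (s₂.reg (tmp (i + 1))) = 8 * v := by
    rw [hs₂, setReg_tmp_of_ne _ _ (by omega), setReg_self, hv]; simp only [BinOp.eval]; ring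
  set s₃ := s₂.setReg (tmp i) (BinOp.mul.eval (s₂.reg (tmp i)) (s₂.reg (tmp (i + 1)))) with hs₃
  set s₄ := s₃.setReg (tmp (i + 1)) a.toNat with hs₄
  have e4 : BinOp.add.eval (s₄.reg (tmp i)) (s₄.reg (tmp (i + 1))) = 8 * v + a.toNat := by
    have e4a : s₄.reg (tmp i) = 8 * v := by
      rw [hs₄, setReg_tmp_of_ne _ _ (by omega), hs₃, setReg_self, e2]
    have e4b : s₄.reg (tmp (i + 1)) = a.toNat := setReg_self _ _ _
    rw [e4a, e4b]; rfl
  set s₅ := s₄.setReg (tmp i) (BinOp.add.eval (s₄.reg (tmp i)) (s₄.reg (tmp (i + 1)))) with hs₅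
  have x₂ : Exec W ω inp (.const (tmp (i + 1)) 8) s 1 s₂ := .const _ _ _ (by omega)
  have x₃ : Exec W ω inp (.op .mul (tmp i) (tmp i) (tmp (i + 1))) s₂ 1 s₃ :=
    .op _ .mul _ _ _ (by rw [e2]; omega)
  have x₄ : Exec W ω inp (.const (tmp (i + 1)) a.toNat) s₃ 1 s₄ := .const _ _ _ (by omega)
  have x₅ : Exec W ω inp (.op .add (tmp i) (tmp i) (tmp (i + 1))) s₄ 1 s₅ :=
    .op _ .add _ _ _ (by rw [e4]; omega)
  refine ⟨s₅, (((hs.setTmp _ _).setTmp _ _).setTmp _ _).setTmp _ _, by rw [hs₅, setReg_self, e4],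
    fun j hj => ?_, fun q t s'' hq => .seq x₂ (.seq x₃ (.seq x₄ (.seq x₅ hq)))⟩
  have n1 : j ≠ i := by omega
  have n2 : j ≠ i + 1 := by omega
  rw [hs₅, setReg_tmp_of_ne _ _ n1, hs₄, setReg_tmp_of_ne _ _ n2, hs₃,
    setReg_tmp_of_ne _ _ n1, hs₂, setReg_tmp_of_ne _ _ n2]

/-- Preservation of the registers `tmp j` with `j < i` is the heart of the induction: the left
operand waits in `tmp i` while the right one is evaluated from `tmp (i + 1)` on. -/
theorem Expr.compile_correct {B W : ℕ} {ω : ℕ → Bool} {inp : List ℕ} {h : HState} (hh : h.Bdd B)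
    (hinp : ∀ i, inp.getD i 0 < B) (hB : 8 ≤ B) (e : Expr) (hW : B ^ e.size ≤ W) (i : ℕ)
    {s : State} (hs : Represents s h) :
    ∃ t s', Exec W ω inp (e.compile i) s t s' ∧ t ≤ e.size ∧ Represents s' h ∧
      s'.reg (tmp i) = e.eval inp h ∧ ∀ j < i, s'.reg (tmp j) = s.reg (tmp j) := by
  have hmono : ∀ k, k ≤ e.size → B ^ k ≤ W := fun k hk =>
    (Nat.pow_le_pow_right (by omega) hk).trans hW
  have hlt := (e.eval_lt_pow hh hinp hB).trans_le hW
  induction e generalizing i s with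
  | const c =>
    exact ⟨_, _, .const s (tmp i) c hlt, by simp [Expr.size], hs.setTmp _ _, setReg_self _ _ _,
      fun j hj => setReg_tmp_of_ne _ _ hj.ne⟩
  | var x =>
    refine ⟨_, _, .seq (.const s (tmp i) 0 (by omega)) (.op _ .add (tmp i) (tmp i) x.toReg ?_), ?_,
      (hs.setTmp _ _).setTmp _ _, ?_, fun j hj => ?_⟩
    · rw [(hs.setTmp _ _).var, setReg_self]
      simpa [BinOp.eval] using hlt
    · simp [Expr.size]
    · rw [setReg_self, (hs.setTmp _ _).var, setReg_self]
      simp [BinOp.eval]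
    · rw [setReg_tmp_of_ne _ _ hj.ne, setReg_tmp_of_ne _ _ hj.ne]
  | arr a e ih =>
    have h0 := e.eval_lt_pow hh hinp hB
    simp only [Expr.size] at hW hmono
    obtain ⟨t, s₁, hex, ht, hr, hv, hf⟩ := ih (hmono _ (by omega)) i hs
      (fun k hk => hmono k (by omega)) (h0.trans_le (hmono _ (by omega)))
    have ha := a.toNat_lt
    have h8 : 8 * (e.eval inp h) + 9 ≤ W := by
      have h2 := hmono (e.size + 2) (by omega)
      have h3 : B ^ e.size * (8 * 8) ≤ B ^ e.size * (B * B) :=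
        Nat.mul_le_mul_left _ (Nat.mul_le_mul hB hB)
      have : B ^ (e.size + 2) = B ^ e.size * (B * B) := by ring
      omega
    obtain ⟨s₅, r5, e5, f5, x5⟩ := exec_addressThen (W := W) (ω := ω) (inp := inp) a i _ hr hv h8
    refine ⟨_, _, .seq hex (x5 _ _ _ (.load _ _ _)), ?_, r5.setTmp _ _, ?_, fun j hj => ?_⟩
    · simp only [Expr.size]; omega
    · rw [setReg_self, e5, r5.arr]
      rfl
    · rw [setReg_tmp_of_ne _ _ (by omega), f5 j hj, hf j hj]
  | inp e ih =>
    have h0 := e.eval_lt_pow hh hinp hB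
    simp only [Expr.size] at hW hmono
    obtain ⟨t, s₁, hex, ht, hr, hv, hf⟩ := ih (hmono _ (by omega)) i hs
      (fun k hk => hmono k (by omega)) (h0.trans_le (hmono _ (by omega)))
    refine ⟨_, _, .seq hex (.input _ _ _ ?_), ?_, hr.setTmp _ _, ?_, fun j hj => ?_⟩
    · rw [hv]; exact hlt
    · simp only [Expr.size]; omega
    · rw [setReg_self, hv]; rfl
    · rw [setReg_tmp_of_ne _ _ (by omega), hf j hj]
  | bin o e f ihe ihf =>
    have h0 := e.eval_lt_pow hh hinp hB
    have h0' := f.eval_lt_pow hh hinp hB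
    simp only [Expr.size] at hW hmono
    obtain ⟨t, s₁, hex, ht, hr, hv, hf⟩ := ihe (hmono _ (by omega)) i hs
      (fun k hk => hmono k (by omega)) (h0.trans_le (hmono _ (by omega)))
    obtain ⟨t', s₂, hex', ht', hr', hv', hf'⟩ := ihf (hmono _ (by omega)) (i + 1) hr
      (fun k hk => hmono k (by omega)) (h0'.trans_le (hmono _ (by omega)))
    refine ⟨_, _, .seq hex (.seq hex' (.op _ _ _ _ _ ?_)), ?_, hr'.setTmp _ _, ?_, fun j hj => ?_⟩
    · rw [hv', hf' i (by omega), hv]; exact hlt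
    · simp only [Expr.size]; omega
    · rw [setReg_self, hv', hf' i (by omega), hv]; rfl
    · rw [setReg_tmp_of_ne _ _ (by omega), hf' j (by omega), hf j hj]

theorem Represents.setVar {s : State} {h : HState} (H : Represents s h) (x : Var) (v : ℕ) :
    Represents (s.setReg x.toReg v) (h.set x v) := by
  refine ⟨fun y => ?_, H.arr, H.out, H.coins⟩
  by_cases e : y = x
  · subst e; simp [State.setReg, HState.set]
  · have : y.toReg ≠ x.toReg := fun h => e (Var.toReg_injective h)
    simp [State.setReg, HState.set, e, this, H.var]

theorem Represents.tick {s : State} {h : HState} (H : Represents s h) : Represents s h.tick :=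
  ⟨H.var, H.arr, H.out, H.coins⟩

theorem Represents.setArr {s : State} {h : HState} (H : Represents s h) (a : Arr) (i v : ℕ) :
    Represents { s with mem := Function.update s.mem (8 * i + a.toNat) v } (h.setArr a i v) := by
  refine ⟨H.var, fun a' i' => ?_, H.out, H.coins⟩
  have h1 := a.toNat_lt
  have h2 := a'.toNat_lt
  by_cases e : a' = a
  · subst e
    by_cases e' : i' = i
    · subst e'; simp [HState.setArr]
    · simp [HState.setArr, e', H.arr]
  · have h3 : a'.toNat ≠ a.toNat := fun h => e (Arr.toNat_injective h)
    have : 8 * i' + a'.toNat ≠ 8 * i + a.toNat := by omega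
    simp [HState.setArr, e, this, H.arr]

/-- Each unit of high-level time pays for at most `2 * S + 8` machine steps: two expressions of size
at most `S` and a few extra instructions. The exponent `S + 2` leaves room for addresses, which are
about eight times the index. -/
theorem Cmd.compile_correct {B W S : ℕ} {ω : ℕ → Bool} {inp : List ℕ}
    (hinp : ∀ i, inp.getD i 0 < B) (hB : 8 ≤ B) (hW : B ^ (S + 2) ≤ W) {c : Cmd} (hc : c.Fits S)
    {h h' : HState} (H : HExec B ω inp c h h') (hh : h.Bdd B) {s : State} (hs : Represents s h) :
    ∃ t s', Exec W ω inp c.compile s t s' ∧ Represents s' h' ∧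
      t + (2 * S + 8) * h.time ≤ (2 * S + 8) * h'.time := by
  have hmono : ∀ k, k ≤ S + 2 → B ^ k ≤ W := fun k hk =>
    (Nat.pow_le_pow_right (by omega) hk).trans hW
  have hBW : B ≤ W := by simpa using hmono 1 (by omega)
  induction H generalizing s with
  | skip h => exact ⟨_, _, .skip s, hs.tick, by simp only [HState.tick]; lia⟩
  | assign h x e hv =>
    obtain ⟨t, s₁, hex, ht, hr, hv', hf⟩ := e.compile_correct (ω := ω) hh hinp hB
      (hmono _ (le_trans hc (by omega))) 0 hs
    have e1 : BinOp.add.eval ((s₁.setReg (tmp 1) 0).reg (tmp 0))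
        ((s₁.setReg (tmp 1) 0).reg (tmp 1)) = e.eval inp h := by
      rw [setReg_tmp_of_ne _ _ (by omega), setReg_self, hv']; rfl
    refine ⟨_, _, .seq hex (.seq (.const _ _ _ (by omega)) (.op _ .add _ _ _ (by omega))), ?_, ?_⟩
    · rw [e1]
      exact ((hr.setTmp _ _).setVar _ _).tick
    · simp only [HState.tick, HState.set, Cmd.Fits] at hc ⊢; lia
  | op h o x y z hv =>
    rw [← hs.var y, ← hs.var z] at hv ⊢
    exact ⟨_, _, .op s o _ _ _ (by omega), (hs.setVar _ _).tick,
      by simp only [HState.tick, HState.set]; lia⟩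
  | store h a e f hv =>
    obtain ⟨t, s₁, hex, ht, hr, hv', hf⟩ := e.compile_correct (ω := ω) hh hinp hB
      (hmono _ (le_trans hc.1 (by omega))) 0 hs
    have ha := a.toNat_lt
    have h0 := e.eval_lt_pow hh hinp hB
    have h8 : 8 * (e.eval inp h) + 9 ≤ W := by
      have h2 := hmono (e.size + 2) (by have := hc.1; omega)
      have h3 : B ^ e.size * (8 * 8) ≤ B ^ e.size * (B * B) :=
        Nat.mul_le_mul_left _ (Nat.mul_le_mul hB hB)
      have : B ^ (e.size + 2) = B ^ e.size * (B * B) := by ring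
      omega
    obtain ⟨s₅, r5, e5, f5, x5⟩ := exec_addressThen (W := W) (ω := ω) (inp := inp) a 0 _ hr hv' h8
    obtain ⟨t', s₆, hex', ht', hr', hv'', hf'⟩ := f.compile_correct (ω := ω) hh hinp hB
      (hmono _ (le_trans hc.2 (by omega))) 1 r5
    refine ⟨_, _, .seq hex (x5 _ _ _ (.seq hex' (.store _ _ _))), ?_, ?_⟩
    · rw [hf' 0 (by omega), e5, hv'']
      exact (hr'.setArr _ _ _).tick
    · simp only [HState.tick, HState.setArr, Cmd.Fits] at hc ⊢; lia
  | out h e f =>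
    obtain ⟨t, s₁, hex, ht, hr, hv', hf⟩ := e.compile_correct (ω := ω) hh hinp hB
      (hmono _ (le_trans hc.1 (by omega))) 0 hs
    obtain ⟨t', s₆, hex', ht', hr', hv'', hf'⟩ := f.compile_correct (ω := ω) hh hinp hB
      (hmono _ (le_trans hc.2 (by omega))) 1 hr
    refine ⟨_, _, .seq hex (.seq hex' (.output _ _ _)), ?_, ?_⟩
    · rw [hf' 0 (by omega), hv', hv'']
      exact ⟨hr'.var, hr'.arr, by simp [HState.tick, hr'.out], hr'.coins⟩
    · simp only [HState.tick, Cmd.Fits] at hc ⊢; lia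
  | flip h x =>
    have e : ω s.coins = ω h.coins := by rw [hs.coins]
    refine ⟨_, _, .flip s _ ((Bool.toNat_le _).trans_lt (by omega)), ?_, ?_⟩
    · rw [e]
      have := hs.setVar x (ω h.coins).toNat
      exact ⟨this.var, this.arr, this.out, by simp [HState.tick, hs.coins]⟩
    · simp only [HState.tick, HState.set]; lia
  | seq H₁ H₂ ih₁ ih₂ =>
    obtain ⟨t, s₁, hex, hr, ht⟩ := ih₁ hc.1 hh hs
    obtain ⟨t', s₂, hex', hr', ht'⟩ := ih₂ hc.2 (H₁.bdd (by omega) hh) hr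
    exact ⟨_, _, .seq hex hex', hr', by omega⟩
  | ite_true he H ih =>
    rename_i e c d h h'
    obtain ⟨t, s₁, hex, ht, hr, hv', hf⟩ := e.compile_correct (ω := ω) hh hinp hB
      (hmono _ (le_trans hc.1 (by omega))) 0 hs
    obtain ⟨t', s₂, hex', hr', ht'⟩ := ih hc.2.1 hh hr.tick
    refine ⟨_, _, .seq hex (.ite_true (by rwa [hv']) hex'), hr', ?_⟩
    simp only [HState.tick, Cmd.Fits] at hc ht' ⊢; lia
  | ite_false he H ih =>
    rename_i e c d h h'
    obtain ⟨t, s₁, hex, ht, hr, hv', hf⟩ := e.compile_correct (ω := ω) hh hinp hB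
      (hmono _ (le_trans hc.1 (by omega))) 0 hs
    obtain ⟨t', s₂, hex', hr', ht'⟩ := ih hc.2.2 hh hr.tick
    refine ⟨_, _, .seq hex (.ite_false (by rwa [hv']) hex'), hr', ?_⟩
    simp only [HState.tick, Cmd.Fits] at hc ht' ⊢; lia
  | while_done he =>
    rename_i e c h
    obtain ⟨t, s₁, hex, ht, hr, hv', hf⟩ := e.compile_correct (ω := ω) hh hinp hB
      (hmono _ (le_trans hc.1 (by omega))) 0 hs
    refine ⟨_, _, .seq hex (.while_done (by rwa [hv'])), hr.tick, ?_⟩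
    simp only [HState.tick, Cmd.Fits] at hc ⊢; lia
  | while_step he H₁ H₂ ih₁ ih₂ =>
    rename_i e c h h' h''
    obtain ⟨t, s₁, hex, ht, hr, hv', hf⟩ := e.compile_correct (ω := ω) hh hinp hB
      (hmono _ (le_trans hc.1 (by omega))) 0 hs
    obtain ⟨t', s₂, hex', hr', ht'⟩ := ih₁ hc.2 hh hr.tick
    obtain ⟨t'', s₃, hex'', hr'', ht''⟩ := ih₂ hc (H₁.bdd (by omega) hh) hr'
    -- The rest of the loop starts with an evaluation of the condition; in the compiled program this
    -- evaluation is the end of the loop body, so the execution is regrouped.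
    cases hex'' with
    | seq ha hb =>
      refine ⟨_, _, .seq hex (.while_step (by rwa [hv']) (.seq hex' ha) hb), hr'', ?_⟩
      simp only [HState.tick, Cmd.Fits] at hc ht' ⊢; lia

/-! ### Weakest preconditions -/

/-- Executing `c` from `h` ends in a state with property `Q`. -/
def WP (B : ℕ) (ω : ℕ → Bool) (inp : List ℕ) (c : Cmd) (h : HState) (Q : HState → Prop) : Prop :=
  ∃ h', HExec B ω inp c h h' ∧ Q h'

/-- Sequential composition of a list of commands. -/
def Cmd.block : List Cmd → Cmd
  | [] => .skip
  | c :: l => .seq c (Cmd.block l)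

/-- Execute `c` for `x = 0, …, e - 1`. -/
def Cmd.for (x : Var) (e : Expr) (c : Cmd) : Cmd :=
  .seq (.assign x 0) (.while (Expr.lt x e) (.seq c (.assign x (x + 1 : Expr))))

section simps
variable (h : HState) (x y : Var) (a a' : Arr) (i j v : ℕ)

@[simp] theorem HState.tick_var : h.tick.var = h.var := rfl
@[simp] theorem HState.tick_arr : h.tick.arr = h.arr := rfl
@[simp] theorem HState.tick_out : h.tick.out = h.out := rfl
@[simp] theorem HState.tick_coins : h.tick.coins = h.coins := rfl
@[simp] theorem HState.tick_time : h.tick.time = h.time + 1 := rfl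
@[simp] theorem HState.set_var : (h.set x v).var y = if y = x then v else h.var y := by
  simp [HState.set, Function.update_apply]
@[simp] theorem HState.set_arr : (h.set x v).arr = h.arr := rfl
@[simp] theorem HState.set_out : (h.set x v).out = h.out := rfl
@[simp] theorem HState.set_coins : (h.set x v).coins = h.coins := rfl
@[simp] theorem HState.set_time : (h.set x v).time = h.time := rfl
@[simp] theorem HState.setArr_var : (h.setArr a i v).var = h.var := rfl
@[simp] theorem HState.setArr_out : (h.setArr a i v).out = h.out := rfl
@[simp] theorem HState.setArr_coins : (h.setArr a i v).coins = h.coins := rfl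
@[simp] theorem HState.setArr_time : (h.setArr a i v).time = h.time := rfl
@[simp] theorem HState.setArr_arr :
    (h.setArr a i v).arr a' j = if a' = a ∧ j = i then v else h.arr a' j := by
  by_cases e : a' = a
  · subst e; simp [HState.setArr, Function.update_apply]
  · simp [HState.setArr, e]

theorem HState.setArr_arr_of_ne (e : a' ≠ a) : (h.setArr a i v).arr a' = h.arr a' := by
  simp [HState.setArr, e]

end simps

section wp
variable {B : ℕ} {ω : ℕ → Bool} {inp : List ℕ} {h : HState} {Q Q' : HState → Prop}

theorem WP.mono {c : Cmd} (H : WP B ω inp c h Q') (hQ : ∀ h', Q' h' → Q h') :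
    WP B ω inp c h Q :=
  H.imp fun _ hh => ⟨hh.1, hQ _ hh.2⟩

theorem wp_skip (H : Q h.tick) : WP B ω inp .skip h Q := ⟨_, .skip h, H⟩

theorem wp_assign {x : Var} {e : Expr} (hB : e.eval inp h < B)
    (H : Q (h.set x (e.eval inp h)).tick) : WP B ω inp (.assign x e) h Q :=
  ⟨_, .assign h x e hB, H⟩

theorem wp_op {o : BinOp} {x y z : Var} (hB : o.eval (h.var y) (h.var z) < B)
    (H : Q (h.set x (o.eval (h.var y) (h.var z))).tick) : WP B ω inp (.op o x y z) h Q :=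
  ⟨_, .op h o x y z hB, H⟩

theorem wp_store {a : Arr} {e f : Expr} (hB : f.eval inp h < B)
    (H : Q (h.setArr a (e.eval inp h) (f.eval inp h)).tick) : WP B ω inp (.store a e f) h Q :=
  ⟨_, .store h a e f hB, H⟩

theorem wp_out {e f : Expr}
    (H : Q { h with out := Function.update h.out (e.eval inp h) (f.eval inp h) }.tick) :
    WP B ω inp (.out e f) h Q :=
  ⟨_, .out h e f, H⟩

theorem wp_flip {x : Var}
    (H : Q { h.set x (ω h.coins).toNat with coins := h.coins + 1 }.tick) :
    WP B ω inp (.flip x) h Q :=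
  ⟨_, .flip h x, H⟩

theorem wp_seq {c d : Cmd} (H : WP B ω inp c h fun h' => WP B ω inp d h' Q) :
    WP B ω inp (.seq c d) h Q := by
  obtain ⟨h', hc, h'', hd, hQ⟩ := H
  exact ⟨h'', .seq hc hd, hQ⟩

theorem wp_ite {e : Expr} {c d : Cmd} (H₁ : e.eval inp h ≠ 0 → WP B ω inp c h.tick Q)
    (H₂ : e.eval inp h = 0 → WP B ω inp d h.tick Q) : WP B ω inp (.ite e c d) h Q := by
  by_cases he : e.eval inp h = 0
  · obtain ⟨h', hd, hQ⟩ := H₂ he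
    exact ⟨h', .ite_false he hd, hQ⟩
  · obtain ⟨h', hc, hQ⟩ := H₁ he
    exact ⟨h', .ite_true he hc, hQ⟩

theorem wp_nil (H : Q h.tick) : WP B ω inp (.block []) h Q := wp_skip H

theorem wp_cons {c : Cmd} {l : List Cmd}
    (H : WP B ω inp c h fun h' => WP B ω inp (.block l) h' Q) :
    WP B ω inp (.block (c :: l)) h Q := wp_seq H

/-- The bound `e` is evaluated anew in every round, so the invariant has to fix its value as well as
that of the counter. Each round costs one tick for the test and one for the increment; `n < B` is
needed because the counter ends at `n`. -/
theorem wp_for {x : Var} {e : Expr} {c : Cmd} (I : ℕ → HState → Prop) (n : ℕ) (hn : n < B)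
    (h0 : I 0 (h.set x 0).tick)
    (hx : ∀ k h, k ≤ n → I k h → h.var x = k ∧ e.eval inp h = n)
    (hstep : ∀ k h, k < n → I k h →
      WP B ω inp c h.tick fun h' => h'.var x = k ∧ I (k + 1) (h'.set x (k + 1)).tick)
    (hQ : ∀ h, I n h → Q h.tick) : WP B ω inp (.for x e c) h Q := by
  refine wp_seq (wp_assign (by simp; omega) ?_)
  have key : ∀ m k h, k + m = n → I k h →
      WP B ω inp (.while (Expr.lt x e) (.seq c (.assign x (x + 1 : Expr)))) h Q := by
    intro m
    induction m with
    | zero =>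
      intro k h hk hI
      obtain rfl : k = n := by omega
      obtain ⟨h1, h2⟩ := hx k h le_rfl hI
      exact ⟨_, .while_done (by simp [h1, h2]), hQ h hI⟩
    | succ m ih =>
      intro k h hk hI
      obtain ⟨h1, h2⟩ := hx k h (by omega) hI
      obtain ⟨h', hc, hk', hI'⟩ := hstep k h (by omega) hI
      have ev : ((x + 1 : Expr)).eval inp h' = k + 1 := by simp [hk']
      obtain ⟨h'', hw, hQ'⟩ := ih (k + 1) _ (by omega) hI'
      refine ⟨h'', .while_step (by simp [h1, h2]; omega)
        (.seq hc (.assign h' x _ (by rw [ev]; omega))) ?_, hQ'⟩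
      rw [ev]
      exact hw
  exact key n 0 _ (by omega) h0

end wp

/-! ### Simulation of a program inside the high-level language

The memory of the simulated program consists of cells at the addresses `base, base + 1, …`: the
number of coins consumed, the registers, and the memory. Each cell is stored twice: a permanent
value, and a value that counts only if its stamp equals the current (positive) generation. Starting
a new generation thus takes back all changes made in earlier positive generations. -/

/-- Index of the valid copy of a cell. -/
def cellIndex (y : Expr) : Expr :=
  2 * y + (1 - (Expr.lt 0 Var.gen) * (Expr.arr .stamp y).eq Var.gen)

/-- Content of a cell. -/
def cell (y : Expr) : Expr := .arr .cells (cellIndex y)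

/-- Content of a cell. -/
def HState.view (h : HState) (y : ℕ) : ℕ :=
  h.arr .cells (2 * y + (1 - (if 0 < h.var .gen then 1 else 0) *
    (if h.arr .stamp y = h.var .gen then 1 else 0)))

/-- Permanent content of a cell. -/
def HState.snap (h : HState) (y : ℕ) : ℕ := h.arr .cells (2 * y + 1)

@[simp] theorem eval_cell (inp : List ℕ) (h : HState) (y : Expr) :
    (cell y).eval inp h = h.view (y.eval inp h) := rfl

/-- Write to a cell. -/
def writeCell (y e : Expr) : Cmd :=
  .block [.assign .y₁ y, .assign .y₂ e, .store .cells (2 * Var.y₁ + (Expr.eq Var.gen 0)) Var.y₂,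
    .store .stamp Var.y₁ Var.gen]

/-- Effect of writing to a cell. -/
def HState.write (h : HState) (a v : ℕ) : HState :=
  (((((h.set .y₁ a).tick.set .y₂ v).tick.setArr .cells
    (2 * a + if h.var .gen = 0 then 1 else 0) v).tick.setArr .stamp a (h.var .gen)).tick).tick

/-- The value is computed after the address has been put into `y₁`, hence the hypothesis on `e` in
the modified state. -/
theorem wp_writeCell {B : ℕ} {ω : ℕ → Bool} {inp : List ℕ} {h : HState} {Q : HState → Prop}
    {y e : Expr} (a v : ℕ) (ha : y.eval inp h = a) (hv : e.eval inp (h.set .y₁ a).tick = v)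
    (haB : a < B) (hvB : v < B) (hg : h.var .gen < B) (H : Q (h.write a v)) :
    WP B ω inp (writeCell y e) h Q := by
  refine wp_cons (wp_assign (by rwa [ha]) (wp_cons (wp_assign (by rw [ha, hv]; exact hvB)
    (wp_cons (wp_store (by simpa [ha, hv] using hvB) (wp_cons (wp_store (by simpa using hg)
    (wp_nil ?_))))))))
  rw [ha, hv]
  simp
  exact H

section write
variable (h : HState) (a v y : ℕ)

theorem HState.write_var (x : Var) (h₁ : x ≠ .y₁) (h₂ : x ≠ .y₂) :
    (h.write a v).var x = h.var x := by
  simp [HState.write, h₁, h₂]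

theorem HState.write_arr (b : Arr) (h₁ : b ≠ .cells) (h₂ : b ≠ .stamp) :
    (h.write a v).arr b = h.arr b := by
  unfold HState.write
  simp only [HState.tick_arr]
  rw [HState.setArr_arr_of_ne _ _ _ _ _ h₂, HState.tick_arr, HState.setArr_arr_of_ne _ _ _ _ _ h₁]
  rfl

@[simp] theorem HState.write_time : (h.write a v).time = h.time + 5 := rfl

-- In generation zero the permanent copy is written, later the temporary one together with the
-- current stamp. Both are the copies that `view` reads afterwards.
@[simp] theorem HState.write_view : (h.write a v).view y = if y = a then v else h.view y := by
  have hg : (h.write a v).var .gen = h.var .gen := h.write_var a v _ (by simp) (by simp)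
  unfold HState.view
  rw [hg]
  by_cases e : y = a
  · subst e
    rcases Nat.eq_zero_or_pos (h.var .gen) with h0 | h0
    · simp [HState.write, h0]
    · simp [HState.write, h0, h0.ne']
  · simp only [HState.write, HState.tick_arr, HState.setArr_arr, HState.set_arr, e, and_false,
      if_false, reduceCtorEq, false_and, true_and]
    rw [if_neg]
    split_ifs <;> omega

theorem HState.write_cells (hy : y ≠ a) : (h.write a v).arr .stamp y = h.arr .stamp y ∧
    (h.write a v).arr .cells (2 * y) = h.arr .cells (2 * y) ∧
    (h.write a v).arr .cells (2 * y + 1) = h.arr .cells (2 * y + 1) := by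
  refine ⟨by simp [HState.write, hy], ?_, ?_⟩ <;>
  · simp only [HState.write, HState.tick_arr, HState.setArr_arr, HState.set_arr,
      reduceCtorEq, false_and, true_and, if_false]
    rw [if_neg]
    split_ifs <;> omega

/-- In a positive generation only cells with even index are written, whereas permanent values have
odd index. -/
theorem HState.write_snap (hg : 0 < h.var .gen) (y : ℕ) : (h.write a v).snap y = h.snap y := by
  simp only [HState.snap, HState.write, HState.tick_arr, HState.setArr_arr, HState.set_arr,
    reduceCtorEq, false_and, true_and, if_false]
  rw [if_neg]
  simp [hg.ne']
  try omega

theorem HState.write_stamp (y : ℕ) : (h.write a v).arr .stamp y = h.arr .stamp y ∨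
    (h.write a v).arr .stamp y = h.var .gen := by
  by_cases hy : y = a <;> simp [HState.write, hy]

end write

@[simp] theorem HState.tick_view (h : HState) : h.tick.view = h.view := rfl
@[simp] theorem HState.tick_snap (h : HState) : h.tick.snap = h.snap := rfl
@[simp] theorem HState.set_snap (h : HState) (x : Var) (v : ℕ) : (h.set x v).snap = h.snap := rfl
theorem HState.set_view (h : HState) (x : Var) (v : ℕ) (hx : x ≠ .gen) :
    (h.set x v).view = h.view := by
  funext y
  simp [HState.view, hx.symm]

/-- Variables used by the simulation. -/
def Var.scratch : Var → Bool
  | .x₁ | .x₂ | .x₃ | .y₁ | .y₂ | .answer => true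
  | _ => false

/-- What a simulation working on the cells from `b` to `b + Z` leaves unchanged. -/
structure SimFrame (b Z : ℕ) (h h' : HState) : Prop where
  var : ∀ x : Var, x.scratch = false → h'.var x = h.var x
  arr : ∀ a : Arr, a ≠ .cells → a ≠ .stamp → h'.arr a = h.arr a
  out : h'.out = h.out
  coins : h'.coins = h.coins
  cells : ∀ y, (y < b ∨ b + Z ≤ y) → h'.arr .stamp y = h.arr .stamp y ∧
    h'.arr .cells (2 * y) = h.arr .cells (2 * y) ∧
    h'.arr .cells (2 * y + 1) = h.arr .cells (2 * y + 1)
  snap : 0 < h.var .gen → ∀ y, h'.snap y = h.snap y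
  stamp : ∀ y, h'.arr .stamp y = h.arr .stamp y ∨ h'.arr .stamp y = h.var .gen

theorem SimFrame.refl (b Z : ℕ) (h : HState) : SimFrame b Z h h :=
  ⟨fun _ _ => rfl, fun _ _ _ => rfl, rfl, rfl, fun _ _ => ⟨rfl, rfl, rfl⟩, fun _ _ => rfl,
    fun _ => .inl rfl⟩

theorem SimFrame.trans {b Z : ℕ} {h h' h'' : HState} (H : SimFrame b Z h h')
    (H' : SimFrame b Z h' h'') : SimFrame b Z h h'' := by
  have hg : h'.var .gen = h.var .gen := H.var _ rfl
  refine ⟨fun x hx => (H'.var x hx).trans (H.var x hx),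
    fun a h₁ h₂ => (H'.arr a h₁ h₂).trans (H.arr a h₁ h₂), H'.out.trans H.out,
    H'.coins.trans H.coins, fun y hy => ?_, fun hp y => ?_, fun y => ?_⟩
  · obtain ⟨a1, a2, a3⟩ := H.cells y hy
    obtain ⟨b1, b2, b3⟩ := H'.cells y hy
    exact ⟨b1.trans a1, b2.trans a2, b3.trans a3⟩
  · exact (H'.snap (by rwa [hg]) y).trans (H.snap hp y)
  · rcases H'.stamp y with h1 | h1
    · rw [h1]; exact H.stamp y
    · right; rw [h1, hg]

theorem SimFrame.tick {b Z : ℕ} {h h' : HState} (H : SimFrame b Z h h') :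
    SimFrame b Z h h'.tick :=
  ⟨H.var, H.arr, H.out, H.coins, H.cells, H.snap, H.stamp⟩

theorem SimFrame.set {b Z : ℕ} {h h' : HState} (H : SimFrame b Z h h') {x : Var}
    (hx : x.scratch = true) (v : ℕ) : SimFrame b Z h (h'.set x v) := by
  refine ⟨fun y hy => ?_, H.arr, H.out, H.coins, H.cells, H.snap, H.stamp⟩
  have : y ≠ x := by rintro rfl; rw [hx] at hy; cases hy
  simp [this, H.var y hy]

theorem SimFrame.write {b Z : ℕ} {h h' : HState} (H : SimFrame b Z h h') {a : ℕ} (v : ℕ)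
    (h₁ : b ≤ a) (h₂ : a < b + Z) : SimFrame b Z h (h'.write a v) := by
  refine H.trans ⟨fun y hy => h'.write_var a v y ?_ ?_, fun c => h'.write_arr a v c, rfl, rfl,
    fun y hy => h'.write_cells a v y (by omega), fun hg y => h'.write_snap a v hg y,
    fun y => h'.write_stamp a v y⟩
  · rintro rfl; cases hy
  · rintro rfl; cases hy

/-- The array `inp` holds the list `l`. -/
def HState.Holds (h : HState) (l : List ℕ) : Prop :=
  h.var .inpLen = l.length ∧ ∀ i < l.length, h.arr .inp i = l.getD i 0

/-- All registers of a program are less than `ρ`. -/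
def Prog.RegsLT (ρ : ℕ) : Prog → Prop
  | .skip => True
  | .const r _ => r < ρ
  | .op _ r a b => r < ρ ∧ a < ρ ∧ b < ρ
  | .load r a => r < ρ ∧ a < ρ
  | .store a r => r < ρ ∧ a < ρ
  | .input r a => r < ρ ∧ a < ρ
  | .output a r => r < ρ ∧ a < ρ
  | .flip r => r < ρ
  | .seq p q => p.RegsLT ρ ∧ q.RegsLT ρ
  | .ite r p q => r < ρ ∧ p.RegsLT ρ ∧ q.RegsLT ρ
  | .while r p => r < ρ ∧ p.RegsLT ρ

theorem Prog.RegsLT.mono {ρ ρ' : ℕ} (hρ : ρ ≤ ρ') {p : Prog} (h : p.RegsLT ρ) : p.RegsLT ρ' := by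
  induction p with
  | seq p q ih₁ ih₂ => exact ⟨ih₁ h.1, ih₂ h.2⟩
  | ite r p q ih₁ ih₂ => exact ⟨h.1.trans_le hρ, ih₁ h.2.1, ih₂ h.2.2⟩
  | skip => trivial
  | const | op | load | store | input | output | flip =>
    simp only [Prog.RegsLT] at *; omega
  | _ =>
    rename_i ih
    exact ⟨h.1.trans_le hρ, ih h.2⟩

theorem Prog.exists_regsLT (p : Prog) : ∃ ρ, p.RegsLT ρ := by
  induction p with
  | skip => exact ⟨0, trivial⟩
  | const r c => exact ⟨r + 1, by simp [Prog.RegsLT]⟩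
  | op o r a b => exact ⟨r + a + b + 1, by simp only [Prog.RegsLT]; omega⟩
  | load r a => exact ⟨r + a + 1, by simp only [Prog.RegsLT]; omega⟩
  | store a r => exact ⟨r + a + 1, by simp only [Prog.RegsLT]; omega⟩
  | input r a => exact ⟨r + a + 1, by simp only [Prog.RegsLT]; omega⟩
  | output a r => exact ⟨r + a + 1, by simp only [Prog.RegsLT]; omega⟩
  | flip r => exact ⟨r + 1, by simp [Prog.RegsLT]⟩
  | seq p q ih₁ ih₂ =>
    obtain ⟨ρ, h⟩ := ih₁
    obtain ⟨ρ', h'⟩ := ih₂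
    exact ⟨ρ + ρ', h.mono (by omega), h'.mono (by omega)⟩
  | ite r p q ih₁ ih₂ =>
    obtain ⟨ρ, h⟩ := ih₁
    obtain ⟨ρ', h'⟩ := ih₂
    exact ⟨r + 1 + ρ + ρ', by omega, h.mono (by omega), h'.mono (by omega)⟩
  | _ =>
    rename_i r p ih
    obtain ⟨ρ, h⟩ := ih
    exact ⟨r + 1 + ρ, by omega, h.mono (by omega)⟩

/-- The cell of a register. -/
def regCell (r : ℕ) : Expr := Expr.var .base + .const (r + 1)

/-- The cell of the memory address in `x₁`. -/
def memCell (ρ : ℕ) : Expr := Expr.var .base + .const (ρ + 1) + .var .x₁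

/-- Simulation of a program that uses registers less than `ρ`. -/
def Prog.sim (ρ : ℕ) : Prog → Cmd
  | .skip => .skip
  | .const r c => writeCell (regCell r) (.const c)
  | .op o r a b => .block [.assign .x₁ (cell (regCell a)), .assign .x₂ (cell (regCell b)),
      .op o .x₃ .x₁ .x₂, writeCell (regCell r) Var.x₃]
  | .load r a => .block [.assign .x₁ (cell (regCell a)),
      writeCell (regCell r) (cell (memCell ρ))]
  | .store a r => .block [.assign .x₁ (cell (regCell a)),
      writeCell (memCell ρ) (cell (regCell r))]
  | .input r a => .block [.assign .x₁ (cell (regCell a)),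
      writeCell (regCell r) (.arr .inp Var.x₁ * Expr.lt Var.x₁ Var.inpLen)]
  | .output a r => .block [.assign .x₁ (cell (regCell a)),
      .ite Var.x₁ .skip (.assign .answer (cell (regCell r)))]
  | .flip r => .block [.assign .x₁ (cell Var.base),
      writeCell (regCell r) (.arr .coins (Expr.var .x₁ * Var.copies + Var.copy)),
      writeCell Var.base (Expr.var .x₁ + 1)]
  | .seq p q => .seq (p.sim ρ) (q.sim ρ)
  | .ite r p q => .ite (cell (regCell r)) (p.sim ρ) (q.sim ρ)
  | .while r p => .while (cell (regCell r)) (p.sim ρ)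

/-- The cells `f 0, f 1, …` represent the state `σ` of the simulated program. -/
structure CellsFor (W ρ : ℕ) (f : ℕ → ℕ) (σ : State) : Prop where
  coins : f 0 = σ.coins
  reg : ∀ r < ρ, f (r + 1) = σ.reg r
  mem : ∀ a < W, f (ρ + 1 + a) = σ.mem a
  bdd : σ.Bdd W

/-- The surroundings in which a call is simulated. -/
structure SimEnv (B W ρ L b Z R r : ℕ) (τ : ℕ → Bool) (inp : List ℕ) (h : HState) : Prop where
  size : ρ + 1 + W ≤ Z
  bound : b + Z ≤ B
  coins_lt : L < B
  base : h.var .base = b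
  gen : h.var .gen < B
  copies : h.var .copies = R
  copy : h.var .copy = r
  coins : ∀ l < L, h.arr .coins (l * R + r) = (τ l).toNat
  inp : h.Holds inp

theorem SimEnv.frame {B W ρ L b Z R r : ℕ} {τ : ℕ → Bool} {inp : List ℕ} {h h' : HState}
    (H : SimEnv B W ρ L b Z R r τ inp h) (hf : SimFrame b Z h h') :
    SimEnv B W ρ L b Z R r τ inp h' := by
  obtain ⟨h1, h2, h3, h4, h5, h6, h7, h8, h9⟩ := H
  refine ⟨h1, h2, h3, ?_, ?_, ?_, ?_, ?_, ?_, ?_⟩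
  · rw [hf.var _ rfl, h4]
  · rwa [hf.var _ rfl]
  · rw [hf.var _ rfl, h6]
  · rw [hf.var _ rfl, h7]
  · rwa [hf.arr _ (by simp) (by simp)]
  · rw [hf.var _ rfl, h9.1]
  · rw [hf.arr _ (by simp) (by simp)]; exact h9.2

theorem CellsFor.setReg {W ρ : ℕ} {f g : ℕ → ℕ} {σ : State} (H : CellsFor W ρ f σ) {r v : ℕ}
    (hv : v < W) (hr : r < ρ) (hg : ∀ y, g y = if y = r + 1 then v else f y) :
    CellsFor W ρ g (σ.setReg r v) := by
  refine ⟨?_, fun r' hr' => ?_, fun a ha => ?_, H.bdd.setReg hv⟩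
  · rw [hg, if_neg (by omega), H.coins]; rfl
  · rw [hg]
    by_cases e : r' = r
    · subst e; simp [State.setReg]
    · rw [if_neg (by omega), H.reg r' hr']; simp [State.setReg, e]
  · rw [hg, if_neg (by omega), H.mem a ha]; rfl

/-- Random bits and input words come from arrays, so the tape `τ` and the input `inp` of the
simulated program are unrelated to `ω` and `inp'`; `L` is the length of the prepared tape. Of the
output only cell `0`, kept in `answer`, is simulated. The factor 12 is the cost of `flip`: an
assignment, two writes of five ticks, and the end of the block. -/
theorem wp_sim {B W ρ L b Z R r : ℕ} {τ ω : ℕ → Bool} {inp inp' : List ℕ} {p : Prog}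
    (hp : p.RegsLT ρ) {σ σ' : State} {t : ℕ} (H : Exec W τ inp p σ t σ') (hL : σ'.coins ≤ L)
    {h : HState} (hE : SimEnv B W ρ L b Z R r τ inp h)
    (hS : CellsFor W ρ (fun y => h.view (b + y)) σ) (ho : h.var .answer = σ.out 0) :
    WP B ω inp' (p.sim ρ) h fun h' => SimFrame b Z h h' ∧ h'.time ≤ h.time + 12 * t ∧
      CellsFor W ρ (fun y => h'.view (b + y)) σ' ∧ h'.var .answer = σ'.out 0 := by
  have hWZ := hE.size
  have hZB := hE.bound
  have hLB := hE.coins_lt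
  induction H generalizing h with
  | skip s => exact wp_skip ⟨(SimFrame.refl b Z h).tick, by simp, hS, ho⟩
  | const s r c hc =>
    simp only [Prog.RegsLT] at hp
    refine wp_writeCell (b + (r + 1)) c (by simp [regCell, hE.base]) rfl (by omega)
      (by omega) hE.gen ⟨(SimFrame.refl b Z h).write _ (by omega) (by omega), by simp,
        hS.setReg hc hp fun y => ?_, ?_⟩
    · simp
    · rw [h.write_var _ _ _ (by simp) (by simp), ho]; rfl
  | op s o r a b' hv =>
    obtain ⟨hr, ha, hb'⟩ := hp
    have e1 := hS.reg a ha
    have e2 := hS.reg b' hb'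
    have w1 := hS.bdd.1 a
    have w2 := hS.bdd.1 b'
    refine wp_cons (wp_assign ?_ (wp_cons (wp_assign ?_ (wp_cons (wp_op ?_ (wp_cons (wp_writeCell
      (b + (r + 1)) (o.eval (s.reg a) (s.reg b')) ?_ ?_ ?_ ?_ ?_ (wp_nil ?_))))))))
    all_goals try simp [regCell, hE.base, e1, e2, HState.set_view]
    · omega
    · omega
    · omega
    · omega
    · omega
    · exact hE.gen
    · refine ⟨SimFrame.tick (SimFrame.write ?_ _ (by omega) (by omega)),
        hS.setReg hv hr fun y => ?_, ?_⟩
      · exact (((((SimFrame.refl b Z h).set rfl _).tick.set rfl _).tick.set rfl _).tick)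
      · simp
      · rw [HState.write_var _ _ _ _ (by simp) (by simp)]
        simpa [State.setReg] using ho
  | load s r a =>
    obtain ⟨hr, ha⟩ := hp
    have e1 := hS.reg a ha
    have w1 := hS.bdd.1 a
    have e2 := hS.mem _ w1
    have w2 := hS.bdd.2 (s.reg a)
    refine wp_cons (wp_assign ?_ (wp_cons (wp_writeCell
      (b + (r + 1)) (s.mem (s.reg a)) ?_ ?_ ?_ ?_ ?_ (wp_nil ?_))))
    all_goals try simp [regCell, memCell, hE.base, e1, HState.set_view]
    · omega
    · rw [← e2, add_assoc]
    · omega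
    · omega
    · exact hE.gen
    · refine ⟨SimFrame.tick (SimFrame.write ?_ _ (by omega) (by omega)),
        hS.setReg w2 hr fun y => ?_, ?_⟩
      · exact ((SimFrame.refl b Z h).set rfl _).tick
      · simp
      · rw [HState.write_var _ _ _ _ (by simp) (by simp)]
        simpa [State.setReg] using ho
  | store s a r =>
    obtain ⟨hr, ha⟩ := hp
    have e1 := hS.reg a ha
    have e2 := hS.reg r hr
    have w1 := hS.bdd.1 a
    have w2 := hS.bdd.1 r
    refine wp_cons (wp_assign ?_ (wp_cons (wp_writeCell
      (b + (ρ + 1 + s.reg a)) (s.reg r) ?_ ?_ ?_ ?_ ?_ (wp_nil ?_))))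
    all_goals try simp [regCell, memCell, hE.base, e1, e2, HState.set_view]
    · omega
    · omega
    · omega
    · omega
    · exact hE.gen
    · refine ⟨SimFrame.tick (SimFrame.write ?_ _ (by omega) (by omega)),
        ⟨?_, fun r' hr' => ?_, fun a' ha' => ?_, ?_⟩, ?_⟩
      · exact ((SimFrame.refl b Z h).set rfl _).tick
      · have := hS.coins
        simp at this ⊢
        rw [if_neg (by omega)]; exact this
      · have := hS.reg r' hr'
        simp
        rw [if_neg (by omega)]; exact this
      · have := hS.mem a' ha'
        simp [Function.update_apply]
        split_ifs
        · rfl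
        · exact this
      · exact (Exec.store (W := W) (ω := τ) (inp := inp) s a r).bdd hS.bdd
      · rw [HState.write_var _ _ _ _ (by simp) (by simp)]
        simpa using ho
  | input s r a hv =>
    obtain ⟨hr, ha⟩ := hp
    have e1 := hS.reg a ha
    have w1 := hS.bdd.1 a
    -- The array may contain remains of a longer earlier input. The comparison with `inpLen`
    -- replaces them by the default value zero.
    have e2 : h.arr .inp (s.reg a) * (if s.reg a < h.var .inpLen then 1 else 0) =
        inp.getD (s.reg a) 0 := by
      rw [hE.inp.1]
      split_ifs with hc
      · rw [hE.inp.2 _ hc, mul_one]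
      · rw [List.getD_eq_default _ _ (by omega), mul_zero]
    refine wp_cons (wp_assign ?_ (wp_cons (wp_writeCell
      (b + (r + 1)) (inp.getD (s.reg a) 0) ?_ ?_ ?_ ?_ ?_ (wp_nil ?_))))
    · simp [regCell, hE.base, e1]; omega
    · simp [regCell, hE.base]
    · simp [regCell, hE.base, e1, e2]
    · omega
    · omega
    · simpa using hE.gen
    · refine ⟨SimFrame.tick (SimFrame.write ?_ _ (by omega) (by omega)), ?_,
        hS.setReg hv hr fun y => ?_, ?_⟩
      · exact ((SimFrame.refl b Z h).set rfl _).tick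
      · simp
      · simp [HState.set_view]
      · simp only [HState.tick_var]
        rw [HState.write_var _ _ _ _ (by simp) (by simp)]
        simpa [State.setReg] using ho
  | output s a r =>
    obtain ⟨hr, ha⟩ := hp
    have e1 := hS.reg a ha
    have e2 := hS.reg r hr
    have w1 := hS.bdd.1 a
    have w2 := hS.bdd.1 r
    have fr := ((SimFrame.refl b Z h).set (x := .x₁) rfl (s.reg a)).tick.tick
    have hx : (cell (regCell a)).eval inp' h = s.reg a := by
      simpa [regCell, hE.base] using e1
    refine wp_cons (wp_assign (by rw [hx]; omega) (wp_cons ?_))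
    rw [hx]
    refine wp_ite (fun hc => wp_skip (wp_nil ?_)) (fun hc => wp_assign ?_ (wp_nil ?_))
    all_goals simp at hc
    · refine ⟨fr.tick.tick, by simp, ⟨?_, ?_, ?_, hS.bdd⟩, ?_⟩
      · simpa [HState.set_view] using hS.coins
      · simpa [HState.set_view] using hS.reg
      · simpa [HState.set_view] using hS.mem
      · simp [Ne.symm hc, ho]
    · simp [regCell, hE.base, e2, HState.set_view]; omega
    · refine ⟨(fr.set rfl _).tick.tick, by simp, ⟨?_, ?_, ?_, hS.bdd⟩, ?_⟩
      · simpa [HState.set_view] using hS.coins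
      · simpa [HState.set_view] using hS.reg
      · simpa [HState.set_view] using hS.mem
      · simp [regCell, hE.base, e2, HState.set_view, hc]
  | flip s r hv =>
    have hr : r < ρ := hp
    have e0 := hS.coins
    simp at e0 hL
    have e1 := hE.coins _ hL
    have hW := hS.bdd.1 0
    refine wp_cons (wp_assign ?_ (wp_cons (wp_writeCell
      (b + (r + 1)) (τ s.coins).toNat ?_ ?_ ?_ ?_ ?_ (wp_cons
      (wp_writeCell b (s.coins + 1) ?_ ?_ ?_ ?_ ?_ (wp_nil ?_))))))
    · simp [hE.base, e0]; omega
    · simp [regCell, hE.base]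
    · simp [hE.base, hE.copies, hE.copy, e0, e1]
    · omega
    · omega
    · simpa using hE.gen
    · simp [HState.write_var, hE.base]
    · simp [HState.write_var, hE.base, e0]
    · omega
    · omega
    · simpa [HState.write_var] using hE.gen
    · refine ⟨SimFrame.tick (SimFrame.write (SimFrame.write ?_ _ (by omega) (by omega)) _
        (by omega) (by omega)), ?_, ?_, ?_⟩
      · exact ((SimFrame.refl b Z h).set rfl _).tick
      · simp
      · have h1 : CellsFor W ρ
            (fun y => if y = r + 1 then (τ s.coins).toNat else h.view (b + y))
            (s.setReg r (τ s.coins).toNat) := hS.setReg hv hr fun y => rfl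
        refine ⟨by simp, fun r' hr' => ?_, fun a ha => ?_, h1.bdd⟩
        · have := h1.reg r' hr'
          simpa [HState.set_view] using this
        · have := h1.mem a ha
          have hne : b + (ρ + 1 + a) ≠ b := by omega
          simp only [HState.tick_view, HState.write_view, hne, if_false]
          simpa [HState.set_view] using this
      · simp [HState.write_var, ho, State.setReg]
  | seq H₁ H₂ ih₁ ih₂ =>
    refine wp_seq (WP.mono (ih₁ hp.1 (H₂.coins_le.1.trans hL) hE hS ho) ?_)
    rintro h' ⟨f1, t1, c1, a1⟩
    refine WP.mono (ih₂ hp.2 hL (hE.frame f1) c1 a1) ?_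
    rintro h'' ⟨f2, t2, c2, a2⟩
    exact ⟨f1.trans f2, by omega, c2, a2⟩
  | ite_true hc H₁ ih =>
    have e := hS.reg _ hp.1
    refine wp_ite (fun _ => ?_) (fun hc' => ?_)
    · refine WP.mono (ih hp.2.1 hL (hE.frame (SimFrame.refl b Z h).tick) hS ho) ?_
      rintro h'' ⟨f2, t2, c2, a2⟩
      exact ⟨(SimFrame.refl b Z h).tick.trans f2, by simp at t2; omega, c2, a2⟩
    · simp [regCell, hE.base, e] at hc'
      exact absurd hc' hc
  | ite_false hc H₁ ih =>
    have e := hS.reg _ hp.1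
    refine wp_ite (fun hc' => ?_) (fun _ => ?_)
    · simp [regCell, hE.base, e] at hc'
      exact absurd hc hc'
    · refine WP.mono (ih hp.2.2 hL (hE.frame (SimFrame.refl b Z h).tick) hS ho) ?_
      rintro h'' ⟨f2, t2, c2, a2⟩
      exact ⟨(SimFrame.refl b Z h).tick.trans f2, by simp at t2; omega, c2, a2⟩
  | while_done hc =>
    have e := hS.reg _ hp.1
    exact ⟨_, .while_done (by simpa [regCell, hE.base, e] using hc),
      (SimFrame.refl b Z h).tick, by simp, hS, ho⟩
  | while_step hc H₁ H₂ ih₁ ih₂ =>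
    have e := hS.reg _ hp.1
    obtain ⟨h', x1, f1, t1, c1, a1⟩ := ih₁ hp.2 (H₂.coins_le.1.trans hL)
      (hE.frame (SimFrame.refl b Z h).tick) hS ho
    have f1' := (SimFrame.refl b Z h).tick.trans f1
    obtain ⟨h'', x2, f2, t2, c2, a2⟩ := ih₂ hp hL (hE.frame f1') c1 a1
    exact ⟨h'', .while_step (by simpa [regCell, hE.base, e] using hc) x1 x2, f1'.trans f2,
      by simp at t1; omega, c2, a2⟩

/-! ### Dynamic graphs that encode vector-matrix-vector products

The graph for a `b × b` matrix has the rows as vertices `0, …, b - 1`, the columns as vertices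
`b, …, 2b - 1`, dummy rows, which cannot be reached, at `2b, …, 3b - 1`, and for each stage `k < b`
a source `3b + k` and a sink `4b + k`. In stage `k`, a row `l` has an edge from the source, and a
column `l` has an edge to the sink, if the bit `w k l` is set. -/

/-- The edge of the entry number `e` of the matrix; it starts in a dummy row for zero entries. -/
def matEdge (b : ℕ) (M : ℕ → ℕ → Bool) (e : ℕ) : ℕ × ℕ :=
  (e / b + (if M (e / b) (e % b) then 0 else 2 * b), b + e % b)

/-- The edge of bit `l` in stage `k`. -/
def stageEdge (b k l : ℕ) : ℕ × ℕ := if l < b then (3 * b + k, l) else (l, 4 * b + k)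

/-- The vertex with a given number. -/
def vertex {b : ℕ} (hb : 0 < b) (x : ℕ) : Fin (5 * b) := ⟨x % (5 * b), Nat.mod_lt _ (by omega)⟩

theorem vertex_val {b : ℕ} (hb : 0 < b) {x : ℕ} (hx : x < 5 * b) : (vertex hb x : ℕ) = x :=
  Nat.mod_eq_of_lt hx

/-- An edge given by the numbers of its endpoints. -/
def toEdge {b : ℕ} (hb : 0 < b) (p : ℕ × ℕ) : Fin (5 * b) × Fin (5 * b) :=
  (vertex hb p.1, vertex hb p.2)

theorem toEdge_inj {b : ℕ} (hb : 0 < b) {p q : ℕ × ℕ} (hp : p.1 < 5 * b ∧ p.2 < 5 * b)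
    (hq : q.1 < 5 * b ∧ q.2 < 5 * b) (h : toEdge hb p = toEdge hb q) : p = q := by
  have h1 := congrArg (fun e => (e.1 : ℕ)) h
  have h2 := congrArg (fun e => (e.2 : ℕ)) h
  simp only [toEdge] at h1 h2
  rw [vertex_val hb hp.1, vertex_val hb hq.1] at h1
  rw [vertex_val hb hp.2, vertex_val hb hq.2] at h2
  exact Prod.ext h1 h2

/-- In the incremental case, the edges of the bits that are set are updated before the query of a
stage, in the decremental case those of the other bits. -/
def Mode.early : Mode → Bool
  | .incremental => true
  | .decremental => false

section
variable (b : ℕ) (m : Mode) (M : ℕ → ℕ → Bool) (w : ℕ → ℕ → Bool)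

/-- All edges of the matrix. -/
def matEdges : List (ℕ × ℕ) := (List.range (b * b)).map (matEdge b M)

/-- The edges updated in a stage before the query. -/
def earlyEdges (k : ℕ) (u : ℕ → Bool) : List (ℕ × ℕ) :=
  ((List.range (2 * b)).filter fun l => u l = m.early).map (stageEdge b k)

/-- The edges updated in a stage after the query. -/
def lateEdges (k : ℕ) (u : ℕ → Bool) : List (ℕ × ℕ) :=
  ((List.range (2 * b)).filter fun l => ¬ u l = m.early).map (stageEdge b k)

/-- All edges of a stage. -/
def stageEdges (k : ℕ) : List (ℕ × ℕ) := (List.range (2 * b)).map (stageEdge b k)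

/-- The edges updated before the first stage. -/
def firstEdges : List (ℕ × ℕ) :=
  match m with
  | .incremental => matEdges b M
  | .decremental => []

/-- The edges updated after the last stage. -/
def lastEdges : List (ℕ × ℕ) :=
  match m with
  | .incremental => []
  | .decremental => matEdges b M

/-- The predicted sequence of edges. -/
def predictedEdges : List (ℕ × ℕ) :=
  firstEdges b m M ++ (List.range b).flatMap (stageEdges b) ++ lastEdges b m M

/-- The edges in the order of the updates. -/
def actualEdges : List (ℕ × ℕ) :=
  firstEdges b m M ++
    (List.range b).flatMap (fun k => earlyEdges b m k (w k) ++ lateEdges b m k (w k)) ++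
    lastEdges b m M

theorem earlyEdges_append_perm (k : ℕ) (u : ℕ → Bool) :
    (earlyEdges b m k u ++ lateEdges b m k u).Perm (stageEdges b k) := by
  unfold earlyEdges lateEdges stageEdges
  rw [← List.map_append]
  refine List.Perm.map _ ?_
  simpa using List.filter_append_perm (fun l => decide (u l = m.early)) (List.range (2 * b))

theorem actualEdges_perm : (actualEdges b m M w).Perm (predictedEdges b m M) := by
  unfold actualEdges predictedEdges
  exact ((List.Perm.refl _).append
    (List.Perm.flatMap_left _ fun k _ => earlyEdges_append_perm b m k (w k))).append
    (List.Perm.refl _)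

variable {b m M w}

theorem mem_stageEdges {k : ℕ} {p : ℕ × ℕ} :
    p ∈ stageEdges b k ↔ ∃ l < 2 * b, stageEdge b k l = p := by
  simp [stageEdges]

theorem mem_earlyEdges {k : ℕ} {u : ℕ → Bool} {p : ℕ × ℕ} :
    p ∈ earlyEdges b m k u ↔ ∃ l < 2 * b, u l = m.early ∧ stageEdge b k l = p := by
  simp [earlyEdges, and_assoc]

theorem mem_matEdges (hb : 0 < b) {p : ℕ × ℕ} : p ∈ matEdges b M ↔
    ∃ i < b, ∃ j < b, p = (i + (if M i j then 0 else 2 * b), b + j) := by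
  simp only [matEdges, List.mem_map, List.mem_range, matEdge]
  constructor
  · rintro ⟨e, he, rfl⟩
    exact ⟨e / b, Nat.div_lt_of_lt_mul he, e % b, Nat.mod_lt _ hb, rfl⟩
  · rintro ⟨i, hi, j, hj, rfl⟩
    refine ⟨b * i + j, ?_, ?_⟩
    · calc b * i + j < b * (i + 1) := by rw [mul_add]; omega
        _ ≤ b * b := Nat.mul_le_mul_left _ hi
    · have h1 : (b * i + j) / b = i := by
        rw [Nat.mul_add_div hb, Nat.div_eq_of_lt hj, add_zero]
      have h2 : (b * i + j) % b = j := by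
        rw [Nat.mul_add_mod, Nat.mod_eq_of_lt hj]
      rw [h1, h2]

theorem stageEdge_inj {k k' l l' : ℕ} (hk' : k' < b) (hl : l < 2 * b)
    (h : stageEdge b k l = stageEdge b k' l') : k = k' ∧ l = l' := by
  unfold stageEdge at h
  split_ifs at h <;> simp only [Prod.mk.injEq] at h <;> omega

theorem stageEdge_lt {k l : ℕ} (hk : k < b) (hl : l < 2 * b) :
    (stageEdge b k l).1 < 5 * b ∧ (stageEdge b k l).2 < 5 * b := by
  unfold stageEdge
  split_ifs <;> simp only <;> omega

theorem matEdges_lt (hb : 0 < b) {p : ℕ × ℕ} (hp : p ∈ matEdges b M) :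
    p.1 < 5 * b ∧ p.2 < 5 * b := by
  obtain ⟨i, hi, j, hj, rfl⟩ := (mem_matEdges hb).1 hp
  simp only
  split_ifs <;> omega

theorem stageEdge_notMem_matEdges (hb : 0 < b) {k l : ℕ} (hl : l < 2 * b) :
    stageEdge b k l ∉ matEdges b M := by
  intro h
  obtain ⟨i, hi, j, hj, h⟩ := (mem_matEdges hb).1 h
  unfold stageEdge at h
  split_ifs at h <;> simp only [Prod.mk.injEq] at h <;> omega

/-- Rows and dummy rows occupy disjoint ranges of vertices, so the entry can be recovered from its
edge whatever its value. -/
theorem matEdges_nodup : (matEdges b M).Nodup := by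
  refine List.Nodup.map_on ?_ List.nodup_range
  intro x hx y hy h
  simp only [List.mem_range] at hx hy
  simp only [matEdge, Prod.mk.injEq] at h
  have h1 := Nat.div_lt_of_lt_mul hx
  have h2 := Nat.div_lt_of_lt_mul hy
  have h3 : x % b = y % b := by omega
  have h4 : x / b = y / b := by
    obtain ⟨ha, -⟩ := h
    generalize x / b = c at *
    generalize y / b = d at *
    split_ifs at ha <;> omega
  rw [← Nat.div_add_mod x b, ← Nat.div_add_mod y b, h3, h4]

theorem stages_nodup : ((List.range b).flatMap (stageEdges b)).Nodup := by
  rw [List.nodup_flatMap]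
  refine ⟨fun k hk => List.Nodup.map_on ?_ List.nodup_range, ?_⟩
  · intro x hx y hy h
    simp only [List.mem_range] at hx hy hk
    exact (stageEdge_inj hk hx h).2
  · refine List.Pairwise.imp_of_mem ?_ List.nodup_range
    intro k k' hk hk' hne p hp hp'
    obtain ⟨l, hl, rfl⟩ := mem_stageEdges.1 hp
    obtain ⟨l', hl', h⟩ := mem_stageEdges.1 hp'
    simp only [List.mem_range] at hk hk'
    exact hne (stageEdge_inj hk hl' h).1.symm

theorem mem_stages {p : ℕ × ℕ} : p ∈ (List.range b).flatMap (stageEdges b) ↔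
    ∃ k < b, ∃ l < 2 * b, stageEdge b k l = p := by
  simp [mem_stageEdges]

theorem predictedEdges_nodup (hb : 0 < b) : (predictedEdges b m M).Nodup := by
  have h1 := matEdges_nodup (b := b) (M := M)
  have h2 := stages_nodup (b := b)
  have h3 : ∀ p ∈ (List.range b).flatMap (stageEdges b), p ∉ matEdges b M := by
    intro p hp
    obtain ⟨k, hk, l, hl, rfl⟩ := mem_stages.1 hp
    exact stageEdge_notMem_matEdges hb hl
  cases m
  · simp only [predictedEdges, firstEdges, lastEdges, List.append_nil]
    exact List.nodup_append'.2 ⟨h1, h2, fun p hp hp' => h3 p hp' hp⟩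
  · simp only [predictedEdges, firstEdges, lastEdges, List.nil_append]
    exact List.nodup_append'.2 ⟨h2, h1, fun p hp hp' => h3 p hp hp'⟩

theorem mem_predictedEdges {p : ℕ × ℕ} : p ∈ predictedEdges b m M ↔
    p ∈ matEdges b M ∨ ∃ k < b, ∃ l < 2 * b, stageEdge b k l = p := by
  cases m <;>
  simp only [predictedEdges, firstEdges, lastEdges, List.mem_append, List.not_mem_nil, or_false,
    false_or, mem_stages]
  exact or_comm

theorem predictedEdges_lt (hb : 0 < b) {p : ℕ × ℕ} (hp : p ∈ predictedEdges b m M) :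
    p.1 < 5 * b ∧ p.2 < 5 * b := by
  rcases mem_predictedEdges.1 hp with h | ⟨k, hk, l, hl, rfl⟩
  · exact matEdges_lt hb h
  · exact stageEdge_lt hk hl

variable (b m M w)

/-- The requests of a stage. -/
def stageRequests {b : ℕ} (hb : 0 < b) (m : Mode) (k : ℕ) (u : ℕ → Bool) :
    List (Request (5 * b)) :=
  (earlyEdges b m k u).map (fun p => .update (toEdge hb p)) ++
    .query (vertex hb (3 * b + k)) (vertex hb (4 * b + k)) ::
    (lateEdges b m k u).map (fun p => .update (toEdge hb p))

/-- The requests of the first `k` stages, and the updates before them. -/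
def requestsUpTo {b : ℕ} (hb : 0 < b) (m : Mode) (M : ℕ → ℕ → Bool) (w : ℕ → ℕ → Bool) (k : ℕ) :
    List (Request (5 * b)) :=
  (firstEdges b m M).map (fun p => .update (toEdge hb p)) ++
    (List.range k).flatMap fun k => stageRequests hb m k (w k)

/-- All requests. -/
def allRequests {b : ℕ} (hb : 0 < b) (m : Mode) (M : ℕ → ℕ → Bool) (w : ℕ → ℕ → Bool) :
    List (Request (5 * b)) :=
  requestsUpTo hb m M w b ++ (lastEdges b m M).map (fun p => .update (toEdge hb p))

theorem updates_append {n : ℕ} (l l' : List (Request n)) :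
    updates (l ++ l') = updates l ++ updates l' := by simp [updates]

theorem updates_map_update {n : ℕ} {α : Type*} (f : α → Fin n × Fin n) (l : List α) :
    updates (l.map fun p => Request.update (f p)) = l.map f := by
  induction l with
  | nil => rfl
  | cons a l ih => simpa [updates, Request.edge?] using ih

theorem updates_query_cons {n : ℕ} (s t : Fin n) (l : List (Request n)) :
    updates (.query s t :: l) = updates l := rfl

theorem updates_stageRequests {b : ℕ} (hb : 0 < b) (m : Mode) (k : ℕ) (u : ℕ → Bool) :
    updates (stageRequests hb m k u) =
      (earlyEdges b m k u ++ lateEdges b m k u).map (toEdge hb) := by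
  rw [stageRequests, updates_append, updates_query_cons, updates_map_update, updates_map_update,
    List.map_append]

theorem updates_requestsUpTo {b : ℕ} (hb : 0 < b) (k : ℕ) :
    updates (requestsUpTo hb m M w k) = (firstEdges b m M ++
      (List.range k).flatMap fun k => earlyEdges b m k (w k) ++ lateEdges b m k (w k)).map
        (toEdge hb) := by
  induction k with
  | zero => simp [requestsUpTo, updates_map_update]
  | succ k ih =>
    have e : requestsUpTo hb m M w (k + 1) =
        requestsUpTo hb m M w k ++ stageRequests hb m k (w k) := by
      simp [requestsUpTo, List.range_succ]
    rw [e, updates_append, ih, updates_stageRequests, List.range_succ]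
    simp

theorem updates_allRequests {b : ℕ} (hb : 0 < b) :
    updates (allRequests hb m M w) = (actualEdges b m M w).map (toEdge hb) := by
  rw [allRequests, updates_append, updates_requestsUpTo, updates_map_update, ← List.map_append]
  rfl

/-- The instance for a matrix and the bits of all stages. -/
def productInstance {b : ℕ} (hb : 0 < b) (m : Mode) (M : ℕ → ℕ → Bool) (w : ℕ → ℕ → Bool) :
    Instance (5 * b) where
  predicted := (predictedEdges b m M).map (toEdge hb)
  requests := allRequests hb m M w
  nodup := (predictedEdges_nodup hb).map_on fun _ hp _ hq h =>
    toEdge_inj hb (predictedEdges_lt hb hp) (predictedEdges_lt hb hq) h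
  perm := by
    rw [updates_allRequests]
    exact (actualEdges_perm b m M w).map _

/-! ### Lengths, positions and the prediction error. -/

theorem stageEdges_length (k : ℕ) : (stageEdges b k).length = 2 * b := by simp [stageEdges]

theorem earlyEdges_append_length (k : ℕ) (u : ℕ → Bool) :
    (earlyEdges b m k u ++ lateEdges b m k u).length = 2 * b := by
  rw [(earlyEdges_append_perm b m k u).length_eq, stageEdges_length]

theorem flatMap_range_length {α : Type*} (f : ℕ → List α) (c k : ℕ) (hf : ∀ i, (f i).length = c) :
    ((List.range k).flatMap f).length = k * c := by
  induction k with
  | zero => simp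
  | succ k ih => rw [List.range_succ]; simp [ih, hf, add_mul]

theorem predictedEdges_length : (predictedEdges b m M).length = 3 * (b * b) := by
  have h := flatMap_range_length _ _ b (stageEdges_length b)
  cases m <;>
  · simp only [predictedEdges, firstEdges, lastEdges, List.length_append, h, matEdges,
      List.length_map, List.length_range, List.length_nil]
    ring

theorem flatMap_range_split {α : Type*} (f : ℕ → List α) {k n : ℕ} (hk : k < n) :
    ∃ r, (List.range n).flatMap f = (List.range k).flatMap f ++ (f k ++ r) := by
  refine ⟨(List.range' (k + 1) (n - k - 1)).flatMap f, ?_⟩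
  have e : List.range n = List.range k ++ (k :: List.range' (k + 1) (n - k - 1)) := by
    rw [List.range_eq_range', List.range_eq_range', ← List.range'_succ, show n - k - 1 + 1 = n - k by
      omega]
    have := List.range'_append (s := 0) (m := k) (n := n - k) (step := 1)
    simp only [one_mul, zero_add] at this
    rw [this, Nat.add_sub_cancel' hk.le]
  rw [e, List.flatMap_append, List.flatMap_cons]

theorem idxOf_bounds {α : Type*} [BEq α] [LawfulBEq α] {A B C : List α} {e : α} (hA : e ∉ A)
    (hB : e ∈ B) : A.length ≤ (A ++ (B ++ C)).idxOf e ∧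
      (A ++ (B ++ C)).idxOf e < A.length + B.length := by
  rw [List.idxOf_append_of_notMem hA, List.idxOf_append_of_mem hB]
  have := List.idxOf_lt_length_of_mem hB
  omega

/-- Positions in the lists of updates, for pairs of numbers. -/
theorem abs_idxOf_sub_le (hb : 0 < b) {p : ℕ × ℕ} (hp : p ∈ predictedEdges b m M) :
    (((actualEdges b m M w).idxOf p : ℤ) - ((predictedEdges b m M).idxOf p : ℤ)).natAbs ≤
      2 * b := by
  set f : ℕ → List (ℕ × ℕ) := fun k => earlyEdges b m k (w k) ++ lateEdges b m k (w k) with hf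
  have hlen : ∀ k, ((List.range k).flatMap f).length = ((List.range k).flatMap (stageEdges b)).length :=
    fun k => by
      rw [flatMap_range_length f (2 * b) k fun k => earlyEdges_append_length b m k (w k),
        flatMap_range_length _ (2 * b) k (stageEdges_length b)]
  have hperm : ∀ k, ((List.range k).flatMap f).Perm ((List.range k).flatMap (stageEdges b)) :=
    fun k => List.Perm.flatMap_left _ fun k _ => earlyEdges_append_perm b m k (w k)
  rcases mem_predictedEdges.1 hp with h | ⟨k, hk, l, hl, rfl⟩
  · have h3 : p ∉ (List.range b).flatMap (stageEdges b) := by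
      intro hp
      obtain ⟨k, hk, l, hl, rfl⟩ := mem_stages.1 hp
      exact stageEdge_notMem_matEdges hb hl h
    have h4 : p ∉ (List.range b).flatMap f := fun hp => h3 ((hperm b).mem_iff.1 hp)
    have : (actualEdges b m M w).idxOf p = (predictedEdges b m M).idxOf p := by
      cases m
      · simp only [actualEdges, predictedEdges, firstEdges, lastEdges, List.append_nil]
        rw [List.idxOf_append_of_mem h, List.idxOf_append_of_mem h]
      · simp only [actualEdges, predictedEdges, firstEdges, lastEdges, List.nil_append]
        rw [List.idxOf_append_of_notMem h3, List.idxOf_append_of_notMem h4, hlen]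
    rw [this]; simp
  · have hF : stageEdge b k l ∉ firstEdges b m M := by
      cases m
      · exact stageEdge_notMem_matEdges hb hl
      · simp [firstEdges]
    have hS : stageEdge b k l ∉ (List.range k).flatMap (stageEdges b) := by
      intro h
      simp only [List.mem_flatMap, List.mem_range, mem_stageEdges] at h
      obtain ⟨k', hk', l', hl', h⟩ := h
      have := (stageEdge_inj hk hl' h).1
      omega
    have hS' : stageEdge b k l ∉ (List.range k).flatMap f := fun h => hS ((hperm k).mem_iff.1 h)
    have hB : stageEdge b k l ∈ stageEdges b k := mem_stageEdges.2 ⟨l, hl, rfl⟩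
    have hB' : stageEdge b k l ∈ f k := (earlyEdges_append_perm b m k (w k)).mem_iff.2 hB
    obtain ⟨r, hr⟩ := flatMap_range_split (stageEdges b) hk
    obtain ⟨r', hr'⟩ := flatMap_range_split f hk
    -- What precedes stage `k` has the same length in both lists, so both positions lie in the same
    -- window of length `2 * b`.
    have h1 := idxOf_bounds (C := r ++ lastEdges b m M)
      (A := firstEdges b m M ++ (List.range k).flatMap (stageEdges b))
      (by simp only [List.mem_append, not_or]; exact ⟨hF, hS⟩) hB
    have h2 := idxOf_bounds (C := r' ++ lastEdges b m M)
      (A := firstEdges b m M ++ (List.range k).flatMap f)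
      (by simp only [List.mem_append, not_or]; exact ⟨hF, hS'⟩) hB'
    have e1 : predictedEdges b m M = firstEdges b m M ++ (List.range k).flatMap (stageEdges b) ++
        (stageEdges b k ++ (r ++ lastEdges b m M)) := by
      rw [predictedEdges, hr]; simp
    have e2 : actualEdges b m M w = firstEdges b m M ++ (List.range k).flatMap f ++
        (f k ++ (r' ++ lastEdges b m M)) := by
      rw [actualEdges, hr']; simp
    rw [← e1] at h1
    rw [← e2] at h2
    rw [List.length_append, stageEdges_length] at h1
    rw [List.length_append, hlen, hf, earlyEdges_append_length] at h2
    omega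

theorem idxOf_map_of_injOn {α β : Type*} [BEq α] [LawfulBEq α] [BEq β] [LawfulBEq β] (f : α → β) (l : List α)
    (a : α) (h : ∀ x ∈ l, f x = f a → x = a) : (l.map f).idxOf (f a) = l.idxOf a := by
  induction l with
  | nil => rfl
  | cons c l ih =>
    rw [List.map_cons, List.idxOf_cons, List.idxOf_cons, ih fun x hx => h x (by simp [hx])]
    by_cases e : c = a
    · simp [e]
    · have : f c ≠ f a := fun h' => e (h c (by simp) h')
      rw [beq_eq_false_iff_ne.2 e, beq_eq_false_iff_ne.2 this]

/-- The bits permute the edges only within a stage of `2 * b` edges. This keeps the allowed query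
time at `O(b ^ (2 - ε))` although there are `3 * b ^ 2` updates. -/
theorem etaInf_productInstance_le {b : ℕ} (hb : 0 < b) :
    (productInstance hb m M w).etaInf ≤ 2 * b := by
  refine Finset.sup_le fun e he => ?_
  simp only [productInstance, List.mem_toFinset, List.mem_map] at he
  obtain ⟨p, hp, rfl⟩ := he
  simp only [productInstance, updates_allRequests]
  rw [idxOf_map_of_injOn, idxOf_map_of_injOn]
  · exact abs_idxOf_sub_le b m M w hb hp
  · exact fun x hx h => toEdge_inj hb (predictedEdges_lt hb hx) (predictedEdges_lt hb hp) h
  · exact fun x hx h => toEdge_inj hb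
      (predictedEdges_lt hb ((actualEdges_perm b m M w).mem_iff.1 hx)) (predictedEdges_lt hb hp) h

end

/-! ### The answers to the queries -/

/-- The set `E` may contain any edges of other stages, because their sources and the dummy rows have
no incoming edges and their sinks no outgoing ones. This freedom lets one argument serve both modes:
earlier stages are complete in one of them and empty in the other, and conversely for later stages.
-/
theorem reachable_iff {b : ℕ} (hb : 0 < b) {M : ℕ → ℕ → Bool} {u : ℕ → Bool} {k : ℕ} (hk : k < b)
    {E : Set (Fin (5 * b) × Fin (5 * b))} (hM : ∀ p ∈ matEdges b M, toEdge hb p ∈ E)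
    (hu : ∀ l < 2 * b, u l = true → toEdge hb (stageEdge b k l) ∈ E)
    (hE : ∀ e ∈ E, ∃ p, toEdge hb p = e ∧ (p ∈ matEdges b M ∨
      (∃ l < 2 * b, u l = true ∧ p = stageEdge b k l) ∨
      ∃ k' < b, k' ≠ k ∧ ∃ l < 2 * b, p = stageEdge b k' l)) :
    Reachable E (vertex hb (3 * b + k)) (vertex hb (4 * b + k)) ↔
      ∃ i < b, ∃ j < b, u i = true ∧ M i j = true ∧ u (b + j) = true := by
  constructor
  · intro h
    -- An invariant along paths. The cases are the source itself, rows with set bit, columns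
    -- adjacent to such rows, sinks of other stages, and the sink of stage `k`, which can be entered
    -- only if the product is nonzero.
    have key : ∀ v : Fin (5 * b),
        Relation.ReflTransGen (fun x y => (x, y) ∈ E) (vertex hb (3 * b + k)) v →
        (v : ℕ) = 3 * b + k ∨ ((v : ℕ) < b ∧ u v = true) ∨
        (b ≤ (v : ℕ) ∧ (v : ℕ) < 2 * b ∧ ∃ i < b, u i = true ∧ M i (v - b) = true) ∨
        (4 * b ≤ (v : ℕ) ∧ (v : ℕ) ≠ 4 * b + k) ∨
        ((v : ℕ) = 4 * b + k ∧ ∃ i < b, ∃ j < b, u i = true ∧ M i j = true ∧ u (b + j) = true) := by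
      intro v hv
      induction hv with
      | refl => left; exact vertex_val hb (by omega)
      | @tail x y _ hxy ih =>
        obtain ⟨p, hp, hcase⟩ := hE _ hxy
        have hlt : p.1 < 5 * b ∧ p.2 < 5 * b := by
          rcases hcase with h | ⟨l, hl, -, rfl⟩ | ⟨k', hk', -, l, hl, rfl⟩
          · exact matEdges_lt hb h
          · exact stageEdge_lt hk hl
          · exact stageEdge_lt hk' hl
        have hx : (x : ℕ) = p.1 := by
          rw [← vertex_val hb hlt.1]; exact congrArg (fun e => (e.1 : ℕ)) hp.symm
        have hy : (y : ℕ) = p.2 := by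
          rw [← vertex_val hb hlt.2]; exact congrArg (fun e => (e.2 : ℕ)) hp.symm
        rw [hx] at ih
        rw [hy]
        rcases hcase with h | ⟨l, hl, hul, rfl⟩ | ⟨k', hk', hne, l, hl, rfl⟩
        · obtain ⟨i, hi, j, hj, rfl⟩ := (mem_matEdges hb).1 h
          simp only at ih ⊢
          split_ifs at ih with hij
          · rcases ih with ih | ih | ih | ih | ih
            · omega
            · right; right; left
              refine ⟨by omega, by omega, i, hi, ih.2, ?_⟩
              rwa [Nat.add_sub_cancel_left]
            · omega
            · omega
            · omega
          · rcases ih with ih | ⟨ih, -⟩ | ⟨ih, ih', -⟩ | ih | ⟨ih, -⟩ <;> omega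
        · unfold stageEdge at ih ⊢
          split_ifs at ih ⊢ with hlb
          · exact .inr (.inl ⟨hlb, hul⟩)
          · simp only at ih ⊢
            rcases ih with ih | ih | ih | ih | ih
            · omega
            · omega
            · obtain ⟨-, -, i, hi, h1, h2⟩ := ih
              refine .inr (.inr (.inr (.inr ⟨by trivial, i, hi, l - b, by omega, h1, h2, ?_⟩)))
              rwa [Nat.add_sub_cancel' (by omega)]
            · omega
            · omega
        · unfold stageEdge at ih ⊢
          split_ifs at ih ⊢ with hlb
          · simp only at ih
            rcases ih with ih | ⟨ih, -⟩ | ⟨ih, ih', -⟩ | ih | ⟨ih, -⟩ <;> omega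
          · exact .inr (.inr (.inr (.inl (by simp only; omega))))
    have hv := vertex_val hb (x := 4 * b + k) (by omega)
    rcases key _ h with h | h | h | h | h <;> rw [hv] at h
    · omega
    · omega
    · omega
    · omega
    · exact h.2
  · rintro ⟨i, hi, j, hj, h1, h2, h3⟩
    have e1 := hu i (by omega) h1
    have e2 := hu (b + j) (by omega) h3
    have e3 := hM _ ((mem_matEdges hb).2 ⟨i, hi, j, hj, rfl⟩)
    rw [h2] at e3
    rw [stageEdge, if_pos hi] at e1
    rw [stageEdge, if_neg (by omega)] at e2
    exact ((Relation.ReflTransGen.single e1).tail e3).tail e2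

/-- The requests before the query of stage `k`. -/
def requestsBefore {b : ℕ} (hb : 0 < b) (m : Mode) (M : ℕ → ℕ → Bool) (w : ℕ → ℕ → Bool) (k : ℕ) :
    List (Request (5 * b)) :=
  requestsUpTo hb m M w k ++ (earlyEdges b m k (w k)).map fun p => .update (toEdge hb p)

theorem requestsUpTo_succ {b : ℕ} (hb : 0 < b) (m : Mode) (M : ℕ → ℕ → Bool) (w : ℕ → ℕ → Bool)
    (k : ℕ) : requestsUpTo hb m M w (k + 1) =
      requestsUpTo hb m M w k ++ stageRequests hb m k (w k) := by
  simp [requestsUpTo, List.range_succ]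

theorem requestsUpTo_prefix {b : ℕ} (hb : 0 < b) (m : Mode) (M : ℕ → ℕ → Bool) (w : ℕ → ℕ → Bool)
    {k : ℕ} (hk : k ≤ b) : ∃ r, allRequests hb m M w = requestsUpTo hb m M w k ++ r := by
  rcases hk.lt_or_eq with h | rfl
  · obtain ⟨r, hr⟩ := flatMap_range_split (fun k => stageRequests hb m k (w k)) h
    rw [allRequests, requestsUpTo, hr]
    exact ⟨stageRequests hb m k (w k) ++ (r ++ (lastEdges b m M).map fun p =>
      .update (toEdge hb p)), by simp only [requestsUpTo, List.append_assoc]⟩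
  · exact ⟨_, rfl⟩

theorem allRequests_split {b : ℕ} (hb : 0 < b) (m : Mode) (M : ℕ → ℕ → Bool) (w : ℕ → ℕ → Bool)
    {k : ℕ} (hk : k < b) : ∃ r, allRequests hb m M w = requestsBefore hb m M w k ++
      .query (vertex hb (3 * b + k)) (vertex hb (4 * b + k)) :: r := by
  obtain ⟨r, hr⟩ := requestsUpTo_prefix hb m M w (k := k + 1) hk
  rw [hr, requestsUpTo_succ, stageRequests, requestsBefore]
  exact ⟨(lateEdges b m k (w k)).map (fun p => .update (toEdge hb p)) ++ r, by simp⟩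

theorem mem_updates_requestsBefore {b : ℕ} (hb : 0 < b) (m : Mode) (M : ℕ → ℕ → Bool)
    (w : ℕ → ℕ → Bool) (k : ℕ) (e : Fin (5 * b) × Fin (5 * b)) :
    e ∈ updates (requestsBefore hb m M w k) ↔ ∃ p, toEdge hb p = e ∧ (p ∈ firstEdges b m M ∨
      (∃ k' < k, ∃ l < 2 * b, stageEdge b k' l = p) ∨
      ∃ l < 2 * b, w k l = m.early ∧ stageEdge b k l = p) := by
  have h1 : ∀ p, (p ∈ (List.range k).flatMap fun k => earlyEdges b m k (w k) ++
      lateEdges b m k (w k)) ↔ ∃ k' < k, ∃ l < 2 * b, stageEdge b k' l = p := by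
    intro p
    rw [List.mem_flatMap]
    refine exists_congr fun k' => ?_
    rw [List.mem_range, (earlyEdges_append_perm b m k' (w k')).mem_iff, mem_stageEdges]
  rw [requestsBefore, updates_append, updates_requestsUpTo, updates_map_update, ← List.map_append,
    List.mem_map]
  refine exists_congr fun p => ?_
  rw [List.mem_append, List.mem_append, h1, mem_earlyEdges, or_assoc]
  exact and_comm

/-- At the query, the edges of the unset bits of stage `k` are missing in both modes: they are not
yet inserted, or already deleted. -/
theorem reachable_productInstance {b : ℕ} (hb : 0 < b) (m : Mode) (M : ℕ → ℕ → Bool)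
    (w : ℕ → ℕ → Bool) {k : ℕ} (hk : k < b) :
    Reachable ((productInstance hb m M w).edgesAt m (requestsBefore hb m M w k).length)
        (vertex hb (3 * b + k)) (vertex hb (4 * b + k)) ↔
      ∃ i < b, ∃ j < b, w k i = true ∧ M i j = true ∧ w k (b + j) = true := by
  obtain ⟨r, hr⟩ := allRequests_split hb m M w hk
  have ht : (productInstance hb m M w).requests.take (requestsBefore hb m M w k).length =
      requestsBefore hb m M w k := by
    simp [productInstance, hr]
  cases m with
  | incremental =>
    have hE : ∀ e, e ∈ (productInstance hb .incremental M w).edgesAt .incremental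
        (requestsBefore hb .incremental M w k).length ↔ _ := fun e => by
      simp only [Instance.edgesAt, Set.mem_ofPred_eq, ht]
      exact mem_updates_requestsBefore hb .incremental M w k e
    refine reachable_iff hb hk (fun p hp => ?_) (fun l hl h => ?_) fun e he => ?_
    · exact (hE _).2 ⟨p, rfl, .inl hp⟩
    · exact (hE _).2 ⟨_, rfl, .inr (.inr ⟨l, hl, h, rfl⟩)⟩
    · obtain ⟨p, hp, h | ⟨k', hk', l, hl, h⟩ | ⟨l, hl, h, h'⟩⟩ := (hE _).1 he
      · exact ⟨p, hp, .inl h⟩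
      · exact ⟨p, hp, .inr (.inr ⟨k', by omega, by omega, l, hl, h.symm⟩)⟩
      · exact ⟨p, hp, .inr (.inl ⟨l, hl, h, h'.symm⟩)⟩
  | decremental =>
    have hE : ∀ e, e ∈ (productInstance hb .decremental M w).edgesAt .decremental
        (requestsBefore hb .decremental M w k).length ↔
        e ∈ (predictedEdges b .decremental M).map (toEdge hb) ∧ ¬ _ := fun e => by
      simp only [Instance.edgesAt, Set.mem_ofPred_eq, ht]
      rw [mem_updates_requestsBefore hb .decremental M w k e]
      rfl
    -- `toEdge` is injective only on pairs of genuine vertex numbers, so absence of an edge from the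
    -- updates needs these bounds.
    have hup : ∀ q, (q ∈ firstEdges b .decremental M ∨
        (∃ k' < k, ∃ l < 2 * b, stageEdge b k' l = q) ∨
        ∃ l < 2 * b, w k l = Mode.decremental.early ∧ stageEdge b k l = q) →
        q.1 < 5 * b ∧ q.2 < 5 * b := by
      rintro q (h | ⟨k', hk', l, hl, rfl⟩ | ⟨l, hl, h, rfl⟩)
      · simp [firstEdges] at h
      · exact stageEdge_lt (by omega) hl
      · exact stageEdge_lt hk hl
    refine reachable_iff hb hk (fun p hp => ?_) (fun l hl h => ?_) fun e he => ?_
    · refine (hE _).2 ⟨List.mem_map_of_mem (mem_predictedEdges.2 (.inl hp)), ?_⟩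
      rintro ⟨q, hq, h⟩
      obtain rfl := toEdge_inj hb (hup q h) (matEdges_lt hb hp) hq
      rcases h with h | ⟨k', hk', l, hl, rfl⟩ | ⟨l, hl, h, rfl⟩
      · simp [firstEdges] at h
      · exact stageEdge_notMem_matEdges hb hl hp
      · exact stageEdge_notMem_matEdges hb hl hp
    · refine (hE _).2 ⟨List.mem_map_of_mem (mem_predictedEdges.2 (.inr ⟨k, hk, l, hl, rfl⟩)), ?_⟩
      rintro ⟨q, hq, h'⟩
      obtain rfl := toEdge_inj hb (hup q h') (stageEdge_lt hk hl) hq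
      rcases h' with h' | ⟨k', hk', l', hl', h'⟩ | ⟨l', hl', h'', h'⟩
      · simp [firstEdges] at h'
      · have := (stageEdge_inj hk hl' h').1
        omega
      · obtain ⟨-, rfl⟩ := stageEdge_inj hk hl' h'
        rw [h] at h''
        cases h''
    · obtain ⟨h1, h2⟩ := (hE _).1 he
      obtain ⟨p, hp, rfl⟩ := List.mem_map.1 h1
      refine ⟨p, rfl, ?_⟩
      rcases mem_predictedEdges.1 hp with h | ⟨k', hk', l, hl, rfl⟩
      · exact .inl h
      · rcases lt_trichotomy k' k with hlt | rfl | hgt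
        · exact absurd ⟨_, rfl, .inr (.inl ⟨k', hlt, l, hl, rfl⟩)⟩ h2
        · refine .inr (.inl ⟨l, hl, ?_, rfl⟩)
          by_contra hw
          exact h2 ⟨_, rfl, .inr (.inr ⟨l, hl, by simpa [Mode.early] using hw, rfl⟩)⟩
        · exact .inr (.inr ⟨k', hk', by omega, l, hl, rfl⟩)

/-! ### Probability amplification by majority votes -/

open MeasureTheory ProbabilityTheory

open scoped ENNReal

instance : IsProbabilityMeasure coinMeasure := by unfold coinMeasure; infer_instance

/-- The tape number `r` when a coin sequence is split into `R` tapes. -/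
def tape (R r : ℕ) (ω : ℕ → Bool) (l : ℕ) : Bool := ω (l * R + r)

/-- The positions `l * R + r` are pairwise distinct. An infinite product measure restricted along an
injection is again a product, and currying groups it into independent tapes. -/
theorem map_tapes (R : ℕ) : coinMeasure.map (fun ω (r : Fin R) => tape R r ω) =
    Measure.infinitePi fun _ : Fin R => coinMeasure := by
  have hinj : Function.Injective fun p : Fin R × ℕ => p.2 * R + p.1 := by
    rintro ⟨r, l⟩ ⟨r', l'⟩ h
    have hR : 0 < R := by have := r.2; omega
    simp only at h
    have h1 := congrArg (· % R) h
    have h2 := congrArg (· / R) h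
    simp only [Nat.mul_add_mod_self_right, Nat.mod_eq_of_lt r.2, Nat.mod_eq_of_lt r'.2] at h1
    simp only [mul_comm _ R, Nat.mul_add_div hR, Nat.div_eq_of_lt r.2, Nat.div_eq_of_lt r'.2] at h2
    exact Prod.ext (Fin.ext h1) (by simpa using h2)
  have h1 := Measure.map_infinitePi_infinitePi_of_inj
    (P := fun _ : ℕ => (PMF.uniformOfFintype Bool).toMeasure) hinj
  have h2 := Measure.infinitePi_map_curry (ι := Fin R) (κ := ℕ)
    (fun _ _ => (PMF.uniformOfFintype Bool).toMeasure)
  unfold coinMeasure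
  rw [← h2, ← h1, Measure.map_map]
  · rfl
  · fun_prop
  · fun_prop

theorem measurable_tape (R r : ℕ) : Measurable (tape R r) := by
  unfold tape; fun_prop

theorem map_tape {R r : ℕ} (hr : r < R) : coinMeasure.map (tape R r) = coinMeasure := by
  have h1 := Measure.map_infinitePi_infinitePi_of_inj
    (P := fun _ : ℕ => (PMF.uniformOfFintype Bool).toMeasure)
    (f := fun l : ℕ => l * R + r) (fun l l' h => by
      simp only [Nat.add_right_cancel_iff] at h
      exact Nat.eq_of_mul_eq_mul_right (by omega) h)
  exact h1

theorem iIndepFun_tapes (R : ℕ) : iIndepFun (fun r : Fin R => tape R r) coinMeasure := by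
  rw [iIndepFun_iff_map_fun_eq_infinitePi_map (X := fun r : Fin R => tape R r)
    fun r => measurable_tape R r]
  simp only [map_tape (Fin.is_lt _)]
  exact map_tapes R

-- A Chernoff-type argument. Give weight `2 / 3` to a tape in `S` and `3 / 2` to any other; the mean
-- weight is at most `2 / 3 + 5 / 6 * (1 / 3) = 17 / 18`. If at most half of the tapes are in `S`,
-- the product of the weights is at least 1, so Markov's inequality and independence give the bound.
open Classical in
theorem majority_error_le (R : ℕ) {S : Set (ℕ → Bool)} (hS : MeasurableSet S)
    (h : 2 / 3 ≤ coinMeasure S) :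
    coinMeasure {ω | 2 * (Finset.univ.filter fun r : Fin R => tape R r ω ∈ S).card ≤ R} ≤
      (17 / 18 : ℝ≥0∞) ^ R := by
  set g : (ℕ → Bool) → ℝ≥0∞ := fun τ => if τ ∈ S then 2 / 3 else 3 / 2 with hg
  have hgm : Measurable g := Measurable.ite hS measurable_const measurable_const
  have hint : ∫⁻ τ, g τ ∂coinMeasure ≤ 17 / 18 := by
    have e : g = fun τ => 2 / 3 + Sᶜ.indicator (fun _ => (5 / 6 : ℝ≥0∞)) τ := by
      funext τ
      by_cases hτ : τ ∈ S
      · simp [hg, hτ]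
      · simp only [hg, hτ, if_false, Set.indicator_of_mem (Set.mem_compl hτ)]
        rw [← ENNReal.toReal_eq_toReal_iff' (by finiteness) (by finiteness),
          ENNReal.toReal_add (by finiteness) (by finiteness)]
        simp
        norm_num
    have hc : coinMeasure Sᶜ ≤ 1 / 3 := by
      rw [prob_compl_eq_one_sub hS]
      refine (tsub_le_tsub_left h 1).trans (le_of_eq ?_)
      rw [← ENNReal.toReal_eq_toReal_iff' (by finiteness) (by finiteness),
        ENNReal.toReal_sub_of_le ?_ (by finiteness)]
      · simp
        norm_num
      · exact ENNReal.div_le_of_le_mul (by norm_num)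
    rw [e, lintegral_add_left measurable_const, lintegral_indicator hS.compl]
    simp only [lintegral_const, measure_univ, mul_one, Measure.restrict_apply, Set.univ_inter,
      MeasurableSet.univ]
    calc (2 / 3 + 5 / 6 * coinMeasure Sᶜ : ℝ≥0∞) ≤ 2 / 3 + 5 / 6 * (1 / 3) := by gcongr
      _ = 17 / 18 := by
        rw [← ENNReal.toReal_eq_toReal_iff' (by finiteness) (by finiteness),
          ENNReal.toReal_add (by finiteness) (by finiteness)]
        simp
        norm_num
  have hprod : ∫⁻ ω, ∏ r : Fin R, g (tape R r ω) ∂coinMeasure ≤ (17 / 18 : ℝ≥0∞) ^ R := by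
    have hi : iIndepFun (fun r : Fin R => g ∘ tape R r) coinMeasure :=
      (iIndepFun_tapes R).comp _ fun _ => hgm
    have := lintegral_prod_eq_prod_lintegral_of_indepFun Finset.univ _ hi
      fun r => hgm.comp (measurable_tape R r)
    simp only [Function.comp_apply] at this
    rw [this]
    calc ∏ r : Fin R, ∫⁻ ω, g (tape R r ω) ∂coinMeasure ≤ ∏ _r : Fin R, (17 / 18 : ℝ≥0∞) := by
          refine Finset.prod_le_prod' fun r _ => ?_
          rw [← lintegral_map hgm (measurable_tape R r), map_tape r.2]
          exact hint
      _ = (17 / 18 : ℝ≥0∞) ^ R := by simp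
  refine le_trans ?_ hprod
  have hm : Measurable fun ω => ∏ r : Fin R, g (tape R r ω) :=
    Finset.measurable_fun_prod _ fun r _ => hgm.comp (measurable_tape R r)
  have hmark := mul_meas_ge_le_lintegral₀ (μ := coinMeasure) hm.aemeasurable 1
  rw [one_mul] at hmark
  refine le_trans (measure_mono fun ω hω => ?_) hmark
  simp only [Set.mem_ofPred_eq] at hω ⊢
  simp only [hg, Finset.prod_ite, Finset.prod_const]
  set a := (Finset.univ.filter fun r : Fin R => tape R r ω ∈ S).card with ha
  have hb : a + (Finset.univ.filter fun r : Fin R => tape R r ω ∉ S).card = R := by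
    rw [ha, Finset.card_filter_add_card_filter_not]; simp
  set b := (Finset.univ.filter fun r : Fin R => tape R r ω ∉ S).card
  have e1 : (2 / 3 * (3 / 2) : ℝ≥0∞) = 1 := by
    rw [← ENNReal.toReal_eq_toReal_iff' (by finiteness) (by finiteness)]
    simp
  have e2 : (1 : ℝ≥0∞) ≤ 3 / 2 := by
    rw [ENNReal.le_div_iff_mul_le (by simp) (by simp)]; norm_num
  calc (1 : ℝ≥0∞) = (2 / 3) ^ a * (3 / 2) ^ a := by rw [← mul_pow, e1, one_pow]
    _ ≤ (2 / 3) ^ a * (3 / 2) ^ b := by gcongr; omega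

/-- A property of coin sequences that depends on finitely many coins is measurable. -/
theorem measurableSet_of_finite_coins (L : ℕ) {S : Set (ℕ → Bool)}
    (h : ∀ τ τ' : ℕ → Bool, (∀ i < L, τ i = τ' i) → τ ∈ S → τ' ∈ S) : MeasurableSet S := by
  let f : (ℕ → Bool) → (Fin L → Bool) := fun τ i => τ i
  have hf : Measurable f := by fun_prop
  have : S = f ⁻¹' (f '' S) := by
    refine Set.Subset.antisymm (Set.subset_preimage_image f S) ?_
    rintro τ ⟨τ', hτ', he⟩
    exact h τ' τ (fun i hi => congrFun he ⟨i, hi⟩) hτ'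
  rw [this]
  exact hf (Set.toFinite _).measurableSet

/-! ### Runs of a dynamic algorithm on the graphs of products -/

section
variable (A : TCAlgorithm) (κ b : ℕ) (m : Mode) (M : ℕ → ℕ → Bool) (w : ℕ → ℕ → Bool)
  (τ : ℕ → Bool)

/-- The bound for words in the runs on the graphs of products of size `b`. -/
def wordBound : ℕ := (5 * b + (3 * (b * b) + b) + 2) ^ κ

/-- The call that updates an edge. -/
def updateCall (p : ℕ × ℕ) : Prog × List ℕ := (A.update, [p.1, p.2])

/-- The query of stage `k`. -/
def queryCall (k : ℕ) : Prog × List ℕ := (A.query, [3 * b + k, 4 * b + k])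

/-- The input of the preprocessing. -/
def preInput : List ℕ := 5 * b :: 3 * (b * b) :: (predictedEdges b m M).flatMap fun p => [p.1, p.2]

/-- The calls of stage `k` with bits `u`. -/
def stageCalls (k : ℕ) (u : ℕ → Bool) : List (Prog × List ℕ) :=
  (earlyEdges b m k u).map (updateCall A) ++
    queryCall A b k :: (lateEdges b m k u).map (updateCall A)

/-- The calls before the first stage. -/
def firstCalls : List (Prog × List ℕ) :=
  (A.preprocess, preInput b m M) :: (firstEdges b m M).map (updateCall A)

/-- The calls of the first `k` stages. -/
def stagesCalls (k : ℕ) : List (Prog × List ℕ) :=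
  (List.range k).flatMap fun k => stageCalls A b m k (w k)

/-- The state before the first stage. -/
noncomputable def firstState : State :=
  runState (wordBound κ b) τ State.init (firstCalls A b m M)

/-- The state after `k` stages. -/
noncomputable def stagesState (k : ℕ) : State :=
  runState (wordBound κ b) τ (firstState A κ b m M τ) (stagesCalls A b m w k)

/-- The time of the first `k` stages. -/
noncomputable def stagesTime (k : ℕ) : ℕ :=
  runTime (wordBound κ b) τ (firstState A κ b m M τ) (stagesCalls A b m w k)

/-- The answer to the query of stage `k`. -/
noncomputable def stageAnswer (k : ℕ) : ℕ :=
  (callState (wordBound κ b) τ (runState (wordBound κ b) τ (stagesState A κ b m M w τ k)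
    ((earlyEdges b m k (w k)).map (updateCall A))) (queryCall A b k)).out 0

/-- All runs on graphs of products halt; the preprocessing takes at most `T₀` steps, and the
updates and queries take at most `T` steps. -/
def HaltsWithin (T₀ T : ℕ) : Prop :=
  ∀ (M : ℕ → ℕ → Bool) (w : ℕ → ℕ → Bool) (τ : ℕ → Bool),
    RunHalts (wordBound κ b) τ State.init (firstCalls A b m M ++ stagesCalls A b m w b) ∧
    runTime (wordBound κ b) τ State.init (firstCalls A b m M) ≤ T₀ + T ∧
    stagesTime A κ b m M w τ b ≤ T ∧
    runTime (wordBound κ b) τ State.init (firstCalls A b m M ++ stagesCalls A b m w b) ≤ T₀ + T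

theorem stagesCalls_succ (k : ℕ) : stagesCalls A b m w (k + 1) =
    stagesCalls A b m w k ++ stageCalls A b m k (w k) := by
  simp [stagesCalls, List.range_succ]

/-- The calls of the first stages do not depend on later bits. Hence the bits may be chosen
adaptively and the function `w` completed only in retrospect. -/
theorem stagesCalls_congr {w w' : ℕ → ℕ → Bool} {k : ℕ} (h : ∀ k' < k, w k' = w' k') :
    stagesCalls A b m w k = stagesCalls A b m w' k := by
  induction k with
  | zero => rfl
  | succ k ih =>
    rw [stagesCalls_succ, stagesCalls_succ, ih fun k' hk' => h k' (by omega), h k (by omega)]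

theorem stagesState_congr {w w' : ℕ → ℕ → Bool} {k : ℕ} (h : ∀ k' < k, w k' = w' k') :
    stagesState A κ b m M w τ k = stagesState A κ b m M w' τ k := by
  rw [stagesState, stagesState, stagesCalls_congr A b m h]

theorem stagesTime_congr {w w' : ℕ → ℕ → Bool} {k : ℕ} (h : ∀ k' < k, w k' = w' k') :
    stagesTime A κ b m M w τ k = stagesTime A κ b m M w' τ k := by
  rw [stagesTime, stagesTime, stagesCalls_congr A b m h]

theorem stageAnswer_congr {w w' : ℕ → ℕ → Bool} {k : ℕ} (h : ∀ k' ≤ k, w k' = w' k') :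
    stageAnswer A κ b m M w τ k = stageAnswer A κ b m M w' τ k := by
  rw [stageAnswer, stageAnswer, stagesState_congr A κ b m M τ fun k' hk' => h k' hk'.le,
    h k le_rfl]

theorem stagesState_zero : stagesState A κ b m M w τ 0 = firstState A κ b m M τ := rfl

theorem stagesTime_zero : stagesTime A κ b m M w τ 0 = 0 := rfl

theorem stagesState_succ (k : ℕ) : stagesState A κ b m M w τ (k + 1) =
    runState (wordBound κ b) τ (stagesState A κ b m M w τ k) (stageCalls A b m k (w k)) := by
  rw [stagesState, stagesCalls_succ, runState_append]; rfl

theorem stagesTime_succ (k : ℕ) : stagesTime A κ b m M w τ (k + 1) = stagesTime A κ b m M w τ k +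
    runTime (wordBound κ b) τ (stagesState A κ b m M w τ k) (stageCalls A b m k (w k)) := by
  rw [stagesTime, stagesCalls_succ, runTime_append]; rfl

theorem stagesCalls_split {k : ℕ} (hk : k ≤ b) :
    ∃ r, stagesCalls A b m w b = stagesCalls A b m w k ++ r := by
  rcases hk.lt_or_eq with h | rfl
  · obtain ⟨r, hr⟩ := flatMap_range_split (fun k => stageCalls A b m k (w k)) h
    exact ⟨_, hr⟩
  · exact ⟨[], by simp⟩

variable {A κ b m} {T₀ T : ℕ}

theorem HaltsWithin.first (H : HaltsWithin A κ b m T₀ T) :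
    RunHalts (wordBound κ b) τ State.init (firstCalls A b m M) :=
  ((runHalts_append _ _ _ _ _).1 (H M (fun _ _ => false) τ).1).1

theorem HaltsWithin.stages (H : HaltsWithin A κ b m T₀ T) {k : ℕ} (hk : k ≤ b) :
    RunHalts (wordBound κ b) τ (firstState A κ b m M τ) (stagesCalls A b m w k) := by
  have h := ((runHalts_append _ _ _ _ _).1 (H M w τ).1).2
  obtain ⟨r, hr⟩ := stagesCalls_split A b m w hk
  rw [hr, runHalts_append] at h
  exact h.1

theorem HaltsWithin.stage (H : HaltsWithin A κ b m T₀ T) {k : ℕ} (hk : k < b) :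
    RunHalts (wordBound κ b) τ (stagesState A κ b m M w τ k) (stageCalls A b m k (w k)) := by
  have h := H.stages M w τ (k := k + 1) hk
  rw [stagesCalls_succ, runHalts_append] at h
  exact h.2

theorem HaltsWithin.stagesTime_le (H : HaltsWithin A κ b m T₀ T) {k : ℕ} (hk : k ≤ b) :
    stagesTime A κ b m M w τ k ≤ T := by
  obtain ⟨r, hr⟩ := stagesCalls_split A b m w hk
  have h := (H M w τ).2.2.1
  rw [stagesTime, hr, runTime_append] at h
  exact (Nat.le_add_right _ _).trans h

theorem HaltsWithin.coins_first_le (H : HaltsWithin A κ b m T₀ T) :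
    (firstState A κ b m M τ).coins ≤ T₀ + T := by
  have h := (H.first M τ).coins_le.2
  have h' := (H M (fun _ _ => false) τ).2.1
  simp only [State.init, zero_add] at h
  exact h.trans h'

theorem HaltsWithin.coins_stages_le (H : HaltsWithin A κ b m T₀ T) {k : ℕ} (hk : k ≤ b) :
    (stagesState A κ b m M w τ k).coins ≤ T₀ + T := by
  obtain ⟨r, hr⟩ := stagesCalls_split A b m w hk
  obtain ⟨h, -, -, h'⟩ := H M w τ
  rw [hr, ← List.append_assoc] at h h'
  have h2 := ((runHalts_append _ _ _ _ _).1 h).1.coins_le.2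
  rw [runTime_append] at h'
  rw [runState_append] at h2
  simp only [State.init, zero_add] at h2
  exact h2.trans ((Nat.le_add_right _ _).trans h')

theorem State.init_bdd {W : ℕ} (hW : 0 < W) : State.init.Bdd W := ⟨fun _ => hW, fun _ => hW⟩

theorem wordBound_pos (κ b : ℕ) : 0 < wordBound κ b := Nat.pow_pos (by omega)

/-- The answer is computed from the first `T₀ + T` coins, because every run up to it takes at most
that many steps. -/
theorem HaltsWithin.measurableSet_answer (H : HaltsWithin A κ b m T₀ T) {k : ℕ} (hk : k < b)
    (a : ℕ) : MeasurableSet {τ | stageAnswer A κ b m M w τ k = a} := by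
  refine measurableSet_of_finite_coins (T₀ + T) fun τ τ' hτ h => ?_
  rw [Set.mem_ofPred_eq] at h ⊢
  rw [← h]
  set pre := firstCalls A b m M ++ (stagesCalls A b m w k ++
    (earlyEdges b m k (w k)).map (updateCall A)) with hpre
  have key : ∀ τ, stageAnswer A κ b m M w τ k =
      (runState (wordBound κ b) τ State.init (pre ++ [queryCall A b k])).out 0 := by
    intro τ
    rw [hpre, List.append_assoc, runState_append, List.append_assoc, runState_append,
      runState_append]
    rfl
  rw [key, key]
  obtain ⟨r, hr⟩ := stagesCalls_split A b m w (k := k + 1) hk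
  obtain ⟨r', hr'⟩ : ∃ r', firstCalls A b m M ++ stagesCalls A b m w b =
      (pre ++ [queryCall A b k]) ++ r' :=
    ⟨(lateEdges b m k (w k)).map (updateCall A) ++ r, by
      rw [hr, stagesCalls_succ, stageCalls, hpre]; simp⟩
  obtain ⟨h1, -, -, h2⟩ := H M w τ
  rw [hr', runHalts_append] at h1
  rw [hr', runTime_append] at h2
  have h3 := h1.1.coins_le.2
  simp only [State.init, zero_add] at h3
  rw [h1.1.congr_coins fun i hi => hτ i (hi.trans_le (h3.trans ((Nat.le_add_right _ _).trans h2)))]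

end

/-! ### Consequences of the bounds for correctness and time -/

theorem flatMap_map_pair {b : ℕ} (hb : 0 < b) (l : List (ℕ × ℕ))
    (h : ∀ p ∈ l, p.1 < 5 * b ∧ p.2 < 5 * b) :
    (l.map (toEdge hb)).flatMap (fun e => [(e.1 : ℕ), (e.2 : ℕ)]) =
      l.flatMap fun p => [p.1, p.2] := by
  induction l with
  | nil => rfl
  | cons p l ih =>
    have hp := h p (by simp)
    simp [ih fun q hq => h q (by simp [hq]), toEdge, vertex_val hb hp.1, vertex_val hb hp.2]

theorem map_call_update (A : TCAlgorithm) {b : ℕ} (hb : 0 < b) (l : List (ℕ × ℕ))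
    (h : ∀ p ∈ l, p.1 < 5 * b ∧ p.2 < 5 * b) :
    (l.map fun p => Request.update (toEdge hb p)).map A.call = l.map (updateCall A) := by
  rw [List.map_map]
  refine List.map_congr_left fun p hp => ?_
  simp [TCAlgorithm.call, updateCall, toEdge, vertex_val hb (h p hp).1, vertex_val hb (h p hp).2]

theorem firstEdges_lt {b : ℕ} (hb : 0 < b) (m : Mode) (M : ℕ → ℕ → Bool) :
    ∀ p ∈ firstEdges b m M, p.1 < 5 * b ∧ p.2 < 5 * b := by
  intro p hp
  cases m
  · exact matEdges_lt hb hp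
  · simp [firstEdges] at hp

section
variable (A : TCAlgorithm) {b : ℕ} (hb : 0 < b) (m : Mode) (M : ℕ → ℕ → Bool)
  (w : ℕ → ℕ → Bool)

theorem earlyEdges_lt {k : ℕ} (hk : k < b) (u : ℕ → Bool) :
    ∀ p ∈ earlyEdges b m k u, p.1 < 5 * b ∧ p.2 < 5 * b := by
  intro p hp
  obtain ⟨l, hl, -, rfl⟩ := mem_earlyEdges.1 hp
  exact stageEdge_lt hk hl

theorem lateEdges_lt {k : ℕ} (hk : k < b) (u : ℕ → Bool) :
    ∀ p ∈ lateEdges b m k u, p.1 < 5 * b ∧ p.2 < 5 * b := by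
  intro p hp
  have : p ∈ stageEdges b k :=
    (earlyEdges_append_perm b m k u).mem_iff.1 (List.mem_append_right _ hp)
  obtain ⟨l, hl, rfl⟩ := mem_stageEdges.1 this
  exact stageEdge_lt hk hl

theorem map_call_requestsUpTo {k : ℕ} (hk : k ≤ b) : (requestsUpTo hb m M w k).map A.call =
    (firstEdges b m M).map (updateCall A) ++ stagesCalls A b m w k := by
  induction k with
  | zero =>
    simpa [requestsUpTo, stagesCalls] using map_call_update A hb _ (firstEdges_lt hb m M)
  | succ k ih =>
    rw [requestsUpTo_succ, List.map_append, ih (by omega), stagesCalls_succ, List.append_assoc,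
      stageRequests, List.map_append, List.map_cons,
      map_call_update A hb _ (earlyEdges_lt m hk _), map_call_update A hb _ (lateEdges_lt m hk _)]
    simp [stageCalls, TCAlgorithm.call, queryCall, vertex_val hb (show 3 * b + k < 5 * b by omega),
      vertex_val hb (show 4 * b + k < 5 * b by omega)]

theorem calls_productInstance : A.calls (productInstance hb m M w) =
    (A.preprocess, preInput b m M) :: (allRequests hb m M w).map A.call := by
  simp only [TCAlgorithm.calls, productInstance, preInput, List.length_map, predictedEdges_length]
  rw [flatMap_map_pair hb _ fun p hp => predictedEdges_lt hb hp]

theorem stageRequests_length (k : ℕ) (u : ℕ → Bool) :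
    (stageRequests hb m k u).length = 2 * b + 1 := by
  have := earlyEdges_append_length b m k u
  rw [List.length_append] at this
  simp only [stageRequests, List.length_append, List.length_map, List.length_cons]
  omega

/-- Owing to the dummy rows this number does not depend on the matrix. So all runs for a given `b`
use the same word size `wordBound`, which the reduction can compute beforehand. -/
theorem allRequests_length : (allRequests hb m M w).length = 3 * (b * b) + b := by
  have h := flatMap_range_length (fun k => stageRequests hb m k (w k)) (2 * b + 1) b
    fun k => stageRequests_length hb m k (w k)
  cases m <;>
  · simp only [allRequests, requestsUpTo, firstEdges, lastEdges, List.length_append, h, matEdges,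
      List.length_map, List.length_range, List.length_nil]
    ring

theorem run_productInstance_iff (κ : ℕ) (τ : ℕ → Bool) (r₀ : CallRecord) (rs : List CallRecord) :
    A.Run κ (productInstance hb m M w) τ r₀ rs ↔
      RunHalts (wordBound κ b) τ State.init
        ((A.preprocess, preInput b m M) :: (allRequests hb m M w).map A.call) ∧
      r₀ :: rs = runRecords (wordBound κ b) τ State.init
        ((A.preprocess, preInput b m M) :: (allRequests hb m M w).map A.call) := by
  rw [TCAlgorithm.Run, session_iff, calls_productInstance]
  have : (5 * b + (productInstance hb m M w).requests.length + 2) ^ κ = wordBound κ b := by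
    rw [show (productInstance hb m M w).requests = allRequests hb m M w from rfl,
      allRequests_length, wordBound]
  rw [this]

theorem sum_allowedTime {n : ℕ} (C ε : ℝ) (I : Instance n) (l : List (Request n)) :
    (l.map (allowedTime C ε I)).sum = (updates l).length * (C * (n : ℝ) ^ (1 - ε)) +
      ((l.length : ℝ) - (updates l).length) * (C * (1 + (I.etaInf : ℝ)) ^ (2 - ε)) := by
  induction l with
  | nil => simp [updates]
  | cons r l ih =>
    cases r with
    | update e =>
      have : updates (.update e :: l) = e :: updates l := rfl
      rw [List.map_cons, List.sum_cons, ih, this]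
      simp only [allowedTime, List.length_cons, Nat.cast_add, Nat.cast_one]
      ring
    | query s t =>
      have : updates (.query s t :: l) = updates l := rfl
      rw [List.map_cons, List.sum_cons, ih, this]
      simp only [allowedTime, List.length_cons, Nat.cast_add, Nat.cast_one]
      ring

/-- The `3 * b ^ 2` updates cost at most `5 * C * b ^ (1 - ε)` each and the `b` queries at most `C *
(3 * b) ^ (2 - ε) ≤ 9 * C * b ^ (2 - ε)` each; both groups are of order `b ^ (3 - ε)`, and `24 = 15
+ 9`. -/
theorem sum_allowedTime_productInstance_le {C ε : ℝ} (hC : 0 ≤ C) (hε : 0 ≤ ε) (hε' : ε ≤ 1 / 2) :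
    ((allRequests hb m M w).map (allowedTime C ε (productInstance hb m M w))).sum ≤
      24 * C * (b : ℝ) ^ (3 - ε) := by
  have hb' : (1 : ℝ) ≤ b := by exact_mod_cast hb
  have hb0 : (0 : ℝ) < b := by linarith
  have hu : (updates (allRequests hb m M w)).length = 3 * (b * b) := by
    rw [updates_allRequests, List.length_map, (actualEdges_perm b m M w).length_eq,
      predictedEdges_length]
  rw [sum_allowedTime, hu, allRequests_length]
  push_cast
  have h5 : (5 * (b : ℝ)) ^ (1 - ε) ≤ 5 * (b : ℝ) ^ (1 - ε) := by
    rw [Real.mul_rpow (by norm_num) hb0.le]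
    gcongr
    calc (5 : ℝ) ^ (1 - ε) ≤ 5 ^ (1 : ℝ) := Real.rpow_le_rpow_of_exponent_le (by norm_num) (by linarith)
      _ = 5 := Real.rpow_one 5
  have hη : (1 + ((productInstance hb m M w).etaInf : ℝ)) ≤ 3 * b := by
    have : ((productInstance hb m M w).etaInf : ℝ) ≤ 2 * b := by
      exact_mod_cast etaInf_productInstance_le m M w hb
    linarith
  have h9 : (1 + ((productInstance hb m M w).etaInf : ℝ)) ^ (2 - ε) ≤ 9 * (b : ℝ) ^ (2 - ε) := by
    calc (1 + ((productInstance hb m M w).etaInf : ℝ)) ^ (2 - ε) ≤ (3 * (b : ℝ)) ^ (2 - ε) :=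
          Real.rpow_le_rpow (by positivity) hη (by linarith)
      _ = 3 ^ (2 - ε) * (b : ℝ) ^ (2 - ε) := Real.mul_rpow (by norm_num) hb0.le
      _ ≤ 9 * (b : ℝ) ^ (2 - ε) := by
        gcongr
        calc (3 : ℝ) ^ (2 - ε) ≤ 3 ^ (2 : ℝ) :=
              Real.rpow_le_rpow_of_exponent_le (by norm_num) (by linarith)
          _ = 9 := by norm_num
  have e1 : (b : ℝ) ^ (3 - ε) = b * b * (b : ℝ) ^ (1 - ε) := by
    rw [show 3 - ε = 1 + 1 + (1 - ε) by ring, Real.rpow_add hb0, Real.rpow_add hb0, Real.rpow_one]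
  have e2 : (b : ℝ) ^ (3 - ε) = b * (b : ℝ) ^ (2 - ε) := by
    rw [show 3 - ε = 1 + (2 - ε) by ring, Real.rpow_add hb0, Real.rpow_one]
  calc _ ≤ 3 * ((b : ℝ) * b) * (C * (5 * (b : ℝ) ^ (1 - ε))) +
        (3 * ((b : ℝ) * b) + b - 3 * (b * b)) * (C * (9 * (b : ℝ) ^ (2 - ε))) := by
        have : 0 ≤ (3 * ((b : ℝ) * b) + b - 3 * (b * b)) := by linarith
        gcongr
    _ = 15 * C * (b * b * (b : ℝ) ^ (1 - ε)) + 9 * C * (b * (b : ℝ) ^ (2 - ε)) := by ring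
    _ = 24 * C * (b : ℝ) ^ (3 - ε) := by rw [← e1, ← e2]; ring

end

/-- An amortized bound concerns complete request sequences only. The reduction stops before the last
edges, but the time of a prefix is at most the time of the whole sequence. -/
theorem haltsWithin_of_amortizedTimeBound {A : TCAlgorithm} {m : Mode} {b : ℕ} (hb : 0 < b)
    {κ d T : ℕ} {C ε : ℝ} (hC : 0 ≤ C) (hε : 0 ≤ ε)
    (hε' : ε ≤ 1 / 2) (hA : A.AmortizedTimeBound κ d C ε)
    (hT : 24 * C * (b : ℝ) ^ (3 - ε) < T + 1) :
    HaltsWithin A κ b m ((5 * b) ^ d + d) T := by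
  intro M w τ
  obtain ⟨r₀, rs, hrun, hr₀, hrs⟩ := hA (5 * b) (by omega) (productInstance hb m M w) τ
  rw [run_productInstance_iff] at hrun
  obtain ⟨hh, hrec⟩ := hrun
  have hle := hrs.trans (sum_allowedTime_productInstance_le hb m M w hC hε hε')
  have hle' : (rs.map CallRecord.time).sum ≤ T := by
    have := hle.trans_lt hT
    exact_mod_cast Nat.lt_succ_iff.1 (by exact_mod_cast this)
  simp only [runRecords, List.cons.injEq] at hrec
  obtain ⟨h1, h2⟩ := hrec
  rw [h1] at hr₀
  simp only at hr₀
  rw [h2, runRecords_time] at hle'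
  have hall : (allRequests hb m M w).map A.call =
      (firstEdges b m M).map (updateCall A) ++ (stagesCalls A b m w b ++
        ((lastEdges b m M).map (fun p => Request.update (toEdge hb p))).map A.call) := by
    rw [allRequests, List.map_append, map_call_requestsUpTo A hb m M w le_rfl, List.append_assoc]
  have hcons : (A.preprocess, preInput b m M) :: (allRequests hb m M w).map A.call =
      (firstCalls A b m M ++ stagesCalls A b m w b) ++
        ((lastEdges b m M).map (fun p => Request.update (toEdge hb p))).map A.call := by
    rw [hall, firstCalls]; simp
  have hh' := hh
  rw [hcons, runHalts_append] at hh'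
  rw [hall, runTime_append, runTime_append] at hle'
  have e3 : stagesTime A κ b m M w τ b = runTime (wordBound κ b) τ
      (runState (wordBound κ b) τ (callState (wordBound κ b) τ State.init
        (A.preprocess, preInput b m M)) ((firstEdges b m M).map (updateCall A)))
      (stagesCalls A b m w b) := rfl
  have e4 : runTime (wordBound κ b) τ State.init (firstCalls A b m M) =
      callTime (wordBound κ b) τ State.init (A.preprocess, preInput b m M) +
        runTime (wordBound κ b) τ (callState (wordBound κ b) τ State.init
        (A.preprocess, preInput b m M)) ((firstEdges b m M).map (updateCall A)) := rfl
  have e5 : runTime (wordBound κ b) τ State.init (firstCalls A b m M ++ stagesCalls A b m w b) =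
      runTime (wordBound κ b) τ State.init (firstCalls A b m M) + stagesTime A κ b m M w τ b :=
    runTime_append _ _ _ _ _
  refine ⟨hh'.1, ?_, ?_, ?_⟩ <;> omega

/-- Here `w` is fixed before `τ` is drawn, as the correctness assumption demands. Adaptive bits are
dealt with later by comparison with an ideal history. -/
theorem stageAnswer_correct {A : TCAlgorithm} {m : Mode} {b : ℕ} (hb : 0 < b)
    (M : ℕ → ℕ → Bool) (w : ℕ → ℕ → Bool) {κ : ℕ} (hA : A.Correct m κ) {k : ℕ} (hk : k < b) :
    2 / 3 ≤ coinMeasure {τ | stageAnswer A κ b m M w τ k =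
      if ∃ i < b, ∃ j < b, w k i = true ∧ M i j = true ∧ w k (b + j) = true then 1 else 0} := by
  obtain ⟨r, hr⟩ := allRequests_split hb m M w hk
  have hi : (productInstance hb m M w).requests[(requestsBefore hb m M w k).length]? =
      some (.query (vertex hb (3 * b + k)) (vertex hb (4 * b + k))) := by
    simp [productInstance, hr]
  refine (hA (5 * b) (by omega) (productInstance hb m M w) _ _ _ hi).trans
    (measure_mono fun τ hτ => ?_)
  obtain ⟨r₀, rs, hrun, hout⟩ := hτ
  rw [run_productInstance_iff] at hrun
  obtain ⟨hh, hrec⟩ := hrun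
  simp only [runRecords, List.cons.injEq] at hrec
  obtain ⟨-, h2⟩ := hrec
  have hbef : (requestsBefore hb m M w k).map A.call = (firstEdges b m M).map (updateCall A) ++
      (stagesCalls A b m w k ++ (earlyEdges b m k (w k)).map (updateCall A)) := by
    rw [requestsBefore, List.map_append, map_call_requestsUpTo A hb m M w hk.le,
      map_call_update A hb _ (earlyEdges_lt m hk _), List.append_assoc]
  have hq : A.call (.query (vertex hb (3 * b + k)) (vertex hb (4 * b + k))) = queryCall A b k := by
    simp [TCAlgorithm.call, queryCall, vertex_val hb (show 3 * b + k < 5 * b by omega),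
      vertex_val hb (show 4 * b + k < 5 * b by omega)]
  rw [hr, List.map_append, List.map_cons, hq] at h2
  have h3 := runRecords_append_getElem? (wordBound κ b) τ
    (callState (wordBound κ b) τ State.init (A.preprocess, preInput b m M))
    ((requestsBefore hb m M w k).map A.call) (r.map A.call) (queryCall A b k)
  rw [← h2, List.length_map] at h3
  have h4 := hout _ h3
  rw [hbef, runState_append, runState_append] at h4
  simp only [reachable_productInstance hb m M w hk] at h4
  exact h4

/-! ### Calls of the simulated algorithm -/

/-- Only the listed variables and arrays, and only the cells from `b` to `b + Z`, are changed. -/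
structure Keeps (vs : List Var) (as : List Arr) (b Z : ℕ) (h h' : HState) : Prop where
  var : ∀ x, x ∉ vs → h'.var x = h.var x
  arr : ∀ a, a ∉ as → h'.arr a = h.arr a
  out : h'.out = h.out
  coins : h'.coins = h.coins
  cells : ∀ y, (y < b ∨ b + Z ≤ y) → h'.arr .stamp y = h.arr .stamp y ∧
    h'.arr .cells (2 * y) = h.arr .cells (2 * y) ∧
    h'.arr .cells (2 * y + 1) = h.arr .cells (2 * y + 1)
  snap : 0 < h.var .gen → ∀ y, h'.snap y = h.snap y
  stamp : ∀ y, h'.arr .stamp y = h.arr .stamp y ∨ h'.arr .stamp y = h.var .gen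

section
variable {vs vs' : List Var} {as as' : List Arr} {b Z : ℕ} {h h' h'' : HState}

theorem Keeps.refl (vs : List Var) (as : List Arr) (b Z : ℕ) (h : HState) : Keeps vs as b Z h h :=
  ⟨fun _ _ => rfl, fun _ _ => rfl, rfl, rfl, fun _ _ => ⟨rfl, rfl, rfl⟩, fun _ _ => rfl,
    fun _ => .inl rfl⟩

theorem Keeps.trans (H : Keeps vs as b Z h h') (H' : Keeps vs as b Z h' h'')
    (hg : .gen ∉ vs := by decide) : Keeps vs as b Z h h'' := by
  have hg : h'.var .gen = h.var .gen := H.var _ hg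
  refine ⟨fun x hx => (H'.var x hx).trans (H.var x hx),
    fun a ha => (H'.arr a ha).trans (H.arr a ha), H'.out.trans H.out,
    H'.coins.trans H.coins, fun y hy => ?_, fun hp y => ?_, fun y => ?_⟩
  · obtain ⟨a1, a2, a3⟩ := H.cells y hy
    obtain ⟨b1, b2, b3⟩ := H'.cells y hy
    exact ⟨b1.trans a1, b2.trans a2, b3.trans a3⟩
  · exact (H'.snap (by rwa [hg]) y).trans (H.snap hp y)
  · rcases H'.stamp y with h1 | h1
    · rw [h1]; exact H.stamp y
    · right; rw [h1, hg]

theorem Keeps.mono (H : Keeps vs as b Z h h') (h₁ : vs ⊆ vs' := by decide)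
    (h₂ : as ⊆ as' := by decide) : Keeps vs' as' b Z h h' :=
  ⟨fun x hx => H.var x fun hh => hx (h₁ hh), fun a ha => H.arr a fun hh => ha (h₂ hh), H.out,
    H.coins, H.cells, H.snap, H.stamp⟩

theorem Keeps.tick (H : Keeps vs as b Z h h') : Keeps vs as b Z h h'.tick :=
  ⟨H.var, H.arr, H.out, H.coins, H.cells, H.snap, H.stamp⟩

theorem Keeps.set (H : Keeps vs as b Z h h') (x : Var) (v : ℕ) (hx : x ∈ vs := by decide) :
    Keeps vs as b Z h (h'.set x v) := by
  refine ⟨fun y hy => ?_, H.arr, H.out, H.coins, H.cells, H.snap, H.stamp⟩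
  have : y ≠ x := by rintro rfl; exact hy hx
  simp [this, H.var y hy]

theorem Keeps.setArr (H : Keeps vs as b Z h h') (a : Arr) (i v : ℕ) (ha : a ∈ as := by decide)
    (h₁ : a ≠ .cells := by decide) (h₂ : a ≠ .stamp := by decide) :
    Keeps vs as b Z h (h'.setArr a i v) := by
  refine ⟨H.var, fun c hc => ?_, H.out, H.coins, fun y hy => ?_, fun hg y => ?_, fun y => ?_⟩
  · rw [HState.setArr_arr_of_ne, H.arr c hc]
    rintro rfl; exact hc ha
  · simpa [h₁.symm, h₂.symm] using H.cells y hy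
  · simpa [HState.snap, h₁.symm] using H.snap hg y
  · simpa [h₂.symm] using H.stamp y

theorem SimFrame.keeps (H : SimFrame b Z h h') :
    Keeps [.x₁, .x₂, .x₃, .y₁, .y₂, .answer] [.cells, .stamp] b Z h h' := by
  refine ⟨fun x hx => H.var x ?_, fun a ha => H.arr a ?_ ?_, H.out, H.coins, H.cells, H.snap,
    H.stamp⟩
  · revert hx; cases x <;> simp [Var.scratch]
  · rintro rfl; simp at ha
  · rintro rfl; simp at ha

theorem Keeps.view (H : Keeps vs as b Z h h') {y : ℕ} (hy : y < b ∨ b + Z ≤ y)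
    (hg : .gen ∉ vs := by decide) : h'.view y = h.view y := by
  obtain ⟨a1, a2, a3⟩ := H.cells y hy
  unfold HState.view
  rw [H.var .gen hg, a1]
  split_ifs <;> simp_all

end

/-- Variables changed by calls. -/
abbrev callVars : List Var := [.x₁, .x₂, .x₃, .y₁, .y₂, .answer, .inpLen]

/-- Arrays changed by calls. -/
abbrev callArrs : List Arr := [.cells, .stamp, .inp]

/-- Append a value to the input of the simulated program. -/
def push (e : Expr) : Cmd := .block [.store .inp Var.inpLen e, .assign .inpLen (Var.inpLen + 1 : Expr)]

/-- Call a program whose input has two numbers. -/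
def call (ρ : ℕ) (p : Prog) (e f : Expr) : Cmd :=
  .block [.assign .inpLen 0, push e, push f, .assign .answer 0, p.sim ρ]

section
variable {B W ρ L b Z R r : ℕ} {τ ω : ℕ → Bool} {inp : List ℕ} {h : HState}

theorem wp_push {Q : HState → Prop} {e : Expr} (l : List ℕ) (x : ℕ) (hl : h.Holds l)
    (he : e.eval inp h = x) (hx : x < B) (hB : l.length + 1 < B)
    (hQ : ∀ h', h'.Holds (l ++ [x]) → Keeps [.inpLen] [.inp] b Z h h' → h'.time = h.time + 3 →
      Q h') : WP B ω inp (push e) h Q := by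
  refine wp_cons (wp_store (by omega) (wp_cons (wp_assign ?_ (wp_nil (hQ _ ?_ ?_ ?_)))))
  · simpa [hl.1] using hB
  · refine ⟨by simp [hl.1], fun i hi => ?_⟩
    simp only [List.length_append, List.length_cons, List.length_nil] at hi
    simp only [HState.tick_arr, HState.set_arr, HState.setArr_arr, Expr.eval_var, hl.1, he,
      true_and]
    split_ifs with hc
    · subst hc; simp
    · rw [hl.2 i (by omega), List.getD_append _ _ _ _ (by omega)]
  · exact (((Keeps.refl _ _ b Z h).setArr .inp _ _).tick.set .inpLen _).tick.tick
  · simp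

/-- The surroundings in which calls are simulated. -/
structure CallEnv (B W ρ L b Z R r : ℕ) (τ : ℕ → Bool) (h : HState) : Prop where
  size : ρ + 1 + W ≤ Z
  bound : b + Z ≤ B
  coins_lt : L < B
  base : h.var .base = b
  gen : h.var .gen < B
  copies : h.var .copies = R
  copy : h.var .copy = r
  coins : ∀ l < L, h.arr .coins (l * R + r) = (τ l).toNat

theorem CallEnv.keeps {vs : List Var} {as : List Arr} {h' : HState}
    (H : CallEnv B W ρ L b Z R r τ h) (hf : Keeps vs as b Z h h')
    (h₁ : .base ∉ vs := by decide) (h₂ : .gen ∉ vs := by decide)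
    (h₃ : .copies ∉ vs := by decide) (h₄ : .copy ∉ vs := by decide)
    (h₅ : .coins ∉ as := by decide) : CallEnv B W ρ L b Z R r τ h' := by
  obtain ⟨k1, k2, k3, k4, k5, k6, k7, k8⟩ := H
  refine ⟨k1, k2, k3, ?_, ?_, ?_, ?_, ?_⟩
  · rw [hf.var _ h₁, k4]
  · rwa [hf.var _ h₂]
  · rw [hf.var _ h₃, k6]
  · rw [hf.var _ h₄, k7]
  · rwa [hf.arr _ h₅]

theorem CellsFor.clear {f : ℕ → ℕ} {σ : State} (H : CellsFor W ρ f σ) : CellsFor W ρ f σ.clear :=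
  ⟨H.coins, H.reg, H.mem, H.bdd⟩

theorem CellsFor.congr {f g : ℕ → ℕ} {σ : State} (H : CellsFor W ρ f σ)
    (hfg : ∀ y < ρ + 1 + W, g y = f y) : CellsFor W ρ g σ := by
  refine ⟨?_, fun r hr => ?_, fun a ha => ?_, H.bdd⟩
  · rw [hfg _ (by omega), H.coins]
  · rw [hfg _ (by omega), H.reg r hr]
  · rw [hfg _ (by omega), H.mem a ha]

/-- Simulate a program whose input has been prepared. -/
theorem wp_simCall {p : Prog} (hp : p.RegsLT ρ) {σ : State} {l : List ℕ}
    (hH : CallHalts W τ σ (p, l)) (hL : (callState W τ σ (p, l)).coins ≤ L)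
    (hE : CallEnv B W ρ L b Z R r τ h) (hS : CellsFor W ρ (fun y => h.view (b + y)) σ)
    (hl : h.Holds l) (ha : h.var .answer = 0) :
    WP B ω inp (p.sim ρ) h fun h' => Keeps callVars callArrs b Z h h' ∧
      h'.time ≤ h.time + 12 * callTime W τ σ (p, l) ∧
      CellsFor W ρ (fun y => h'.view (b + y)) (callState W τ σ (p, l)) ∧
      h'.var .answer = (callState W τ σ (p, l)).out 0 := by
  have hE' : SimEnv B W ρ L b Z R r τ l h :=
    ⟨hE.size, hE.bound, hE.coins_lt, hE.base, hE.gen, hE.copies, hE.copy, hE.coins, hl⟩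
  refine (wp_sim hp hH.exec hL hE' hS.clear (by rw [ha]; rfl)).mono ?_
  rintro h' ⟨h1, h2, h3, h4⟩
  exact ⟨h1.keeps.mono, h2, h3, h4⟩

/-- The arguments are evaluated while the input is being assembled, so their values are required in
all states that a call can pass through. The 9 extra ticks are two assignments, two appends of three
ticks, and the end of the block. -/
theorem wp_call {p : Prog} (hp : p.RegsLT ρ) {σ : State} {x y : ℕ}
    (hH : CallHalts W τ σ (p, [x, y])) (hL : (callState W τ σ (p, [x, y])).coins ≤ L)
    (hE : CallEnv B W ρ L b Z R r τ h) (hS : CellsFor W ρ (fun y => h.view (b + y)) σ)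
    {e f : Expr} (he : ∀ h', Keeps callVars callArrs b Z h h' → e.eval inp h' = x)
    (hf : ∀ h', Keeps callVars callArrs b Z h h' → f.eval inp h' = y) (hx : x < B) (hy : y < B)
    (hB : 2 < B) :
    WP B ω inp (call ρ p e f) h fun h' => Keeps callVars callArrs b Z h h' ∧
      h'.time ≤ h.time + 12 * callTime W τ σ (p, [x, y]) + 9 ∧
      CellsFor W ρ (fun y => h'.view (b + y)) (callState W τ σ (p, [x, y])) ∧
      h'.var .answer = (callState W τ σ (p, [x, y])).out 0 := by
  have k0 : Keeps callVars callArrs b Z h (h.set .inpLen 0).tick :=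
    ((Keeps.refl _ _ _ _ _).set .inpLen _).tick
  refine wp_cons (wp_assign (by simp; omega) (wp_cons (wp_push (b := b) (Z := Z) [] x ?_ ?_ hx
    (by simp; omega) ?_)))
  · exact ⟨by simp, by simp⟩
  · exact he _ k0
  intro h₁ l₁ k₁ t₁
  have k1 := k0.trans k₁.mono
  refine wp_cons (wp_push (b := b) (Z := Z) _ y l₁ (hf _ k1) hy (by simp; omega) ?_)
  intro h₂ l₂ k₂ t₂
  have k2 := k1.trans k₂.mono
  have k3 : Keeps callVars callArrs b Z h (h₂.set .answer 0).tick := (k2.set .answer 0).tick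
  refine wp_cons (wp_assign (by simp; omega) (wp_cons ((wp_simCall hp hH hL (hE.keeps k3) ?_ ?_ ?_
    ).mono ?_)))
  · have hv : (h₂.set .answer 0).tick.view = h.view := by
      have e1 : ∀ (g g' : HState), Keeps [.inpLen] [.inp] b Z g g' → g'.view = g.view := by
        intro g g' hg
        funext y
        unfold HState.view
        rw [hg.var _ (by decide), hg.arr _ (by decide), hg.arr _ (by decide)]
      simp only [HState.tick_view, HState.set_view _ _ _ (show Var.answer ≠ .gen by decide)]
      rw [e1 _ _ k₂, e1 _ _ k₁]
      simp [HState.set_view]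
    simpa [hv] using hS
  · exact l₂
  · simp
  · rintro h' ⟨k4, t4, c4, a4⟩
    refine wp_nil ⟨(k3.trans k4).tick, ?_, c4, a4⟩
    simp at t₁ t4 ⊢
    omega

/-- A loop of updates. -/
def updateLoop (ρ : ℕ) (A : TCAlgorithm) (n cond e f : Expr) : Cmd :=
  .for .l n (.ite cond (call ρ A.update e f) .skip)

/-- The loop runs over all `n` indices, while the simulated algorithm receives only the calls
selected by `c`. The invariant says that the remaining calls lead from the current simulated state
to the prescribed final one. Every index costs at most 12 ticks besides the simulation. -/
theorem wp_updateLoop {A : TCAlgorithm} (hp : A.update.RegsLT ρ) {σ : State} {n : ℕ}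
    {c : ℕ → Bool} {g : ℕ → ℕ × ℕ}
    (hH : RunHalts W τ σ ((((List.range n).filter fun l => c l).map g).map (updateCall A)))
    (hL : (runState W τ σ ((((List.range n).filter fun l => c l).map g).map
      (updateCall A))).coins ≤ L)
    (hE : CallEnv B W ρ L b Z R r τ h) (hS : CellsFor W ρ (fun y => h.view (b + y)) σ)
    {ne cond e f : Expr}
    (hne : ∀ h', Keeps (.l :: callVars) callArrs b Z h h' → ne.eval inp h' = n)
    (hev : ∀ h', Keeps (.l :: callVars) callArrs b Z h h' → h'.var .l < n →
      cond.eval inp h' = (c (h'.var .l)).toNat ∧ e.eval inp h' = (g (h'.var .l)).1 ∧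
      f.eval inp h' = (g (h'.var .l)).2)
    (hg : ∀ l < n, (g l).1 < B ∧ (g l).2 < B) (hn : n < B) (hB : 2 < B) :
    WP B ω inp (updateLoop ρ A ne cond e f) h fun h' => Keeps (.l :: callVars) callArrs b Z h h' ∧
      h'.time ≤ h.time + 12 * runTime W τ σ ((((List.range n).filter fun l => c l).map g).map
        (updateCall A)) + 12 * n + 2 ∧
      CellsFor W ρ (fun y => h'.view (b + y))
        (runState W τ σ ((((List.range n).filter fun l => c l).map g).map (updateCall A))) := by
  set rest : ℕ → List (Prog × List ℕ) := fun i =>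
    (((List.range' i (n - i)).filter fun l => c l).map g).map (updateCall A) with hrest
  have h0 : (((List.range n).filter fun l => c l).map g).map (updateCall A) = rest 0 := by
    simp [hrest, List.range_eq_range']
  have hn0 : rest n = [] := by simp [hrest]
  have hsucc : ∀ i < n, rest i = if c i then updateCall A (g i) :: rest (i + 1) else rest (i + 1) := by
    intro i hi
    have : n - i = (n - (i + 1)) + 1 := by omega
    simp only [hrest]
    rw [this, List.range'_succ]
    by_cases hc : c i <;> simp [hc]
  rw [h0] at hH hL ⊢
  set σ' := runState W τ σ (rest 0) with hσ'
  set T := runTime W τ σ (rest 0) with hT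
  refine wp_for (fun i h' => Keeps (.l :: callVars) callArrs b Z h h' ∧ h'.var .l = i ∧
    ∃ s, RunHalts W τ s (rest i) ∧ runState W τ s (rest i) = σ' ∧
      CellsFor W ρ (fun y => h'.view (b + y)) s ∧
      h'.time + 12 * runTime W τ s (rest i) ≤ h.time + 12 * T + 12 * i + 1) n hn
      ⟨((Keeps.refl _ _ _ _ _).set .l _).tick, by simp, σ, hH, rfl, ?_, ?_⟩ ?_ ?_ ?_
  · simpa [HState.set_view] using hS
  · simp; omega
  · rintro k h' - ⟨k1, k2, -⟩
    exact ⟨k2, hne _ k1⟩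
  · rintro i h' hi ⟨k1, k2, s, k3, k4, k5, k6⟩
    obtain ⟨v1, v2, v3⟩ := hev _ k1.tick (by simp; omega)
    rw [hsucc i hi] at k3 k4 k6
    rw [HState.tick_var, k2] at v1 v2 v3
    refine wp_ite (fun hc => ?_) (fun hc => ?_)
    · have hci : c i = true := by
        by_contra hh
        simp only [Bool.not_eq_true] at hh
        rw [v1, hh] at hc
        exact hc rfl
      simp only [hci, if_true] at k3 k4 k6
      have hco : (callState W τ s (updateCall A (g i))).coins ≤ L := by
        refine (RunHalts.coins_le k3.2).1.trans ?_
        have : runState W τ (callState W τ s (updateCall A (g i))) (rest (i + 1)) = σ' := k4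
        rw [this]; exact hL
      refine (wp_call hp k3.1 hco (hE.keeps k1.tick.tick) (by simpa using k5) ?_ ?_
        (hg i hi).1 (hg i hi).2 hB).mono ?_
      · intro h'' kk
        have kk' := k1.tick.tick.trans kk.mono
        have hl : h''.var .l = i := by rw [kk.var _ (by decide)]; simpa using k2
        have := (hev _ kk' (by omega)).2.1
        rwa [hl] at this
      · intro h'' kk
        have kk' := k1.tick.tick.trans kk.mono
        have hl : h''.var .l = i := by rw [kk.var _ (by decide)]; simpa using k2
        have := (hev _ kk' (by omega)).2.2
        rwa [hl] at this
      · rintro h'' ⟨m1, m2, m3, m4⟩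
        refine ⟨?_, ((k1.tick.tick.trans m1.mono).set .l _).tick, by simp, _, k3.2, k4, ?_, ?_⟩
        · rw [m1.var _ (by decide)]; simpa using k2
        · simpa [HState.set_view, updateCall] using m3
        · simp only [HState.tick_time, HState.set_time] at m2 ⊢
          have : runTime W τ s (updateCall A (g i) :: rest (i + 1)) =
            callTime W τ s (updateCall A (g i)) +
              runTime W τ (callState W τ s (updateCall A (g i))) (rest (i + 1)) := rfl
          rw [this] at k6
          have : callTime W τ s (A.update, [(g i).1, (g i).2]) =
            callTime W τ s (updateCall A (g i)) := rfl
          rw [this] at m2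
          omega
    · have hci : c i = false := by
        by_contra hh
        simp only [Bool.not_eq_false] at hh
        rw [v1, hh] at hc
        simp at hc
      simp only [hci, Bool.false_eq_true, if_false] at k3 k4 k6
      refine wp_skip ⟨by simpa using k2, ((k1.tick.tick.tick).set .l _).tick, by simp, s, k3, k4,
        ?_, ?_⟩
      · simpa [HState.set_view] using k5
      · simp; omega
  · rintro h' ⟨k1, k2, s, k3, k4, k5, k6⟩
    rw [hn0] at k4 k6
    refine ⟨k1.tick, ?_, ?_⟩
    · simp only [runTime] at k6; simp; omega
    · rw [← k4]; simpa [runState] using k5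

end

/-! ### The program for matrix-vector products -/

/-- The bit of row or column `l` of the current block. -/
def bitExpr : Expr :=
  Expr.lt Var.l Var.side *
      Expr.eq (.arr .det (Expr.var .block / Var.blocks * Var.side + Var.l)) 0 +
    (1 - Expr.lt Var.l Var.side) *
      .arr .vec (Expr.var .block % Var.blocks * Var.side + (Expr.var .l - Var.side))

/-- The source of edge `l` of the current stage. -/
def srcExpr : Expr :=
  Expr.lt Var.l Var.side * (3 * Expr.var .side + Var.step) + (1 - Expr.lt Var.l Var.side) * Var.l

/-- The target of edge `l` of the current stage. -/
def dstExpr : Expr :=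
  Expr.lt Var.l Var.side * Var.l + (1 - Expr.lt Var.l Var.side) * (4 * Expr.var .side + Var.step)

/-- Whether edge `l` is updated before the query. -/
def earlyCond : Mode → Expr
  | .incremental => bitExpr
  | .decremental => 1 - bitExpr

/-- Whether edge `l` is updated after the query. -/
def lateCond : Mode → Expr
  | .incremental => 1 - bitExpr
  | .decremental => bitExpr

/-- One stage of the current copy of the dynamic algorithm for the current block. -/
def stageCmd (ρ : ℕ) (A : TCAlgorithm) (m : Mode) : Cmd := .block
  [.assign .base ((Expr.var .block * Var.copies + Var.copy) * Var.stride),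
    updateLoop ρ A (2 * Var.side) (earlyCond m) srcExpr dstExpr,
    call ρ A.query (3 * Expr.var .side + Var.step) (4 * Expr.var .side + Var.step),
    .assign .votes (Expr.var .votes + Expr.eq Var.answer 1),
    updateLoop ρ A (2 * Var.side) (lateCond m) srcExpr dstExpr]

/-- Determine the rows of the current block that have a nonzero product. -/
def bruteCmd : Cmd :=
  .for .i Var.side (.for .j Var.side (.ite
    (.arr .mat ((Expr.var .block / Var.blocks * Var.side + Var.i) * Var.padded +
        (Expr.var .block % Var.blocks * Var.side + Var.j)) *
      .arr .vec (Expr.var .block % Var.blocks * Var.side + Var.j))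
    (.store .det (Expr.var .block / Var.blocks * Var.side + Var.i) 1) .skip))

/-- Treat a block: if the majority of the copies finds a new nonzero entry, then find all of them. -/
def blockCmd (ρ : ℕ) (A : TCAlgorithm) (m : Mode) : Cmd := .block
  [.assign .votes 0, .for .copy Var.copies (stageCmd ρ A m),
    .ite (Expr.lt Var.copies (2 * Var.votes) * Expr.lt Var.found Var.padded)
      (.block [.assign .found (Expr.var .found + 1), bruteCmd]) .skip]

/-- The program that multiplies a vector. -/
def queryCmd (ρ : ℕ) (A : TCAlgorithm) (m : Mode) : Cmd := .block
  [.for .j Var.dim (.store .vec Var.j (.inp Var.j)), .for .i Var.padded (.store .det Var.i 0),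
    .assign .found 0, .for .block (Expr.var .blocks * Var.blocks) (blockCmd ρ A m),
    .for .i Var.dim (.out Var.i (.arr .det Var.i)), .assign .step (Expr.var .step + 1),
    .ite (Expr.eq Var.step Var.side)
      (.block [.assign .step 0, .assign .gen (Expr.var .gen + 1)]) .skip]

/-- The sizes that occur in the reduction. -/
structure Layout where
  (N b nb R Z L B ρ κ : ℕ)

/-- Constraints for the sizes. -/
structure Layout.Valid (D : Layout) : Prop where
  b_pos : 0 < D.b
  nb_pos : 0 < D.nb
  N_le : D.N ≤ D.nb * D.b
  stride : D.ρ + 1 + wordBound D.κ D.b ≤ D.Z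
  cells_le : D.nb * D.nb * D.R * D.Z ≤ D.B
  tape_lt : D.L * D.R < D.B
  L_lt : D.L < D.B
  size_lt : D.nb * D.b * (D.nb * D.b) < D.B
  verts_lt : 5 * D.b < D.B
  copies_lt : 2 * D.R < D.B
  two_lt : 2 < D.B

/-- What holds between the calls. -/
structure Layout.Fixed (D : Layout) (M : ℕ → ℕ → Bool) (ω : ℕ → Bool) (h : HState) : Prop where
  dim : h.var .dim = D.N
  side : h.var .side = D.b
  blocks : h.var .blocks = D.nb
  padded : h.var .padded = D.nb * D.b
  copies : h.var .copies = D.R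
  stride : h.var .stride = D.Z
  mat : ∀ i < D.nb * D.b, ∀ j < D.nb * D.b, h.arr .mat (i * (D.nb * D.b) + j) = (M i j).toNat
  coins : ∀ i < D.L * D.R, h.arr .coins i = (ω i).toNat

theorem Layout.Fixed.of_eq {D : Layout} {M : ℕ → ℕ → Bool} {ω : ℕ → Bool} {h h' : HState}
    (H : D.Fixed M ω h)
    (h₁ : ∀ x ∈ [Var.dim, .side, .blocks, .padded, .copies, .stride], h'.var x = h.var x)
    (h₂ : ∀ a ∈ [Arr.mat, .coins], h'.arr a = h.arr a) : D.Fixed M ω h' := by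
  obtain ⟨k1, k2, k3, k4, k5, k6, k7, k8⟩ := H
  refine ⟨?_, ?_, ?_, ?_, ?_, ?_, ?_, ?_⟩
  · rw [h₁ _ (by simp), k1]
  · rw [h₁ _ (by simp), k2]
  · rw [h₁ _ (by simp), k3]
  · rw [h₁ _ (by simp), k4]
  · rw [h₁ _ (by simp), k5]
  · rw [h₁ _ (by simp), k6]
  · rw [h₂ _ (by simp)]; exact k7
  · rw [h₂ _ (by simp)]; exact k8

theorem Layout.Fixed.keeps {D : Layout} {M : ℕ → ℕ → Bool} {ω : ℕ → Bool} {b Z : ℕ}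
    {h h' : HState} {vs : List Var} {as : List Arr} (H : D.Fixed M ω h) (hk : Keeps vs as b Z h h')
    (h₁ : ∀ x ∈ [Var.dim, .side, .blocks, .padded, .copies, .stride], x ∉ vs := by decide)
    (h₂ : ∀ a ∈ [Arr.mat, .coins], a ∉ as := by decide) : D.Fixed M ω h' :=
  H.of_eq (fun x hx => hk.var x (h₁ x hx)) fun a ha => hk.arr a (h₂ a ha)

theorem Keeps.widen {vs : List Var} {as : List Arr} {b Z b' Z' : ℕ} {h h' : HState}
    (H : Keeps vs as b Z h h') (h₁ : b' ≤ b) (h₂ : b + Z ≤ b' + Z') : Keeps vs as b' Z' h h' :=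
  ⟨H.var, H.arr, H.out, H.coins, fun y hy => H.cells y (by omega), H.snap, H.stamp⟩

/-- The matrix of a block. -/
def blockMat (b nb : ℕ) (M : ℕ → ℕ → Bool) (x : ℕ) (i j : ℕ) : Bool :=
  M (x / nb * b + i) (x % nb * b + j)

/-- The bits of a block: the rows that have not been determined yet, and the entries of the
vector. -/
def blockBits (b nb : ℕ) (d v : ℕ → Bool) (x l : ℕ) : Bool :=
  if l < b then !d (x / nb * b + l) else v (x % nb * b + (l - b))

theorem block_index_lt {b nb x i : ℕ} (hx : x < nb * nb) (hi : i < b) :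
    x / nb * b + i < nb * b ∧ x % nb * b + i < nb * b := by
  have hnb : 0 < nb := by
    rcases Nat.eq_zero_or_pos nb with rfl | h
    · simp at hx
    · exact h
  have h1 : x / nb + 1 ≤ nb := Nat.div_lt_of_lt_mul hx
  have h2 : x % nb + 1 ≤ nb := Nat.mod_lt _ hnb
  have h3 := Nat.mul_le_mul_right b h1
  have h4 := Nat.mul_le_mul_right b h2
  rw [add_mul, one_mul] at h3 h4
  omega

section
variable {D : Layout} {A : TCAlgorithm} {m : Mode} {M : ℕ → ℕ → Bool} {ω : ℕ → Bool}
  {inp : List ℕ} {h : HState} {x r k T₀ T : ℕ} {d v : ℕ → Bool}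

/-- What holds for the current vector. -/
structure Layout.Vec (D : Layout) (d v : ℕ → Bool) (h : HState) : Prop where
  det : ∀ i < D.nb * D.b, h.arr .det i = (d i).toNat
  vec : ∀ i < D.nb * D.b, h.arr .vec i = (v i).toNat

theorem eval_bitExpr (hF : D.Fixed M ω h) (hV : D.Vec d v h) (hx : x < D.nb * D.nb)
    (hb : h.var .block = x) (hl : h.var .l < 2 * D.b) :
    bitExpr.eval inp h = (blockBits D.b D.nb d v x (h.var .l)).toNat := by
  simp only [bitExpr, Expr.eval_add, Expr.eval_mul, Expr.eval_sub, Expr.eval_lt, Expr.eval_eq,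
    Expr.eval_arr, Expr.eval_var, Expr.eval_div, Expr.eval_mod, Expr.eval_ofNat, hF.side, hb,
    hF.blocks, blockBits]
  by_cases hc : h.var .l < D.b
  · rw [if_pos hc, if_pos hc, hV.det _ (block_index_lt hx hc).1]
    cases d (x / D.nb * D.b + h.var .l) <;> simp
  · rw [if_neg hc, if_neg hc, hV.vec _ (block_index_lt hx (by omega)).2]
    simp

theorem eval_srcExpr (hF : D.Fixed M ω h) (hk : h.var .step = k) :
    srcExpr.eval inp h = (stageEdge D.b k (h.var .l)).1 := by
  simp only [srcExpr, Expr.eval_add, Expr.eval_mul, Expr.eval_sub, Expr.eval_lt,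
    Expr.eval_var, Expr.eval_ofNat, hF.side, hk, stageEdge]
  split_ifs <;> simp

theorem eval_dstExpr (hF : D.Fixed M ω h) (hk : h.var .step = k) :
    dstExpr.eval inp h = (stageEdge D.b k (h.var .l)).2 := by
  simp only [dstExpr, Expr.eval_add, Expr.eval_mul, Expr.eval_sub, Expr.eval_lt,
    Expr.eval_var, Expr.eval_ofNat, hF.side, hk, stageEdge]
  split_ifs <;> simp

theorem Layout.base_le (hx : x < D.nb * D.nb) (hr : r < D.R) :
    (x * D.R + r) * D.Z + D.Z ≤ D.nb * D.nb * D.R * D.Z := by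
  have h1 : x * D.R + r + 1 ≤ D.nb * D.nb * D.R :=
    calc x * D.R + r + 1 ≤ (x + 1) * D.R := by rw [add_mul]; omega
      _ ≤ _ := Nat.mul_le_mul_right _ hx
  calc (x * D.R + r) * D.Z + D.Z = (x * D.R + r + 1) * D.Z := by ring
    _ ≤ _ := Nat.mul_le_mul_right _ h1

theorem Layout.Valid.callEnv (hD : D.Valid) (hF : D.Fixed M ω h) (hx : x < D.nb * D.nb)
    (hr : r < D.R) (hcopy : h.var .copy = r) (hbase : h.var .base = (x * D.R + r) * D.Z)
    (hg : h.var .gen < D.B) :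
    CallEnv D.B (wordBound D.κ D.b) D.ρ D.L ((x * D.R + r) * D.Z) D.Z D.R r (tape D.R r ω) h := by
  refine ⟨hD.stride, (Layout.base_le hx hr).trans hD.cells_le, hD.L_lt, hbase, hg, hF.copies, hcopy,
    fun l hl => hF.coins _ ?_⟩
  calc l * D.R + r < (l + 1) * D.R := by rw [add_mul]; omega
    _ ≤ D.L * D.R := Nat.mul_le_mul_right _ hl

/-- The equation `hw` ties the recorded history `w` to the bits that the program computes. The time
is expressed by `stagesTime` before and after the stage, so that the bounds telescope over a batch;
`48 * b` stems from two loops over `2 * b` edges. -/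
theorem wp_stage (hD : D.Valid) (hA : HaltsWithin A D.κ D.b m T₀ T) (hL : T₀ + T ≤ D.L)
    (hu : A.update.RegsLT D.ρ) (hq : A.query.RegsLT D.ρ) (hF : D.Fixed M ω h) (hV : D.Vec d v h)
    (hx : x < D.nb * D.nb) (hr : r < D.R) (hk : k < D.b) (hblock : h.var .block = x)
    (hcopy : h.var .copy = r) (hstep : h.var .step = k) (hg : h.var .gen < D.B)
    (hvotes : h.var .votes ≤ r) {w : ℕ → ℕ → Bool} (hw : w k = blockBits D.b D.nb d v x)
    (hS : CellsFor (wordBound D.κ D.b) D.ρ (fun y => h.view ((x * D.R + r) * D.Z + y))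
      (stagesState A D.κ D.b m (blockMat D.b D.nb M x) w (tape D.R r ω) k)) :
    WP D.B ω inp (stageCmd D.ρ A m) h fun h' =>
      Keeps (.votes :: .base :: .l :: callVars) callArrs ((x * D.R + r) * D.Z) D.Z h h' ∧
      CellsFor (wordBound D.κ D.b) D.ρ (fun y => h'.view ((x * D.R + r) * D.Z + y))
        (stagesState A D.κ D.b m (blockMat D.b D.nb M x) w (tape D.R r ω) (k + 1)) ∧
      h'.var .votes = h.var .votes +
        (if stageAnswer A D.κ D.b m (blockMat D.b D.nb M x) w (tape D.R r ω) k = 1 then 1 else 0) ∧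
      h'.time + 12 * stagesTime A D.κ D.b m (blockMat D.b D.nb M x) w (tape D.R r ω) k ≤
        h.time + 12 * stagesTime A D.κ D.b m (blockMat D.b D.nb M x) w (tape D.R r ω) (k + 1) +
          (48 * D.b + 20) := by
  set W := wordBound D.κ D.b with hW
  set τ := tape D.R r ω with hτ
  set Mb := blockMat D.b D.nb M x with hMb
  set s₀ := stagesState A D.κ D.b m Mb w τ k with hs₀
  set bs := (x * D.R + r) * D.Z with hbs
  set vs : List Var := .votes :: .base :: .l :: callVars with hvs
  have hbB : bs + D.Z ≤ D.B := (Layout.base_le hx hr).trans hD.cells_le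
  have hZ : 0 < D.Z := by have := hD.stride; omega
  have hH := hA.stage Mb w τ hk
  have hcoins := hA.coins_stages_le Mb w τ (k := k + 1) hk
  rw [stagesState_succ] at hcoins ⊢
  rw [stagesTime_succ]
  have hsplit : stageCalls A D.b m k (w k) = (earlyEdges D.b m k (w k)).map (updateCall A) ++
      ([queryCall A D.b k] ++ (lateEdges D.b m k (w k)).map (updateCall A)) := rfl
  rw [hsplit, runHalts_append, runHalts_append] at hH
  obtain ⟨hH1, hH2, hH3⟩ := hH
  rw [hsplit, runState_append, runState_append] at hcoins ⊢
  rw [runTime_append, runTime_append]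
  set s₁ := runState W τ s₀ ((earlyEdges D.b m k (w k)).map (updateCall A)) with hs₁
  set s₂ := runState W τ s₁ [queryCall A D.b k] with hs₂
  have hc2 : s₂.coins ≤ D.L := (RunHalts.coins_le hH3).1.trans (hcoins.trans hL)
  have hc1 : s₁.coins ≤ D.L := (RunHalts.coins_le hH2).1.trans hc2
  have hSa : stageAnswer A D.κ D.b m Mb w τ k = s₂.out 0 := rfl
  have hlt : ∀ l < 2 * D.b, (stageEdge D.b k l).1 < D.B ∧ (stageEdge D.b k l).2 < D.B := by
    intro l hl
    have := stageEdge_lt hk hl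
    have := hD.verts_lt
    omega
  have hkB := hD.verts_lt
  have hcB := hD.copies_lt
  have h2B := hD.two_lt
  have hebase : ((Expr.var .block * Var.copies + Var.copy) * Var.stride : Expr).eval inp h = bs := by
    simp [hblock, hF.copies, hcopy, hF.stride, hbs]
  have k0 : Keeps vs callArrs bs D.Z h (h.set .base bs).tick :=
    ((Keeps.refl _ _ _ _ _).set .base _).tick
  refine wp_cons (wp_assign (by rw [hebase]; omega) ?_)
  rw [hebase]
  have ev : ∀ h', Keeps vs callArrs bs D.Z h h' → h'.var .l < 2 * D.b →
      bitExpr.eval inp h' = (w k (h'.var .l)).toNat ∧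
      srcExpr.eval inp h' = (stageEdge D.b k (h'.var .l)).1 ∧
      dstExpr.eval inp h' = (stageEdge D.b k (h'.var .l)).2 := by
    intro h' kk hl
    have hF' := hF.keeps kk
    have hV' : D.Vec d v h' := ⟨by rw [kk.arr _ (by decide)]; exact hV.det,
      by rw [kk.arr _ (by decide)]; exact hV.vec⟩
    have hst : h'.var .step = k := by rw [kk.var _ (by decide), hstep]
    refine ⟨?_, eval_srcExpr hF' hst, eval_dstExpr hF' hst⟩
    rw [eval_bitExpr hF' hV' hx (by rw [kk.var _ (by decide), hblock]) hl, hw]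
  have ev2 : ∀ h', Keeps vs callArrs bs D.Z h h' → h'.var .side = D.b := fun h' kk =>
    (hF.keeps kk).side
  have ev3 : ∀ h', Keeps vs callArrs bs D.Z h h' → h'.var .step = k := fun h' kk => by
    rw [kk.var _ (by decide), hstep]
  have E0 := hD.callEnv (h := (h.set .base bs).tick) (hF.keeps k0) hx hr (by simpa using hcopy)
    (by simp [hbs]) (by simpa using hg)
  refine wp_cons ((wp_updateLoop (c := fun l => decide (w k l = m.early)) (g := stageEdge D.b k)
    hu hH1 hc1 E0 (by simpa [HState.set_view] using hS) ?_ ?_ hlt (by omega) h2B).mono ?_)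
  · intro h' kk
    simp [ev2 h' (k0.trans kk.mono)]
  · intro h' kk hl
    obtain ⟨e1, e2, e3⟩ := ev h' (k0.trans kk.mono) hl
    refine ⟨?_, e2, e3⟩
    cases m <;> simp only [earlyCond, Expr.eval_sub, Expr.eval_ofNat, e1, Mode.early] <;>
      cases w k (h'.var .l) <;> rfl
  rintro h₁ ⟨k₁, t₁, c₁⟩
  have k1 := k0.trans k₁.mono
  refine wp_cons ((wp_call hq hH2.1 hc2 (E0.keeps k₁) c₁ ?_ ?_ ?_ ?_ h2B).mono ?_)
  · intro h' kk
    simp [ev2 h' (k1.trans kk.mono), ev3 h' (k1.trans kk.mono)]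
  · intro h' kk
    simp [ev2 h' (k1.trans kk.mono), ev3 h' (k1.trans kk.mono)]
  · omega
  · omega
  rintro h₂ ⟨k₂, t₂, c₂, a₂⟩
  have k2 := k1.trans k₂.mono
  have hv2 : h₂.var .votes = h.var .votes := by
    rw [k₂.var _ (by decide), k₁.var _ (by decide)]; simp
  have a₂' : h₂.var .answer = stageAnswer A D.κ D.b m Mb w τ k := a₂
  have hev : (Expr.var .votes + Expr.eq Var.answer 1 : Expr).eval inp h₂ = h.var .votes +
      (if stageAnswer A D.κ D.b m Mb w τ k = 1 then 1 else 0) := by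
    simp [hv2, a₂']
  refine wp_cons (wp_assign ?_ ?_)
  · rw [hev]; split_ifs <;> omega
  rw [hev]
  set vt := h.var .votes + (if stageAnswer A D.κ D.b m Mb w τ k = 1 then 1 else 0) with hvt
  have k3 : Keeps vs callArrs bs D.Z h (h₂.set .votes vt).tick := (k2.set .votes _).tick
  have E3 : CallEnv D.B W D.ρ D.L bs D.Z D.R r τ (h₂.set .votes vt).tick :=
    ((E0.keeps k₁).keeps k₂).keeps (vs := [.votes]) (as := [])
      ((Keeps.refl _ _ bs D.Z h₂).set .votes vt).tick
  have c₂' : CellsFor W D.ρ (fun y => h₂.view (bs + y)) s₂ := c₂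
  refine wp_cons ((wp_updateLoop (c := fun l => decide (¬ w k l = m.early)) (g := stageEdge D.b k)
    (σ := s₂) hu hH3 (hcoins.trans hL) E3 (by simpa [HState.set_view] using c₂') ?_ ?_ hlt
    (by omega) h2B).mono ?_)
  · intro h' kk
    simp [ev2 h' (k3.trans kk.mono)]
  · intro h' kk hl
    obtain ⟨e1, e2, e3⟩ := ev h' (k3.trans kk.mono) hl
    refine ⟨?_, e2, e3⟩
    cases m <;> simp only [lateCond, Expr.eval_sub, Expr.eval_ofNat, e1, Mode.early] <;>
      cases w k (h'.var .l) <;> rfl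
  rintro h₃ ⟨k₃, t₃, c₃⟩
  refine wp_nil ⟨(k3.trans k₃.mono).tick, c₃, ?_, ?_⟩
  · rw [HState.tick_var, k₃.var _ (by decide)]; simp
  · have e1 : callTime W τ s₁ (A.query, [3 * D.b + k, 4 * D.b + k]) =
        runTime W τ s₁ [queryCall A D.b k] := by simp [runTime, queryCall]
    have t₂' : h₂.time ≤ h₁.time + 12 * callTime W τ s₁ (A.query, [3 * D.b + k, 4 * D.b + k]) +
      9 := t₂
    rw [e1] at t₂'
    have t₁' : h₁.time ≤ h.time + 1 + 12 * runTime W τ s₀ ((earlyEdges D.b m k (w k)).map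
      (updateCall A)) + 12 * (2 * D.b) + 2 := t₁
    have t₃' : h₃.time ≤ h₂.time + 1 + 12 * runTime W τ s₂ ((lateEdges D.b m k (w k)).map
      (updateCall A)) + 12 * (2 * D.b) + 2 := t₃
    rw [← hs₀, ← hW]
    rw [HState.tick_time]
    omega

end

/-! ### Treating one block -/

/-- Row `i` has a nonzero product with the part of the vector that belongs to block `x`. -/
def rowHit (b nb : ℕ) (M : ℕ → ℕ → Bool) (v : ℕ → Bool) (x i : ℕ) : Prop :=
  x / nb = i / b ∧ ∃ j < b, M i (x % nb * b + j) = true ∧ v (x % nb * b + j) = true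

open Classical in
/-- Determine the rows of block `x`. -/
noncomputable def determine (b nb : ℕ) (M : ℕ → ℕ → Bool) (v d : ℕ → Bool) (x i : ℕ) : Bool :=
  d i || decide (rowHit b nb M v x i)

section
variable {D : Layout} {A : TCAlgorithm} {m : Mode} {M : ℕ → ℕ → Bool} {ω : ℕ → Bool}
  {inp : List ℕ} {h h' : HState} {x r k T₀ T : ℕ} {d v : ℕ → Bool}

open Classical in
theorem wp_brute (hD : D.Valid) (hF : D.Fixed M ω h) (hV : D.Vec d v h)
    (hx : x < D.nb * D.nb) (hblock : h.var .block = x) (bs Z : ℕ) :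
    WP D.B ω inp bruteCmd h fun h' => Keeps [.i, .j] [.det] bs Z h h' ∧
      D.Vec (determine D.b D.nb M v d x) v h' ∧
      h'.time ≤ h.time + D.b * (4 * D.b + 4) + 2 := by
  set P := D.nb * D.b with hP
  have hbpos := hD.b_pos
  -- Row `y` has a witness among the entries of the block that precede position `(i, j)` in the
  -- order of the scan.
  let S : ℕ → ℕ → ℕ → Prop := fun i j y => x / D.nb = y / D.b ∧ ∃ j' < D.b,
    (y % D.b < i ∨ y % D.b = i ∧ j' < j) ∧
      M y (x % D.nb * D.b + j') = true ∧ v (x % D.nb * D.b + j') = true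
  have hS0 : ∀ y, ¬ S 0 0 y := by
    rintro y ⟨-, j', -, h | h, -⟩ <;> omega
  have hSb : ∀ i y, S i D.b y ↔ S (i + 1) 0 y := by
    intro i y
    refine and_congr_right fun _ => exists_congr fun j' => and_congr_right fun hj => ?_
    refine and_congr_left fun _ => ?_
    omega
  have hSend : ∀ y, S D.b 0 y ↔ rowHit D.b D.nb M v x y := by
    intro y
    refine and_congr_right fun _ => exists_congr fun j' => and_congr_right fun hj => ?_
    have := Nat.mod_lt y hbpos
    simp [this]
  have hSs : ∀ i < D.b, ∀ j < D.b, ∀ y, S i (j + 1) y ↔ S i j y ∨ (y = x / D.nb * D.b + i ∧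
      M y (x % D.nb * D.b + j) = true ∧ v (x % D.nb * D.b + j) = true) := by
    intro i hi j hj y
    constructor
    · rintro ⟨h1, j', h2, h3, h4⟩
      by_cases hc : y % D.b = i ∧ j' = j
      · obtain ⟨hc1, rfl⟩ := hc
        refine .inr ⟨?_, h4⟩
        have := Nat.div_add_mod' y D.b
        rw [h1, ← hc1, this]
      · exact .inl ⟨h1, j', h2, by omega, h4⟩
    · rintro (⟨h1, j', h2, h3, h4⟩ | ⟨rfl, h4⟩)
      · exact ⟨h1, j', h2, by omega, h4⟩
      · refine ⟨?_, j, hj, .inr ⟨?_, by omega⟩, h4⟩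
        · rw [mul_comm, Nat.mul_add_div hbpos, Nat.div_eq_of_lt hi, add_zero]
        · rw [mul_comm, Nat.mul_add_mod, Nat.mod_eq_of_lt hi]
  have hbB : D.b < D.B := by have := hD.verts_lt; omega
  have h2B := hD.two_lt
  refine wp_for (fun i g => Keeps [.i, .j] [.det] bs Z h g ∧ g.var .i = i ∧
    (∀ y < P, g.arr .det y = (d y || decide (S i 0 y)).toNat) ∧
    g.time ≤ h.time + i * (4 * D.b + 4) + 1) D.b hbB
    ⟨((Keeps.refl _ _ _ _ _).set .i _).tick, by simp, fun y hy => ?_, by simp⟩ ?_ ?_ ?_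
  · simp [hS0, hV.det y hy]
  · rintro i g - ⟨k1, k2, -⟩
    exact ⟨k2, (hF.keeps k1).side⟩
  · rintro i g hi ⟨k1, k2, k3, k4⟩
    refine wp_for (fun j g => Keeps [.i, .j] [.det] bs Z h g ∧ g.var .i = i ∧ g.var .j = j ∧
      (∀ y < P, g.arr .det y = (d y || decide (S i j y)).toNat) ∧
      g.time ≤ h.time + i * (4 * D.b + 4) + 4 * j + 3) D.b hbB
      ⟨(k1.tick.set .j _).tick, by simpa using k2, by simp, by simpa using k3, by simp; omega⟩ ?_ ?_ ?_
    · rintro j g - ⟨k1, -, k2, -⟩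
      exact ⟨k2, (hF.keeps k1).side⟩
    · rintro j g hj ⟨l1, l2, l3, l4, l5⟩
      have F := hF.keeps l1
      obtain ⟨i1, -⟩ := block_index_lt hx hi
      obtain ⟨-, i2⟩ := block_index_lt hx hj
      have hbl : g.var .block = x := by rw [l1.var _ (by decide), hblock]
      have e1 : (Expr.var .block / Var.blocks * Var.side + Var.i : Expr).eval inp g.tick =
          x / D.nb * D.b + i := by simp [hbl, F.blocks, F.side, l2]
      have e2 : (Expr.arr .mat ((Expr.var .block / Var.blocks * Var.side + Var.i) * Var.padded +
          (Expr.var .block % Var.blocks * Var.side + Var.j)) *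
          .arr .vec (Expr.var .block % Var.blocks * Var.side + Var.j)).eval inp g.tick =
          (M (x / D.nb * D.b + i) (x % D.nb * D.b + j)).toNat * (v (x % D.nb * D.b + j)).toNat := by
        have hv : g.arr .vec = h.arr .vec := l1.arr _ (by decide)
        simp only [Expr.eval_mul, Expr.eval_arr, Expr.eval_add, Expr.eval_div, Expr.eval_mod,
          Expr.eval_var, HState.tick_var, HState.tick_arr, hbl, F.blocks, F.side, l2, l3, F.padded,
          F.mat _ i1 _ i2, hv, hV.vec _ i2]
      refine wp_ite (fun hc => ?_) (fun hc => ?_)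
      · rw [e2] at hc
        have hc' : M (x / D.nb * D.b + i) (x % D.nb * D.b + j) = true ∧
            v (x % D.nb * D.b + j) = true := by
          revert hc
          cases M (x / D.nb * D.b + i) (x % D.nb * D.b + j) <;>
            cases v (x % D.nb * D.b + j) <;> simp
        refine wp_store (by simp; omega) ?_
        have e1' : (Expr.var .block / Var.blocks * Var.side + Var.i : Expr).eval inp g.tick.tick =
          x / D.nb * D.b + i := e1
        rw [e1']
        refine ⟨by simpa using l3, (((l1.tick.tick.setArr .det _ _).tick).set .j _).tick,
          by simpa using l2, by simp, fun y hy => ?_, by simp; omega⟩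
        simp only [HState.tick_arr, HState.set_arr, HState.setArr_arr, Expr.eval_ofNat, true_and]
        split_ifs with hy'
        · subst hy'
          have : S i (j + 1) (x / D.nb * D.b + i) := (hSs i hi j hj _).2 (.inr ⟨rfl, hc'⟩)
          simp [this]
        · rw [l4 y hy]
          have : S i (j + 1) y ↔ S i j y := by
            rw [hSs i hi j hj]
            simp [hy']
          simp [this]
      · rw [e2] at hc
        have hc' : ¬ (M (x / D.nb * D.b + i) (x % D.nb * D.b + j) = true ∧
            v (x % D.nb * D.b + j) = true) := by
          rintro ⟨c1, c2⟩
          simp [c1, c2] at hc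
        refine wp_skip ⟨by simpa using l3, ((l1.tick.tick.tick).set .j _).tick, by simpa using l2,
          by simp, fun y hy => ?_, by simp; omega⟩
        have : S i (j + 1) y ↔ S i j y := by
          rw [hSs i hi j hj, or_iff_left]
          rintro ⟨rfl, hh⟩
          exact hc' hh
        simp only [HState.tick_arr, HState.set_arr, l4 y hy, this]
    · rintro g ⟨l1, l2, -, l4, l5⟩
      refine ⟨by simpa using l2, (l1.tick.set .i _).tick, by simp, fun y hy => ?_, ?_⟩
      · simp only [HState.tick_arr, HState.set_arr, l4 y hy, hSb]
      · simp only [HState.tick_time, HState.set_time]; linarith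
  · rintro g ⟨k1, -, k3, k4⟩
    refine ⟨k1.tick, ⟨fun y hy => ?_, ?_⟩, by simp only [HState.tick_time]; omega⟩
    · simp only [HState.tick_arr, k3 y hy, hSend, determine]
    · rw [HState.tick_arr, k1.arr _ (by decide)]; exact hV.vec

/-- The state of copy `c % R` of the algorithm for block `c / R` after `K c` stages. -/
noncomputable def Layout.sessionState (D : Layout) (A : TCAlgorithm) (m : Mode) (M : ℕ → ℕ → Bool)
    (ω : ℕ → Bool) (ws : ℕ → ℕ → ℕ → Bool) (K : ℕ → ℕ) (c : ℕ) : State :=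
  stagesState A D.κ D.b m (blockMat D.b D.nb M (c / D.R)) (ws (c / D.R)) (tape D.R (c % D.R) ω) (K c)

/-- The time of copy `c % R` of the algorithm for block `c / R` in `K c` stages. -/
noncomputable def Layout.sessionTime (D : Layout) (A : TCAlgorithm) (m : Mode) (M : ℕ → ℕ → Bool)
    (ω : ℕ → Bool) (ws : ℕ → ℕ → ℕ → Bool) (K : ℕ → ℕ) (c : ℕ) : ℕ :=
  stagesTime A D.κ D.b m (blockMat D.b D.nb M (c / D.R)) (ws (c / D.R)) (tape D.R (c % D.R) ω) (K c)

/-- The total time of all copies for all blocks. -/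
noncomputable def Layout.totalTime (D : Layout) (A : TCAlgorithm) (m : Mode) (M : ℕ → ℕ → Bool)
    (ω : ℕ → Bool) (ws : ℕ → ℕ → ℕ → Bool) (K : ℕ → ℕ) : ℕ :=
  ∑ c ∈ Finset.range (D.nb * D.nb * D.R), D.sessionTime A m M ω ws K c

/-- The cells hold the states of all copies for all blocks. -/
def Layout.Sessions (D : Layout) (A : TCAlgorithm) (m : Mode) (M : ℕ → ℕ → Bool)
    (ω : ℕ → Bool) (ws : ℕ → ℕ → ℕ → Bool) (K : ℕ → ℕ) (f : ℕ → ℕ) : Prop :=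
  ∀ c < D.nb * D.nb * D.R, CellsFor (wordBound D.κ D.b) D.ρ (fun y => f (c * D.Z + y))
    (D.sessionState A m M ω ws K c)

/-- The number of completed stages when the first `n` copies have completed stage `k` as well. -/
def stageCount (k n c : ℕ) : ℕ := if c < n then k + 1 else k

/-- The number of votes for a nonzero product. -/
noncomputable def Layout.voteCount (D : Layout) (A : TCAlgorithm) (m : Mode) (M : ℕ → ℕ → Bool)
    (ω : ℕ → Bool) (x : ℕ) (w : ℕ → ℕ → Bool) (k n : ℕ) : ℕ :=
  ∑ r ∈ Finset.range n,
    if stageAnswer A D.κ D.b m (blockMat D.b D.nb M x) w (tape D.R r ω) k = 1 then 1 else 0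

/-- Different copies own disjoint intervals of `Z` cells, so simulating one of them does not disturb
another. -/
theorem CellsFor.keeps_other {c c' : ℕ} {vs : List Var} {as : List Arr} {s : State}
    (hD : D.Valid)
    (H : CellsFor (wordBound D.κ D.b) D.ρ (fun y => h.view (c' * D.Z + y)) s)
    (hk : Keeps vs as (c * D.Z) D.Z h h') (hc : c' ≠ c) (hg : .gen ∉ vs := by decide) :
    CellsFor (wordBound D.κ D.b) D.ρ (fun y => h'.view (c' * D.Z + y)) s := by
  refine H.congr fun y hy => hk.view ?_ hg
  have hZ := hD.stride
  rcases Nat.lt_or_gt_of_ne hc with h3 | h3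
  · left
    calc c' * D.Z + y < (c' + 1) * D.Z := by rw [add_mul]; omega
      _ ≤ c * D.Z := Nat.mul_le_mul_right _ h3
  · right
    calc c * D.Z + D.Z = (c + 1) * D.Z := by ring
      _ ≤ c' * D.Z := Nat.mul_le_mul_right _ h3
      _ ≤ _ := Nat.le_add_right _ _

theorem Layout.Sessions.step {ws : ℕ → ℕ → ℕ → Bool} {K K' : ℕ → ℕ} {c : ℕ} {vs : List Var}
    {as : List Arr} (hD : D.Valid) (H : D.Sessions A m M ω ws K h.view)
    (hk : Keeps vs as (c * D.Z) D.Z h h') (hK : ∀ c' ≠ c, K' c' = K c')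
    (hc : CellsFor (wordBound D.κ D.b) D.ρ (fun y => h'.view (c * D.Z + y))
      (D.sessionState A m M ω ws K' c)) (hg : .gen ∉ vs := by decide) :
    D.Sessions A m M ω ws K' h'.view := by
  intro c' hc'
  by_cases e : c' = c
  · subst e; exact hc
  · have h2 : D.sessionState A m M ω ws K' c' = D.sessionState A m M ω ws K c' := by
      rw [Layout.sessionState, hK c' e, Layout.sessionState]
    rw [h2]
    exact (H c' hc').keeps_other hD hk e hg

theorem Layout.totalTime_step {ws : ℕ → ℕ → ℕ → Bool} {K K' : ℕ → ℕ} {c : ℕ}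
    (hc : c < D.nb * D.nb * D.R) (hK : ∀ c' ≠ c, K' c' = K c') :
    D.totalTime A m M ω ws K' + D.sessionTime A m M ω ws K c =
      D.totalTime A m M ω ws K + D.sessionTime A m M ω ws K' c := by
  have hc' : c ∈ Finset.range (D.nb * D.nb * D.R) := Finset.mem_range.2 hc
  unfold Layout.totalTime
  rw [← Finset.add_sum_erase _ _ hc', ← Finset.add_sum_erase _ (D.sessionTime A m M ω ws K) hc']
  have : ∑ c' ∈ (Finset.range (D.nb * D.nb * D.R)).erase c, D.sessionTime A m M ω ws K' c' =
      ∑ c' ∈ (Finset.range (D.nb * D.nb * D.R)).erase c, D.sessionTime A m M ω ws K c' := by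
    refine Finset.sum_congr rfl fun c' hc' => ?_
    rw [Layout.sessionTime, hK c' (Finset.mem_erase.1 hc').1, Layout.sessionTime]
  omega

/-- The copies for block `x` have the numbers from `x * R` to `x * R + R - 1`. Advancing the second
argument of `stageCount` by one records that one further copy has completed stage `k`. -/
theorem wp_copies (hD : D.Valid) (hA : HaltsWithin A D.κ D.b m T₀ T) (hL : T₀ + T ≤ D.L)
    (hu : A.update.RegsLT D.ρ) (hq : A.query.RegsLT D.ρ) (hF : D.Fixed M ω h) (hV : D.Vec d v h)
    (hx : x < D.nb * D.nb) (hk : k < D.b) (hblock : h.var .block = x)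
    (hstep : h.var .step = k) (hg : h.var .gen < D.B)
    (hvotes : h.var .votes = 0) {ws : ℕ → ℕ → ℕ → Bool} (hw : ws x k = blockBits D.b D.nb d v x)
    (hS : D.Sessions A m M ω ws (stageCount k (x * D.R)) h.view) :
    WP D.B ω inp (.for .copy Var.copies (stageCmd D.ρ A m)) h fun h' =>
      Keeps (.copy :: .votes :: .base :: .l :: callVars) callArrs 0 (D.nb * D.nb * D.R * D.Z) h h' ∧
      D.Sessions A m M ω ws (stageCount k ((x + 1) * D.R)) h'.view ∧
      h'.var .votes = D.voteCount A m M ω x (ws x) k D.R ∧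
      h'.time + 12 * D.totalTime A m M ω ws (stageCount k (x * D.R)) ≤
        h.time + 12 * D.totalTime A m M ω ws (stageCount k ((x + 1) * D.R)) +
          D.R * (48 * D.b + 22) + 2 := by
  refine wp_for (fun r g =>
    Keeps (.copy :: .votes :: .base :: .l :: callVars) callArrs 0 (D.nb * D.nb * D.R * D.Z) h g ∧
    g.var .copy = r ∧
    D.Sessions A m M ω ws (stageCount k (x * D.R + r)) g.view ∧
    g.var .votes = D.voteCount A m M ω x (ws x) k r ∧
    g.time + 12 * D.totalTime A m M ω ws (stageCount k (x * D.R)) ≤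
      h.time + 12 * D.totalTime A m M ω ws (stageCount k (x * D.R + r)) +
        r * (48 * D.b + 22) + 1) D.R (by have := hD.copies_lt; omega)
    ⟨((Keeps.refl _ _ _ _ _).set .copy _).tick, by simp, ?_, ?_, ?_⟩ ?_ ?_ ?_
  · simpa [HState.set_view] using hS
  · simpa [Layout.voteCount] using hvotes
  · simp; omega
  · rintro r g - ⟨k1, k2, -⟩
    exact ⟨k2, (hF.keeps k1).copies⟩
  · rintro r g hr ⟨k1, k2, k3, k4, k5⟩
    have hR : 0 < D.R := by omega
    have hdiv : (x * D.R + r) / D.R = x := by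
      rw [mul_comm, Nat.mul_add_div hR, Nat.div_eq_of_lt hr, add_zero]
    have hmod : (x * D.R + r) % D.R = r := by
      rw [mul_comm, Nat.mul_add_mod, Nat.mod_eq_of_lt hr]
    have hc : x * D.R + r < D.nb * D.nb * D.R :=
      calc x * D.R + r < (x + 1) * D.R := by rw [add_mul]; omega
        _ ≤ _ := Nat.mul_le_mul_right _ hx
    have hVg : D.Vec d v g := ⟨by rw [k1.arr _ (by decide)]; exact hV.det,
      by rw [k1.arr _ (by decide)]; exact hV.vec⟩
    have hS1 := k3 _ hc
    have hs1 : ∀ n, D.sessionState A m M ω ws (stageCount k n) (x * D.R + r) =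
        stagesState A D.κ D.b m (blockMat D.b D.nb M x) (ws x) (tape D.R r ω)
          (stageCount k n (x * D.R + r)) := by
      intro n
      rw [Layout.sessionState, hdiv, hmod]
    have ht1 : ∀ n, D.sessionTime A m M ω ws (stageCount k n) (x * D.R + r) =
        stagesTime A D.κ D.b m (blockMat D.b D.nb M x) (ws x) (tape D.R r ω)
          (stageCount k n (x * D.R + r)) := by
      intro n
      rw [Layout.sessionTime, hdiv, hmod]
    have n0 : stageCount k (x * D.R + r) (x * D.R + r) = k := by simp [stageCount]
    have n1 : stageCount k (x * D.R + (r + 1)) (x * D.R + r) = k + 1 := by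
      rw [stageCount, if_pos (by omega)]
    have nK : ∀ c' ≠ x * D.R + r,
        stageCount k (x * D.R + (r + 1)) c' = stageCount k (x * D.R + r) c' := by
      intro c' hc'
      unfold stageCount
      split_ifs <;> omega
    rw [hs1, n0] at hS1
    have hvle : D.voteCount A m M ω x (ws x) k r ≤ r := by
      refine (Finset.sum_le_card_nsmul _ _ 1 fun i _ => ?_).trans (by simp)
      split_ifs <;> omega
    refine (wp_stage (h := g.tick) hD hA hL hu hq (hF.keeps k1.tick) ⟨hVg.det, hVg.vec⟩ hx hr hk
      (by rw [HState.tick_var, k1.var _ (by decide), hblock]) k2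
      (by rw [HState.tick_var, k1.var _ (by decide), hstep])
      (by rw [HState.tick_var, k1.var _ (by decide)]; exact hg)
      (by rw [HState.tick_var, k4]; exact hvle) hw hS1).mono ?_
    rintro g' ⟨l1, l2, l3, l4⟩
    refine ⟨?_, ((k1.tick.trans (l1.mono.widen (Nat.zero_le _) ?_)).set .copy _).tick, by simp, ?_,
      ?_, ?_⟩
    · rw [l1.var _ (by decide)]; exact k2
    · simpa using Layout.base_le hx hr
    · have := Layout.Sessions.step (h := g.tick) (h' := g') (K' := stageCount k (x * D.R + (r + 1)))
        hD k3 l1 nK (by rw [hs1, n1]; exact l2)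
      simpa [HState.set_view] using this
    · simp only [HState.tick_var, HState.set_var, reduceCtorEq, if_false] at l3 ⊢
      rw [l3, k4, Layout.voteCount, Layout.voteCount, Finset.sum_range_succ]
    · have := Layout.totalTime_step (A := A) (m := m) (M := M) (ω := ω) (ws := ws) hc nK
      rw [ht1, ht1, n0, n1] at this
      simp only [HState.tick_time, HState.set_time] at l4 ⊢
      linarith
  · rintro g ⟨k1, -, k3, k4, k5⟩
    rw [add_mul, one_mul]
    refine ⟨k1.tick, k3, k4, ?_⟩
    simp only [HState.tick_time]
    linarith

end

/-- Replace the bits of block `x` in stage `k`. -/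
def setBits (ws : ℕ → ℕ → ℕ → Bool) (x k : ℕ) (u : ℕ → Bool) (x' k' : ℕ) : ℕ → Bool :=
  if x' = x ∧ k' = k then u else ws x' k'

/-- Variables changed in the treatment of a block. -/
abbrev blockVars : List Var := .i :: .j :: .found :: .copy :: .votes :: .base :: .l :: callVars

/-- Arrays changed in the treatment of a block. -/
abbrev blockArrs : List Arr := .det :: callArrs

section
variable {D : Layout} {A : TCAlgorithm} {m : Mode} {M : ℕ → ℕ → Bool} {ω : ℕ → Bool}
  {inp : List ℕ} {h h' : HState} {x r k T₀ T : ℕ} {d v : ℕ → Bool}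

/-- When block `x` is about to be treated, none of its copies has executed stage `k`, and earlier
copies belong to other blocks. Hence the bits of this stage can be entered into the history at the
moment when they become known, without changing any simulated state. -/
theorem setBits_congr {ws : ℕ → ℕ → ℕ → Bool} {c : ℕ} (u : ℕ → Bool) :
    (∀ k' < stageCount k (x * D.R) c, setBits ws x k u (c / D.R) k' = ws (c / D.R) k') := by
  intro k' hk'
  unfold setBits
  rw [if_neg]
  rintro ⟨h1, rfl⟩
  have : x * D.R ≤ c := by
    rw [← h1]; exact Nat.div_mul_le_self c D.R
  rw [stageCount, if_neg (by omega)] at hk'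
  omega

theorem Layout.Sessions.setBits {ws : ℕ → ℕ → ℕ → Bool} {f : ℕ → ℕ} (u : ℕ → Bool)
    (H : D.Sessions A m M ω ws (stageCount k (x * D.R)) f) :
    D.Sessions A m M ω (setBits ws x k u) (stageCount k (x * D.R)) f := by
  intro c hc
  have := H c hc
  rwa [Layout.sessionState, ← stagesState_congr _ _ _ _ _ _ (setBits_congr u)] at this

theorem Layout.totalTime_setBits (ws : ℕ → ℕ → ℕ → Bool) (u : ℕ → Bool) :
    D.totalTime A m M ω (OMvLB.setBits ws x k u) (stageCount k (x * D.R)) =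
      D.totalTime A m M ω ws (stageCount k (x * D.R)) := by
  refine Finset.sum_congr rfl fun c _ => ?_
  rw [Layout.sessionTime, stagesTime_congr _ _ _ _ _ _ (setBits_congr u), Layout.sessionTime]

/-- The variable `found` acts as a potential that pays for the scans. Its cap `nb * b` limits their
total cost even if wrong votes trigger useless scans. -/
theorem wp_block (hD : D.Valid) (hA : HaltsWithin A D.κ D.b m T₀ T) (hL : T₀ + T ≤ D.L)
    (hu : A.update.RegsLT D.ρ) (hq : A.query.RegsLT D.ρ) (hF : D.Fixed M ω h) (hV : D.Vec d v h)
    (hx : x < D.nb * D.nb) (hk : k < D.b) (hblock : h.var .block = x)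
    (hstep : h.var .step = k) (hg : h.var .gen < D.B)
    {ws : ℕ → ℕ → ℕ → Bool} (hS : D.Sessions A m M ω ws (stageCount k (x * D.R)) h.view)
    {ws' : ℕ → ℕ → ℕ → Bool} (hws : ws' = setBits ws x k (blockBits D.b D.nb d v x)) :
    WP D.B ω inp (blockCmd D.ρ A m) h fun h' =>
      Keeps blockVars blockArrs 0 (D.nb * D.nb * D.R * D.Z) h h' ∧
      D.Sessions A m M ω ws' (stageCount k ((x + 1) * D.R)) h'.view ∧
      (if D.R < 2 * D.voteCount A m M ω x (ws' x) k D.R ∧ h.var .found < D.nb * D.b then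
        h'.var .found = h.var .found + 1 ∧ D.Vec (determine D.b D.nb M v d x) v h' else
        h'.var .found = h.var .found ∧ D.Vec d v h') ∧
      h'.time + 12 * D.totalTime A m M ω ws (stageCount k (x * D.R)) +
          h.var .found * (D.b * (4 * D.b + 4) + 10) ≤
        h.time + 12 * D.totalTime A m M ω ws' (stageCount k ((x + 1) * D.R)) +
          h'.var .found * (D.b * (4 * D.b + 4) + 10) + (D.R * (48 * D.b + 22) + 10) := by
  set n := D.nb * D.nb * D.R * D.Z with hn
  have hw : ws' x k = blockBits D.b D.nb d v x := by simp [hws, setBits]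
  have hS' := hS.setBits (blockBits D.b D.nb d v x)
  have htot : D.totalTime A m M ω ws' (stageCount k (x * D.R)) =
      D.totalTime A m M ω ws (stageCount k (x * D.R)) := by
    rw [hws]; exact D.totalTime_setBits ws _
  rw [← hws] at hS'
  have h2B := hD.two_lt
  have k0 : Keeps blockVars blockArrs 0 n h (h.set .votes 0).tick :=
    ((Keeps.refl _ _ _ _ _).set .votes _).tick
  refine wp_cons (wp_assign (by simp; omega) ?_)
  refine wp_cons ((wp_copies hD hA hL hu hq (hF.keeps k0) (d := d) (v := v) ?_ hx hk
    (by simpa using hblock) (by simpa using hstep) (by simpa using hg) (by simp) hw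
    (by simpa [HState.set_view] using hS')).mono ?_)
  · exact ⟨hV.det, hV.vec⟩
  rintro h₁ ⟨k₁, s₁, v₁, t₁⟩
  have k1 : Keeps blockVars blockArrs 0 n h h₁ := k0.trans k₁.mono
  have hf1 : h₁.var .found = h.var .found := by rw [k₁.var _ (by decide)]; simp
  have hV1 : D.Vec d v h₁ := ⟨by rw [k₁.arr _ (by decide)]; exact hV.det,
      by rw [k₁.arr _ (by decide)]; exact hV.vec⟩
  have F1 := hF.keeps k1
  have hev : (Expr.lt Var.copies (2 * Var.votes) * Expr.lt Var.found Var.padded : Expr).eval inp h₁ =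
      if D.R < 2 * D.voteCount A m M ω x (ws' x) k D.R ∧ h.var .found < D.nb * D.b then 1 else 0 := by
    simp only [Expr.eval_mul, Expr.eval_lt, Expr.eval_var, Expr.eval_ofNat, F1.copies, v₁, hf1,
      F1.padded]
    split_ifs <;> first | rfl | (exfalso; omega)
  simp only [HState.tick_time, HState.set_time] at t₁
  rw [htot] at t₁
  refine wp_cons (wp_ite (fun hc => ?_) (fun hc => ?_))
  · rw [hev] at hc
    have hc' : D.R < 2 * D.voteCount A m M ω x (ws' x) k D.R ∧ h.var .found < D.nb * D.b := by
      by_contra hh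
      rw [if_neg hh] at hc
      exact hc rfl
    have hsz : h.var .found + 1 < D.B := by
      have h1 := hD.size_lt
      have h2 : 0 < D.nb * D.b := by omega
      nlinarith
    have ev2 : (Expr.var .found + 1 : Expr).eval inp h₁.tick = h.var .found + 1 := by
      simp [hf1]
    refine wp_cons (wp_assign (by rw [ev2]; exact hsz) ?_)
    rw [ev2]
    set h₂ := (h₁.tick.set .found (h.var .found + 1)).tick with hh₂
    have k2 : Keeps blockVars blockArrs 0 n h h₂ := (k1.tick.set .found _).tick
    refine wp_cons ((wp_brute (h := h₂) (d := d) (v := v) hD (hF.keeps k2) ⟨hV1.det, hV1.vec⟩ hx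
      (by rw [k2.var _ (by decide), hblock]) 0 n).mono ?_)
    rintro h₃ ⟨k₃, v₃, t₃⟩
    have hf3 : h₃.var .found = h.var .found + 1 := by
      rw [k₃.var _ (by decide)]; simp [hh₂]
    refine wp_nil (wp_nil ?_)
    rw [if_pos hc']
    refine ⟨(k2.trans k₃.mono).tick.tick, ?_, ⟨hf3, v₃.det, v₃.vec⟩, ?_⟩
    · have : h₃.view = h₁.view := by
        funext y
        unfold HState.view
        rw [k₃.var _ (by decide), k₃.arr _ (by decide), k₃.arr _ (by decide)]
        simp [hh₂]
      simpa [this] using s₁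
    · simp only [HState.tick_var, hf3]
      simp only [hh₂, HState.tick_time, HState.set_time] at t₃ ⊢
      linarith
  · rw [hev] at hc
    have hc' : ¬ (D.R < 2 * D.voteCount A m M ω x (ws' x) k D.R ∧ h.var .found < D.nb * D.b) := by
      intro hh
      rw [if_pos hh] at hc
      exact one_ne_zero hc
    refine wp_skip (wp_nil ?_)
    rw [if_neg hc']
    refine ⟨k1.tick.tick.tick, s₁, ⟨hf1, hV1.det, hV1.vec⟩, ?_⟩
    simp only [HState.tick_var, HState.tick_time, hf1]
    linarith

end

/-! ### Multiplying one vector -/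

open Classical in
/-- Some block before block `x` has a nonzero product in row `i`. -/
noncomputable def doneRows (b nb : ℕ) (M : ℕ → ℕ → Bool) (v : ℕ → Bool) (x i : ℕ) : Bool :=
  decide (∃ x' < x, rowHit b nb M v x' i)

theorem doneRows_succ (b nb : ℕ) (M : ℕ → ℕ → Bool) (v : ℕ → Bool) (x : ℕ) :
    doneRows b nb M v (x + 1) = determine b nb M v (doneRows b nb M v x) x := by
  funext i
  have : (∃ x' < x + 1, rowHit b nb M v x' i) ↔
      (∃ x' < x, rowHit b nb M v x' i) ∨ rowHit b nb M v x i := by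
    simp only [Nat.lt_succ_iff_lt_or_eq, or_and_right, exists_or, exists_eq_left]
  rw [Bool.eq_iff_iff]
  simp only [doneRows, determine, Bool.or_eq_true, decide_eq_true_iff]
  exact this

/-- The bits of the stage find a nonzero product in the block. -/
def blockHit (b nb : ℕ) (M : ℕ → ℕ → Bool) (x : ℕ) (u : ℕ → Bool) : Prop :=
  ∃ i < b, ∃ j < b, u i = true ∧ blockMat b nb M x i j = true ∧ u (b + j) = true

/-- Rows already determined are masked in `blockBits`, so a nonzero product always comes from a new
row. This is why a right positive vote makes progress. -/
theorem blockHit_blockBits_iff {b nb : ℕ} (hb : 0 < b) {M : ℕ → ℕ → Bool} {x : ℕ}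
    (hx : x < nb * nb) {d v : ℕ → Bool} : blockHit b nb M x (blockBits b nb d v x) ↔
      ∃ i < nb * b, d i = false ∧ rowHit b nb M v x i := by
  constructor
  · rintro ⟨i, hi, j, hj, h1, h2, h3⟩
    refine ⟨_, (block_index_lt hx hi).1, ?_, ?_, j, hj, h2, ?_⟩
    · simpa [blockBits, hi] using h1
    · rw [mul_comm, Nat.mul_add_div hb, Nat.div_eq_of_lt hi, add_zero]
    · simpa [blockBits] using h3
  · rintro ⟨i, hi, h1, h2, j, hj, h3, h4⟩
    have hi' := Nat.mod_lt i hb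
    have e : x / nb * b + i % b = i := by rw [h2]; exact Nat.div_add_mod' i b
    refine ⟨i % b, hi', j, hj, ?_, ?_, ?_⟩
    · simp [blockBits, hi', e, h1]
    · rw [blockMat, e]; exact h3
    · simpa [blockBits] using h4

section
variable {D : Layout} {A : TCAlgorithm} {m : Mode} {M : ℕ → ℕ → Bool} {ω : ℕ → Bool}
  {inp : List ℕ} {h h' : HState} {x r k T₀ T : ℕ} {d v : ℕ → Bool}

theorem Layout.voteCount_congr {w w' : ℕ → ℕ → Bool} (hw : ∀ k' ≤ k, w k' = w' k') (n : ℕ) :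
    D.voteCount A m M ω x w k n = D.voteCount A m M ω x w' k n := by
  unfold Layout.voteCount
  refine Finset.sum_congr rfl fun r _ => ?_
  rw [stageAnswer_congr _ _ _ _ _ _ hw]

/-- The bits in the runs for a sequence of vectors if all majority votes are right, and the
statement that they are right in stage `k`. -/
structure Layout.Ideal (D : Layout) (A : TCAlgorithm) (m : Mode) (M : ℕ → ℕ → Bool)
    (ω : ℕ → Bool) (v : ℕ → Bool) (k : ℕ) (ws us : ℕ → ℕ → ℕ → Bool) : Prop where
  before : ∀ x < D.nb * D.nb, ∀ k' < k, ws x k' = us x k'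
  bits : ∀ x < D.nb * D.nb, us x k = blockBits D.b D.nb (doneRows D.b D.nb M v x) v x
  vote : ∀ x < D.nb * D.nb, (D.R < 2 * D.voteCount A m M ω x (us x) k D.R ↔
    blockHit D.b D.nb M x (us x k))

-- As long as the votes are right, the number of scans is at most the number of determined rows. A
-- hit adds a row, so the cap cannot be reached before the scan; without a hit the block adds no
-- row, and skipping it is correct.
open Classical in
theorem Layout.Ideal.block {ws us ws₁ ws₂ : ℕ → ℕ → ℕ → Bool} (hD : D.Valid)
    (H : D.Ideal A m M ω v k ws us) (hx : x < D.nb * D.nb)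
    (h₁ : ∀ x', ∀ k' < k, ws₁ x' k' = ws x' k') (h₂ : ∀ x' < x, ws₁ x' k = us x' k)
    (hd : ∀ i < D.nb * D.b, d i = doneRows D.b D.nb M v x i) {f : ℕ}
    (hf : f ≤ ((Finset.range (D.nb * D.b)).filter fun i => doneRows D.b D.nb M v x i).card)
    (hws₂ : ws₂ = setBits ws₁ x k (blockBits D.b D.nb d v x)) {d' : ℕ → Bool} {f' : ℕ}
    (hd' : if D.R < 2 * D.voteCount A m M ω x (ws₂ x) k D.R ∧ f < D.nb * D.b then
      f' = f + 1 ∧ d' = determine D.b D.nb M v d x else f' = f ∧ d' = d) :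
    (∀ x' < x + 1, ws₂ x' k = us x' k) ∧
    (∀ i < D.nb * D.b, d' i = doneRows D.b D.nb M v (x + 1) i) ∧
    f' ≤ ((Finset.range (D.nb * D.b)).filter fun i => doneRows D.b D.nb M v (x + 1) i).card := by
  have hbits : blockBits D.b D.nb d v x = us x k := by
    rw [H.bits x hx]
    funext l
    unfold blockBits
    split_ifs with hl
    · rw [hd _ (block_index_lt hx hl).1]
    · rfl
  have h3 : ws₂ x k = us x k := by simp [hws₂, setBits, hbits]
  have h4 : ∀ k' ≤ k, ws₂ x k' = us x k' := by
    intro k' hk'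
    rcases hk'.lt_or_eq with h | rfl
    · rw [hws₂, setBits, if_neg (by omega), h₁ x k' h, H.before x hx k' h]
    · exact h3
  simp only [Layout.voteCount_congr h4, H.vote x hx, H.bits x hx,
    blockHit_blockBits_iff hD.b_pos hx] at hd'
  refine ⟨?_, ?_⟩
  · intro x' hx'
    rcases (Nat.lt_succ_iff.1 hx').lt_or_eq with h | rfl
    · rw [hws₂, setBits, if_neg (by omega), h₂ x' h]
    · exact h3
  have hmono : ∀ i, doneRows D.b D.nb M v x i = true → doneRows D.b D.nb M v (x + 1) i = true := by
    intro i hi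
    rw [doneRows_succ]
    simp [determine, hi]
  by_cases hc : ∃ i < D.nb * D.b, doneRows D.b D.nb M v x i = false ∧ rowHit D.b D.nb M v x i
  · obtain ⟨i, hi, hi1, hi2⟩ := hc
    -- Strict growth inside a set of `nb * b` rows shows that the cap does not suppress this scan.
    have hcard : ((Finset.range (D.nb * D.b)).filter fun i => doneRows D.b D.nb M v x i).card <
        ((Finset.range (D.nb * D.b)).filter fun i => doneRows D.b D.nb M v (x + 1) i).card := by
      refine Finset.card_lt_card ⟨?_, ?_⟩
      · intro y hy
        rw [Finset.mem_filter] at hy ⊢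
        exact ⟨hy.1, hmono _ hy.2⟩
      · intro hsub
        have : i ∈ ((Finset.range (D.nb * D.b)).filter fun i => doneRows D.b D.nb M v x i) := by
          refine hsub (Finset.mem_filter.2 ⟨Finset.mem_range.2 hi, ?_⟩)
          rw [doneRows_succ]
          simp [determine, hi2]
        rw [Finset.mem_filter, hi1] at this
        exact absurd this.2 (by simp)
    have hle : ((Finset.range (D.nb * D.b)).filter fun i =>
        doneRows D.b D.nb M v (x + 1) i).card ≤ D.nb * D.b := by
      simpa using Finset.card_filter_le (Finset.range (D.nb * D.b))
        fun i => doneRows D.b D.nb M v (x + 1) i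
    rw [if_pos ⟨⟨i, hi, hi1, hi2⟩, by omega⟩] at hd'
    refine ⟨fun y hy => ?_, by omega⟩
    rw [hd'.2, doneRows_succ, determine, determine, hd y hy]
  · have hsame : ∀ i < D.nb * D.b, doneRows D.b D.nb M v (x + 1) i = doneRows D.b D.nb M v x i := by
      intro i hi
      rw [doneRows_succ, determine]
      cases hdi : doneRows D.b D.nb M v x i
      · have : ¬ rowHit D.b D.nb M v x i := fun hh => hc ⟨i, hi, hdi, hh⟩
        simp [this]
      · simp
    rw [if_neg fun hh => hc hh.1] at hd'
    refine ⟨fun y hy => ?_, ?_⟩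
    · rw [hd'.2, hsame y hy, hd y hy]
    · rw [hd'.1]
      refine hf.trans (Finset.card_le_card fun y hy => ?_)
      rw [Finset.mem_filter] at hy ⊢
      exact ⟨hy.1, hmono _ hy.2⟩

-- The time bound and the description of the simulated states hold for all coins. Only the last
-- clause, that the bits are the ideal ones and all rows are determined, presupposes right votes;
-- wrong votes merely make the history unknown, hence the existential `ws'`.
open Classical in
theorem wp_blocks (hD : D.Valid) (hA : HaltsWithin A D.κ D.b m T₀ T) (hL : T₀ + T ≤ D.L)
    (hu : A.update.RegsLT D.ρ) (hq : A.query.RegsLT D.ρ) (hF : D.Fixed M ω h)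
    (hV : D.Vec (fun _ => false) v h) (hk : k < D.b) (hstep : h.var .step = k)
    (hg : h.var .gen < D.B) (hfound : h.var .found = 0)
    {ws : ℕ → ℕ → ℕ → Bool} (hS : D.Sessions A m M ω ws (fun _ => k) h.view)
    (us : ℕ → ℕ → ℕ → Bool) :
    WP D.B ω inp (.for .block (Expr.var .blocks * Var.blocks) (blockCmd D.ρ A m)) h fun h' =>
      Keeps (.block :: blockVars) blockArrs 0 (D.nb * D.nb * D.R * D.Z) h h' ∧
      ∃ ws' d, D.Sessions A m M ω ws' (fun _ => k + 1) h'.view ∧ D.Vec d v h' ∧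
      h'.time + 12 * D.totalTime A m M ω ws (fun _ => k) ≤
        h.time + 12 * D.totalTime A m M ω ws' (fun _ => k + 1) +
          D.nb * D.b * (D.b * (4 * D.b + 4) + 10) +
          D.nb * D.nb * (D.R * (48 * D.b + 22) + 12) + 2 ∧
      (D.Ideal A m M ω v k ws us →
        (∀ x < D.nb * D.nb, ∀ k' < k + 1, ws' x k' = us x k') ∧
        ∀ i < D.nb * D.b, d i = doneRows D.b D.nb M v (D.nb * D.nb) i) := by
  set n := D.nb * D.nb with hn
  have hnB : n < D.B := by
    have h1 := hD.size_lt
    have h2 : D.nb ≤ D.nb * D.b := Nat.le_mul_of_pos_right _ hD.b_pos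
    exact (Nat.mul_le_mul h2 h2).trans_lt h1
  set Q := D.b * (4 * D.b + 4) + 10 with hQ
  have h0 : stageCount k 0 = fun _ => k := by funext c; simp [stageCount]
  refine wp_for (fun x g => Keeps (.block :: blockVars) blockArrs 0 (n * D.R * D.Z) h g ∧
    g.var .block = x ∧ ∃ ws' d, D.Sessions A m M ω ws' (stageCount k (x * D.R)) g.view ∧
      D.Vec d v g ∧ g.var .found ≤ D.nb * D.b ∧
      g.time + 12 * D.totalTime A m M ω ws (fun _ => k) ≤
        h.time + 12 * D.totalTime A m M ω ws' (stageCount k (x * D.R)) + g.var .found * Q +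
          x * (D.R * (48 * D.b + 22) + 12) + 1 ∧
      (∀ x', ∀ k' < k, ws' x' k' = ws x' k') ∧
      (D.Ideal A m M ω v k ws us → (∀ x' < x, ws' x' k = us x' k) ∧
        (∀ i < D.nb * D.b, d i = doneRows D.b D.nb M v x i) ∧
        g.var .found ≤
          ((Finset.range (D.nb * D.b)).filter fun i => doneRows D.b D.nb M v x i).card)) n hnB
    ⟨((Keeps.refl _ _ _ _ _).set .block _).tick, by simp, ws, fun _ => false, ?_, ?_, ?_, ?_,
      fun _ _ _ => rfl, fun _ => ⟨by simp, fun i _ => ?_, ?_⟩⟩ ?_ ?_ ?_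
  · rw [zero_mul, h0]; simpa [HState.set_view] using hS
  · exact ⟨hV.det, hV.vec⟩
  · simp [hfound]
  · rw [zero_mul, h0]; simp [hfound]; omega
  · simp [doneRows]
  · simp [hfound]
  · rintro x g - ⟨k1, k2, -⟩
    have F := hF.keeps k1
    exact ⟨k2, by simp [F.blocks, hn]⟩
  · rintro x g hx ⟨k1, k2, ws₁, d, s1, v1, f1, t1, w1, i1⟩
    refine (wp_block (h := g.tick) (d := d) (v := v) hD hA hL hu hq (hF.keeps k1.tick)
      ⟨v1.det, v1.vec⟩ hx hk k2 (by rw [HState.tick_var, k1.var _ (by decide), hstep])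
      (by rw [HState.tick_var, k1.var _ (by decide)]; exact hg) s1 rfl).mono ?_
    rintro g' ⟨l1, l2, l3, l4⟩
    set ws₂ := setBits ws₁ x k (blockBits D.b D.nb d v x) with hws₂
    obtain ⟨d', hd', hf', hV'⟩ : ∃ d', (if D.R < 2 * D.voteCount A m M ω x (ws₂ x) k D.R ∧
        g.var .found < D.nb * D.b then
          g'.var .found = g.var .found + 1 ∧ d' = determine D.b D.nb M v d x else
          g'.var .found = g.var .found ∧ d' = d) ∧ g'.var .found ≤ D.nb * D.b ∧ D.Vec d' v g' := by
      split_ifs at l3 with hc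
      · rw [HState.tick_var] at hc l3
        refine ⟨determine D.b D.nb M v d x, ?_, ?_, l3.2⟩
        · rw [if_pos hc]; exact ⟨l3.1, rfl⟩
        · omega
      · rw [HState.tick_var] at hc l3
        refine ⟨d, ?_, ?_, l3.2⟩
        · rw [if_neg hc]; exact ⟨l3.1, rfl⟩
        · omega
    refine ⟨by rw [l1.var _ (by decide)]; exact k2, ((k1.tick.trans l1.mono).set .block _).tick,
      by simp, ws₂, d', ?_, ⟨hV'.det, hV'.vec⟩, by simpa using hf', ?_, ?_, fun hI => ?_⟩
    · simpa [HState.set_view] using l2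
    · rw [← hQ] at l4
      simp only [HState.tick_time, HState.set_time, HState.tick_var, HState.set_var, reduceCtorEq,
        if_false] at l4 ⊢
      linarith
    · intro x' k' hk'
      rw [hws₂, setBits, if_neg (by omega), w1 x' k' hk']
    · obtain ⟨a1, a2, a3⟩ := i1 hI
      have := hI.block hD hx w1 a1 a2 a3 hws₂ hd'
      simpa using this
  · rintro g ⟨k1, -, ws₁, d, s1, v1, f1, t1, w1, i1⟩
    have e : ∀ c < n * D.R, stageCount k (n * D.R) c = k + 1 := fun c hc => if_pos hc
    have etot : D.totalTime A m M ω ws₁ (stageCount k (n * D.R)) =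
        D.totalTime A m M ω ws₁ fun _ => k + 1 := by
      refine Finset.sum_congr rfl fun c hc => ?_
      rw [Layout.sessionTime, e c (Finset.mem_range.1 hc), Layout.sessionTime]
    refine ⟨k1.tick, ws₁, d, fun c hc => ?_, ⟨v1.det, v1.vec⟩, ?_, fun hI => ?_⟩
    · have := s1 c hc
      rwa [Layout.sessionState, e c hc] at this
    · rw [etot] at t1
      have := Nat.mul_le_mul_right Q f1
      simp only [HState.tick_time]
      linarith
    · obtain ⟨a1, a2, -⟩ := i1 hI
      refine ⟨fun x hx k' hk' => ?_, a2⟩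
      rcases (Nat.lt_succ_iff.1 hk').lt_or_eq with hh | rfl
      · rw [w1 x k' hh, hI.before x hx k' hh]
      · exact a1 x hx

end

/-! ### The complete treatment of a vector and the reset after a batch. -/

section
variable {D : Layout} {A : TCAlgorithm} {m : Mode} {M : ℕ → ℕ → Bool} {ω : ℕ → Bool}
  {inp : List ℕ} {h h' : HState} {g k T₀ T : ℕ} {d v : ℕ → Bool}

/-- What holds after `k` vectors of batch `g`. -/
structure Layout.Ready (D : Layout) (A : TCAlgorithm) (m : Mode) (M : ℕ → ℕ → Bool) (ω : ℕ → Bool)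
    (g k : ℕ) (ws : ℕ → ℕ → ℕ → Bool) (h : HState) : Prop where
  fixed : D.Fixed M ω h
  step : h.var .step = k
  gen : h.var .gen = g + 1
  vec : ∀ j, D.N ≤ j → h.arr .vec j = 0
  sessions : D.Sessions A m M ω ws (fun _ => k) h.view
  snap : D.Sessions A m M ω (fun _ _ _ => false) (fun _ => 0) h.snap
  stamp : ∀ y, h.arr .stamp y ≤ g + 1

/-- The state that differs from `h` in the generation does not use the stamped cells. -/
theorem HState.view_eq_snap {h : HState} (hs : ∀ y, h.arr .stamp y ≠ h.var .gen) :
    h.view = h.snap := by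
  funext y
  simp [HState.view, HState.snap, hs y]

theorem Layout.N_lt (hD : D.Valid) : D.N < D.B ∧ D.nb * D.b < D.B := by
  have h1 := hD.size_lt
  have h2 := hD.N_le
  have h3 : 0 < D.nb * D.b := Nat.mul_pos hD.nb_pos hD.b_pos
  have h4 : D.nb * D.b ≤ D.nb * D.b * (D.nb * D.b) := Nat.le_mul_of_pos_right _ h3
  omega

theorem wp_readVec (hD : D.Valid) (hF : D.Fixed M ω h) (hvec : ∀ j, D.N ≤ j → h.arr .vec j = 0)
    (hv : ∀ j < D.N, inp.getD j 0 = (v j).toNat) (hv0 : ∀ j, D.N ≤ j → v j = false) (b Z : ℕ) :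
    WP D.B ω inp (.for .j Var.dim (.store .vec Var.j (.inp Var.j))) h fun h' =>
      Keeps [.j] [.vec] b Z h h' ∧ (∀ j, h'.arr .vec j = (v j).toNat) ∧
      h'.time ≤ h.time + 3 * D.N + 2 := by
  refine wp_for (fun j g => Keeps [.j] [.vec] b Z h g ∧ g.var .j = j ∧
    (∀ j', g.arr .vec j' = if j' < j then (v j').toNat else h.arr .vec j') ∧
    g.time ≤ h.time + 3 * j + 1) D.N (Layout.N_lt hD).1
    ⟨((Keeps.refl _ _ _ _ _).set .j _).tick, by simp, by simp, by simp⟩ ?_ ?_ ?_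
  · rintro j g - ⟨k1, k2, -⟩
    exact ⟨k2, (hF.keeps k1).dim⟩
  · rintro j g hj ⟨k1, k2, k3, k4⟩
    have h2 := hD.two_lt
    have ev : (Expr.inp Var.j).eval inp g.tick = (v j).toNat := by
      rw [Expr.eval_inp, Expr.eval_var, HState.tick_var, k2, hv j hj]
    have := Bool.toNat_le (v j)
    refine wp_store (by rw [ev]; omega) ?_
    rw [ev]
    refine ⟨by simpa using k2, (((k1.tick.setArr .vec _ _).tick).set .j _).tick, by simp, ?_, ?_⟩
    · intro j'
      simp only [HState.tick_arr, HState.set_arr, HState.setArr_arr, Expr.eval_var, HState.tick_var,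
        k2, true_and, k3]
      split_ifs with h1 h2 h3 h3 <;> first | rfl | (subst h1; rfl) | (exfalso; omega)
    · simp; omega
  · rintro g ⟨k1, -, k3, k4⟩
    refine ⟨k1.tick, fun j => ?_, by simp; omega⟩
    rw [HState.tick_arr, k3]
    split_ifs with hj
    · rfl
    · rw [hvec j (by omega), hv0 j (by omega)]; rfl

theorem wp_clearDet (hD : D.Valid) (hF : D.Fixed M ω h) (b Z : ℕ) :
    WP D.B ω inp (.for .i Var.padded (.store .det Var.i 0)) h fun h' =>
      Keeps [.i] [.det] b Z h h' ∧ (∀ i < D.nb * D.b, h'.arr .det i = 0) ∧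
      h'.time ≤ h.time + 3 * (D.nb * D.b) + 2 := by
  refine wp_for (fun i g => Keeps [.i] [.det] b Z h g ∧ g.var .i = i ∧
    (∀ i' < i, g.arr .det i' = 0) ∧
    g.time ≤ h.time + 3 * i + 1) (D.nb * D.b) (Layout.N_lt hD).2
    ⟨((Keeps.refl _ _ _ _ _).set .i _).tick, by simp, by simp, by simp⟩ ?_ ?_ ?_
  · rintro i g - ⟨k1, k2, -⟩
    exact ⟨k2, (hF.keeps k1).padded⟩
  · rintro i g hi ⟨k1, k2, k3, k4⟩
    have h2 := hD.two_lt
    refine wp_store (by simp; omega) ?_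
    refine ⟨by simpa using k2, (((k1.tick.setArr .det _ _).tick).set .i _).tick, by simp, ?_, ?_⟩
    · intro i' hi'
      simp only [HState.tick_arr, HState.set_arr, HState.setArr_arr, Expr.eval_var, HState.tick_var,
        k2, true_and, Expr.eval_ofNat]
      split_ifs with h1
      · rfl
      · exact k3 i' (by omega)
    · simp; omega
  · rintro g ⟨k1, -, k3, k4⟩
    exact ⟨k1.tick, k3, by simp; omega⟩

theorem wp_output (hD : D.Valid) (hdim : h.var .dim = D.N) :
    WP D.B ω inp (.for .i Var.dim (.out Var.i (.arr .det Var.i))) h fun h' =>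
      (∀ x ≠ .i, h'.var x = h.var x) ∧ h'.arr = h.arr ∧ (∀ i < D.N, h'.out i = h.arr .det i) ∧
      h'.time ≤ h.time + 3 * D.N + 2 := by
  refine wp_for (fun i g => (∀ x ≠ .i, g.var x = h.var x) ∧ g.arr = h.arr ∧ g.var .i = i ∧
    (∀ i' < i, g.out i' = h.arr .det i') ∧ g.time ≤ h.time + 3 * i + 1) D.N (Layout.N_lt hD).1
    ⟨fun x hx => by simp [hx], rfl, by simp, by simp, by simp⟩ ?_ ?_ ?_
  · rintro i g - ⟨k1, -, k2, -⟩
    exact ⟨k2, by rw [Expr.eval_var, k1 _ (by decide), hdim]⟩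
  · rintro i g hi ⟨k1, k2, k3, k4, k5⟩
    refine wp_out ⟨by simpa using k3, fun x hx => by simp [hx, k1 x hx], k2, by simp, ?_, ?_⟩
    · intro i' hi'
      simp only [HState.tick_out, HState.set_out, Function.update_apply, Expr.eval_arr,
        Expr.eval_var, HState.tick_var, HState.tick_arr, k2, k3]
      split_ifs with h1
      · rw [h1]
      · exact k4 i' (by omega)
    · simp; omega
  · rintro g ⟨k1, k2, -, k4, k5⟩
    exact ⟨k1, k2, k4, by simp; omega⟩

/-- A bound for the time of a query except for the time of the simulated algorithm. -/
def Layout.overhead (D : Layout) : ℕ :=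
  6 * D.N + 3 * (D.nb * D.b) + D.nb * D.b * (D.b * (4 * D.b + 4) + 10) +
    D.nb * D.nb * (D.R * (48 * D.b + 22) + 12) + 30

/-- After `b` vectors all stages are used up. Raising the generation invalidates every temporary
value at once, so all copies return to their state after preprocessing without any copying. Their
coin counters are cells too, so the next batch rereads the same tapes. -/
theorem wp_query (hD : D.Valid) (hA : HaltsWithin A D.κ D.b m T₀ T) (hL : T₀ + T ≤ D.L)
    (hu : A.update.RegsLT D.ρ) (hq : A.query.RegsLT D.ρ) {ws : ℕ → ℕ → ℕ → Bool}
    (H : D.Ready A m M ω g k ws h) (hk : k < D.b) (hg : g + 2 < D.B)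
    (hv : ∀ j < D.N, inp.getD j 0 = (v j).toNat) (hv0 : ∀ j, D.N ≤ j → v j = false)
    (us : ℕ → ℕ → ℕ → Bool) :
    WP D.B ω inp (queryCmd D.ρ A m) h fun h' => ∃ ws',
      D.Ready A m M ω (if k + 1 = D.b then g + 1 else g) (if k + 1 = D.b then 0 else k + 1) ws' h' ∧
      h'.time + 12 * D.totalTime A m M ω ws (fun _ => k) ≤
        h.time + 12 * D.totalTime A m M ω ws' (fun _ => k + 1) + D.overhead ∧
      (D.Ideal A m M ω v k ws us →
        (∀ x < D.nb * D.nb, ∀ k' < k + 1, ws' x k' = us x k') ∧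
        ∀ i < D.N, h'.out i = (doneRows D.b D.nb M v (D.nb * D.nb) i).toNat) := by
  set n := D.nb * D.nb * D.R * D.Z with hn
  have hNB := Layout.N_lt hD
  have h2B := hD.two_lt
  have h5B := hD.verts_lt
  let vs : List Var := .block :: blockVars
  let as : List Arr := .vec :: blockArrs
  have hview : ∀ {g g' : HState} {vs : List Var} {as : List Arr}, Keeps vs as 0 n g g' →
      .gen ∉ vs → .cells ∉ as → .stamp ∉ as → g'.view = g.view := by
    intro g g' vs as hk h1 h2 h3
    funext y
    unfold HState.view
    rw [hk.var _ h1, hk.arr _ h2, hk.arr _ h3]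
  refine wp_cons ((wp_readVec hD H.fixed H.vec hv hv0 0 n).mono ?_)
  rintro h₁ ⟨k₁, v₁, t₁⟩
  refine wp_cons ((wp_clearDet hD (H.fixed.keeps k₁) 0 n).mono ?_)
  rintro h₂ ⟨k₂, d₂, t₂⟩
  have k2 : Keeps vs as 0 n h h₂ := (k₁.mono : Keeps vs as 0 n h h₁).trans k₂.mono
  refine wp_cons (wp_assign (by simp; omega) ?_)
  set h₃ := (h₂.set .found ((0 : Expr).eval inp h₂)).tick with hh₃
  have k3 : Keeps vs as 0 n h h₃ := (k2.set .found _).tick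
  have w3 : h₃.view = h.view := by
    rw [hh₃, HState.tick_view, HState.set_view _ _ _ (by decide),
      hview k₂ (by decide) (by decide) (by decide), hview k₁ (by decide) (by decide) (by decide)]
  refine wp_cons ((wp_blocks (h := h₃) hD hA hL hu hq (H.fixed.keeps k3) (v := v) ?_ hk
    (by rw [k3.var _ (by decide), H.step]) (by rw [k3.var _ (by decide), H.gen]; omega)
    (by simp [hh₃]) (by rw [w3]; exact H.sessions) us).mono ?_)
  · refine ⟨fun i hi => ?_, fun i _ => ?_⟩
    · simpa [hh₃] using d₂ i hi
    · have : h₂.arr .vec = h₁.arr .vec := k₂.arr _ (by decide)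
      simp [hh₃, this, v₁]
  rintro h₄ ⟨k₄, ws', d, s₄, V₄, t₄, i₄⟩
  have k4 : Keeps vs as 0 n h h₄ := k3.trans k₄.mono
  have e4 : h₄.arr .vec = h₁.arr .vec := by
    rw [k₄.arr _ (by decide), hh₃, HState.tick_arr, HState.set_arr, k₂.arr _ (by decide)]
  have F4 := H.fixed.keeps k4
  refine wp_cons ((wp_output hD F4.dim).mono ?_)
  rintro h₅ ⟨k₅, a₅, o₅, t₅⟩
  have F5 : D.Fixed M ω h₅ := F4.of_eq
    (fun x hx => k₅ x (by rintro rfl; revert hx; decide)) fun a _ => by rw [a₅]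
  have hs5 : h₅.var .step = k := by rw [k₅ _ (by decide), k4.var _ (by decide), H.step]
  have hg5 : h₅.var .gen = g + 1 := by rw [k₅ _ (by decide), k4.var _ (by decide), H.gen]
  have ev5 : (Expr.var .step + 1 : Expr).eval inp h₅ = k + 1 := by simp [hs5]
  refine wp_cons (wp_assign (by rw [ev5]; omega) ?_)
  rw [ev5]
  have w5 : h₅.view = h₄.view := by
    funext y
    unfold HState.view
    rw [k₅ _ (by decide), a₅]
  have p5 : h₅.snap = h.snap := by
    funext y
    have : h₅.snap y = h₄.snap y := by rw [HState.snap, HState.snap, a₅]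
    rw [this, k4.snap (by rw [H.gen]; omega)]
  have vec5 : ∀ j, D.N ≤ j → h₅.arr .vec j = 0 := by
    intro j hj
    rw [a₅, e4, v₁, hv0 j hj]; rfl
  have st5 : ∀ y, h₅.arr .stamp y ≤ g + 1 := by
    intro y
    rw [a₅]
    rcases k4.stamp y with hh | hh
    · rw [hh]; exact H.stamp y
    · rw [hh, H.gen]
  have out5 : D.Ideal A m M ω v k ws us →
        (∀ x < D.nb * D.nb, ∀ k' < k + 1, ws' x k' = us x k') ∧
        ∀ i < D.N, h₅.out i = (doneRows D.b D.nb M v (D.nb * D.nb) i).toNat := by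
    intro hI
    obtain ⟨c1, c2⟩ := i₄ hI
    refine ⟨c1, fun i hi => ?_⟩
    have := hD.N_le
    rw [o₅ i hi, V₄.det i (by omega), c2 i (by omega)]
  have time5 : h₅.time + 12 * D.totalTime A m M ω ws (fun _ => k) + 12 ≤
        h.time + 12 * D.totalTime A m M ω ws' (fun _ => k + 1) + D.overhead := by
    simp only [hh₃, HState.tick_time, HState.set_time] at t₄
    unfold Layout.overhead
    linarith
  set h₆ := (h₅.set .step (k + 1)).tick with hh₆
  have F6 : D.Fixed M ω h₆ := F5.keeps (b := 0) (Z := n)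
    ((Keeps.refl [.step] [] _ _ _).set .step _).tick
  have hs6 : h₆.var .step = k + 1 := by simp [hh₆]
  have ev6 : (Expr.eq Var.step Var.side).eval inp h₆ = if k + 1 = D.b then 1 else 0 := by
    rw [Expr.eval_eq, Expr.eval_var, Expr.eval_var, F6.side, hs6]
  have hg6 : h₆.var .gen = g + 1 := by simp [hh₆, hg5]
  refine wp_cons (wp_ite (fun hc => ?_) (fun hc => ?_))
  · have hc' : k + 1 = D.b := by
      by_contra hh
      rw [ev6, if_neg hh] at hc
      exact hc rfl
    refine wp_cons (wp_assign (by simp; omega) (wp_cons (wp_assign ?_ ?_)))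
    · simp [hh₆, hg5]; omega
    refine wp_nil (wp_nil ⟨ws', ?_, ?_, out5⟩)
    · rw [if_pos hc', if_pos hc']
      have ev7 : (Expr.var .gen + 1 : Expr).eval inp
          (h₆.tick.set .step ((0 : Expr).eval inp h₆.tick)).tick = g + 2 := by simp [hg6]
      rw [ev7]
      set h₇ := ((h₆.tick.set .step ((0 : Expr).eval inp h₆.tick)).tick.set .gen (g + 2)).tick
        with hh₇
      have hgen7 : h₇.var .gen = g + 2 := by simp [hh₇]
      refine ⟨?_, by simp [hh₇], hgen7, vec5, ?_, ?_, ?_⟩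
      · exact F6.of_eq (fun x hx => by
          simp only [List.mem_cons, List.not_mem_nil, or_false] at hx
          rcases hx with rfl | rfl | rfl | rfl | rfl | rfl <;> simp [hh₇]) fun a _ => rfl
      -- Stamps are at most `g + 1` and the generation is now `g + 2`, so no temporary value is
      -- valid.
      · have hw : h₇.tick.tick.view = h.snap := by
          rw [HState.tick_view, HState.tick_view, HState.view_eq_snap (h := h₇), ← p5]
          · rfl
          · intro y
            have : h₇.arr .stamp y ≤ g + 1 := st5 y
            omega
        rw [hw]
        exact H.snap
      · have hw : h₇.tick.tick.snap = h.snap := p5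
        rw [hw]
        exact H.snap
      · intro y
        exact (st5 y).trans (by omega)
    · simp only [hh₆, HState.tick_time, HState.set_time]
      omega
  · have hc' : k + 1 ≠ D.b := by
      intro hh
      rw [ev6, if_pos hh] at hc
      exact one_ne_zero hc
    refine wp_skip (wp_nil ⟨ws', ?_, ?_, out5⟩)
    · rw [if_neg hc', if_neg hc']
      refine ⟨⟨F6.dim, F6.side, F6.blocks, F6.padded, F6.copies, F6.stride, F6.mat, F6.coins⟩, hs6,
        hg6, vec5, ?_, ?_, st5⟩
      · have hw : h₆.tick.tick.tick.view = h₄.view := by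
          rw [HState.tick_view, HState.tick_view, HState.tick_view, hh₆, HState.tick_view,
            HState.set_view _ _ _ (by decide), w5]
        rw [hw]
        exact s₄
      · have hw : h₆.tick.tick.tick.snap = h.snap := p5
        rw [hw]
        exact H.snap
    · simp only [hh₆, HState.tick_time, HState.set_time]
      omega

end

/-! ### Initializing a copy of the dynamic algorithm -/

/-- The source of the edge for entry number `l` of the current block of the matrix. -/
def matSrc : Expr :=
  Expr.var .l / Var.side + 2 * Expr.var .side * Expr.eq
    (.arr .mat ((Expr.var .block / Var.blocks * Var.side + (Expr.var .l / Var.side)) * Var.padded +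
      (Expr.var .block % Var.blocks * Var.side + (Expr.var .l % Var.side)))) 0

/-- The target of the edge for entry number `l` of the current block of the matrix. -/
def matDst : Expr := Expr.var .side + (Expr.var .l % Var.side)

/-- Append the endpoints of the edges of the current block. -/
def pushMat : Cmd := .for .l (Expr.var .side * Var.side) (.block [push matSrc, push matDst])

/-- Append the endpoints of the edges of all stages. -/
def pushStages : Cmd :=
  .for .step Var.side (.for .l (2 * Var.side) (.block [push srcExpr, push dstExpr]))

/-- Append the predicted sequence of edges. -/
def pushEdges : Mode → Cmd
  | .incremental => .block [pushMat, pushStages]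
  | .decremental => .block [pushStages, pushMat]

/-- The updates before the first stage. -/
def firstUpdates (ρ : ℕ) (A : TCAlgorithm) : Mode → Cmd
  | .incremental => updateLoop ρ A (Expr.var .side * Var.side) 1 matSrc matDst
  | .decremental => .skip

/-- Initialize the current copy for the current block. -/
def initCmd (ρ : ℕ) (A : TCAlgorithm) (m : Mode) : Cmd := .block
  [.assign .base ((Expr.var .block * Var.copies + Var.copy) * Var.stride), .assign .inpLen 0,
    push (5 * Var.side), push (3 * (Expr.var .side * Var.side)), pushEdges m, .assign .answer 0,
    A.preprocess.sim ρ, firstUpdates ρ A m]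

/-- The list of the endpoints of edges. -/
def endpoints (l : List (ℕ × ℕ)) : List ℕ := l.flatMap fun p => [p.1, p.2]

@[simp] theorem endpoints_length (l : List (ℕ × ℕ)) : (endpoints l).length = 2 * l.length := by
  induction l with
  | nil => rfl
  | cons p l ih =>
    have : endpoints (p :: l) = [p.1, p.2] ++ endpoints l := rfl
    rw [this, List.length_append, ih]
    simp only [List.length_cons, List.length_nil]
    ring

theorem endpoints_append (l l' : List (ℕ × ℕ)) :
    endpoints (l ++ l') = endpoints l ++ endpoints l' := by simp [endpoints]

section
variable {D : Layout} {A : TCAlgorithm} {m : Mode} {M : ℕ → ℕ → Bool} {ω : ℕ → Bool}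
  {inp : List ℕ} {h h' : HState} {x r k T₀ T b Z B : ℕ} {d v : ℕ → Bool}

theorem eval_matSrc (hD : D.Valid) (hF : D.Fixed M ω h) (hx : x < D.nb * D.nb)
    (hb : h.var .block = x) (hl : h.var .l < D.b * D.b) :
    matSrc.eval inp h = (matEdge D.b (blockMat D.b D.nb M x) (h.var .l)).1 := by
  have h1 : h.var .l / D.b < D.b := Nat.div_lt_of_lt_mul hl
  have h2 : h.var .l % D.b < D.b := Nat.mod_lt _ hD.b_pos
  simp only [matSrc, Expr.eval_add, Expr.eval_mul, Expr.eval_eq, Expr.eval_arr, Expr.eval_var,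
    Expr.eval_div, Expr.eval_mod, Expr.eval_ofNat, hF.side, hb, hF.blocks, hF.padded, matEdge,
    hF.mat _ (block_index_lt hx h1).1 _ (block_index_lt hx h2).2, blockMat]
  by_cases hM : M (x / D.nb * D.b + h.var .l / D.b) (x % D.nb * D.b + h.var .l % D.b) = true <;>
    simp [hM]

theorem eval_matDst (hF : D.Fixed M ω h) :
    matDst.eval inp h = (matEdge D.b (blockMat D.b D.nb M x) (h.var .l)).2 := by
  simp only [matDst, Expr.eval_add, Expr.eval_var, Expr.eval_mod, hF.side, matEdge]

theorem wp_pushLoop {y : Var} (hy : y ≠ .inpLen) {acc : List ℕ} (hl : h.Holds acc) {n : ℕ}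
    {ne e f : Expr} {g : ℕ → ℕ × ℕ}
    (hne : ∀ h', Keeps [y, .inpLen] [.inp] b Z h h' → ne.eval inp h' = n)
    (hev : ∀ h', Keeps [y, .inpLen] [.inp] b Z h h' → h'.var y < n →
      e.eval inp h' = (g (h'.var y)).1 ∧ f.eval inp h' = (g (h'.var y)).2)
    (hg : ∀ l < n, (g l).1 < B ∧ (g l).2 < B) (hB : acc.length + 2 * n + 2 < B)
    (hgen : y ≠ .gen) :
    WP B ω inp (.for y ne (.block [push e, push f])) h fun h' =>
      h'.Holds (acc ++ endpoints ((List.range n).map g)) ∧ Keeps [y, .inpLen] [.inp] b Z h h' ∧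
      h'.time ≤ h.time + 9 * n + 2 := by
  have hgen' : Var.gen ∉ [y, .inpLen] := by simp [hgen.symm]
  refine wp_for (fun l g' => g'.Holds (acc ++ endpoints ((List.range l).map g)) ∧ g'.var y = l ∧
    Keeps [y, .inpLen] [.inp] b Z h g' ∧ g'.time ≤ h.time + 9 * l + 1) n (by omega)
    ⟨?_, by simp, ((Keeps.refl _ _ _ _ _).set y _ (by simp)).tick, by simp⟩ ?_ ?_ ?_
  · refine ⟨?_, ?_⟩
    · simpa [hy.symm, endpoints] using hl.1
    · simpa [endpoints] using hl.2
  · rintro l g' - ⟨-, k1, k2, -⟩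
    exact ⟨k1, hne _ k2⟩
  · rintro l g' hln ⟨k1, k2, k3, k4⟩
    obtain ⟨e1, e2⟩ := hev _ k3.tick (by simp; omega)
    obtain ⟨g1, g2⟩ := hg l hln
    rw [HState.tick_var, k2] at e1
    have len : (acc ++ endpoints ((List.range l).map g)).length = acc.length + 2 * l := by simp
    refine wp_cons (wp_push (b := b) (Z := Z) _ _ (h := g'.tick) ⟨k1.1, k1.2⟩ e1 g1
      (by omega) ?_)
    intro h₁ l₁ k₁ t₁
    have k1' := k3.tick.trans (k₁.mono (by simp) (by simp)) hgen'
    have hy1 : h₁.var y = l := by rw [k₁.var _ (by simpa using hy)]; exact k2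
    obtain ⟨-, e2⟩ := hev _ k1' (by omega)
    rw [hy1] at e2
    refine wp_cons (wp_push (b := b) (Z := Z) _ _ l₁ e2 g2
      (by rw [List.length_append, len]; simp; omega) ?_)
    intro h₂ l₂ k₂ t₂
    have k2' := k1'.trans (k₂.mono (by simp) (by simp)) hgen'
    have hy2 : h₂.var y = l := by rw [k₂.var _ (by simpa using hy), hy1]
    refine wp_nil ⟨hy2, ?_, by simp, (k2'.tick.set y _ (by simp)).tick, ?_⟩
    · have : acc ++ endpoints ((List.range (l + 1)).map g) =
          acc ++ endpoints ((List.range l).map g) ++ [(g l).1] ++ [(g l).2] := by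
        simp [List.range_succ, endpoints]
      rw [this]
      refine ⟨?_, l₂.2⟩
      simpa [hy.symm] using l₂.1
    · simp at t₁ t₂ ⊢; omega
  · rintro g' ⟨k1, -, k3, k4⟩
    exact ⟨⟨k1.1, k1.2⟩, k3.tick, by simp; omega⟩

/-- Variables changed when the edges are appended. -/
abbrev pushVars : List Var := [.step, .l, .inpLen]

theorem wp_pushMat (hD : D.Valid) (hF : D.Fixed M ω h) (hx : x < D.nb * D.nb)
    (hb : h.var .block = x) {acc : List ℕ} (hl : h.Holds acc)
    (hB : acc.length + 2 * (D.b * D.b) + 2 < D.B) :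
    WP D.B ω inp pushMat h fun h' =>
      h'.Holds (acc ++ endpoints (matEdges D.b (blockMat D.b D.nb M x))) ∧
      Keeps pushVars [.inp] b Z h h' ∧ h'.time ≤ h.time + 9 * (D.b * D.b) + 2 := by
  refine (wp_pushLoop (b := b) (Z := Z) (g := matEdge D.b (blockMat D.b D.nb M x)) (by decide) hl
    ?_ ?_ ?_ hB (by decide)).mono ?_
  · intro h' kk
    simp [(hF.keeps kk).side]
  · intro h' kk hh
    exact ⟨eval_matSrc hD (hF.keeps kk) hx (by rw [kk.var _ (by decide), hb]) hh,
      eval_matDst (hF.keeps kk)⟩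
  · intro l hl
    have := matEdges_lt hD.b_pos (p := matEdge D.b (blockMat D.b D.nb M x) l)
      (List.mem_map.2 ⟨l, List.mem_range.2 hl, rfl⟩)
    have := hD.verts_lt
    omega
  · rintro h' ⟨h1, h2, h3⟩
    exact ⟨h1, h2.mono, h3⟩

theorem wp_pushStages (hD : D.Valid) (hF : D.Fixed M ω h) {acc : List ℕ} (hl : h.Holds acc)
    (hB : acc.length + 4 * (D.b * D.b) + 2 < D.B) :
    WP D.B ω inp pushStages h fun h' =>
      h'.Holds (acc ++ endpoints ((List.range D.b).flatMap (stageEdges D.b))) ∧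
      Keeps pushVars [.inp] b Z h h' ∧ h'.time ≤ h.time + D.b * (18 * D.b + 4) + 2 := by
  have h5 := hD.verts_lt
  refine wp_for (fun k g => g.Holds (acc ++ endpoints ((List.range k).flatMap (stageEdges D.b))) ∧
    g.var .step = k ∧ Keeps pushVars [.inp] b Z h g ∧ g.time ≤ h.time + k * (18 * D.b + 4) + 1) D.b
    (by omega) ⟨?_, by simp, ((Keeps.refl _ _ _ _ _).set .step _).tick, by simp⟩ ?_ ?_ ?_
  · refine ⟨?_, ?_⟩
    · simpa [endpoints] using hl.1
    · simpa [endpoints] using hl.2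
  · rintro k g - ⟨-, k1, k2, -⟩
    exact ⟨k1, (hF.keeps k2).side⟩
  · rintro k g hk ⟨k1, k2, k3, k4⟩
    have F := hF.keeps k3.tick
    refine (wp_pushLoop (b := b) (Z := Z) (h := g.tick) (n := 2 * D.b) (g := stageEdge D.b k)
      (by decide) ⟨k1.1, k1.2⟩ ?_ ?_ ?_ ?_ (by decide)).mono ?_
    · intro h' kk
      simp [(F.keeps kk).side]
    · intro h' kk hh
      have hs : h'.var .step = k := by rw [kk.var _ (by decide)]; exact k2
      exact ⟨eval_srcExpr (F.keeps kk) hs, eval_dstExpr (F.keeps kk) hs⟩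
    · intro l hl
      have := stageEdge_lt hk hl
      omega
    · have h1 : ((List.range k).flatMap (stageEdges D.b)).length = k * (2 * D.b) :=
        flatMap_range_length _ _ _ fun i => stageEdges_length D.b i
      have h2 : (k + 1) * (2 * D.b) ≤ D.b * (2 * D.b) := Nat.mul_le_mul_right _ hk
      rw [List.length_append, endpoints_length, h1]
      linarith
    · rintro g' ⟨l1, l2, l3⟩
      refine ⟨by rw [l2.var _ (by decide)]; exact k2, ?_, by simp,
        ((k3.tick.trans l2.mono).set .step _).tick, ?_⟩
      · have e : acc ++ endpoints ((List.range (k + 1)).flatMap (stageEdges D.b)) =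
            acc ++ endpoints ((List.range k).flatMap (stageEdges D.b)) ++
              endpoints ((List.range (2 * D.b)).map (stageEdge D.b k)) := by
          simp [List.range_succ, endpoints, stageEdges]
        rw [e]
        refine ⟨?_, l1.2⟩
        simpa using l1.1
      · simp only [HState.tick_time, HState.set_time] at l3 ⊢
        linarith
  · rintro g ⟨k1, -, k3, k4⟩
    exact ⟨⟨k1.1, k1.2⟩, k3.tick, by simp only [HState.tick_time]; omega⟩

theorem wp_pushEdges (hD : D.Valid) (hF : D.Fixed M ω h) (hx : x < D.nb * D.nb)
    (hb : h.var .block = x) {acc : List ℕ} (hl : h.Holds acc)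
    (hB : acc.length + 6 * (D.b * D.b) + 2 < D.B) :
    WP D.B ω inp (pushEdges m) h fun h' =>
      h'.Holds (acc ++ endpoints (predictedEdges D.b m (blockMat D.b D.nb M x))) ∧
      Keeps pushVars [.inp] b Z h h' ∧ h'.time ≤ h.time + 31 * (D.b * D.b) + 5 := by
  have hbb : D.b ≤ D.b * D.b := Nat.le_mul_of_pos_right _ hD.b_pos
  have hlen1 : (endpoints (matEdges D.b (blockMat D.b D.nb M x))).length = 2 * (D.b * D.b) := by
    simp [matEdges]
  have hlen2 : (endpoints ((List.range D.b).flatMap (stageEdges D.b))).length =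
      4 * (D.b * D.b) := by
    rw [endpoints_length, flatMap_range_length _ _ _ fun i => stageEdges_length D.b i]; ring
  cases m
  · refine wp_cons ((wp_pushMat (b := b) (Z := Z) hD hF hx hb hl (by omega)).mono ?_)
    rintro h₁ ⟨l₁, k₁, t₁⟩
    refine wp_cons ((wp_pushStages (b := b) (Z := Z) hD (hF.keeps k₁) l₁
      (by rw [List.length_append, hlen1]; omega)).mono ?_)
    rintro h₂ ⟨l₂, k₂, t₂⟩
    refine wp_nil ⟨?_, (k₁.trans k₂).tick, ?_⟩
    · simp only [predictedEdges, firstEdges, lastEdges, List.append_nil, endpoints_append]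
      rw [← List.append_assoc]
      exact l₂
    · simp only [HState.tick_time]; linarith
  · refine wp_cons ((wp_pushStages (b := b) (Z := Z) hD hF hl (by omega)).mono ?_)
    rintro h₁ ⟨l₁, k₁, t₁⟩
    refine wp_cons ((wp_pushMat (b := b) (Z := Z) hD (hF.keeps k₁) hx
      (by rw [k₁.var _ (by decide), hb]) l₁ (by rw [List.length_append, hlen2]; omega)).mono ?_)
    rintro h₂ ⟨l₂, k₂, t₂⟩
    refine wp_nil ⟨?_, (k₁.trans k₂).tick, ?_⟩
    · simp only [predictedEdges, firstEdges, lastEdges, List.nil_append, endpoints_append]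
      rw [← List.append_assoc]
      exact l₂
    · simp only [HState.tick_time]; linarith

/-- Variables changed by the initialization of a copy. -/
abbrev initVars : List Var := .base :: .step :: .l :: callVars

/-- The updates that precede the first stage are executed here as well. Thus the state to which
every batch returns already contains the matrix in the incremental case. -/
theorem wp_init (hD : D.Valid) (hA : HaltsWithin A D.κ D.b m T₀ T) (hL : T₀ + T ≤ D.L)
    (hu : A.update.RegsLT D.ρ) (hp : A.preprocess.RegsLT D.ρ) (hF : D.Fixed M ω h)
    (hB : 6 * (D.b * D.b) + 4 < D.B)
    (hx : x < D.nb * D.nb) (hr : r < D.R) (hblock : h.var .block = x)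
    (hcopy : h.var .copy = r) (hg : h.var .gen < D.B)
    (hS : CellsFor (wordBound D.κ D.b) D.ρ (fun y => h.view ((x * D.R + r) * D.Z + y)) State.init) :
    WP D.B ω inp (initCmd D.ρ A m) h fun h' =>
      Keeps initVars callArrs ((x * D.R + r) * D.Z) D.Z h h' ∧
      CellsFor (wordBound D.κ D.b) D.ρ (fun y => h'.view ((x * D.R + r) * D.Z + y))
        (firstState A D.κ D.b m (blockMat D.b D.nb M x) (tape D.R r ω)) ∧
      h'.time ≤ h.time + (12 * (T₀ + T) + 43 * (D.b * D.b) + 20) := by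
  set W := wordBound D.κ D.b with hW
  set τ := tape D.R r ω with hτ
  set Mb := blockMat D.b D.nb M x with hMb
  set bs := (x * D.R + r) * D.Z with hbs
  have hbB : bs + D.Z ≤ D.B := (Layout.base_le hx hr).trans hD.cells_le
  have hZ : 0 < D.Z := by have := hD.stride; omega
  have hH := hA.first Mb τ
  have hcoins := hA.coins_first_le Mb τ
  have hrt := (hA Mb (fun _ _ => false) τ).2.1
  have h5B := hD.verts_lt
  have h2B := hD.two_lt
  have hfirst : firstState A D.κ D.b m Mb τ =
      runState W τ (callState W τ State.init (A.preprocess, preInput D.b m Mb))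
        ((firstEdges D.b m Mb).map (updateCall A)) := rfl
  have hrt' : runTime W τ State.init (firstCalls A D.b m Mb) =
      callTime W τ State.init (A.preprocess, preInput D.b m Mb) +
      runTime W τ (callState W τ State.init (A.preprocess, preInput D.b m Mb))
        ((firstEdges D.b m Mb).map (updateCall A)) := rfl
  rw [hfirst] at hcoins ⊢
  rw [hrt'] at hrt
  obtain ⟨hH1, hH2⟩ : CallHalts W τ State.init (A.preprocess, preInput D.b m Mb) ∧
    RunHalts W τ (callState W τ State.init (A.preprocess, preInput D.b m Mb))
      ((firstEdges D.b m Mb).map (updateCall A)) := hH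
  set s₁ := callState W τ State.init (A.preprocess, preInput D.b m Mb) with hs₁
  have hc1 : s₁.coins ≤ D.L := (RunHalts.coins_le hH2).1.trans (hcoins.trans hL)
  have hview : ∀ {g g' : HState} {vs : List Var} {as : List Arr}, Keeps vs as bs D.Z g g' →
      .gen ∉ vs → .cells ∉ as → .stamp ∉ as → g'.view = g.view := by
    intro g g' vs as hk h1 h2 h3
    funext y
    unfold HState.view
    rw [hk.var _ h1, hk.arr _ h2, hk.arr _ h3]
  have hebase : ((Expr.var .block * Var.copies + Var.copy) * Var.stride : Expr).eval inp h = bs := by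
    simp [hblock, hF.copies, hcopy, hF.stride, hbs]
  refine wp_cons (wp_assign (by rw [hebase]; omega) (wp_cons (wp_assign (by simp; omega) ?_)))
  rw [hebase]
  set h₁ := ((h.set .base bs).tick.set .inpLen ((0 : Expr).eval inp (h.set .base bs).tick)).tick
    with hh₁
  have k1 : Keeps initVars callArrs bs D.Z h h₁ :=
    ((((Keeps.refl _ _ _ _ _).set .base _).tick).set .inpLen _).tick
  have w1 : h₁.view = h.view := by simp [hh₁, HState.set_view]
  have l1 : h₁.Holds [] := ⟨by simp [hh₁], by simp⟩
  have F1 := hF.keeps k1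
  refine wp_cons (wp_push (b := bs) (Z := D.Z) _ (5 * D.b) l1 (by simp [F1.side]) h5B
    (by simp; omega) ?_)
  intro h₂ l₂ k₂ t₂
  have F2 := F1.keeps k₂
  refine wp_cons (wp_push (b := bs) (Z := D.Z) _ (3 * (D.b * D.b)) l₂ (by simp [F2.side]) (by omega)
    (by simp; omega) ?_)
  intro h₃ l₃ k₃ t₃
  have F3 := F2.keeps k₃
  have k3 : Keeps initVars callArrs bs D.Z h h₃ := (k1.trans k₂.mono).trans k₃.mono
  refine wp_cons ((wp_pushEdges (m := m) (b := bs) (Z := D.Z) hD F3 hx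
    (by rw [k3.var _ (by decide), hblock]) l₃ (by simp; omega)).mono ?_)
  rintro h₄ ⟨l₄, k₄, t₄⟩
  have k4 : Keeps initVars callArrs bs D.Z h h₄ := k3.trans k₄.mono
  refine wp_cons (wp_assign (by simp; omega) ?_)
  set h₅ := (h₄.set .answer ((0 : Expr).eval inp h₄)).tick with hh₅
  have k5 : Keeps initVars callArrs bs D.Z h h₅ := (k4.set .answer _).tick
  have w5 : h₅.view = h.view := by
    rw [hh₅, HState.tick_view, HState.set_view _ _ _ (by decide),
      hview k₄ (by decide) (by decide) (by decide), hview k₃ (by decide) (by decide) (by decide),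
      hview k₂ (by decide) (by decide) (by decide), w1]
  have E5 := hD.callEnv (h := h₅) (hF.keeps k5) hx hr (by rw [k5.var _ (by decide), hcopy])
    (by
      rw [hh₅, HState.tick_var, HState.set_var, if_neg (by decide), k₄.var _ (by decide),
        k₃.var _ (by decide), k₂.var _ (by decide)]
      simp [hh₁, hbs]) (by rw [k5.var _ (by decide)]; exact hg)
  have hl5 : h₅.Holds (preInput D.b m Mb) := ⟨l₄.1, l₄.2⟩
  refine wp_cons ((wp_simCall hp hH1 hc1 E5 (by rw [w5]; exact hS) hl5 (by simp [hh₅])).mono ?_)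
  rintro h₆ ⟨k₆, t₆, c₆, -⟩
  have k6 : Keeps initVars callArrs bs D.Z h h₆ := k5.trans k₆.mono
  have time6 : h₆.time ≤ h.time + 12 * callTime W τ State.init (A.preprocess, preInput D.b m Mb) +
      31 * (D.b * D.b) + 14 := by
    simp only [hh₅, hh₁, HState.tick_time, HState.set_time] at t₂ t₃ t₄ t₆
    linarith
  cases m
  · have hlist : (firstEdges D.b .incremental Mb) =
        ((List.range (D.b * D.b)).filter fun _ => true).map (matEdge D.b Mb) := by
      simp [firstEdges, matEdges]
    rw [hlist] at hH2 hcoins hrt ⊢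
    refine wp_cons ((wp_updateLoop (c := fun _ => true) (g := matEdge D.b Mb) hu hH2
      (hcoins.trans hL) (E5.keeps k₆) c₆ ?_ ?_ ?_ (by omega) h2B).mono ?_)
    · intro h' kk
      simp [(hF.keeps (k6.trans kk.mono)).side]
    · intro h' kk hl
      have F' := hF.keeps (k6.trans kk.mono)
      exact ⟨rfl, eval_matSrc hD F' hx
        (by rw [kk.var _ (by decide), k6.var _ (by decide), hblock]) hl, eval_matDst F'⟩
    · intro l hl
      have := matEdges_lt hD.b_pos (p := matEdge D.b Mb l)
        (List.mem_map.2 ⟨l, List.mem_range.2 hl, rfl⟩)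
      omega
    · rintro h₇ ⟨k₇, t₇, c₇⟩
      refine wp_nil ⟨(k6.trans k₇.mono).tick, c₇, ?_⟩
      rw [HState.tick_time]
      linarith
  · refine wp_cons (wp_skip (wp_nil ⟨k6.tick.tick, c₆, ?_⟩))
    simp only [HState.tick_time]
    have : runTime W τ s₁ ((firstEdges D.b .decremental Mb).map (updateCall A)) = 0 := rfl
    rw [this] at hrt
    omega

end

/-! ### Reading the matrix -/

/-- Find the size of the blocks. -/
def sideCmd (e : ℕ) : Cmd := .block [.assign .side 0,
  .for .i Var.dim (.ite (Expr.lt Var.dim (Expr.pow (Expr.var .side + 1) e)) .skip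
    (.assign .side (Expr.var .side + 1)))]

/-- Find the binary logarithm. -/
def logCmd : Cmd := .block [.assign .pow 1, .assign .log 0,
  .for .i Var.dim (.ite (Expr.lt Var.dim Var.pow) .skip
    (.block [.assign .pow (Expr.var .pow * 2), .assign .log (Expr.var .log + 1)]))]

/-- Compute all sizes. -/
def sizesCmd (ρ κ d C e : ℕ) : Cmd := .block [.assign .dim (.inp 0), sideCmd e, logCmd,
  .assign .copies (80 * Var.log), .assign .blocks (Expr.var .dim / Var.side + 1),
  .assign .padded (Expr.var .blocks * Var.side),
  .assign .tapeLen (Expr.pow (5 * Var.side) d + .const d + .const C * Expr.pow Var.side 3),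
  .assign .stride (.const (ρ + 1) +
    Expr.pow (5 * Expr.var .side + (3 * (Expr.var .side * Var.side) + Var.side) + 2) κ),
  .assign .coinLen (Expr.var .tapeLen * Var.copies)]

/-- Toss all coins. -/
def coinsCmd : Cmd := .for .i Var.coinLen (.block [.flip .x₁, .store .coins Var.i Var.x₁])

/-- Store the matrix. -/
def matCmd : Cmd := .for .i Var.dim (.for .j Var.dim
  (.store .mat (Expr.var .i * Var.padded + Var.j) (.inp (1 + Expr.var .i * Var.dim + Var.j))))

/-- Initialize all copies for all blocks. -/
def initAllCmd (ρ : ℕ) (A : TCAlgorithm) (m : Mode) : Cmd :=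
  .for .block (Expr.var .blocks * Var.blocks) (.for .copy Var.copies (initCmd ρ A m))

/-- The program that reads the matrix. -/
def startCmd (ρ κ d C e : ℕ) (A : TCAlgorithm) (m : Mode) : Cmd := .block
  [sizesCmd ρ κ d C e, coinsCmd, matCmd, initAllCmd ρ A m, .assign .step 0, .assign .gen 1]

/-- The relations between the sizes. -/
structure Layout.Sized (D : Layout) (d C e lg : ℕ) : Prop where
  N_pos : 0 < D.N
  root : ∀ s, D.N < (s + 1) ^ e ↔ D.b ≤ s
  root_le : D.b ≤ D.N
  log : ∀ s, D.N < 2 ^ s ↔ lg ≤ s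
  log_le : lg ≤ D.N
  nb : D.nb = D.N / D.b + 1
  R : D.R = 80 * lg
  L : D.L = (5 * D.b) ^ d + d + C * D.b ^ 3
  Z : D.Z = D.ρ + 1 + wordBound D.κ D.b
  pow_lt : 2 ^ lg < D.B
  stride_lt : D.Z < D.B
  input_lt : 6 * (D.b * D.b) + 4 < D.B

/-- The initial state. -/
def HState.init : HState := ⟨fun _ => 0, fun _ _ => 0, fun _ => 0, 0, 0⟩

section
variable {D : Layout} {A : TCAlgorithm} {m : Mode} {M : ℕ → ℕ → Bool} {ω : ℕ → Bool}
  {inp : List ℕ} {h h' : HState} {d C e lg T₀ T : ℕ}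

/-- The integer root is found by trial: `side` increases while `(side + 1) ^ e` does not exceed the
dimension. As `b ≤ N`, going `N` times through the loop is enough. -/
theorem wp_side (hD : D.Valid) (hS : D.Sized d C e lg) (hdim : h.var .dim = D.N) :
    WP D.B ω inp (sideCmd e) h fun h' => Keeps [.side, .i] [] 0 0 h h' ∧ h'.var .side = D.b ∧
      h'.time ≤ h.time + 4 * D.N + 4 := by
  have hN := (Layout.N_lt hD).1
  have hb := hS.root_le
  refine wp_cons (wp_assign (by simp; omega) (wp_cons (wp_for (fun i g =>
    Keeps [.side, .i] [] 0 0 h g ∧ g.var .i = i ∧ g.var .side = min i D.b ∧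
      g.time ≤ h.time + 4 * i + 2) D.N hN
    ⟨(((Keeps.refl _ _ _ _ _).set .side _).tick.set .i _).tick, by simp, by simp, by simp⟩
    ?_ ?_ ?_)))
  · rintro i g - ⟨k1, k2, -⟩
    exact ⟨k2, by rw [Expr.eval_var, k1.var _ (by decide), hdim]⟩
  · rintro i g hi ⟨k1, k2, k3, k4⟩
    have ev : (Expr.lt Var.dim (Expr.pow (Expr.var .side + 1) e)).eval inp g.tick =
        if D.b ≤ i then 1 else 0 := by
      have hd : g.var .dim = D.N := by rw [k1.var _ (by decide), hdim]
      simp only [Expr.eval_lt, Expr.eval_var, Expr.eval_pow, Expr.eval_add, Expr.eval_ofNat,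
        HState.tick_var, hd, k3, hS.root]
      congr 1
      simp only [eq_iff_iff]
      omega
    refine wp_ite (fun hc => ?_) (fun hc => ?_)
    · have hc' : D.b ≤ i := by
        by_contra hh
        rw [ev, if_neg hh] at hc
        exact hc rfl
      refine wp_skip ⟨by simpa using k2, (k1.tick.tick.tick.set .i _).tick, by simp, ?_, ?_⟩
      · simp [k3]; omega
      · simp; omega
    · have hc' : ¬ D.b ≤ i := by
        intro hh
        rw [ev, if_pos hh] at hc
        exact one_ne_zero hc
      have ev2 : (Expr.var .side + 1 : Expr).eval inp g.tick.tick = i + 1 := by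
        simp [k3]; omega
      refine wp_assign (by rw [ev2]; omega) ?_
      rw [ev2]
      refine ⟨by simpa using k2, ((k1.tick.tick.set .side _).tick.set .i _).tick, by simp, ?_, ?_⟩
      · simp; omega
      · simp; omega
  · rintro g ⟨k1, -, k3, k4⟩
    exact wp_nil ⟨k1.tick.tick, by simp [k3, hb], by simp; omega⟩

theorem wp_log (hD : D.Valid) (hS : D.Sized d C e lg) (hdim : h.var .dim = D.N) :
    WP D.B ω inp logCmd h fun h' => Keeps [.pow, .log, .i] [] 0 0 h h' ∧ h'.var .log = lg ∧
      h'.time ≤ h.time + 6 * D.N + 5 := by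
  have hN := (Layout.N_lt hD).1
  have h2B := hD.two_lt
  have hb := hS.log_le
  refine wp_cons (wp_assign (by simp; omega) (wp_cons (wp_assign (by simp; omega)
    (wp_cons (wp_for (fun i g =>
    Keeps [.pow, .log, .i] [] 0 0 h g ∧ g.var .i = i ∧ g.var .log = min i lg ∧
      g.var .pow = 2 ^ min i lg ∧
      g.time ≤ h.time + 6 * i + 3) D.N hN
    ⟨((((Keeps.refl _ _ _ _ _).set .pow _).tick.set .log _).tick.set .i _).tick, by simp, by simp,
      by simp, by simp⟩
    ?_ ?_ ?_)))))
  · rintro i g - ⟨k1, k2, -⟩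
    exact ⟨k2, by rw [Expr.eval_var, k1.var _ (by decide), hdim]⟩
  · rintro i g hi ⟨k1, k2, k3, k5, k4⟩
    have ev : (Expr.lt Var.dim Var.pow).eval inp g.tick = if lg ≤ i then 1 else 0 := by
      have hd : g.var .dim = D.N := by rw [k1.var _ (by decide), hdim]
      simp only [Expr.eval_lt, Expr.eval_var, HState.tick_var, hd, k5, hS.log]
      congr 1
      simp only [eq_iff_iff]
      omega
    refine wp_ite (fun hc => ?_) (fun hc => ?_)
    · have hc' : lg ≤ i := by
        by_contra hh
        rw [ev, if_neg hh] at hc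
        exact hc rfl
      have e1 : min (i + 1) lg = min i lg := by omega
      refine wp_skip ⟨by simpa using k2, (k1.tick.tick.tick.set .i _).tick, by simp, ?_, ?_, ?_⟩
      · simp [k3, e1]
      · simp [k5, e1]
      · simp; omega
    · have hc' : ¬ lg ≤ i := by
        intro hh
        rw [ev, if_pos hh] at hc
        exact one_ne_zero hc
      have e1 : min i lg = i := by omega
      have e2 : min (i + 1) lg = i + 1 := by omega
      rw [e1] at k3 k5
      have hpow : 2 ^ (i + 1) < D.B :=
        (Nat.pow_le_pow_right (by omega) (by omega)).trans_lt hS.pow_lt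
      have ev2 : (Expr.var .pow * 2 : Expr).eval inp g.tick.tick = 2 ^ (i + 1) := by
        simp [k5, pow_succ]
      have ev3 : (Expr.var .log + 1 : Expr).eval inp (g.tick.tick.set .pow (2 ^ (i + 1))).tick =
          i + 1 := by
        simp [k3]
      refine wp_cons (wp_assign (by rw [ev2]; exact hpow) ?_)
      rw [ev2]
      refine wp_cons (wp_assign (by rw [ev3]; omega) (wp_nil ?_))
      rw [ev3]
      refine ⟨by simpa using k2,
        (((k1.tick.tick.set .pow _).tick.set .log _).tick.tick.set .i _).tick, by simp, ?_, ?_, ?_⟩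
      · simp [e2]
      · simp [e2]
      · simp; omega
  · rintro g ⟨k1, -, k3, -, k4⟩
    exact wp_nil ⟨k1.tick.tick, by simp [k3, hb], by simp; omega⟩

/-- Variables set by `sizesCmd`. -/
abbrev sizeVars : List Var := [.dim, .side, .i, .pow, .log, .copies, .blocks, .padded, .tapeLen,
  .stride, .coinLen]

theorem wp_sizes (hD : D.Valid) (hS : D.Sized d C e lg) (hinp : inp.getD 0 0 = D.N) :
    WP D.B ω inp (sizesCmd D.ρ D.κ d C e) h fun h' => Keeps sizeVars [] 0 0 h h' ∧
      h'.var .dim = D.N ∧ h'.var .side = D.b ∧ h'.var .copies = D.R ∧ h'.var .blocks = D.nb ∧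
      h'.var .padded = D.nb * D.b ∧ h'.var .stride = D.Z ∧ h'.var .coinLen = D.L * D.R ∧
      h'.time ≤ h.time + 10 * D.N + 20 := by
  have hN := (Layout.N_lt hD)
  have h2B := hD.two_lt
  have hRB := hD.copies_lt
  refine wp_cons (wp_assign (by rw [Expr.eval_inp]; simp only [Expr.eval_ofNat, hinp]; omega) ?_)
  set h₁ := (h.set .dim ((Expr.inp 0).eval inp h)).tick with hh₁
  have d1 : h₁.var .dim = D.N := by
    rw [hh₁, HState.tick_var, HState.set_var, if_pos rfl, Expr.eval_inp, Expr.eval_ofNat, hinp]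
  have k1 : Keeps sizeVars [] 0 0 h h₁ := ((Keeps.refl _ _ _ _ _).set .dim _).tick
  refine wp_cons ((wp_side hD hS d1).mono ?_)
  rintro h₂ ⟨k₂, s₂, t₂⟩
  have k2 := k1.trans (k₂.mono (vs' := sizeVars))
  have d2 : h₂.var .dim = D.N := by rw [k₂.var _ (by decide), d1]
  refine wp_cons ((wp_log hD hS d2).mono ?_)
  rintro h₃ ⟨k₃, g₃, t₃⟩
  have k3 := k2.trans (k₃.mono (vs' := sizeVars))
  have d3 : h₃.var .dim = D.N := by rw [k₃.var _ (by decide), d2]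
  have s3 : h₃.var .side = D.b := by rw [k₃.var _ (by decide), s₂]
  have e4 : (80 * Var.log : Expr).eval inp h₃ = D.R := by simp [g₃, hS.R]
  refine wp_cons (wp_assign (by rw [e4]; omega) ?_)
  rw [e4]
  set h₄ := (h₃.set .copies D.R).tick with hh₄
  have e5 : (Expr.var .dim / Var.side + 1 : Expr).eval inp h₄ = D.nb := by
    simp [hh₄, d3, s3, hS.nb]
  have hnbB : D.nb < D.B :=
    (Nat.le_mul_of_pos_right _ hD.b_pos).trans_lt hN.2
  refine wp_cons (wp_assign (by rw [e5]; exact hnbB) ?_)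
  rw [e5]
  set h₅ := (h₄.set .blocks D.nb).tick with hh₅
  have e6 : (Expr.var .blocks * Var.side : Expr).eval inp h₅ = D.nb * D.b := by
    simp [hh₅, hh₄, s3]
  refine wp_cons (wp_assign (by rw [e6]; exact hN.2) ?_)
  rw [e6]
  set h₆ := (h₅.set .padded (D.nb * D.b)).tick with hh₆
  have e7 : (Expr.pow (5 * Var.side) d + .const d + .const C * Expr.pow Var.side 3 : Expr).eval
      inp h₆ = D.L := by
    simp [hh₆, hh₅, hh₄, s3, hS.L]
  refine wp_cons (wp_assign (by rw [e7]; exact hD.L_lt) ?_)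
  rw [e7]
  set h₇ := (h₆.set .tapeLen D.L).tick with hh₇
  have e8 : (.const (D.ρ + 1) +
    Expr.pow (5 * Expr.var .side + (3 * (Expr.var .side * Var.side) + Var.side) + 2) D.κ :
      Expr).eval inp h₇ = D.Z := by
    simp [hh₇, hh₆, hh₅, hh₄, s3, hS.Z, wordBound]
  refine wp_cons (wp_assign (by rw [e8]; exact hS.stride_lt) ?_)
  rw [e8]
  set h₈ := (h₇.set .stride D.Z).tick with hh₈
  have e9 : (Expr.var .tapeLen * Var.copies : Expr).eval inp h₈ = D.L * D.R := by
    simp [hh₈, hh₇, hh₆, hh₅, hh₄]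
  refine wp_cons (wp_assign (by rw [e9]; exact hD.tape_lt) (wp_nil ?_))
  rw [e9]
  refine ⟨((((((((k3.set .copies _).tick.set .blocks _).tick.set .padded _).tick.set
    .tapeLen _).tick.set .stride _).tick.set .coinLen _).tick).tick), ?_, ?_, ?_, ?_, ?_, ?_, ?_, ?_⟩
  · simp [hh₈, hh₇, hh₆, hh₅, hh₄, d3]
  · simp [hh₈, hh₇, hh₆, hh₅, hh₄, s3]
  · simp [hh₈, hh₇, hh₆, hh₅, hh₄]
  · simp [hh₈, hh₇, hh₆, hh₅, hh₄]
  · simp [hh₈, hh₇, hh₆, hh₅, hh₄]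
  · simp [hh₈, hh₇, hh₆, hh₅, hh₄]
  · simp [hh₈, hh₇, hh₆, hh₅, hh₄]
  · simp [hh₈, hh₇, hh₆, hh₅, hh₄]
    simp [hh₁] at t₂
    omega

/-- All coins are tossed in advance. The `R` tapes are shared by all blocks and batches;
independence is needed only among the copies that take part in one vote. -/
theorem wp_coins (hD : D.Valid) (hlen : h.var .coinLen = D.L * D.R) (hc : h.coins = 0) :
    WP D.B ω inp coinsCmd h fun h' => (∀ x, x ≠ .i → x ≠ .x₁ → h'.var x = h.var x) ∧
      (∀ a ≠ .coins, h'.arr a = h.arr a) ∧ (∀ i < D.L * D.R, h'.arr .coins i = (ω i).toNat) ∧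
      h'.time ≤ h.time + 5 * (D.L * D.R) + 2 := by
  have h2B := hD.two_lt
  refine wp_for (fun i g => (∀ x, x ≠ .i → x ≠ .x₁ → g.var x = h.var x) ∧
      (∀ a ≠ .coins, g.arr a = h.arr a) ∧ (∀ i' < i, g.arr .coins i' = (ω i').toNat) ∧
      g.coins = i ∧ g.var .i = i ∧ g.time ≤ h.time + 5 * i + 1) (D.L * D.R) hD.tape_lt
    ⟨fun x hx _ => by simp [hx], fun _ _ => rfl, by simp, hc, by simp, by simp⟩ ?_ ?_ ?_
  · rintro i g - ⟨k1, -, -, -, k2, -⟩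
    exact ⟨k2, by rw [Expr.eval_var, k1 _ (by decide) (by decide), hlen]⟩
  · rintro i g hi ⟨k1, k2, k3, k4, k5, k6⟩
    have hω := Bool.toNat_le (ω i)
    refine wp_cons (wp_flip (wp_cons (wp_store ?_ (wp_nil ?_))))
    · simp [k4]; omega
    · refine ⟨by simpa using k5, fun x h1 h2 => ?_, fun a ha => ?_, fun i' hi' => ?_, ?_, by simp, ?_⟩
      · simp [h1, h2, k1 x h1 h2]
      · funext y
        simp [ha, k2 a ha]
      · simp [k4, k5]
        split_ifs with hh
        · rw [hh]
        · exact k3 i' (by omega)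
      · simp [k4]
      · simp; omega
  · rintro g ⟨k1, k2, k3, -, -, k6⟩
    exact ⟨k1, k2, k3, by simp; omega⟩

/-- Only the `N × N` part is written. The padding up to side `nb * b` relies on the array being zero
initially. -/
theorem wp_mat (hD : D.Valid) (hdim : h.var .dim = D.N) (hpad : h.var .padded = D.nb * D.b)
    (hmat : ∀ y, h.arr .mat y = 0)
    (hinp : ∀ i < D.N, ∀ j < D.N, inp.getD (1 + i * D.N + j) 0 = (M i j).toNat)
    (hM : ∀ i j, M i j = true → i < D.N ∧ j < D.N) (b Z : ℕ) :
    WP D.B ω inp matCmd h fun h' => Keeps [.i, .j] [.mat] b Z h h' ∧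
      (∀ i, ∀ j < D.nb * D.b, h'.arr .mat (i * (D.nb * D.b) + j) = (M i j).toNat) ∧
      h'.time ≤ h.time + D.N * (3 * D.N + 4) + 2 := by
  have hN := (Layout.N_lt hD)
  have h2B := hD.two_lt
  have hNP := hD.N_le
  have hM' : ∀ i j, (D.N ≤ i ∨ D.N ≤ j) → (M i j).toNat = 0 := by
    intro i j hij
    by_cases hh : M i j = true
    · have := hM i j hh; omega
    · simp [hh]
  refine wp_for (fun i g => Keeps [.i, .j] [.mat] b Z h g ∧ g.var .i = i ∧
    (∀ i', ∀ j < D.nb * D.b, g.arr .mat (i' * (D.nb * D.b) + j) =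
      if i' < i then (M i' j).toNat else 0) ∧ g.time ≤ h.time + i * (3 * D.N + 4) + 1) D.N hN.1
    ⟨((Keeps.refl _ _ _ _ _).set .i _).tick, by simp, by simp [hmat], by simp⟩ ?_ ?_ ?_
  · rintro i g - ⟨k1, k2, -⟩
    exact ⟨k2, by rw [Expr.eval_var, k1.var _ (by decide), hdim]⟩
  · rintro i g hi ⟨k1, k2, k3, k4⟩
    refine wp_for (fun j g => Keeps [.i, .j] [.mat] b Z h g ∧ g.var .i = i ∧ g.var .j = j ∧
      (∀ i', ∀ j' < D.nb * D.b, g.arr .mat (i' * (D.nb * D.b) + j') =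
        if i' < i ∨ i' = i ∧ j' < j then (M i' j').toNat else 0) ∧
      g.time ≤ h.time + i * (3 * D.N + 4) + 3 * j + 3) D.N hN.1
      ⟨(k1.tick.set .j _).tick, by simpa using k2, by simp, by simpa using k3, by simp; omega⟩
      ?_ ?_ ?_
    · rintro j g - ⟨k1, -, k2, -⟩
      exact ⟨k2, by rw [Expr.eval_var, k1.var _ (by decide), hdim]⟩
    · rintro j g hj ⟨l1, l2, l3, l4, l5⟩
      have e1 : (Expr.inp (1 + Expr.var .i * Var.dim + Var.j)).eval inp g.tick =
          (M i j).toNat := by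
        simp only [Expr.eval_inp, Expr.eval_add, Expr.eval_mul, Expr.eval_var, Expr.eval_ofNat,
          HState.tick_var, l2, l3, l1.var .dim (by decide), hdim, hinp i hi j hj]
      have e2 : (Expr.var .i * Var.padded + Var.j : Expr).eval inp g.tick =
          i * (D.nb * D.b) + j := by
        simp [l2, l3, l1.var .padded (by decide), hpad]
      have := Bool.toNat_le (M i j)
      refine wp_store (by rw [e1]; omega) ?_
      rw [e1, e2]
      refine ⟨by simpa using l3, ((l1.tick.setArr .mat _ _).tick.set .j _).tick, by simpa using l2,
        by simp, fun i' j' hj' => ?_, by simp; omega⟩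
      have e3 : i' * (D.nb * D.b) + j' = i * (D.nb * D.b) + j ↔ i' = i ∧ j' = j := by
        constructor
        · intro hh
          have hP : 0 < D.nb * D.b := by omega
          have h1 := congrArg (· / (D.nb * D.b)) hh
          have h2 := congrArg (· % (D.nb * D.b)) hh
          simp only [mul_comm _ (D.nb * D.b), Nat.mul_add_div hP, Nat.div_eq_of_lt hj',
            Nat.div_eq_of_lt (hj.trans_le hNP), Nat.mul_add_mod, Nat.mod_eq_of_lt hj',
            Nat.mod_eq_of_lt (hj.trans_le hNP)] at h1 h2
          omega
        · rintro ⟨rfl, rfl⟩; rfl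
      simp only [HState.tick_arr, HState.set_arr, HState.setArr_arr, true_and, e3, l4 i' j' hj']
      split_ifs with h1 h2 h3 h3 <;> first | rfl | (obtain ⟨rfl, rfl⟩ := h1; rfl) | (exfalso; omega)
    · rintro g ⟨l1, l2, -, l4, l5⟩
      refine ⟨by simpa using l2, (l1.tick.set .i _).tick, by simp, fun i' j' hj' => ?_, ?_⟩
      · simp only [HState.tick_arr, HState.set_arr, l4 i' j' hj']
        split_ifs with h1 h2 h2
        · rfl
        · omega
        · rw [hM' i' j' (by omega)]
        · rfl
      · simp only [HState.tick_time, HState.set_time]; linarith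
  · rintro g ⟨k1, -, k3, k4⟩
    refine ⟨k1.tick, fun i j hj => ?_, by simp only [HState.tick_time]; omega⟩
    rw [HState.tick_arr, k3 i j hj]
    split_ifs with hh
    · rfl
    · rw [hM' i j (by omega)]

end

section
variable {D : Layout} {A : TCAlgorithm} {m : Mode} {M : ℕ → ℕ → Bool} {ω : ℕ → Bool}
  {inp : List ℕ} {h h' : HState} {d C e lg T₀ T : ℕ}

theorem cellsFor_zero {W ρ : ℕ} (hW : 0 < W) : CellsFor W ρ (fun _ => 0) State.init :=
  ⟨rfl, fun _ _ => rfl, fun _ _ => rfl, State.init_bdd hW⟩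

theorem session_index {R x r : ℕ} (hr : r < R) :
    (x * R + r) / R = x ∧ (x * R + r) % R = r := by
  have hR : 0 < R := by omega
  constructor
  · rw [mul_comm, Nat.mul_add_div hR, Nat.div_eq_of_lt hr, add_zero]
  · rw [mul_comm, Nat.mul_add_mod, Nat.mod_eq_of_lt hr]

/-- In generation zero all writes are permanent, which creates the snapshot for the resets. The
cells are zero at the start and are never cleared one by one; their number grows with the
unrestricted exponent `κ`, so clearing them could be too expensive. -/
theorem wp_initAll (hD : D.Valid) (hS : D.Sized d C e lg) (hA : HaltsWithin A D.κ D.b m T₀ T)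
    (hL : T₀ + T ≤ D.L)
    (hu : A.update.RegsLT D.ρ) (hp : A.preprocess.RegsLT D.ρ) (hF : D.Fixed M ω h)
    (hg : h.var .gen = 0) (hview : h.view = fun _ => 0) :
    WP D.B ω inp (initAllCmd D.ρ A m) h fun h' =>
      Keeps (.block :: .copy :: initVars) callArrs 0 (D.nb * D.nb * D.R * D.Z) h h' ∧
      D.Sessions A m M ω (fun _ _ _ => false) (fun _ => 0) h'.view ∧
      h'.time ≤ h.time +
        D.nb * D.nb * (D.R * (12 * (T₀ + T) + 43 * (D.b * D.b) + 22) + 4) + 2 := by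
  set n := D.nb * D.nb with hn
  have hRB := hD.copies_lt
  have hnB : n < D.B := by
    have h1 := hD.size_lt
    have h2 : D.nb ≤ D.nb * D.b := Nat.le_mul_of_pos_right _ hD.b_pos
    exact (Nat.mul_le_mul h2 h2).trans_lt h1
  let σ : ℕ → ℕ → State := fun cur c => if c < cur then
    D.sessionState A m M ω (fun _ _ _ => false) (fun _ => 0) c else State.init
  let P : ℕ → HState → Prop := fun cur g => ∀ c < n * D.R,
    CellsFor (wordBound D.κ D.b) D.ρ (fun y => g.view (c * D.Z + y)) (σ cur c)
  set Q := 12 * (T₀ + T) + 43 * (D.b * D.b) + 20 with hQ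
  refine wp_for (fun x g => Keeps (.block :: .copy :: initVars) callArrs 0 (n * D.R * D.Z) h g ∧
    g.var .block = x ∧ P (x * D.R) g ∧ g.time ≤ h.time + x * (D.R * (Q + 2) + 4) + 1) n hnB
    ⟨((Keeps.refl _ _ _ _ _).set .block _).tick, by simp, fun c _ => ?_, by simp⟩ ?_ ?_ ?_
  · have : σ (0 * D.R) c = State.init := by simp [σ]
    rw [this, HState.tick_view, HState.set_view _ _ _ (by decide), hview]
    exact cellsFor_zero (wordBound_pos _ _)
  · rintro x g - ⟨k1, k2, -⟩
    have F := hF.keeps k1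
    exact ⟨k2, by simp [F.blocks, hn]⟩
  · rintro x g hx ⟨k1, k2, k3, k4⟩
    refine wp_for (fun r g => Keeps (.block :: .copy :: initVars) callArrs 0 (n * D.R * D.Z) h g ∧
      g.var .block = x ∧ g.var .copy = r ∧ P (x * D.R + r) g ∧
      g.time ≤ h.time + x * (D.R * (Q + 2) + 4) + r * (Q + 2) + 3) D.R (by omega)
      ⟨(k1.tick.set .copy _).tick, by simpa using k2, by simp, ?_, by simp; omega⟩ ?_ ?_ ?_
    · intro c hc
      have := k3 c hc
      simpa [HState.set_view] using this
    · rintro r g - ⟨k1, -, k2, -⟩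
      exact ⟨k2, (hF.keeps k1).copies⟩
    · rintro r g hr ⟨l1, l2, l3, l4, l5⟩
      obtain ⟨i1, i2⟩ := session_index (x := x) hr
      have hc : x * D.R + r < n * D.R :=
        calc x * D.R + r < (x + 1) * D.R := by rw [add_mul]; omega
          _ ≤ _ := Nat.mul_le_mul_right _ hx
      have c0 := l4 _ hc
      have : σ (x * D.R + r) (x * D.R + r) = State.init := by simp [σ]
      rw [this] at c0
      refine (wp_init (h := g.tick) hD hA hL hu hp (hF.keeps l1.tick) hS.input_lt hx hr l2 l3
        (by rw [HState.tick_var, l1.var _ (by decide), hg]; omega) c0).mono ?_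
      rintro g' ⟨m1, m2, m3⟩
      refine ⟨by rw [m1.var _ (by decide)]; exact l3,
        ((l1.tick.trans (m1.mono.widen (Nat.zero_le _) ?_)).set .copy _).tick, ?_, by simp, ?_, ?_⟩
      · simpa using Layout.base_le hx hr
      · simp only [HState.tick_var, HState.set_var, reduceCtorEq, if_false]
        rw [m1.var _ (by decide)]; exact l2
      · intro c hc
        rw [HState.tick_view, HState.set_view _ _ _ (by decide)]
        by_cases e : c = x * D.R + r
        · subst e
          have : σ (x * D.R + (r + 1)) (x * D.R + r) =
              firstState A D.κ D.b m (blockMat D.b D.nb M x) (tape D.R r ω) := by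
            simp only [σ]
            rw [if_pos (by omega), Layout.sessionState, i1, i2, stagesState_zero]
          rw [this]
          exact m2
        · have : σ (x * D.R + (r + 1)) c = σ (x * D.R + r) c := by
            simp only [σ]
            split_ifs <;> first | rfl | (exfalso; omega)
          rw [this]
          exact CellsFor.keeps_other (h := g.tick) hD (l4 c hc) m1 e
      · simp only [HState.tick_time, HState.set_time] at m3 ⊢
        linarith
    · rintro g ⟨l1, l2, -, l4, l5⟩
      refine ⟨by simpa using l2, (l1.tick.set .block _).tick, by simp, ?_, ?_⟩
      · intro c hc
        have := l4 c hc
        rw [add_mul, one_mul]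
        simpa [HState.set_view] using this
      · simp only [HState.tick_time, HState.set_time]; linarith
  · rintro g ⟨k1, -, k3, k4⟩
    refine ⟨k1.tick, fun c hc => ?_, ?_⟩
    · have := k3 c hc
      simp only [σ] at this
      rwa [if_pos hc] at this
    · have e22 : 12 * (T₀ + T) + 43 * (D.b * D.b) + 22 = Q + 2 := by omega
      rw [e22, HState.tick_time]
      omega

/-- A bound for the time of reading the matrix. -/
def Layout.startTime (D : Layout) (T : ℕ) : ℕ :=
  10 * D.N + 5 * (D.L * D.R) + D.N * (3 * D.N + 4) +
    D.nb * D.nb * (D.R * (12 * T + 43 * (D.b * D.b) + 22) + 4) + 40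

theorem wp_start (hD : D.Valid) (hS : D.Sized d C e lg) (hA : HaltsWithin A D.κ D.b m T₀ T)
    (hL : T₀ + T ≤ D.L) (hu : A.update.RegsLT D.ρ) (hp : A.preprocess.RegsLT D.ρ)
    (hinp0 : inp.getD 0 0 = D.N)
    (hinp : ∀ i < D.N, ∀ j < D.N, inp.getD (1 + i * D.N + j) 0 = (M i j).toNat)
    (hM : ∀ i j, M i j = true → i < D.N ∧ j < D.N) :
    WP D.B ω inp (startCmd D.ρ D.κ d C e A m) HState.init fun h' =>
      D.Ready A m M ω 0 0 (fun _ _ _ => false) h' ∧ h'.time ≤ D.startTime (T₀ + T) := by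
  have h2B := hD.two_lt
  refine wp_cons ((wp_sizes hD hS hinp0).mono ?_)
  rintro h₁ ⟨k₁, f1, f2, f3, f4, f5, f6, f7, t₁⟩
  refine wp_cons ((wp_coins hD f7 k₁.coins).mono ?_)
  rintro h₂ ⟨v₂, a₂, c₂, t₂⟩
  have g2 : ∀ a ≠ Arr.coins, h₂.arr a = fun _ => 0 := by
    intro a ha
    rw [a₂ a ha, k₁.arr a (by simp)]; rfl
  refine wp_cons ((wp_mat hD (by rw [v₂ _ (by decide) (by decide), f1])
    (by rw [v₂ _ (by decide) (by decide), f5]) (by simp [g2]) hinp hM 0 0).mono ?_)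
  rintro h₃ ⟨k₃, m₃, t₃⟩
  have F3 : D.Fixed M ω h₃ := by
    have e1 : ∀ x : Var, x ∉ [Var.i, .j] → x ≠ .x₁ → h₃.var x = h₁.var x := by
      intro x hx hx'
      rw [k₃.var x hx, v₂ x (by rintro rfl; simp at hx) hx']
    refine ⟨?_, ?_, ?_, ?_, ?_, ?_, fun i _ => m₃ i, ?_⟩
    · rw [e1 _ (by decide) (by decide), f1]
    · rw [e1 _ (by decide) (by decide), f2]
    · rw [e1 _ (by decide) (by decide), f4]
    · rw [e1 _ (by decide) (by decide), f5]
    · rw [e1 _ (by decide) (by decide), f3]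
    · rw [e1 _ (by decide) (by decide), f6]
    · rw [k₃.arr _ (by decide)]; exact c₂
  have hg3 : h₃.var .gen = 0 := by
    rw [k₃.var _ (by decide), v₂ _ (by decide) (by decide), k₁.var _ (by decide)]; rfl
  have hz : ∀ a ∉ [Arr.coins, .mat], h₃.arr a = fun _ => 0 := by
    intro a ha
    rw [k₃.arr a (by intro hh; simp at hh; simp [hh] at ha),
      g2 a (by rintro rfl; simp at ha)]
  have hview : h₃.view = fun _ => 0 := by
    funext y
    simp [HState.view, hz .cells (by decide)]
  refine wp_cons ((wp_initAll hD hS hA hL hu hp F3 hg3 hview).mono ?_)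
  rintro h₄ ⟨k₄, s₄, t₄⟩
  have hg4 : h₄.var .gen = 0 := by rw [k₄.var _ (by decide), hg3]
  have hstamp : ∀ y, h₄.arr .stamp y = 0 := by
    intro y
    rcases k₄.stamp y with hh | hh
    · rw [hh, hz .stamp (by decide)]
    · rw [hh, hg3]
  have hsnap : h₄.view = h₄.snap := by
    funext y
    simp [HState.view, HState.snap, hg4]
  refine wp_cons (wp_assign (by simp; omega) (wp_cons (wp_assign (by simp; omega) (wp_nil ⟨?_, ?_⟩))))
  · have F4 := F3.keeps k₄
    refine ⟨F4.of_eq (fun x hx => ?_) fun _ _ => rfl, by simp, by simp, fun j _ => ?_, ?_, ?_, ?_⟩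
    · simp only [List.mem_cons, List.not_mem_nil, or_false] at hx
      rcases hx with rfl | rfl | rfl | rfl | rfl | rfl <;> simp
    · simp [k₄.arr .vec (by decide), hz .vec (by decide)]
    -- All stamps are zero and the generation is now one, so the view is the snapshot.
    · rw [HState.view_eq_snap]
      · rw [hsnap] at s₄
        exact s₄
      · intro y
        simp [hstamp]
    · rw [hsnap] at s₄
      exact s₄
    · intro y
      simp [hstamp]
  · have : HState.init.time = 0 := rfl
    simp only [HState.tick_time, HState.set_time, Layout.startTime]
    linarith

end

/-! ### The algorithm for online matrix-vector multiplication -/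

/-- The algorithm that results from the reduction. -/
def reduction (A : TCAlgorithm) (m : Mode) (ρ κ d C e : ℕ) : OMvAlgorithm :=
  ⟨(startCmd ρ κ d C e A m).compile, (queryCmd ρ A m).compile⟩

/-- A matrix extended by zeros. -/
def extend {n : ℕ} (M : Fin n → Fin n → Bool) (i j : ℕ) : Bool :=
  if h : i < n ∧ j < n then M ⟨i, h.1⟩ ⟨j, h.2⟩ else false

theorem extend_lt {n : ℕ} {M : Fin n → Fin n → Bool} {i j : ℕ} (h : extend M i j = true) :
    i < n ∧ j < n := by
  by_contra hh
  simp [extend, hh] at h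

theorem map_finRange {α : Type*} {n : ℕ} (f : Fin n → α) (g : ℕ → α) (h : ∀ i : Fin n, g i = f i) :
    (List.finRange n).map f = (List.range n).map g := by
  refine List.ext_getElem (by simp) fun i h₁ h₂ => ?_
  simpa using (h ⟨i, by simpa using h₁⟩).symm

theorem getD_map_range {n i : ℕ} (f : ℕ → ℕ) :
    ((List.range n).map f).getD i 0 = if i < n then f i else 0 := by
  split_ifs with h
  · simp [List.getD_eq_getElem?_getD, h]
  · simp [List.getD_eq_getElem?_getD, h]

theorem getD_flatMap_range (n k : ℕ) (f : ℕ → ℕ → ℕ) {i j : ℕ} (hi : i < k) (hj : j < n) :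
    ((List.range k).flatMap fun i => (List.range n).map (f i)).getD (i * n + j) 0 = f i j := by
  induction k with
  | zero => omega
  | succ k ih =>
    have hlen : ((List.range k).flatMap fun i => (List.range n).map (f i)).length = k * n :=
      flatMap_range_length _ _ _ fun i => by simp
    rw [List.range_succ, List.flatMap_append]
    rcases (Nat.lt_succ_iff.1 hi).lt_or_eq with h | rfl
    · rw [List.getD_append _ _ _ _ ?_, ih h]
      rw [hlen]
      calc i * n + j < (i + 1) * n := by rw [add_mul]; omega
        _ ≤ k * n := Nat.mul_le_mul_right _ h
    · rw [List.getD_append_right _ _ _ _ (by rw [hlen]; omega), hlen, Nat.add_sub_cancel_left]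
      simp [List.getD_eq_getElem?_getD, hj]

/-- The input that describes a matrix. -/
def matInput (n : ℕ) (M : ℕ → ℕ → Bool) : List ℕ :=
  n :: (List.range n).flatMap fun i => (List.range n).map fun j => (M i j).toNat

/-- The input that describes a vector. -/
def vecInput (n : ℕ) (v : ℕ → Bool) : List ℕ := (List.range n).map fun j => (v j).toNat

theorem extend_val {n : ℕ} (M : Fin n → Fin n → Bool) (i j : Fin n) : extend M i j = M i j := by
  simp [extend]

theorem calls_eq (A : OMvAlgorithm) {n : ℕ} (M : Matrix (Fin n) (Fin n) Bool)
    (v : Fin n → Fin n → Bool) : A.calls M v = (A.start, matInput n (extend M)) ::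
      (List.range n).map fun k => (A.query, vecInput n (extend v k)) := by
  unfold OMvAlgorithm.calls
  congr 1
  · congr 2
    rw [List.flatMap_def, map_finRange _ fun i => (List.range n).map fun j => (extend M i j).toNat,
      ← List.flatMap_def]
    intro i
    exact (map_finRange _ _ fun j => congrArg Bool.toNat (extend_val M i j)).symm
  · refine map_finRange _ _ fun k => ?_
    congr 1
    exact (map_finRange _ _ fun j => by rw [extend_val]).symm

/-- The entry in row `i` and column `y` lies in block `i / b * nb + y / b`, so the blocks together
cover the whole product. -/
theorem doneRows_end {b nb N : ℕ} (hb : 0 < b) (hN : N ≤ nb * b) (M : ℕ → ℕ → Bool) (v : ℕ → Bool)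
    (hv : ∀ j, v j = true → j < N) {i : ℕ} (hi : i < N) :
    doneRows b nb M v (nb * nb) i = true ↔ ∃ j < N, M i j = true ∧ v j = true := by
  simp only [doneRows, decide_eq_true_iff]
  constructor
  · rintro ⟨x, -, -, j, -, h1, h2⟩
    exact ⟨_, hv _ h2, h1, h2⟩
  · rintro ⟨y, hy, h1, h2⟩
    have hi' : i / b < nb := Nat.div_lt_of_lt_mul (by rw [mul_comm]; omega)
    have hy' : y / b < nb := Nat.div_lt_of_lt_mul (by rw [mul_comm]; omega)
    have e1 : (i / b * nb + y / b) / nb = i / b := (session_index hy').1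
    have e2 : (i / b * nb + y / b) % nb = y / b := (session_index hy').2
    have e3 : y / b * b + y % b = y := Nat.div_add_mod' y b
    refine ⟨i / b * nb + y / b, ?_, e1, y % b, Nat.mod_lt _ hb, ?_, ?_⟩
    · calc i / b * nb + y / b < (i / b + 1) * nb := by rw [add_mul]; omega
        _ ≤ nb * nb := Nat.mul_le_mul_right _ hi'
    · rw [e2, e3]; exact h1
    · rw [e2, e3]; exact h2

section
variable {D : Layout} {A : TCAlgorithm} {m : Mode} {ω : ℕ → Bool} {d C e lg T₀ T S W : ℕ}

/-- The bits in stage `k` of batch `g` if all majority votes are right. -/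
noncomputable def Layout.idealBits (D : Layout) (M v : ℕ → ℕ → Bool) (g x k : ℕ) : ℕ → Bool :=
  blockBits D.b D.nb (doneRows D.b D.nb M (v (g * D.b + k)) x) (v (g * D.b + k)) x

/-- All majority votes are right. -/
def Layout.Good (D : Layout) (A : TCAlgorithm) (m : Mode) (M v : ℕ → ℕ → Bool) (ω : ℕ → Bool) :
    Prop :=
  ∀ q < D.N, ∀ x < D.nb * D.nb,
    (D.R < 2 * D.voteCount A m M ω x (D.idealBits M v (q / D.b) x) (q % D.b) D.R ↔
      blockHit D.b D.nb M x (D.idealBits M v (q / D.b) x (q % D.b)))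

theorem Layout.Ready.clear {M : ℕ → ℕ → Bool} {g k : ℕ} {ws : ℕ → ℕ → ℕ → Bool} {h : HState}
    (H : D.Ready A m M ω g k ws h) : D.Ready A m M ω g k ws { h with out := fun _ => 0 } :=
  ⟨H.fixed.of_eq (fun _ _ => rfl) fun _ _ => rfl, H.step, H.gen, H.vec, H.sessions, H.snap, H.stamp⟩

theorem Represents.clear {s : State} {h : HState} (H : Represents s h) :
    Represents { s with out := fun _ => 0 } { h with out := fun _ => 0 } :=
  ⟨H.var, H.arr, rfl, H.coins⟩

theorem Layout.totalTime_le {M : ℕ → ℕ → Bool} (hA : HaltsWithin A D.κ D.b m T₀ T)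
    (ws : ℕ → ℕ → ℕ → Bool) {k : ℕ} (hk : k ≤ D.b) :
    D.totalTime A m M ω ws (fun _ => k) ≤ D.nb * D.nb * D.R * T := by
  refine (Finset.sum_le_card_nsmul _ _ T fun c _ => ?_).trans (by simp)
  exact hA.stagesTime_le _ _ _ hk

theorem Layout.totalTime_zero {M : ℕ → ℕ → Bool} (ws : ℕ → ℕ → ℕ → Bool) :
    D.totalTime A m M ω ws (fun _ => 0) = 0 := by
  refine Finset.sum_eq_zero fun c _ => ?_
  rw [Layout.sessionTime, stagesTime_zero]

/-- A bound for the total time. -/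
def Layout.runTime (D : Layout) (T₀ T : ℕ) : ℕ :=
  D.startTime (T₀ + T) + D.N * D.overhead + (D.N / D.b + 1) * (12 * (D.nb * D.nb * D.R * T))

/-- Induction on the number of remaining vectors. In the time bound a finished batch is charged its
maximal simulation cost, the current one its actual cost so far; at the end of a batch the latter is
moved to the former. If all ideal votes are right, the bits of the current batch are ideal up to the
current stage, which supplies the hypothesis `Layout.Ideal` for the next vector. -/
theorem session_queries (hD : D.Valid) (hA : HaltsWithin A D.κ D.b m T₀ T) (hL : T₀ + T ≤ D.L)
    (hu : A.update.RegsLT D.ρ) (hq : A.query.RegsLT D.ρ) (hS : (queryCmd D.ρ A m).Fits S)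
    (hW : D.B ^ (S + 2) ≤ W) (h8 : 8 ≤ D.B) (hNB : D.N + 2 < D.B) {M v : ℕ → ℕ → Bool}
    (hv : ∀ i j, v i j = true → i < D.N ∧ j < D.N) (p : ℕ) :
    ∀ (q : ℕ) (s : State) (h : HState) (ws : ℕ → ℕ → ℕ → Bool), q + p = D.N → Represents s h →
      h.Bdd D.B → D.Ready A m M ω (q / D.b) (q % D.b) ws h →
      h.time ≤ D.startTime (T₀ + T) + q * D.overhead +
        q / D.b * (12 * (D.nb * D.nb * D.R * T)) + 12 * D.totalTime A m M ω ws (fun _ => q % D.b) →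
      (D.Good A m M v ω → ∀ x < D.nb * D.nb, ∀ k' < q % D.b,
        ws x k' = D.idealBits M v (q / D.b) x k') →
      ∃ rs, Session W ω s ((List.range' q p).map fun k =>
          ((queryCmd D.ρ A m).compile, vecInput D.N (v k))) rs ∧
        (rs.map CallRecord.time).sum + (2 * S + 8) * h.time ≤ (2 * S + 8) * D.runTime T₀ T ∧
        (D.Good A m M v ω → ∀ k r, rs[k]? = some r → ∀ i < D.N,
          (r.out i = if ∃ j < D.N, M i j = true ∧ v (q + k) j = true then 1 else 0)) := by
  induction p with
  | zero =>
    intro q s h ws hqN hs hh H ht hG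
    refine ⟨[], .nil s, ?_, by simp⟩
    obtain rfl : q = D.N := hqN
    have := D.totalTime_le (M := M) (ω := ω) hA ws (Nat.mod_lt D.N hD.b_pos).le
    simp only [List.map_nil, List.sum_nil, zero_add]
    refine Nat.mul_le_mul_left _ ?_
    unfold Layout.runTime
    linarith
  | succ p ih =>
    intro q s h ws hqN hs hh H ht hG
    have hb := hD.b_pos
    set g := q / D.b with hg
    set k := q % D.b with hk
    have hkb : k < D.b := Nat.mod_lt _ hb
    have hgk : g * D.b + k = q := Nat.div_add_mod' q D.b
    have hgq : g ≤ q := Nat.div_le_self _ _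
    have hvec : ∀ j, (vecInput D.N (v q)).getD j 0 = (v q j).toNat := by
      intro j
      rw [vecInput, getD_map_range]
      split_ifs with hj
      · rfl
      · by_cases hvj : v q j = true
        · exact absurd (hv _ _ hvj).2 hj
        · simp [hvj]
    obtain ⟨h', hex, ws', R', t', i'⟩ := wp_query (h := { h with out := fun _ => 0 })
      (inp := vecInput D.N (v q)) (v := v q) hD hA hL hu hq H.clear hkb (by omega)
      (fun j _ => hvec j) (fun j hj => by
        by_contra hvj
        have := (hv q j (by simpa using hvj)).2
        omega) (D.idealBits M v g)
    obtain ⟨t, s', hs1, hs2, hs3⟩ := Cmd.compile_correct (fun i => by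
      rw [hvec]; have := Bool.toNat_le (v q i); omega) h8 hW hS hex ⟨hh.1, hh.2⟩ hs.clear
    have hh' : h'.Bdd D.B := hex.bdd (by omega) ⟨hh.1, hh.2⟩
    have hideal : D.Good A m M v ω → D.Ideal A m M ω (v q) k ws (D.idealBits M v g) := by
      intro hGood
      refine ⟨hG hGood, fun x _ => ?_, fun x hx => hGood q (by omega) x hx⟩
      simp only [Layout.idealBits, hgk]
    have hnext : (q + 1) / D.b = (if k + 1 = D.b then g + 1 else g) ∧
        (q + 1) % D.b = if k + 1 = D.b then 0 else k + 1 := by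
      split_ifs with hc
      · have : q + 1 = (g + 1) * D.b + 0 := by rw [add_mul]; omega
        rw [this]
        exact session_index hb
      · have : q + 1 = g * D.b + (k + 1) := by omega
        rw [this]
        exact session_index (by omega)
    have htime : h'.time ≤ D.startTime (T₀ + T) + (q + 1) * D.overhead +
        (q + 1) / D.b * (12 * (D.nb * D.nb * D.R * T)) +
          12 * D.totalTime A m M ω ws' (fun _ => (q + 1) % D.b) := by
      rw [hnext.1, hnext.2]
      split_ifs with hc
      · have e1 := D.totalTime_le (M := M) (ω := ω) hA ws' (k := k + 1) hkb
        rw [Layout.totalTime_zero]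
        simp only at t'
        linarith
      · simp only at t'
        linarith
    rw [← hnext.1, ← hnext.2] at R'
    obtain ⟨rs, hrs, hsum, hout⟩ := ih (q + 1) s' h' ws' (by omega) hs2 hh' R' htime (by
      intro hGood
      have := (i' (hideal hGood)).1
      rw [hnext.1, hnext.2]
      intro x hx k' hk'
      split_ifs at hk' ⊢ with hc
      · omega
      · exact this x hx k' hk')
    refine ⟨⟨t, s'.out⟩ :: rs, ?_, ?_, ?_⟩
    · rw [List.range'_succ, List.map_cons]
      exact .cons hs1 hrs
    · simp only [List.map_cons, List.sum_cons]
      simp only at hs3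
      omega
    · intro hGood k₁ r hr i hi
      cases k₁ with
      | zero =>
        simp only [List.getElem?_cons_zero, Option.some.injEq] at hr
        subst hr
        have h1 := (i' (hideal hGood)).2 i hi
        have h2 := doneRows_end hb hD.N_le M (v q) (fun j hj => (hv q j hj).2) hi
        simp only [hs2.out, h1, add_zero, ← h2]
        cases doneRows D.b D.nb M (v q) (D.nb * D.nb) i <;> rfl
      | succ k₁ =>
        rw [List.getElem?_cons_succ] at hr
        have := hout hGood k₁ r hr i hi
        rw [this]
        congr 5
        simp [add_assoc, add_comm 1 k₁]

theorem reduction_run (hD : D.Valid) (hZ : D.Sized d C e lg) (hA : HaltsWithin A D.κ D.b m T₀ T)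
    (hL : T₀ + T ≤ D.L) (hu : A.update.RegsLT D.ρ) (hq : A.query.RegsLT D.ρ)
    (hp : A.preprocess.RegsLT D.ρ) (hS₀ : (startCmd D.ρ D.κ d C e A m).Fits S)
    (hS : (queryCmd D.ρ A m).Fits S) {κ' : ℕ} (hW : D.B ^ (S + 2) ≤ (D.N + 2) ^ κ') (h8 : 8 ≤ D.B)
    (hNB : D.N + 2 < D.B) (M : Matrix (Fin D.N) (Fin D.N) Bool) (v : Fin D.N → Fin D.N → Bool) :
    ∃ r₀ rs, (reduction A m D.ρ D.κ d C e).Run κ' M v ω r₀ rs ∧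
      r₀.time + (rs.map CallRecord.time).sum ≤ (2 * S + 8) * D.runTime T₀ T ∧
      (D.Good A m (extend M) (extend v) ω → ∀ (k : Fin D.N) (r : CallRecord),
        rs[(k : ℕ)]? = some r → ∀ i : Fin D.N, r.out i = (boolMulVec M (v k) i).toNat) := by
  have hgetD : ∀ i < D.N, ∀ j < D.N,
      (matInput D.N (extend M)).getD (1 + i * D.N + j) 0 = (extend M i j).toNat := by
    intro i hi j hj
    rw [show 1 + i * D.N + j = (i * D.N + j) + 1 by ring, matInput, List.getD_cons_succ]
    exact getD_flatMap_range D.N D.N (fun i j => (extend M i j).toNat) hi hj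
  have hlt : ∀ i, (matInput D.N (extend M)).getD i 0 < D.B := by
    intro i
    rw [List.getD_eq_getElem?_getD]
    cases hx : (matInput D.N (extend M))[i]? with
    | none => simp; omega
    | some x =>
      have hmem := List.mem_of_getElem? hx
      simp only [matInput, List.mem_cons, List.mem_flatMap, List.mem_map] at hmem
      rcases hmem with rfl | ⟨a, -, c, -, rfl⟩
      · simp; omega
      · have := Bool.toNat_le (extend M a c)
        simp only [Option.getD_some]
        omega
  obtain ⟨h₁, hex, hR, ht⟩ := wp_start (ω := ω) (inp := matInput D.N (extend M)) hD hZ hA hL hu hp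
    rfl hgetD fun i j => extend_lt
  have hb0 : HState.init.Bdd D.B := ⟨fun _ => by simp [HState.init]; omega,
    fun _ _ => by simp [HState.init]; omega⟩
  have hr0 : Represents { State.init with out := fun _ => 0 } HState.init :=
    ⟨fun _ => rfl, fun _ _ => rfl, rfl, rfl⟩
  obtain ⟨t, s', hs1, hs2, hs3⟩ := Cmd.compile_correct hlt h8 hW hS₀ hex hb0 hr0
  have hz : 0 / D.b = 0 ∧ 0 % D.b = 0 := by simp
  obtain ⟨rs, hrs, hsum, hout⟩ := session_queries (ω := ω) hD hA hL hu hq hS hW h8 hNB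
    (M := extend M) (v := extend v) (fun i j => extend_lt) D.N 0 s' h₁ _ (zero_add _) hs2
    (hex.bdd (by omega) hb0) (by rw [hz.1, hz.2]; exact hR) (by rw [hz.1]; omega)
    (by rw [hz.2]; intro _ x _ k' hk'; omega)
  refine ⟨⟨t, s'.out⟩, rs, ?_, ?_, ?_⟩
  · rw [OMvAlgorithm.Run, calls_eq]
    refine .cons hs1 ?_
    rw [List.range_eq_range']
    exact hrs
  · have : HState.init.time = 0 := rfl
    simp only
    omega
  · intro hG k r hr i
    rw [hout hG k r hr i i.2, boolMulVec]
    have : (∃ j < D.N, extend M i j = true ∧ extend v (0 + k) j = true) ↔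
        ∃ j, M i j = true ∧ v k j = true := by
      rw [zero_add]
      constructor
      · rintro ⟨j, hj, h1, h2⟩
        exact ⟨⟨j, hj⟩, (extend_val M i ⟨j, hj⟩).symm.trans h1,
          (extend_val v k ⟨j, hj⟩).symm.trans h2⟩
      · rintro ⟨j, h1, h2⟩
        exact ⟨j, j.2, (extend_val M i j).trans h1, (extend_val v k j).trans h2⟩
    by_cases hc : ∃ j, M i j = true ∧ v k j = true
    · rw [if_pos (this.2 hc)]
      simp only [hc, decide_true, Bool.toNat_true]
    · rw [if_neg (fun hh => hc (this.1 hh))]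
      simp only [hc, decide_false, Bool.toNat_false]

end

/-! ### The probability that all majority votes are right. -/

section
variable {D : Layout} {A : TCAlgorithm} {m : Mode} {ω : ℕ → Bool} {T₀ T x k : ℕ}
  {M : ℕ → ℕ → Bool}

-- The right answer is exactly 1 or 0. In the second case the copies answering 0 form a strict
-- majority and are disjoint from those counted as votes, so the votes stay below one half.
open Classical in
theorem vote_iff_of_majority {w : ℕ → ℕ → Bool}
    (h : D.R < 2 * (Finset.univ.filter fun r : Fin D.R => tape D.R r ω ∈
      {τ | stageAnswer A D.κ D.b m (blockMat D.b D.nb M x) w τ k =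
        if blockHit D.b D.nb M x (w k) then 1 else 0}).card) :
    D.R < 2 * D.voteCount A m M ω x w k D.R ↔ blockHit D.b D.nb M x (w k) := by
  set f : Fin D.R → ℕ := fun r =>
    stageAnswer A D.κ D.b m (blockMat D.b D.nb M x) w (tape D.R r ω) k with hf
  have hv : D.voteCount A m M ω x w k D.R = (Finset.univ.filter fun r => f r = 1).card := by
    rw [Layout.voteCount, Finset.sum_range, Finset.card_filter]
  rw [hv]
  by_cases hc : blockHit D.b D.nb M x (w k)
  · simp only [hc, if_true, iff_true] at h ⊢
    exact h
  · simp only [hc, if_false, iff_false, not_lt] at h ⊢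
    have hdisj : Disjoint (Finset.univ.filter fun r => f r = 0)
        (Finset.univ.filter fun r => f r = 1) := by
      rw [Finset.disjoint_filter]
      intro r _ h1 h2
      omega
    have := Finset.card_le_univ ((Finset.univ.filter fun r => f r = 0) ∪
      (Finset.univ.filter fun r => f r = 1))
    rw [Finset.card_union_of_disjoint hdisj, Fintype.card_fin] at this
    have h' : D.R < 2 * (Finset.univ.filter fun r => f r = 0).card := h
    omega

/-- A union bound over the pairs of a vector and a block. The ideal bits are functions of `M` and
`v` alone, so each pair belongs to an instance fixed in advance; that different pairs share the
tapes is irrelevant for a union bound. -/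
theorem two_thirds_le_good (hD : D.Valid) (hA : HaltsWithin A D.κ D.b m T₀ T)
    (hC : A.Correct m D.κ) (M v : ℕ → ℕ → Bool)
    (hR : ((D.N * (D.nb * D.nb) : ℕ) : ℝ≥0∞) * (17 / 18) ^ D.R ≤ 1 / 3) :
    2 / 3 ≤ coinMeasure {ω | D.Good A m M v ω} := by
  classical
  have hbad : coinMeasure {ω | D.Good A m M v ω}ᶜ ≤ 1 / 3 := by
    refine le_trans ?_ hR
    let S : ℕ × ℕ → Set (ℕ → Bool) := fun p => {τ | stageAnswer A D.κ D.b m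
      (blockMat D.b D.nb M p.2) (D.idealBits M v (p.1 / D.b) p.2) τ (p.1 % D.b) =
        if blockHit D.b D.nb M p.2 (D.idealBits M v (p.1 / D.b) p.2 (p.1 % D.b)) then 1 else 0}
    let E : ℕ × ℕ → Set (ℕ → Bool) := fun p =>
      {ω | 2 * (Finset.univ.filter fun r : Fin D.R => tape D.R r ω ∈ S p).card ≤ D.R}
    have hsub : {ω | D.Good A m M v ω}ᶜ ⊆
        ⋃ p ∈ Finset.range D.N ×ˢ Finset.range (D.nb * D.nb), E p := by
      intro ω hω
      by_contra hh
      refine hω fun q hq x hx => vote_iff_of_majority ?_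
      by_contra hle
      refine hh (Set.mem_biUnion (x := (q, x)) ?_ (not_lt.1 hle))
      simp [hq, hx]
    refine (measure_mono hsub).trans ((measure_biUnion_finset_le _ _).trans ?_)
    refine (Finset.sum_le_card_nsmul _ _ ((17 / 18 : ℝ≥0∞) ^ D.R) fun p _ => ?_).trans ?_
    · have hk : p.1 % D.b < D.b := Nat.mod_lt _ hD.b_pos
      have hS : MeasurableSet (S p) := hA.measurableSet_answer (blockMat D.b D.nb M p.2)
        (D.idealBits M v (p.1 / D.b) p.2) hk
        (if blockHit D.b D.nb M p.2 (D.idealBits M v (p.1 / D.b) p.2 (p.1 % D.b)) then 1 else 0)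
      have hP : 2 / 3 ≤ coinMeasure (S p) := by
        have := stageAnswer_correct hD.b_pos (blockMat D.b D.nb M p.2)
          (D.idealBits M v (p.1 / D.b) p.2) hC hk
        simp only [S, blockHit]
        -- The two `if`s agree up to their decidability instances.
        refine this.trans (measure_mono fun τ hτ => Eq.trans hτ ?_)
        split_ifs with hc
        · exact (if_pos hc).symm
        · exact (if_neg hc).symm
      have := majority_error_le D.R hS hP
      simp only [E]
      refine le_trans (le_of_eq ?_) this
      congr!
    · simp
  have h1 : 1 ≤ coinMeasure {ω | D.Good A m M v ω} + coinMeasure {ω | D.Good A m M v ω}ᶜ := by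
    rw [← measure_univ (μ := coinMeasure), ← Set.union_compl_self {ω | D.Good A m M v ω}]
    exact measure_union_le _ _
  have h3 : (2 / 3 : ℝ≥0∞) + 1 / 3 = 1 := by
    rw [← ENNReal.add_div]
    norm_num
    exact ENNReal.div_self (by norm_num) (by norm_num)
  have h4 : (1 / 3 : ℝ≥0∞) ≠ ⊤ := ENNReal.div_ne_top (by norm_num) (by norm_num)
  exact (ENNReal.add_le_add_iff_right h4).1
    (h3.le.trans (h1.trans (add_le_add_right hbad _)))

end

/-! ### Choice of the sizes and their bounds. -/

/-- The layout used for `N × N` matrices: the blocks have side `N ^ (1 / e)`. -/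
def layoutOf (ρ κ d C e κ₁ N : ℕ) : Layout where
  N := N
  b := Nat.nthRoot e N
  nb := N / Nat.nthRoot e N + 1
  R := 80 * (Nat.log 2 N + 1)
  Z := ρ + 1 + wordBound κ (Nat.nthRoot e N)
  L := (5 * Nat.nthRoot e N) ^ d + d + C * Nat.nthRoot e N ^ 3
  B := (N + 2) ^ κ₁
  ρ := ρ
  κ := κ

/-- An exponent that makes the words large enough. -/
def layoutExponent (ρ κ d C : ℕ) : ℕ := ρ + 4 * κ + (5 ^ d + d + C) + 20

section
variable {ρ κ d C N : ℕ}

theorem nthRoot_pos {e : ℕ} (he : e ≠ 0) (hN : 0 < N) : 0 < Nat.nthRoot e N :=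
  (Nat.le_nthRoot_iff he).2 ((one_pow e).trans_le hN)

theorem nthRoot_le_self {e : ℕ} (he : e ≠ 0) : Nat.nthRoot e N ≤ N :=
  (Nat.le_self_pow he _).trans (Nat.pow_nthRoot_le_iff.2 (Or.inl he))

/-- The length of the tapes compared to a power of the side of the blocks. -/
theorem tapeLength_le {b : ℕ} (hb : 0 < b) (d C : ℕ) :
    (5 * b) ^ d + d + C * b ^ 3 ≤ (5 ^ d + d + C) * b ^ (d + 3) := by
  have h1 : b ^ d ≤ b ^ (d + 3) := Nat.pow_le_pow_right hb (by omega)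
  have h2 : b ^ 3 ≤ b ^ (d + 3) := Nat.pow_le_pow_right hb (by omega)
  have h3 : 1 ≤ b ^ (d + 3) := Nat.one_le_pow _ _ hb
  rw [mul_pow]
  nlinarith [Nat.mul_le_mul_left (5 ^ d) h1, Nat.mul_le_mul_left C h2, Nat.mul_le_mul_left d h3]

/-- Every size is at most a fixed power of `X = N + 2`, because `b ^ (d + 4) ≤ N`; `layoutExponent`
exceeds all exponents that occur. The largest demand is the number of simulated cells, with exponent
`ρ + 4 * κ + 9`. -/
theorem layoutOf_sized (hN : 0 < N) :
    (layoutOf ρ κ d C (d + 4) (layoutExponent ρ κ d C) N).Valid ∧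
    (layoutOf ρ κ d C (d + 4) (layoutExponent ρ κ d C) N).Sized d C (d + 4)
      (Nat.log 2 N + 1) ∧
    8 ≤ (N + 2) ^ layoutExponent ρ κ d C ∧ N + 2 < (N + 2) ^ layoutExponent ρ κ d C := by
  have he : d + 4 ≠ 0 := by omega
  set b := Nat.nthRoot (d + 4) N with hb
  have hb0 : 0 < b := nthRoot_pos he hN
  have hbN : b ≤ N := nthRoot_le_self he
  have hbpow : b ^ (d + 4) ≤ N := Nat.pow_nthRoot_le_iff.2 (Or.inl he)
  have hlog : Nat.log 2 N + 1 ≤ N := Nat.log_lt_self 2 (by omega)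
  have h2log : 2 ^ Nat.log 2 N ≤ N := Nat.pow_log_le_self 2 (by omega)
  obtain ⟨K, hK⟩ : ∃ K, K = 5 ^ d + d + C := ⟨_, rfl⟩
  obtain ⟨κ₁, hκ₁⟩ : ∃ κ₁, κ₁ = layoutExponent ρ κ d C := ⟨_, rfl⟩
  have hκ : κ₁ = ρ + 4 * κ + K + 20 := by rw [hκ₁, hK, layoutExponent]
  rw [← hκ₁]
  obtain ⟨X, hX⟩ : ∃ X, X = N + 2 := ⟨_, rfl⟩
  rw [← hX]
  have hX3 : 3 ≤ X := by omega
  have hp : ∀ c, c < X ^ c := fun c => c.lt_pow_self (by omega)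
  have hlt : ∀ {x} (i : ℕ), x ≤ X ^ i → i < κ₁ → x < X ^ κ₁ := fun i h hi =>
    h.trans_lt (Nat.pow_lt_pow_right (by omega) hi)
  have hmul : ∀ {x y : ℕ} (i j : ℕ), x ≤ X ^ i → y ≤ X ^ j → x * y ≤ X ^ (i + j) := fun i j h h' =>
    (Nat.mul_le_mul h h').trans (pow_add X i j).ge
  have hle : ∀ {x} (i : ℕ), 0 < i → x ≤ X → x ≤ X ^ i := fun i hi h =>
    h.trans (Nat.le_self_pow hi.ne' X)
  have h3 : 27 ≤ X ^ 3 := (Nat.pow_le_pow_left hX3 3)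
  -- This absorbs the factor 80 in the number of copies.
  have h4 : 81 ≤ X ^ 4 := (Nat.pow_le_pow_left hX3 4)
  have hnb : N / b + 1 ≤ X ^ 1 := by
    have := Nat.div_le_self N b
    rw [pow_one]; omega
  have hR : 80 * (Nat.log 2 N + 1) ≤ X ^ 5 := hmul 4 1 (by omega) (by rw [pow_one]; omega)
  have hb1 : b ≤ X ^ 1 := by rw [pow_one]; omega
  have hbb : b * b ≤ X ^ 2 := hmul 1 1 hb1 hb1
  have h2 : 9 ≤ X ^ 2 := Nat.pow_le_pow_left hX3 2
  have h1 : X ≤ X ^ 2 := Nat.le_self_pow (by omega) X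
  have h24 : 9 * X ^ 2 ≤ X ^ 4 := (Nat.mul_le_mul_right _ h2).trans (pow_add X 2 2).ge
  have hword : wordBound κ b ≤ X ^ (4 * κ) := by
    rw [wordBound, pow_mul]
    refine Nat.pow_le_pow_left ?_ κ
    omega
  have hZ : ρ + 1 + wordBound κ b ≤ X ^ (ρ + 4 * κ + 2) := by
    have h1 : ρ + 1 ≤ X ^ (ρ + 1 + 4 * κ) :=
      (hp (ρ + 1)).le.trans (Nat.pow_le_pow_right (by omega) (by omega))
    have h2 : X ^ (4 * κ) ≤ X ^ (ρ + 1 + 4 * κ) := Nat.pow_le_pow_right (by omega) (by omega)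
    have h3 : X ^ (ρ + 4 * κ + 2) = X ^ (ρ + 1 + 4 * κ) * X := by ring
    rw [h3]
    nlinarith
  have hL : (5 * b) ^ d + d + C * b ^ 3 ≤ X ^ (K + 1) := by
    refine (tapeLength_le hb0 d C).trans (hK ▸ hmul K 1 (hp K).le ?_)
    rw [pow_one]
    exact (Nat.pow_le_pow_right hb0 (by omega)).trans (hbpow.trans (by omega))
  have hP : (N / b + 1) * b ≤ X ^ 2 := hmul 1 1 hnb hb1
  refine ⟨⟨?_, ?_, ?_, ?_, ?_, ?_, ?_, ?_, ?_, ?_, ?_⟩,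
    ⟨?_, ?_, ?_, ?_, ?_, ?_, ?_, ?_, ?_, ?_, ?_, ?_⟩, ?_, ?_⟩ <;>
    try simp only [layoutOf, ← hb, ← hX]
  · exact hb0
  · exact Nat.succ_pos _
  · exact (Nat.lt_div_mul_add hb0).le.trans (by rw [add_mul, one_mul])
  · exact le_rfl
  · exact (hlt _ (hmul _ _ (hmul _ _ (hmul _ _ hnb hnb) hR) hZ) (by omega)).le
  · exact hlt _ (hmul _ _ hL hR) (by omega)
  · exact hlt _ hL (by omega)
  · exact hlt _ (hmul _ _ hP hP) (by omega)
  · exact hlt _ (hmul 3 1 (by omega) hb1) (by omega)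
  · exact hlt _ (hmul 1 5 (by rw [pow_one]; omega) hR) (by omega)
  · exact hlt 1 (by rw [pow_one]; omega) (by omega)
  · exact hN
  · intro s
    rw [← Nat.nthRoot_lt_iff he, Nat.lt_succ_iff]
  · exact hbN
  · intro s
    rw [← Nat.log_lt_iff_lt_pow (by omega) (by omega), Nat.lt_iff_add_one_le]
  · exact hlog
  · refine hlt 2 ?_ (by omega)
    rw [pow_succ, pow_two]
    exact Nat.mul_le_mul (by omega) (by omega)
  · exact hlt _ hZ (by omega)
  · exact hlt 4 (by omega) (by omega)
  · exact (hlt 3 (by omega) (by omega)).le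
  · exact hlt 1 (by rw [pow_one]) (by omega)

/-- With `l = log₂ N + 1` there are at most `8 ^ l` votes. The constant 80 is chosen so that `(17 /
18) ^ 80 ≤ 1 / 24`, which leaves a failure probability of at most `(1 / 3) ^ l`. -/
theorem failure_le {b : ℕ} :
    ((N * ((N / b + 1) * (N / b + 1)) : ℕ) : ENNReal) * (17 / 18) ^ (80 * (Nat.log 2 N + 1)) ≤
      1 / 3 := by
  have hlog : N < 2 ^ (Nat.log 2 N + 1) := Nat.lt_pow_succ_log_self (by omega) N
  set l := Nat.log 2 N + 1 with hl
  have hl1 : 1 ≤ l := by omega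
  have hnb : N / b + 1 ≤ 2 ^ l := (Nat.div_le_self N b).trans_lt hlog
  have h8 : N * ((N / b + 1) * (N / b + 1)) ≤ 8 ^ l := by
    refine (Nat.mul_le_mul hlog.le (Nat.mul_le_mul hnb hnb)).trans (le_of_eq ?_)
    rw [← mul_pow, ← mul_pow]
    norm_num
  have hq : (17 / 18 : NNReal) ^ 80 ≤ 1 / 24 := by
    rw [← NNReal.coe_le_coe]
    push_cast
    norm_num
  have key : ((N * ((N / b + 1) * (N / b + 1)) : ℕ) : NNReal) * (17 / 18) ^ (80 * l) ≤ 1 / 3 := by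
    calc ((N * ((N / b + 1) * (N / b + 1)) : ℕ) : NNReal) * (17 / 18) ^ (80 * l)
        ≤ ((8 ^ l : ℕ) : NNReal) * (1 / 24) ^ l := by
          rw [pow_mul]
          gcongr
      _ = (1 / 3) ^ l := by
          push_cast
          rw [← mul_pow]
          congr 1
          rw [← NNReal.coe_inj]; push_cast; norm_num
      _ ≤ 1 / 3 := pow_le_of_le_one (by positivity) (by
          rw [← NNReal.coe_le_coe]; push_cast; norm_num) (by omega)
  have := ENNReal.coe_le_coe.2 key
  push_cast [ENNReal.coe_div] at this ⊢
  convert this using 2; norm_num [ENNReal.coe_div]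

end

/-! ### The total running time. -/

section
variable {ρ κ d C N : ℕ}

/-- Bounding `b` times the time of the start by `N ^ 3 * R`, up to a constant, means a saving of a
factor `b`. Preprocessing and coin tossing fit because `b` times the tape length is at most `K * N`;
this is what the exponent `d + 4` of the root provides. -/
theorem startTime_arith {b nb R K L T : ℕ} (hN : 0 < N) (hR : 0 < R) (hbN : b ≤ N)
    (hnN : nb ≤ 2 * N) (hP : nb * b ≤ 2 * N) (hLb : b * L ≤ K * N) (hbT : b * T ≤ K * N) :
    b * (10 * N + 5 * (L * R) + N * (3 * N + 4) +
      nb * nb * (R * (12 * T + 43 * (b * b) + 22) + 4) + 40) ≤ (333 + 53 * K) * (N ^ 3 * R) := by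
  obtain ⟨Q, hQ⟩ : ∃ Q, Q = N ^ 3 * R := ⟨_, rfl⟩
  rw [← hQ]
  have hNN : N ^ 3 ≤ Q := by rw [hQ]; exact Nat.le_mul_of_pos_right _ hR
  have hNN2 : N ^ 2 ≤ N ^ 3 := Nat.pow_le_pow_right hN (by omega)
  have hNN1 : N ≤ N ^ 2 := Nat.le_self_pow (by omega) N
  have s1 : b * (10 * N) ≤ 10 * Q := by
    calc b * (10 * N) ≤ N * (10 * N) := by gcongr
      _ = 10 * N ^ 2 := by ring
      _ ≤ 10 * Q := by gcongr; omega
  have s2 : b * (5 * (L * R)) ≤ 5 * K * Q := by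
    calc b * (5 * (L * R)) = 5 * ((b * L) * R) := by ring
      _ ≤ 5 * ((K * N) * R) := by gcongr
      _ ≤ 5 * ((K * N ^ 3) * R) := by gcongr; omega
      _ = 5 * K * Q := by rw [hQ]; ring
  have s3 : b * (N * (3 * N + 4)) ≤ 7 * Q := by
    calc b * (N * (3 * N + 4)) ≤ N * (N * (3 * N + 4 * N)) := by gcongr; omega
      _ = 7 * N ^ 3 := by ring
      _ ≤ 7 * Q := by gcongr
  have s4 : b * (nb * nb * (R * (12 * T))) ≤ 48 * K * Q := by
    calc b * (nb * nb * (R * (12 * T))) = nb * nb * (R * (12 * (b * T))) := by ring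
      _ ≤ (2 * N) * (2 * N) * (R * (12 * (K * N))) := by gcongr
      _ = 48 * K * Q := by rw [hQ]; ring
  have s5 : b * (nb * nb * (R * (43 * (b * b)))) ≤ 172 * Q := by
    calc b * (nb * nb * (R * (43 * (b * b)))) = 43 * ((nb * b) * (nb * b) * b * R) := by ring
      _ ≤ 43 * ((2 * N) * (2 * N) * N * R) := by gcongr
      _ = 172 * Q := by rw [hQ]; ring
  have s6 : b * (nb * nb * (R * 22)) ≤ 88 * Q := by
    calc b * (nb * nb * (R * 22)) = 22 * ((nb * b) * nb * R) := by ring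
      _ ≤ 22 * ((2 * N) * (2 * N) * R) := by gcongr
      _ = 88 * (N ^ 2 * R) := by ring
      _ ≤ 88 * (N ^ 3 * R) := by gcongr
      _ = 88 * Q := by rw [hQ]
  have s7 : b * (nb * nb * 4) ≤ 16 * Q := by
    calc b * (nb * nb * 4) = 4 * ((nb * b) * nb) := by ring
      _ ≤ 4 * ((2 * N) * (2 * N)) := by gcongr
      _ = 16 * N ^ 2 := by ring
      _ ≤ 16 * Q := by gcongr; omega
  have s8 : b * 40 ≤ 40 * Q := by omega
  calc _ = b * (10 * N) + b * (5 * (L * R)) + b * (N * (3 * N + 4)) +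
        b * (nb * nb * (R * (12 * T))) + b * (nb * nb * (R * (43 * (b * b)))) +
        b * (nb * nb * (R * 22)) + b * (nb * nb * 4) + b * 40 := by ring
    _ ≤ 10 * Q + 5 * K * Q + 7 * Q + 48 * K * Q + 172 * Q + 88 * Q + 16 * Q + 40 * Q := by
      gcongr
    _ = _ := by ring

/-- The scans cost `O(N * b ^ 2)` per vector. Over all vectors and multiplied by `b` this is `O(N ^
2 * b ^ 3)`, which is cubic in `N` because `b ^ 3 ≤ N`. -/
theorem overhead_arith {b nb R : ℕ} (hN : 0 < N) (hR : 0 < R) (hb0 : 0 < b) (hbN : b ≤ N)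
    (hb3 : b * b * b ≤ N) (hnN : nb ≤ 2 * N) (hP : nb * b ≤ 2 * N) :
    b * (N * (6 * N + 3 * (nb * b) + nb * b * (b * (4 * b + 4) + 10) +
      nb * nb * (R * (48 * b + 22) + 12) + 30)) ≤ 406 * (N ^ 3 * R) := by
  obtain ⟨Q, hQ⟩ : ∃ Q, Q = N ^ 3 * R := ⟨_, rfl⟩
  rw [← hQ]
  have hNN : N ^ 3 ≤ Q := by rw [hQ]; exact Nat.le_mul_of_pos_right _ hR
  have hNN2 : N ^ 2 ≤ N ^ 3 := Nat.pow_le_pow_right hN (by omega)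
  have hNN1 : N ≤ N ^ 2 := Nat.le_self_pow (by omega) N
  have o1 : b * (N * (6 * N)) ≤ 6 * Q := by
    calc b * (N * (6 * N)) ≤ N * (N * (6 * N)) := by gcongr
      _ = 6 * N ^ 3 := by ring
      _ ≤ 6 * Q := by gcongr
  have o2 : b * (N * (3 * (nb * b))) ≤ 6 * Q := by
    calc b * (N * (3 * (nb * b))) ≤ N * (N * (3 * (2 * N))) := by gcongr
      _ = 6 * N ^ 3 := by ring
      _ ≤ 6 * Q := by gcongr
  have o3 : b * (N * (nb * b * (b * (4 * b + 4) + 10))) ≤ 36 * Q := by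
    calc b * (N * (nb * b * (b * (4 * b + 4) + 10)))
        = N * (nb * b) * (4 * (b * b * b) + 4 * (b * b) + 10 * b) := by ring
      _ ≤ N * (2 * N) * (4 * N + 4 * N + 10 * N) := by
          gcongr
          exact (Nat.le_mul_of_pos_right _ hb0).trans hb3
      _ = 36 * N ^ 3 := by ring
      _ ≤ 36 * Q := by gcongr
  have o4 : b * (N * (nb * nb * (R * (48 * b)))) ≤ 192 * Q := by
    calc b * (N * (nb * nb * (R * (48 * b)))) = 48 * (N * (nb * b) * (nb * b) * R) := by ring
      _ ≤ 48 * (N * (2 * N) * (2 * N) * R) := by gcongr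
      _ = 192 * Q := by rw [hQ]; ring
  have o5 : b * (N * (nb * nb * (R * 22))) ≤ 88 * Q := by
    calc b * (N * (nb * nb * (R * 22))) = 22 * (N * (nb * b) * nb * R) := by ring
      _ ≤ 22 * (N * (2 * N) * (2 * N) * R) := by gcongr
      _ = 88 * Q := by rw [hQ]; ring
  have o6 : b * (N * (nb * nb * 12)) ≤ 48 * Q := by
    calc b * (N * (nb * nb * 12)) = 12 * (N * (nb * b) * nb) := by ring
      _ ≤ 12 * (N * (2 * N) * (2 * N)) := by gcongr
      _ = 48 * N ^ 3 := by ring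
      _ ≤ 48 * Q := by gcongr
  have o7 : b * (N * 30) ≤ 30 * Q := by
    calc b * (N * 30) ≤ N * (N * 30) := by gcongr
      _ = 30 * N ^ 2 := by ring
      _ ≤ 30 * Q := by gcongr; omega
  calc _ = b * (N * (6 * N)) + b * (N * (3 * (nb * b))) +
        b * (N * (nb * b * (b * (4 * b + 4) + 10))) + b * (N * (nb * nb * (R * (48 * b)))) +
        b * (N * (nb * nb * (R * 22))) + b * (N * (nb * nb * 12)) + b * (N * 30) := by ring
    _ ≤ 6 * Q + 6 * Q + 36 * Q + 192 * Q + 88 * Q + 48 * Q + 30 * Q := by gcongr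
    _ = _ := by ring

/-- The side of the blocks times the part of the time that does not depend on the time of the
simulated algorithm. -/
theorem layoutOf_overhead_le (hN : 0 < N) {T : ℕ}
    (hT : T ≤ (layoutOf ρ κ d C (d + 4) (layoutExponent ρ κ d C) N).L) :
    Nat.nthRoot (d + 4) N *
      ((layoutOf ρ κ d C (d + 4) (layoutExponent ρ κ d C) N).startTime T +
        N * (layoutOf ρ κ d C (d + 4) (layoutExponent ρ κ d C) N).overhead) ≤
      (1000 + 100 * (5 ^ d + d + C)) * (N ^ 3 * (80 * (Nat.log 2 N + 1))) := by
  have he : d + 4 ≠ 0 := by omega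
  simp only [layoutOf, Layout.startTime, Layout.overhead] at hT ⊢
  set b := Nat.nthRoot (d + 4) N with hb
  set K := 5 ^ d + d + C with hK
  set L := (5 * b) ^ d + d + C * b ^ 3 with hL
  set nb := N / b + 1 with hnb
  obtain ⟨R, hR⟩ : ∃ R, R = 80 * (Nat.log 2 N + 1) := ⟨_, rfl⟩
  rw [← hR]
  have hR1 : 1 ≤ R := by omega
  have hb0 : 0 < b := nthRoot_pos he hN
  have hbN : b ≤ N := nthRoot_le_self he
  have hbpow : b ^ (d + 4) ≤ N := Nat.pow_nthRoot_le_iff.2 (Or.inl he)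
  have hb4 : b ^ 4 ≤ N := (Nat.pow_le_pow_right hb0 (by omega)).trans hbpow
  have hLb : b * L ≤ K * N := by
    calc b * L ≤ b * (K * b ^ (d + 3)) := Nat.mul_le_mul_left b (tapeLength_le hb0 d C)
      _ = K * b ^ (d + 4) := by ring
      _ ≤ K * N := Nat.mul_le_mul_left K hbpow
  have hP : nb * b ≤ 2 * N := by
    have := Nat.div_mul_le_self N b
    rw [hnb, add_mul, one_mul]
    omega
  have hnN : nb ≤ 2 * N := (Nat.le_mul_of_pos_right nb hb0).trans hP
  have hb3 : b * b * b ≤ N := (Nat.le_mul_of_pos_right _ hb0).trans (le_trans (by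
    rw [pow_succ, pow_succ, pow_two]) hb4)
  have hbT : b * T ≤ K * N := (Nat.mul_le_mul_left b hT).trans hLb
  have h1 := startTime_arith hN hR1 hbN hnN hP hLb hbT
  have h2 := overhead_arith hN hR1 hb0 hbN hb3 hnN hP
  rw [mul_add]
  refine (Nat.add_le_add h1 h2).trans ?_
  rw [← add_mul]
  exact Nat.mul_le_mul_right _ (by omega)

theorem logFactor_le {δ : ℝ} (hδ : 0 < δ) (hN : 0 < N) :
    ((Nat.log 2 N + 1 : ℕ) : ℝ) ≤ (2 / δ + 1) * (N : ℝ) ^ δ := by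
  have h1 : (1 : ℝ) ≤ N := by exact_mod_cast hN
  have h2 : ((Nat.log 2 N : ℕ) : ℝ) ≤ Real.log N / Real.log 2 := Real.natLog_le_logb N 2
  have h3 : Real.log N ≤ (N : ℝ) ^ δ / δ := Real.log_le_rpow_div (by linarith) hδ
  have h4 : Real.log N / Real.log 2 ≤ 2 * Real.log N := by
    have := Real.log_two_gt_d9
    rw [div_le_iff₀ (by linarith)]
    nlinarith [Real.log_nonneg h1]
  have h5 : (1 : ℝ) ≤ (N : ℝ) ^ δ := Real.one_le_rpow h1 hδ.le
  push_cast
  have h6 : (2 / δ + 1) * (N : ℝ) ^ δ = 2 * ((N : ℝ) ^ δ / δ) + (N : ℝ) ^ δ := by ring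
  rw [h6]
  linarith

/-- Rounding the root down loses at most a factor 2, since `N < (b + 1) ^ e ≤ (2 * b) ^ e`. -/
theorem nthRoot_rpow_neg_le {e : ℕ} (he : e ≠ 0) {ε : ℝ} (hε : 0 ≤ ε) (hε1 : ε ≤ 1) (hN : 0 < N) :
    ((Nat.nthRoot e N : ℕ) : ℝ) ^ (-ε) ≤ 2 * (N : ℝ) ^ (-(ε / e)) := by
  have hb0 : 0 < Nat.nthRoot e N := nthRoot_pos he hN
  have hlt := Nat.lt_pow_nthRoot_add_one he N
  set b := Nat.nthRoot e N with hb
  have hb' : (0 : ℝ) < b := by exact_mod_cast hb0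
  have hN' : (0 : ℝ) < N := by exact_mod_cast hN
  have h1 : (N : ℝ) ≤ (2 * b) ^ e := by
    have : N ≤ (2 * b) ^ e := hlt.le.trans (Nat.pow_le_pow_left (by omega) e)
    exact_mod_cast this
  have h2 : (N : ℝ) ^ (ε / e) ≤ (2 * b) ^ ε := by
    calc (N : ℝ) ^ (ε / e) ≤ ((2 * b) ^ e) ^ (ε / e) :=
          Real.rpow_le_rpow hN'.le h1 (by positivity)
      _ = (2 * b) ^ ε := by
          rw [← Real.rpow_natCast, ← Real.rpow_mul (by positivity)]
          congr 1
          field_simp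
  have h3 : (2 * (b : ℝ)) ^ ε ≤ 2 * (b : ℝ) ^ ε := by
    rw [Real.mul_rpow (by norm_num) hb'.le]
    gcongr
    calc (2 : ℝ) ^ ε ≤ 2 ^ (1 : ℝ) := Real.rpow_le_rpow_of_exponent_le (by norm_num) hε1
      _ = 2 := Real.rpow_one 2
  rw [Real.rpow_neg hb'.le, Real.rpow_neg hN'.le, inv_le_iff_one_le_mul₀ (by positivity)]
  have h4 : (0 : ℝ) < (N : ℝ) ^ (ε / e) := by positivity
  rw [show 2 * ((N : ℝ) ^ (ε / e))⁻¹ * (b : ℝ) ^ ε = (2 * (b : ℝ) ^ ε) / (N : ℝ) ^ (ε / e) by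
    field_simp, le_div_iff₀ h4, one_mul]
  exact h2.trans h3

/-- All contributions are `O(N ^ 3 * log N * b ^ (-ε))`, and `b ^ (-ε)` is `O(N ^ (-2 * δ))`. One
factor `N ^ δ` of this saving is spent on the logarithm, the other remains. -/
theorem layoutOf_runTime_le {c ε : ℝ} (hε : 0 < ε) (hε1 : ε ≤ 1) (hc : 0 ≤ c) :
    ∃ K : ℝ, ∀ N : ℕ, 0 < N → ∀ T₀ T : ℕ,
      T₀ + T ≤ (layoutOf ρ κ d C (d + 4) (layoutExponent ρ κ d C) N).L →
      (T : ℝ) ≤ c * ((Nat.nthRoot (d + 4) N : ℕ) : ℝ) ^ (3 - ε) →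
      ((layoutOf ρ κ d C (d + 4) (layoutExponent ρ κ d C) N).runTime T₀ T : ℝ) ≤
        K * (N : ℝ) ^ (3 - ε / (2 * (d + 4))) := by
  set δ : ℝ := ε / (2 * (d + 4)) with hδ
  have hδ0 : 0 < δ := by positivity
  -- The number 96 is `12 * 2 ^ 3`, from the cost of simulation and `nb * b ≤ 2 * N`; 160 combines
  -- the 80 of the number of copies with the 2 of `nthRoot_rpow_neg_le`.
  refine ⟨((1000 + 100 * (5 ^ d + d + C) + 96 * c) * 160) * (2 / δ + 1), fun N hN T₀ T hT hTc => ?_⟩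
  have he : d + 4 ≠ 0 := by omega
  have h1 := layoutOf_overhead_le hN hT
  have h2 := nthRoot_rpow_neg_le (N := N) he hε.le hε1 hN
  have h3 := logFactor_le (N := N) hδ0 hN
  have hb0 : 0 < Nat.nthRoot (d + 4) N := nthRoot_pos he hN
  have hbN : Nat.nthRoot (d + 4) N ≤ N := nthRoot_le_self he
  rw [Layout.runTime]
  simp only [show (layoutOf ρ κ d C (d + 4) (layoutExponent ρ κ d C) N).N = N from rfl,
    show (layoutOf ρ κ d C (d + 4) (layoutExponent ρ κ d C) N).b = Nat.nthRoot (d + 4) N from rfl,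
    show (layoutOf ρ κ d C (d + 4) (layoutExponent ρ κ d C) N).nb =
      N / Nat.nthRoot (d + 4) N + 1 from rfl,
    show (layoutOf ρ κ d C (d + 4) (layoutExponent ρ κ d C) N).R =
      80 * (Nat.log 2 N + 1) from rfl]
  set Y := (layoutOf ρ κ d C (d + 4) (layoutExponent ρ κ d C) N).startTime (T₀ + T) +
    N * (layoutOf ρ κ d C (d + 4) (layoutExponent ρ κ d C) N).overhead with hY
  set b := Nat.nthRoot (d + 4) N with hb
  set l := Nat.log 2 N + 1 with hl
  have hP : (N / b + 1) * b ≤ 2 * N := by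
    have := Nat.div_mul_le_self N b
    rw [add_mul, one_mul]
    omega
  set nb := N / b + 1 with hnb
  have hb' : (0 : ℝ) < b := by exact_mod_cast hb0
  have hb1 : (1 : ℝ) ≤ b := by exact_mod_cast hb0
  have hN' : (0 : ℝ) < N := by exact_mod_cast hN
  -- The start and the overhead even save a full factor `b`; as `ε ≤ 1`, this is weakened to the
  -- saving of the simulation.
  have hinv : (b : ℝ)⁻¹ ≤ (b : ℝ) ^ (-ε) := by
    rw [← Real.rpow_neg_one]
    exact Real.rpow_le_rpow_of_exponent_le hb1 (by linarith)
  have hYr : (Y : ℝ) ≤ (1000 + 100 * (5 ^ d + d + C)) * (N ^ 3 * (80 * l)) * (b : ℝ) ^ (-ε) := by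
    have h1' : (b : ℝ) * Y ≤ (1000 + 100 * (5 ^ d + d + C)) * (N ^ 3 * (80 * l)) := by
      exact_mod_cast h1
    have : (Y : ℝ) ≤ (1000 + 100 * (5 ^ d + d + C)) * (N ^ 3 * (80 * l)) * (b : ℝ)⁻¹ := by
      rw [le_mul_inv_iff₀ hb']
      linarith
    exact this.trans (by gcongr)
  have hPr : (nb : ℝ) * b ≤ 2 * N := by exact_mod_cast hP
  have hZr : (nb : ℝ) * (12 * (nb * nb * (80 * l) * T)) ≤
      96 * c * (N ^ 3 * (80 * l)) * (b : ℝ) ^ (-ε) := by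
    have hpow : (b : ℝ) ^ (3 - ε) = b ^ 3 * (b : ℝ) ^ (-ε) := by
      rw [sub_eq_add_neg, Real.rpow_add hb']
      norm_cast
    rw [hpow] at hTc
    calc (nb : ℝ) * (12 * (nb * nb * (80 * l) * T))
        ≤ nb * (12 * (nb * nb * (80 * l) * (c * (b ^ 3 * (b : ℝ) ^ (-ε))))) := by gcongr
      _ = 12 * c * (((nb : ℝ) * b) ^ 3 * (80 * l)) * (b : ℝ) ^ (-ε) := by ring
      _ ≤ 12 * c * ((2 * N : ℝ) ^ 3 * (80 * l)) * (b : ℝ) ^ (-ε) := by gcongr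
      _ = _ := by ring
  push_cast
  have hexp : (N : ℝ) ^ 3 * (N : ℝ) ^ δ * (N : ℝ) ^ (-(ε / (d + 4 : ℕ))) = (N : ℝ) ^ (3 - δ) := by
    have : (N : ℝ) ^ 3 = (N : ℝ) ^ (3 : ℝ) := by norm_cast
    rw [this, ← Real.rpow_add hN', ← Real.rpow_add hN']
    congr 1
    rw [hδ]
    push_cast
    field_simp
    ring
  calc (Y : ℝ) + nb * (12 * (nb * nb * (80 * l) * T))
      ≤ (1000 + 100 * (5 ^ d + d + C) + 96 * c) * (N ^ 3 * (80 * l)) * (b : ℝ) ^ (-ε) := by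
        linarith
    _ ≤ (1000 + 100 * (5 ^ d + d + C) + 96 * c) * (N ^ 3 * (80 * ((2 / δ + 1) * (N : ℝ) ^ δ))) *
        (2 * (N : ℝ) ^ (-(ε / (d + 4 : ℕ)))) := by gcongr
    _ = ((1000 + 100 * (5 ^ d + d + C) + 96 * c) * 160) * (2 / δ + 1) *
        ((N : ℝ) ^ 3 * (N : ℝ) ^ δ * (N : ℝ) ^ (-(ε / (d + 4 : ℕ)))) := by ring
    _ = _ := by rw [hexp]

end

/-! ### Assembly of the reduction. -/

section
variable {A : TCAlgorithm} {m : Mode} {κ d : ℕ} {C C' ε ε' : ℝ}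

/-- Both bases, `n` and `1 + η`, are at least 1, so lowering the exponent's saving enlarges the
bound. This permits the assumptions `0 ≤ C` and `ε ≤ 1 / 2` in the reduction. -/
theorem allowedTime_mono {n : ℕ} (hn : 0 < n) (I : Instance n) (r : Request n) (hC : C ≤ C')
    (hC' : 0 ≤ C') (hε : ε' ≤ ε) : allowedTime C ε I r ≤ allowedTime C' ε' I r := by
  have key : ∀ {x : ℝ} (a : ℝ), 1 ≤ x → C * x ^ (a - ε) ≤ C' * x ^ (a - ε') := fun a hx =>
    mul_le_mul hC (Real.rpow_le_rpow_of_exponent_le hx (by linarith)) (by positivity) hC'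
  cases r with
  | update e => exact key 1 (by exact_mod_cast hn)
  | query s t => exact key 2 (by linarith [Nat.cast_nonneg (α := ℝ) I.etaInf])

theorem TCAlgorithm.AmortizedTimeBound.mono (h : A.AmortizedTimeBound κ d C ε) (hC : C ≤ C')
    (hC' : 0 ≤ C') (hε : ε' ≤ ε) : A.AmortizedTimeBound κ d C' ε' := by
  intro n hn I ω
  obtain ⟨r₀, rs, hrun, h₀, hsum⟩ := h n hn I ω
  exact ⟨r₀, rs, hrun, h₀, hsum.trans
    (List.sum_le_sum fun r _ => allowedTime_mono hn I r hC hC' hε)⟩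

theorem Session.length_eq {W : ℕ} {ω : ℕ → Bool} {s : State} {calls : List (Prog × List ℕ)}
    {rs : List CallRecord} (h : Session W ω s calls rs) : rs.length = calls.length := by
  induction h with
  | nil => rfl
  | cons _ _ ih => simp [ih]

theorem sum_time_le_of_zip {α : Type*} (f : α → ℝ) : ∀ (l : List α) (rs : List CallRecord),
    rs.length = l.length → (∀ p ∈ l.zip rs, (p.2.time : ℝ) ≤ f p.1) →
    (((rs.map CallRecord.time).sum : ℕ) : ℝ) ≤ (l.map f).sum
  | [], [], _, _ => by simp
  | a :: l, r :: rs, hlen, h => by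
    have h1 := h (a, r) (by simp)
    have h2 := sum_time_le_of_zip f l rs (by simpa using hlen) fun p hp => h p (by simp [hp])
    simp only [List.map_cons, List.sum_cons, Nat.cast_add]
    linarith

theorem TCAlgorithm.WorstCaseTimeBound.amortized (h : A.WorstCaseTimeBound κ d C ε) :
    A.AmortizedTimeBound κ d C ε := by
  intro n hn I ω
  obtain ⟨r₀, rs, hrun, h₀, hr⟩ := h n hn I ω
  refine ⟨r₀, rs, hrun, h₀, sum_time_le_of_zip _ _ _ ?_ hr⟩
  have := Session.length_eq hrun
  simpa [TCAlgorithm.calls] using this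

theorem exists_omvAlgorithm (hA : A.Correct m κ) (hT : A.AmortizedTimeBound κ d C ε) (hC : 0 ≤ C)
    (hε : 0 < ε) (hε' : ε ≤ 1 / 2) :
    ∃ (A' : OMvAlgorithm) (κ' : ℕ) (K : ℝ), A'.Correct κ' ∧
      A'.TimeBound κ' K (ε / (2 * (d + 4))) := by
  obtain ⟨ρ₁, hp⟩ := A.preprocess.exists_regsLT
  obtain ⟨ρ₂, hu⟩ := A.update.exists_regsLT
  obtain ⟨ρ₃, hq⟩ := A.query.exists_regsLT
  set ρ := ρ₁ + ρ₂ + ρ₃ with hρ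
  replace hp : A.preprocess.RegsLT ρ := hp.mono (by omega)
  replace hu : A.update.RegsLT ρ := hu.mono (by omega)
  replace hq : A.query.RegsLT ρ := hq.mono (by omega)
  -- The reduction never computes the real bound `24 * C * b ^ (3 - ε)`. The literal `c` gives the
  -- integer bound `c * b ^ 3` for the tape length; the sharper bound enters only the analysis.
  set c := ⌈24 * C⌉₊ with hc
  obtain ⟨S₁, hS₁⟩ := (startCmd ρ κ d c (d + 4) A m).exists_fits
  obtain ⟨S₂, hS₂⟩ := (queryCmd ρ A m).exists_fits
  replace hS₁ := hS₁.mono (Nat.le_add_right S₁ S₂)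
  replace hS₂ := hS₂.mono (Nat.le_add_left S₂ S₁)
  set S := S₁ + S₂ with hS
  set κ₁ := layoutExponent ρ κ d c with hκ₁
  obtain ⟨K, hK⟩ := layoutOf_runTime_le (ρ := ρ) (κ := κ) (d := d) (C := c) (c := 24 * C) hε
    (by linarith) (by positivity)
  have main : ∀ N : ℕ, 0 < N → ∃ T : ℕ,
      HaltsWithin A κ (Nat.nthRoot (d + 4) N) m ((5 * Nat.nthRoot (d + 4) N) ^ d + d) T ∧
      ((5 * Nat.nthRoot (d + 4) N) ^ d + d) + T ≤ (layoutOf ρ κ d c (d + 4) κ₁ N).L ∧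
      (T : ℝ) ≤ 24 * C * ((Nat.nthRoot (d + 4) N : ℕ) : ℝ) ^ (3 - ε) := by
    intro N hN
    have hb := nthRoot_pos (e := d + 4) (by omega) hN
    have hb1 : (1 : ℝ) ≤ (Nat.nthRoot (d + 4) N : ℕ) := by exact_mod_cast hb
    have hfl := Nat.floor_le
      (show 0 ≤ 24 * C * ((Nat.nthRoot (d + 4) N : ℕ) : ℝ) ^ (3 - ε) by positivity)
    refine ⟨⌊24 * C * ((Nat.nthRoot (d + 4) N : ℕ) : ℝ) ^ (3 - ε)⌋₊,
      haltsWithin_of_amortizedTimeBound hb hC hε.le hε' hT (Nat.lt_floor_add_one _), ?_, hfl⟩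
    refine Nat.add_le_add_left ?_ _
    have h1 : 24 * C * ((Nat.nthRoot (d + 4) N : ℕ) : ℝ) ^ (3 - ε) ≤
        c * ((Nat.nthRoot (d + 4) N : ℕ) : ℝ) ^ (3 : ℝ) :=
      mul_le_mul (Nat.le_ceil _) (Real.rpow_le_rpow_of_exponent_le hb1 (by linarith))
        (by positivity) (by positivity)
    have h2 : ((Nat.nthRoot (d + 4) N : ℕ) : ℝ) ^ (3 : ℝ) =
        ((Nat.nthRoot (d + 4) N ^ 3 : ℕ) : ℝ) := by norm_cast
    rw [h2] at h1
    exact_mod_cast hfl.trans h1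
  refine ⟨reduction A m ρ κ d c (d + 4), κ₁ * (S + 2), (2 * S + 8) * K, ?_, ?_⟩
  · intro N hN M v
    obtain ⟨T, hH, hL, -⟩ := main N hN
    obtain ⟨hV, hZ, h8, hB⟩ := layoutOf_sized (ρ := ρ) (κ := κ) (d := d) (C := c) hN
    -- Good coin sequences form a subset of those with right outputs.
    refine (two_thirds_le_good (D := layoutOf ρ κ d c (d + 4) κ₁ N) (T := T) hV hH hA
      (extend M) (extend v) failure_le).trans (measure_mono fun ω hω => ?_)
    obtain ⟨r₀, rs, hrun, -, hout⟩ := reduction_run (D := layoutOf ρ κ d c (d + 4) κ₁ N) (ω := ω)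
      (T := T) hV hZ hH hL hu hq hp hS₁ hS₂ (pow_mul (N + 2) κ₁ (S + 2)).ge h8 hB M v
    exact ⟨r₀, rs, hrun, hout hω⟩
  · intro N hN M v ω
    obtain ⟨T, hH, hL, hTC⟩ := main N hN
    obtain ⟨hV, hZ, h8, hB⟩ := layoutOf_sized (ρ := ρ) (κ := κ) (d := d) (C := c) hN
    obtain ⟨r₀, rs, hrun, htime, -⟩ := reduction_run (D := layoutOf ρ κ d c (d + 4) κ₁ N) (ω := ω)
      (T := T) hV hZ hH hL hu hq hp hS₁ hS₂ (pow_mul (N + 2) κ₁ (S + 2)).ge h8 hB M v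
    refine ⟨r₀, rs, hrun, ?_⟩
    have h1 := hK N hN _ T hL hTC
    have h2 : ((r₀.time + (rs.map CallRecord.time).sum : ℕ) : ℝ) ≤ (2 * S + 8) *
        ((layoutOf ρ κ d c (d + 4) κ₁ N).runTime
          ((5 * Nat.nthRoot (d + 4) N) ^ d + d) T : ℕ) := by
      exact_mod_cast htime
    have h3 : (0 : ℝ) ≤ 2 * S + 8 := by exact_mod_cast Nat.zero_le (2 * S + 8)
    rw [mul_assoc]
    exact h2.trans (mul_le_mul_of_nonneg_left h1 h3)

theorem not_correct_of_amortizedTimeBound (hOMv : OMvHypothesis) (hε : 0 < ε)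
    (hA : A.Correct m κ) (hT : A.AmortizedTimeBound κ d C ε) : False := by
  obtain ⟨A', κ', K, h⟩ := exists_omvAlgorithm hA
    (hT.mono (le_max_left C 0) (le_max_right C 0) (min_le_left ε (1 / 2))) (le_max_right C 0)
    (lt_min hε (by norm_num)) (min_le_right ε (1 / 2))
  exact hOMv _ (div_pos (lt_min hε (by norm_num)) (by positivity)) ⟨A', κ', K, h⟩

end

end OMvLB

theorem theorem1p3 (hOMv : OMvLB.OMvHypothesis) (m : OMvLB.Mode) (ε : ℝ) (hε : 0 < ε) :
    (¬ ∃ (A : OMvLB.TCAlgorithm) (κ d : ℕ) (C : ℝ),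
        A.Correct m κ ∧ A.WorstCaseTimeBound κ d C ε) ∧
    (¬ ∃ (A : OMvLB.TCAlgorithm) (κ d : ℕ) (C : ℝ),
        A.Correct m κ ∧ A.AmortizedTimeBound κ d C ε) := by
  constructor
  · rintro ⟨A, κ, d, C, hA, hT⟩
    exact OMvLB.not_correct_of_amortizedTimeBound hOMv hε hA hT.amortized
  · rintro ⟨A, κ, d, C, hA, hT⟩
    exact OMvLB.not_correct_of_amortizedTimeBound hOMv hε hA hT
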